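/- Let $m_1>0$, $\ell\ge 5$, and let $g$ be a Riemannian metric on $M=\{x\in\mathbb R^3: |x|\ge m_1/2\}$, smooth up to the boundary. Write $r=|x|$, let $(\rho,z,\phi)$ be the cylindrical coordinates of $\mathbb R^3$, and suppose that off the axis $\rho=0$ $$g=e^{-2U+2\alpha}(d\rho^2+dz^2)+\rho^2e^{-2U}(d\phi+A_\rho\,d\rho+A_z\,dz)^2 ,$$ where $U,\alpha,A_\rho/\rho,A_z$ are smooth functions on $M$ independent of $\phi$, $\alpha=0$ on the axis, and as $r\to\infty$ $$U=o_{\ell-3}(r^{-1/2}),\quad \alpha=o_{\ell-4}(r^{-1/2}),\quad A_\rho=\rho\,o_{\ell-3}(r^{-5/2}),\quad A_z=o_{\ell-3}(r^{-3/2}).$$ Here $f=o_k(r^p)$ means that the derivatives of $f$ of each order $j\le k$ are $o(r^{p-j})$. Suppose also that the first derivatives of the Cartesian components $g_{ij}$ lie in $L^2(M)$, that the scalar curvature of $g$ lies in $L^1(M)$, and that the boundary sphere $S_{m_1/2}$ is a minimal surface. Let $f(x)=(m_1/2)^2x/|x|^2$, and let $\bar g$ be the metric on $\bar M=\mathbb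 R^3\setminus\{0\}$ equal to $g$ for $|x|\ge m_1/2$ and to $f^*g$ for $0<|x|<m_1/2$. Let $\bar U,\bar\alpha,\bar A_\rho,\bar A_z$ be $U,\alpha,A_\rho,A_z$ for $|x|\ge m_1/2$, and for $0<|x|<m_1/2$ let $\bar U=2\log r+2\log(2/m_1)+U\circ f$, $\bar\alpha=\alpha\circ f$, and $\bar A_\rho\,d\rho+\bar A_z\,dz=f^*(A_\rho\,d\rho+A_z\,dz)$, i.e. $$\bar A_\rho=\tfrac{(m_1/2)^2}{r^4}\big[(z^2-\rho^2)A_\rho\circ f-2\rho z\,A_z\circ f\big],\qquad \bar A_z=\tfrac{(m_1/2)^2}{r^4}\big[(\rho^2-z^2)A_z\circ f-2\rho z\,A_\rho\circ f\big].$$ Let $\bar R$ be the scalar curvature of $\bar g$ (defined off $S_{m_1/2}$). An asymptotically flat end of order $k$ is one with a chart by $\{y\in\mathbb R^3:|y|>R_0\}$ in which the metric components satisfy $h_{ij}=\delta_{ij}+o_k(|y|^{-1/2})$ and $\partial h_{ij}\in L^2$, and the scalar curvature is in $L^1$. Then: (1) $(\bar M,\bar g)$ has two asymptotically flat ends, one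 at infinity and one at the origin: the complement of two disjoint such ends in $\bar M$ is compact. Precisely, the identity and $f$, both on $\{|y|>m_1/2\}$, are charts of two such ends of order $1$; and if $\Psi$ is any chart in which the end of $(M,g)$ is asymptotically flat of order $k$ with $|\Psi(y)|\to\infty$ as $|y|\to\infty$ and with image in $\{|x|>m_1/2\}$ having compact complement in $M$, then $\Psi$ and $f\circ\Psi$ are charts of two such ends of order $k$ of $(\bar M,\bar g)$. (2) The function $2e^{-2\bar U+2\bar\alpha}\bar R+4|\nabla\bar U|^2+\rho^2e^{-2\bar\alpha}(\bar A_{\rho,z}-\bar A_{z,\rho})^2$ is integrable on $\mathbb R^3$, and the ADM mass $$m=\lim_{r\to\infty}\frac1{16\pi}\int_{S_r}(g_{ij,i}-g_{ii,j})\nu^j$$ exists and satisfies $$m=\frac{1}{32\pi}\int_{\mathbb{R}^{3}}\Big(2e^{-2\bar{U}+2\bar{\alpha}}\bar{R}+4|\nabla \bar{U}|^{2}+\rho^{2}e^{-2\bar{\alpha}}(\bar{A}_{\rho,z}-\bar{A}_{z,\rho})^{2}\Big)dx ;$$ the end at the origin, in the chart $f$, has the same mass. -/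

import Mathlib

open MeasureTheory Filter Topology Bornology Asymptotics
open scoped ContDiff Matrix

noncomputable section

namespace Doubling

/-- Euclidean three-space with its Cartesian coordinates `x 0, x 1, x 2`. -/
abbrev E3 : Type := EuclideanSpace ℝ (Fin 3)

/-- A field of `3 × 3` matrices: the Cartesian components `h x i j` of a 2-tensor. -/
abbrev Field3 : Type := E3 → Matrix (Fin 3) (Fin 3) ℝ

/-! ### Riemannian geometry in Cartesian coordinates -/

/-- The coordinate vector `∂_i`. -/
def basisVec (i : Fin 3) : E3 := EuclideanSpace.single i 1

/-- The partial derivative `∂_i f`. -/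
def pd (i : Fin 3) (f : E3 → ℝ) (x : E3) : ℝ := fderiv ℝ f x (basisVec i)

/-- Christoffel symbols `Γ^k_{ij}`. -/
def christoffel (h : Field3) (k i j : Fin 3) (x : E3) : ℝ :=
  (1 / 2) * ∑ l, (h x)⁻¹ k l *
    (pd i (fun y => h y j l) x + pd j (fun y => h y i l) x - pd l (fun y => h y i j) x)

/-- Ricci curvature `Ric_{ij}`. -/
def ricci (h : Field3) (i j : Fin 3) (x : E3) : ℝ :=
  (∑ k, pd k (christoffel h k i j) x) - (∑ k, pd j (christoffel h k i k) x)
    + (∑ k, ∑ l, christoffel h k k l x * christoffel h l i j x)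
    - ∑ k, ∑ l, christoffel h k j l x * christoffel h l i k x

/-- Scalar curvature. -/
def scalarCurvature (h : Field3) (x : E3) : ℝ :=
  ∑ i, ∑ j, (h x)⁻¹ i j * ricci h i j x

/-- The `h`-length of the differential of `s`. -/
def gradLength (h : Field3) (s : E3 → ℝ) (x : E3) : ℝ :=
  Real.sqrt (∑ i, ∑ j, (h x)⁻¹ i j * pd i s x * pd j s x)

/-- The mean curvature at `x` of the level set of `s` through `x`, with respect to the metric `h`
and the unit normal `N = ∇s / |∇s|`, i.e. the divergence
`(det h)^{-1/2} ∂_i ((det h)^{1/2} h^{ij} ∂_j s / |∇s|)` of `N`. -/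
def meanCurvature (h : Field3) (s : E3 → ℝ) (x : E3) : ℝ :=
  (Real.sqrt (h x).det)⁻¹ *
    ∑ i, pd i (fun y => Real.sqrt (h y).det * (∑ j, (h y)⁻¹ i j * pd j s y) / gradLength h s y) x

/-- The Jacobian matrix of a map. -/
def jacobian (Ψ : E3 → E3) (x : E3) : Matrix (Fin 3) (Fin 3) ℝ :=
  Matrix.of fun a i => (fderiv ℝ Ψ x (basisVec i)) a

/-- The pullback `Ψ^* h`. -/
def pullback (h : Field3) (Ψ : E3 → E3) : Field3 :=
  fun x => (jacobian Ψ x)ᵀ * h (Ψ x) * jacobian Ψ x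

/-! ### Asymptotic flatness and mass -/

/-- `f = o_k(r^p)` as `r → ∞`: for all `j ≤ k`, the derivatives of order `j` are `o(r^{p-j})`. -/
def IsLittleOk (k : ℕ) (f : E3 → ℝ) (p : ℝ) : Prop :=
  ∀ j ≤ k, (fun x => iteratedFDeriv ℝ j f x) =o[cobounded E3] fun x => ‖x‖ ^ (p - j)

/-- `Ψ : {|y| > R₀} → ℝ³` is a diffeomorphism onto its (open) image, and in the coordinates `y` the
metric `h` is asymptotically flat of order `k`: `h_{ij} = δ_{ij} + o_k(|y|^{-1/2})`, the first
derivatives of `h_{ij}` are in `L²`, and the scalar curvature is in `L¹`. -/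
structure IsAFChart (k : ℕ) (h : Field3) (R₀ : ℝ) (Ψ : E3 → E3) : Prop where
  radius_pos : 0 < R₀
  smooth : ContDiffOn ℝ ∞ Ψ {y | R₀ < ‖y‖}
  injOn : Set.InjOn Ψ {y | R₀ < ‖y‖}
  det_ne_zero : ∀ y, R₀ < ‖y‖ → (jacobian Ψ y).det ≠ 0
  metric_smooth : ∀ i j, ContDiffOn ℝ ∞ (fun y => pullback h Ψ y i j) {y | R₀ < ‖y‖}
  metric_posDef : ∀ y, R₀ < ‖y‖ → (pullback h Ψ y).PosDef
  falloff : ∀ i j, IsLittleOk k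
    (fun y => pullback h Ψ y i j - (1 : Matrix (Fin 3) (Fin 3) ℝ) i j) (-1 / 2)
  deriv_L2 : ∀ i j,
    MemLp (fderiv ℝ fun y => pullback h Ψ y i j) 2 (volume.restrict {y | R₀ < ‖y‖})
  scalar_L1 : IntegrableOn (scalarCurvature (pullback h Ψ)) {y | R₀ < ‖y‖}

/-- In the manifold with boundary `{|x| ≥ c}` with metric `h`, the chart `Ψ` exhibits an
asymptotically flat end of order `k`, and this is the only end. -/
structure IsAFEndOfExterior (k : ℕ) (c : ℝ) (h : Field3) (R₀ : ℝ) (Ψ : E3 → E3) : Prop where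
  chart : IsAFChart k h R₀ Ψ
  mapsTo : Set.MapsTo Ψ {y | R₀ < ‖y‖} {x | c < ‖x‖}
  tendsto : Tendsto Ψ (cobounded E3) (cobounded E3)
  compact_compl : IsCompact ({x : E3 | c ≤ ‖x‖} \ Ψ '' {y | R₀ < ‖y‖})

/-- The manifold `ℝ³ ∖ {0}` with metric `h` consists of a compact set and two disjoint
asymptotically flat ends of order `k`, one at infinity with chart `Ψ₁` and one at the origin with
chart `Ψ₂`. -/
structure HasTwoAFEnds (k : ℕ) (h : Field3) (R₀ : ℝ) (Ψ₁ Ψ₂ : E3 → E3) : Prop where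
  chart₁ : IsAFChart k h R₀ Ψ₁
  chart₂ : IsAFChart k h R₀ Ψ₂
  mapsTo₁ : Set.MapsTo Ψ₁ {y | R₀ < ‖y‖} {0}ᶜ
  mapsTo₂ : Set.MapsTo Ψ₂ {y | R₀ < ‖y‖} {0}ᶜ
  tendsto₁ : Tendsto Ψ₁ (cobounded E3) (cobounded E3)
  tendsto₂ : Tendsto Ψ₂ (cobounded E3) (𝓝[≠] 0)
  disjoint : Disjoint (Ψ₁ '' {y | R₀ < ‖y‖}) (Ψ₂ '' {y | R₀ < ‖y‖})
  compact_compl :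
    IsCompact (({0}ᶜ : Set E3) \ (Ψ₁ '' {y | R₀ < ‖y‖} ∪ Ψ₂ '' {y | R₀ < ‖y‖}))

/-- `(16π)⁻¹ ∫_{S_r} (h_{ij,i} - h_{ii,j}) ν^j`; the integral over the coordinate sphere `S_r` is
written as `r²` times an integral over the unit sphere with its surface measure. -/
def admFlux (h : Field3) (r : ℝ) : ℝ :=
  (1 / (16 * Real.pi)) * (r ^ 2 *
    ∫ n : Metric.sphere (0 : E3) 1,
      (∑ j, (∑ i, (pd i (fun y => h y i j) (r • (n : E3)) - pd j (fun y => h y i i) (r • (n : E3))))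
        * (n : E3) j) ∂((volume : Measure E3).toSphere))

/-- The ADM mass of `h`, in the given coordinates, exists and equals `m`. -/
def HasADMMass (h : Field3) (m : ℝ) : Prop :=
  Tendsto (admFlux h) atTop (𝓝 m)

/-! ### Cylindrical coordinates -/

/-- The distance `ρ` to the `z`-axis. -/
def rho (x : E3) : ℝ := Real.sqrt (x 0 ^ 2 + x 1 ^ 2)

/-- Components of the 1-form `dρ`. -/
def dRho (x : E3) : Fin 3 → ℝ := ![x 0 / rho x, x 1 / rho x, 0]

/-- Components of the 1-form `dz`. -/
def dZ : Fin 3 → ℝ := ![0, 0, 1]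

/-- Components of the 1-form `dφ`. -/
def dPhi (x : E3) : Fin 3 → ℝ := ![-(x 1) / rho x ^ 2, x 0 / rho x ^ 2, 0]

/-- `∂f/∂ρ` in cylindrical coordinates. -/
def pdRho (f : E3 → ℝ) (x : E3) : ℝ := fderiv ℝ f x (WithLp.toLp 2 (dRho x))

/-- `∂f/∂z` in cylindrical coordinates. -/
def pdZ (f : E3 → ℝ) (x : E3) : ℝ := pd 2 f x

/-- The metric `e^{-2U+2α}(dρ² + dz²) + ρ² e^{-2U} (dφ + A_ρ dρ + A_z dz)²` off the axis. -/
def brillForm (U α Aρ Az : E3 → ℝ) : Field3 := fun x =>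
  Real.exp (-2 * U x + 2 * α x) •
      (Matrix.vecMulVec (dRho x) (dRho x) + Matrix.vecMulVec dZ dZ)
    + (rho x ^ 2 * Real.exp (-2 * U x)) •
      Matrix.vecMulVec (dPhi x + Aρ x • dRho x + Az x • dZ) (dPhi x + Aρ x • dRho x + Az x • dZ)

/-- `f` is smooth on `s` (up to the boundary): it is smooth on an open neighbourhood of `s`. -/
def SmoothUpTo (f : E3 → ℝ) (s : Set E3) : Prop :=
  ∃ V : Set E3, IsOpen V ∧ s ⊆ V ∧ ContDiffOn ℝ ∞ f V

/-- On `s`, the function `f` does not depend on the angle `φ`. -/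
def AxisymmetricOn (f : E3 → ℝ) (s : Set E3) : Prop :=
  ∀ x ∈ s, ∀ y ∈ s, rho x = rho y → x 2 = y 2 → f x = f y

/-- The closed exterior `{|x| ≥ m₁/2}`. -/
def exterior (m₁ : ℝ) : Set E3 := {x | m₁ / 2 ≤ ‖x‖}

/-- An axisymmetric asymptotically flat Riemannian metric on the exterior of the ball of radius
`m₁/2`, in pseudospherical coordinates. The coefficient `A_ρ` is `ρ a`. -/
structure PseudosphericalData (m₁ : ℝ) (ℓ : ℕ) where
  g : Field3
  U : E3 → ℝ
  α : E3 → ℝ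
  a : E3 → ℝ
  Az : E3 → ℝ
  g_smooth : ∀ i j, SmoothUpTo (fun x => g x i j) (exterior m₁)
  g_posDef : ∀ x ∈ exterior m₁, (g x).PosDef
  U_smooth : SmoothUpTo U (exterior m₁)
  α_smooth : SmoothUpTo α (exterior m₁)
  a_smooth : SmoothUpTo a (exterior m₁)
  Az_smooth : SmoothUpTo Az (exterior m₁)
  U_axisymmetric : AxisymmetricOn U (exterior m₁)
  α_axisymmetric : AxisymmetricOn α (exterior m₁)
  a_axisymmetric : AxisymmetricOn a (exterior m₁)
  Az_axisymmetric : AxisymmetricOn Az (exterior m₁)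
  g_eq : ∀ x ∈ exterior m₁, 0 < rho x → g x = brillForm U α (fun y => rho y * a y) Az x
  α_axis : ∀ x ∈ exterior m₁, rho x = 0 → α x = 0
  U_falloff : IsLittleOk (ℓ - 3) U (-1 / 2)
  α_falloff : IsLittleOk (ℓ - 4) α (-1 / 2)
  a_falloff : IsLittleOk (ℓ - 3) a (-5 / 2)
  Az_falloff : IsLittleOk (ℓ - 3) Az (-3 / 2)
  deriv_L2 : ∀ i j, MemLp (fderiv ℝ fun x => g x i j) 2 (volume.restrict {x | m₁ / 2 < ‖x‖})
  scalar_L1 : IntegrableOn (scalarCurvature g) {x | m₁ / 2 < ‖x‖}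

/-- The boundary sphere `S_{m₁/2}` is a minimal surface. -/
def HasMinimalBoundary (m₁ : ℝ) (g : Field3) : Prop :=
  ∀ x : E3, ‖x‖ = m₁ / 2 → meanCurvature g (fun y => ‖y‖) x = 0

/-! ### The doubling -/

/-- Spherical inversion in `S_{m₁/2}`: `x ↦ (m₁/2)² x / |x|²`. -/
def inv (m₁ : ℝ) : E3 → E3 := EuclideanGeometry.inversion (0 : E3) (m₁ / 2)

namespace PseudosphericalData

variable {m₁ : ℝ} {ℓ : ℕ} (D : PseudosphericalData m₁ ℓ)

/-- The coefficient `A_ρ`. -/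
def Aρ (x : E3) : ℝ := rho x * D.a x

open Classical in
/-- The doubled metric: `g` outside the ball, the pullback of `g` by the inversion inside. -/
def gBar : Field3 := fun x =>
  if m₁ / 2 ≤ ‖x‖ then D.g x else pullback D.g (inv m₁) x

open Classical in
/-- The doubled coefficient `U`. -/
def UBar (x : E3) : ℝ :=
  if m₁ / 2 ≤ ‖x‖ then D.U x
  else 2 * Real.log ‖x‖ + 2 * Real.log (2 / m₁) + D.U (inv m₁ x)

open Classical in
/-- The doubled coefficient `α`. -/
def αBar (x : E3) : ℝ :=
  if m₁ / 2 ≤ ‖x‖ then D.α x else D.α (inv m₁ x)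

open Classical in
/-- The doubled coefficient `A_ρ`; inside the ball it is the `dρ`-component of the pullback of
`A_ρ dρ + A_z dz` by the inversion. -/
def AρBar (x : E3) : ℝ :=
  if m₁ / 2 ≤ ‖x‖ then D.Aρ x
  else (m₁ / 2) ^ 2 / ‖x‖ ^ 4 *
    ((x 2 ^ 2 - rho x ^ 2) * D.Aρ (inv m₁ x) - 2 * rho x * x 2 * D.Az (inv m₁ x))

open Classical in
/-- The doubled coefficient `A_z`; inside the ball it is the `dz`-component of the pullback of
`A_ρ dρ + A_z dz` by the inversion. -/
def AzBar (x : E3) : ℝ :=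
  if m₁ / 2 ≤ ‖x‖ then D.Az x
  else (m₁ / 2) ^ 2 / ‖x‖ ^ 4 *
    ((rho x ^ 2 - x 2 ^ 2) * D.Az (inv m₁ x) - 2 * rho x * x 2 * D.Aρ (inv m₁ x))

/-- `2 e^{-2U+2α} R + 4 |∇U|² + ρ² e^{-2α} (A_{ρ,z} - A_{z,ρ})²` for the doubled data. -/
def massDensity (x : E3) : ℝ :=
  2 * Real.exp (-2 * D.UBar x + 2 * D.αBar x) * scalarCurvature D.gBar x
    + 4 * ‖gradient D.UBar x‖ ^ 2
    + rho x ^ 2 * Real.exp (-2 * D.αBar x) * (pdZ D.AρBar x - pdRho D.AzBar x) ^ 2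

end PseudosphericalData

end Doubling

end

noncomputable section

namespace Doubling


/-! ### Calculus of partial derivatives -/

/-! The mass density is a divergence. Off the axis, the Cartan structure equations for a Brill
metric give `2e^{-2U+2α}R = 8ΔU - 4(α_ρρ + α_zz) - 4|∇U|² - ρ²e^{-2α}(A_{ρ,z} - A_{z,ρ})²`, where
`Δ` is the flat Laplacian of `ℝ³` (`scalarCurvature_brillForm`). The quadratic terms in the mass
density cancel those on the right, and what remains is linear in `U` and `α`
(`density_eq_brillDensity`). In the coordinates `(t, θ) = (log r, θ)` its integral over a sphere is
the `t`-derivative of the flux `e^t ∫ sin θ (8 v_t - 4 a_t + 4 a) dθ`, where `v` and `a` are `U` and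
`α` in these coordinates; the boundary terms at the poles vanish because `α = 0` on the axis
(`hasDerivAt_exp_mul_polarFlux`).

The inversion becomes the reflection `t ↦ 2t₀ - t` with `t₀ = log (m₁/2)`. It is conformal on the
meridian half-plane and fixes `dφ`, so the pulled-back metric is again of Brill form, with the
doubled coefficients (`gBar_eq_brillForm`), and the same divergence identity holds inside the ball.
There the flux tends to `0` at the origin, so the inner integral equals the flux through the sphere
computed from inside (`integral_polarDensity_reflect`). The fluxes from the two sides differ by the
integral of a multiple of `2 - 2v_t + a_t`, which is the mean curvature up to a positive factor
(`minimal_radial`). Minimality is thus exactly what removes any contribution of the sphere, and the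
total integral is the limit of the outer flux, up to the factor `2π`
(`integrable_massDensity_and_tendsto`).

Integrability outside comes from the hypotheses `R ∈ L¹` and `∂g ∈ L²`: suitable combinations of the
Cartesian components show that `∂g` controls `∇U` and `ρ(A_{ρ,z} - A_{z,ρ})` pointwise
(`deriv_bounds`). Inside, integrability is inherited through the reflection.

To identify the flux with the ADM mass, `g - δ` is split into a part linear in the coefficients and
a remainder which is `o(r⁻¹)` with derivatives `o(r⁻²)` (`hasSmallOrder_remainder`). The mass
integrand of the linear part is computed exactly: the terms with `A` drop out by axisymmetry, and
the rest is the integrand of the flux (`admForm_linearPart`, `integral_radialFlux`). The same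
expansion shows that the identity is an asymptotically flat chart of order one.

For the ends, a chart `Ψ` of the exterior and its mirror image `f ∘ Ψ` read the same metric, because
`f` is an involution (`PseudosphericalData.hasTwoAFEnds`). For the same reason both ends have the
same mass. -/

lemma pd_congr {f g : E3 → ℝ} {x : E3} (i : Fin 3) (h : f =ᶠ[𝓝 x] g) : pd i f x = pd i g x := by
  rw [pd, pd, h.fderiv_eq]

lemma pd_add {f g : E3 → ℝ} {x : E3} (i : Fin 3) (hf : DifferentiableAt ℝ f x)
    (hg : DifferentiableAt ℝ g x) : pd i (fun y => f y + g y) x = pd i f x + pd i g x := by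
  simp [pd, fderiv_fun_add hf hg]

lemma pd_sub {f g : E3 → ℝ} {x : E3} (i : Fin 3) (hf : DifferentiableAt ℝ f x)
    (hg : DifferentiableAt ℝ g x) : pd i (fun y => f y - g y) x = pd i f x - pd i g x := by
  simp [pd, fderiv_fun_sub hf hg]

lemma pd_mul {f g : E3 → ℝ} {x : E3} (i : Fin 3) (hf : DifferentiableAt ℝ f x)
    (hg : DifferentiableAt ℝ g x) :
    pd i (fun y => f y * g y) x = pd i f x * g x + f x * pd i g x := by
  simp [pd, fderiv_fun_mul hf hg]; ring

lemma pd_const (i : Fin 3) (a : ℝ) (x : E3) : pd i (fun _ => a) x = 0 := by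
  simp [pd]

lemma pd_sum {ι : Type*} (s : Finset ι) {f : ι → E3 → ℝ} {x : E3} (i : Fin 3)
    (hf : ∀ k ∈ s, DifferentiableAt ℝ (f k) x) :
    pd i (fun y => ∑ k ∈ s, f k y) x = ∑ k ∈ s, pd i (f k) x := by
  simp [pd, fderiv_fun_sum hf]

lemma contDiffAt_pd {f : E3 → ℝ} {x : E3} {n m : ℕ∞} (i : Fin 3) (hf : ContDiffAt ℝ m f x)
    (hnm : n + 1 ≤ m) : ContDiffAt ℝ n (pd i f) x := by
  have := hf.fderiv_right (m := (n : WithTop ℕ∞)) (by exact_mod_cast hnm)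
  exact this.clm_apply contDiffAt_const

lemma pd_comm {f : E3 → ℝ} {x : E3} (hf : ContDiffAt ℝ 2 f x) (i j : Fin 3) :
    pd i (pd j f) x = pd j (pd i f) x := by
  have hsymm : IsSymmSndFDerivAt ℝ f x := hf.isSymmSndFDerivAt (by simp)
  have hd : DifferentiableAt ℝ (fderiv ℝ f) x :=
    (hf.fderiv_right (m := 1) (by norm_num)).differentiableAt (by norm_num)
  have key : ∀ i j, pd i (pd j f) x = fderiv ℝ (fderiv ℝ f) x (basisVec i) (basisVec j) := by
    intro i j
    have : pd j f = fun y => fderiv ℝ f y (basisVec j) := rfl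
    rw [this, pd, fderiv_clm_apply hd (differentiableAt_const _)]
    simp
  rw [key, key]
  exact hsymm _ _

/-- Entrywise partial derivative of a matrix field. -/
def pdM (i : Fin 3) (M : Field3) (x : E3) : Matrix (Fin 3) (Fin 3) ℝ :=
  Matrix.of fun k l => pd i (fun y => M y k l) x

/-- Entrywise differentiability of a matrix field at a point. -/
def DiffM (M : Field3) (x : E3) : Prop := ∀ k l, DifferentiableAt ℝ (fun y => M y k l) x

lemma DiffM.mul {M N : Field3} {x : E3} (hM : DiffM M x) (hN : DiffM N x) :
    DiffM (fun y => M y * N y) x := by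
  intro k l
  simp only [Matrix.mul_apply]
  exact DifferentiableAt.fun_sum fun j _ => (hM k j).mul (hN j l)

lemma DiffM.add {M N : Field3} {x : E3} (hM : DiffM M x) (hN : DiffM N x) :
    DiffM (fun y => M y + N y) x := by
  intro k l
  simp only [Matrix.add_apply]
  exact (hM k l).add (hN k l)

lemma DiffM.transpose {M : Field3} {x : E3} (hM : DiffM M x) : DiffM (fun y => (M y)ᵀ) x :=
  fun k l => hM l k

lemma pdM_mul {M N : Field3} {x : E3} (i : Fin 3) (hM : DiffM M x) (hN : DiffM N x) :
    pdM i (fun y => M y * N y) x = pdM i M x * N x + M x * pdM i N x := by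
  ext k l
  simp only [pdM, Matrix.mul_apply, Matrix.of_apply, Matrix.add_apply]
  rw [pd_sum (f := fun j y => M y k j * N y j l) _ _ fun j _ => (hM k j).mul (hN j l),
    ← Finset.sum_add_distrib]
  exact Finset.sum_congr rfl fun j _ => pd_mul i (hM k j) (hN j l)

lemma pdM_add {M N : Field3} {x : E3} (i : Fin 3) (hM : DiffM M x) (hN : DiffM N x) :
    pdM i (fun y => M y + N y) x = pdM i M x + pdM i N x := by
  ext k l
  exact pd_add i (hM k l) (hN k l)

lemma pdM_transpose (M : Field3) (x : E3) (i : Fin 3) :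
    pdM i (fun y => (M y)ᵀ) x = (pdM i M x)ᵀ := rfl

lemma pdM_congr {M N : Field3} {x : E3} (i : Fin 3) (h : M =ᶠ[𝓝 x] N) :
    pdM i M x = pdM i N x := by
  ext k l
  exact pd_congr i (h.mono fun y hy => congrArg (fun A => A k l) hy)

lemma pdM_comm {M : Field3} {x : E3} (hM : ∀ k l, ContDiffAt ℝ 2 (fun y => M y k l) x)
    (i j : Fin 3) : pdM i (pdM j M) x = pdM j (pdM i M) x := by
  ext k l
  exact pd_comm (hM k l) i j

/-! ### Locality of the curvature -/

lemma christoffel_congr {h h' : Field3} {x : E3} (H : h =ᶠ[𝓝 x] h') (k i j : Fin 3) :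
    christoffel h k i j x = christoffel h' k i j x := by
  have e : ∀ a b c, pd a (fun y => h y b c) x = pd a (fun y => h' y b c) x := fun a b c =>
    pd_congr a (H.mono fun y hy => congrArg (fun A => A b c) hy)
  simp only [christoffel, e, H.self_of_nhds]

lemma scalarCurvature_congr {h h' : Field3} {x : E3} (H : h =ᶠ[𝓝 x] h') :
    scalarCurvature h x = scalarCurvature h' x := by
  have e : ∀ k i j, christoffel h k i j =ᶠ[𝓝 x] christoffel h' k i j := fun k i j =>
    H.eventually_nhds.mono fun y hy => christoffel_congr hy k i j
  have e' : ∀ k i j, christoffel h k i j x = christoffel h' k i j x := fun k i j =>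
    (e k i j).self_of_nhds
  have e2 : ∀ a k i j, pd a (christoffel h k i j) x = pd a (christoffel h' k i j) x :=
    fun a k i j => pd_congr a (e k i j)
  simp only [scalarCurvature, ricci, e', e2, H.self_of_nhds]

/-! ### The curvature in an orthonormal coframe -/

/-- The connection matrix `(Γ_i)_{kl} = Γ^k_{il}`. -/
def gammaM (h : Field3) (i : Fin 3) : Field3 := fun x => Matrix.of fun k l => christoffel h k i l x

/-- Uniqueness of the Levi-Civita connection: for a symmetric and metric `G`, the Koszul combination
of the three first derivatives collapses to `2hG`, and multiplying by the inverse metric leaves `G`.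
-/
lemma gammaM_eq_of_compat {h : Field3} {x : E3} (hdet : IsUnit (h x).det) (hsymm : (h x)ᵀ = h x)
    (G : Fin 3 → Matrix (Fin 3) (Fin 3) ℝ) (hG : ∀ i j k, G i k j = G j k i)
    (hc : ∀ i, pdM i h x = (G i)ᵀ * h x + h x * G i) (i : Fin 3) :
    gammaM h i x = G i := by
  have hs : ∀ a b, h x a b = h x b a := fun a b => congrFun (congrFun hsymm b) a
  have hd : ∀ a b c, pd a (fun y => h y b c) x
      = ∑ m, (h x c m * G a m b + h x b m * G a m c) := by
    intro a b c
    have := congrFun (congrFun (hc a) b) c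
    simp only [pdM, Matrix.of_apply, Matrix.add_apply, Matrix.mul_apply, Matrix.transpose_apply]
      at this
    rw [this, ← Finset.sum_add_distrib]
    refine Finset.sum_congr rfl fun m _ => ?_
    rw [hs m c]; ring
  ext k j
  have hb : ∀ l, pd i (fun y => h y j l) x + pd j (fun y => h y i l) x - pd l (fun y => h y i j) x
      = 2 * ∑ m, h x l m * G i m j := by
    intro l
    rw [hd, hd, hd, ← Finset.sum_add_distrib, ← Finset.sum_sub_distrib, Finset.mul_sum]
    refine Finset.sum_congr rfl fun m _ => ?_
    rw [hG j i m, hG l i m, hG l j m]; ring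
  simp only [gammaM, Matrix.of_apply, christoffel, hb]
  have : (h x)⁻¹ * (h x * G i) = G i := by
    rw [← Matrix.mul_assoc, Matrix.nonsing_inv_mul _ hdet, Matrix.one_mul]
  have h2 := congrFun (congrFun this k) j
  rw [← h2]
  simp only [Matrix.mul_apply, Finset.mul_sum]
  refine Finset.sum_congr rfl fun l _ => Finset.sum_congr rfl fun m _ => ?_
  ring

/-- The scalar curvature of `EᵀE` in terms of the connection matrices `η_i` of the coframe `E`. -/
theorem scalarCurvature_eq_of_coframe {h E B : Field3} {η : Fin 3 → Field3} {x : E3}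
    (hE : ∀ᶠ y in 𝓝 x, h y = (E y)ᵀ * E y) (hB : ∀ᶠ y in 𝓝 x, B y * E y = 1)
    (hEd : ∀ k l, ContDiffAt ℝ 2 (fun y => E y k l) x) (hBd : DiffM B x)
    (hηd : ∀ i, DiffM (η i) x) (hskew : ∀ᶠ y in 𝓝 x, ∀ i, (η i y)ᵀ = -η i y)
    (htor : ∀ᶠ y in 𝓝 x, ∀ i j k,
      (η i y * E y + pdM i E y) k j = (η j y * E y + pdM j E y) k i) :
    scalarCurvature h x = ∑ k, ∑ j, (B x * (pdM k (η j) x - pdM j (η k) x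
      + η k x * η j x - η j x * η k x) * (B x)ᵀ) k j := by
  have hEd1 : ∀ᶠ y in 𝓝 x, DiffM E y := by
    have : ∀ k l, ∀ᶠ y in 𝓝 x, DifferentiableAt ℝ (fun y => E y k l) y := fun k l =>
      ((hEd k l).eventually (by simp)).mono fun y hy => hy.differentiableAt (by simp)
    simpa [DiffM, eventually_all] using this
  -- Changing the frame by `E` turns `η` into a connection on the coordinate frame. Skewness of `η`
  -- makes it metric and the torsion equation makes it symmetric, so it is the Levi-Civita
  -- connection.
  have hΓ : ∀ᶠ y in 𝓝 x, ∀ i, gammaM h i y = B y * (η i y * E y + pdM i E y) := by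
    filter_upwards [hE.eventually_nhds, hB, hskew, htor, hEd1] with y hEy hBy hsk hto hd i
    have hEy0 := hEy.self_of_nhds
    have hEB : E y * B y = 1 := mul_eq_one_comm.mp hBy
    have hdetE : IsUnit (E y).det := (Matrix.isUnit_iff_isUnit_det _).mp ⟨⟨E y, B y, hEB, hBy⟩, rfl⟩
    refine gammaM_eq_of_compat (G := fun i => B y * (η i y * E y + pdM i E y)) ?_ ?_ ?_ ?_ i
    · rw [hEy0, Matrix.det_mul, Matrix.det_transpose]; exact hdetE.mul hdetE
    · rw [hEy0]; simp
    · intro i j k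
      simp only [Matrix.mul_apply (M := B y)]
      exact Finset.sum_congr rfl fun m _ => by rw [hto i j m]
    · intro i
      have h1 : pdM i h y = pdM i (fun z => (E z)ᵀ * E z) y := pdM_congr i hEy
      rw [h1, pdM_mul i hd.transpose hd, pdM_transpose, hEy0, Matrix.transpose_mul,
        Matrix.transpose_add, Matrix.transpose_mul, hsk i]
      have e1 : (E y)ᵀ * E y * (B y * (η i y * E y + pdM i E y))
          = (E y)ᵀ * (η i y * E y + pdM i E y) := by
        rw [Matrix.mul_assoc, ← Matrix.mul_assoc (E y), hEB, Matrix.one_mul]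
      have e2 : ((E y)ᵀ * -η i y + (pdM i E y)ᵀ) * (B y)ᵀ * ((E y)ᵀ * E y)
          = ((E y)ᵀ * -η i y + (pdM i E y)ᵀ) * E y := by
        rw [Matrix.mul_assoc, ← Matrix.mul_assoc (B y)ᵀ, ← Matrix.transpose_mul, hEB]
        simp
      rw [e1, e2]
      noncomm_ring
  have hpdE : ∀ i, DiffM (pdM i E) x := fun i k l =>
    (contDiffAt_pd (n := 1) (m := 2) i (hEd k l) (by norm_num)).differentiableAt (by simp)
  have hEx := hEd1.self_of_nhds
  have hΓd : ∀ i, DiffM (gammaM h i) x := by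
    intro i k l
    have h0 := (hBd.mul (((hηd i).mul hEx).add (hpdE i))) k l
    exact h0.congr_of_eventuallyEq (hΓ.mono fun y hy => congrArg (fun A => A k l) (hy i))
  have hEB : E x * B x = 1 := mul_eq_one_comm.mp hB.self_of_nhds
  have hEΓ : ∀ i, ∀ᶠ y in 𝓝 x, E y * gammaM h i y = η i y * E y + pdM i E y := by
    intro i
    filter_upwards [hΓ, hB] with y hy hBy
    rw [hy i, ← Matrix.mul_assoc, mul_eq_one_comm.mp hBy, Matrix.one_mul]
  have hpE : ∀ i, pdM i E x = E x * gammaM h i x - η i x * E x := fun i => by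
    rw [(hEΓ i).self_of_nhds]; abel
  have hder : ∀ k j, pdM k E x * gammaM h j x + E x * pdM k (gammaM h j) x
      = pdM k (η j) x * E x + η j x * pdM k E x + pdM k (pdM j E) x := by
    intro k j
    rw [← pdM_mul k hEx (hΓd j), pdM_congr k (hEΓ j), pdM_add k ((hηd j).mul hEx) (hpdE j),
      pdM_mul k (hηd j) hEx]
  set Ω : Fin 3 → Fin 3 → Matrix (Fin 3) (Fin 3) ℝ := fun k j =>
    pdM k (η j) x - pdM j (η k) x + η k x * η j x - η j x * η k x with hΩ
  -- The curvature is covariant under the change of frame: differentiating `E Γ = η E + ∂E` and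
  -- antisymmetrizing, the second derivatives of `E` cancel and only `Ω` is left.
  have hcurv : ∀ k j, pdM k (gammaM h j) x - pdM j (gammaM h k) x
      + gammaM h k x * gammaM h j x - gammaM h j x * gammaM h k x = B x * Ω k j * E x := by
    intro k j
    have hkj := hder k j
    have hjk := hder j k
    rw [pdM_comm hEd j k] at hjk
    have : E x * (pdM k (gammaM h j) x - pdM j (gammaM h k) x
      + gammaM h k x * gammaM h j x - gammaM h j x * gammaM h k x) = Ω k j * E x := by
      have h1 : E x * pdM k (gammaM h j) x - E x * pdM j (gammaM h k) x
        = pdM k (η j) x * E x + η j x * pdM k E x - pdM k E x * gammaM h j x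
          - (pdM j (η k) x * E x + η k x * pdM j E x - pdM j E x * gammaM h k x) := by
        rw [eq_sub_of_add_eq' hkj, eq_sub_of_add_eq' hjk]; abel
      have h2 : E x * (pdM k (gammaM h j) x - pdM j (gammaM h k) x
        + gammaM h k x * gammaM h j x - gammaM h j x * gammaM h k x)
        = (E x * pdM k (gammaM h j) x - E x * pdM j (gammaM h k) x)
          + E x * gammaM h k x * gammaM h j x - E x * gammaM h j x * gammaM h k x := by
        noncomm_ring
      rw [h2, h1, hpE k, hpE j, hΩ]
      noncomm_ring
    rw [Matrix.mul_assoc, ← this, ← Matrix.mul_assoc, hB.self_of_nhds, Matrix.one_mul]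
  -- Symmetry of the Christoffel symbols rearranges the lower indices in `ricci` into the order of
  -- the matrices `gammaM`, so that the Ricci tensor becomes a trace of the curvature matrices.
  have hsym : ∀ᶠ y in 𝓝 x, ∀ i j k, christoffel h k i j y = christoffel h k j i y := by
    filter_upwards [hΓ, htor] with y hy hto i j k
    have h1 : christoffel h k i j y = gammaM h i y k j := rfl
    have h2 : christoffel h k j i y = gammaM h j y k i := rfl
    rw [h1, h2, hy i, hy j]
    simp only [Matrix.mul_apply (M := B y)]
    exact Finset.sum_congr rfl fun m _ => by rw [hto i j m]
  have hric : ∀ i j, ricci h i j x = ∑ k, (B x * Ω k j * E x) k i := by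
    intro i j
    have a1 : ∀ k, pd k (christoffel h k i j) x = pd k (christoffel h k j i) x := fun k =>
      pd_congr k (hsym.mono fun y hy => hy i j k)
    have a2 : ∀ k, pd j (christoffel h k i k) x = pd j (christoffel h k k i) x := fun k =>
      pd_congr j (hsym.mono fun y hy => hy i k k)
    have a3 := hsym.self_of_nhds
    simp only [ricci, a1, a2, ← hcurv]
    rw [← Finset.sum_sub_distrib, ← Finset.sum_add_distrib, ← Finset.sum_sub_distrib]
    refine Finset.sum_congr rfl fun k _ => ?_
    simp only [Matrix.sub_apply, Matrix.add_apply, Matrix.mul_apply, pdM, gammaM, Matrix.of_apply]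
    congr 1
    · congr 1
      exact Finset.sum_congr rfl fun l _ => by rw [a3 i j l]
    · exact Finset.sum_congr rfl fun l _ => by rw [a3 i k l]
  have hinv : (h x)⁻¹ = B x * (B x)ᵀ := by
    refine Matrix.inv_eq_left_inv ?_
    rw [hE.self_of_nhds, Matrix.mul_assoc, ← Matrix.mul_assoc (B x)ᵀ, ← Matrix.transpose_mul, hEB]
    simpa using hB.self_of_nhds
  have hfin : ∀ k j, B x * Ω k j * (B x)ᵀ = B x * Ω k j * E x * (h x)⁻¹ := by
    intro k j
    rw [hinv, Matrix.mul_assoc (B x * Ω k j), ← Matrix.mul_assoc (E x), hEB, Matrix.one_mul]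
  have hinvs : ∀ i j, (h x)⁻¹ i j = (h x)⁻¹ j i := by
    intro i j
    have : ((h x)⁻¹)ᵀ = (h x)⁻¹ := by rw [hinv]; simp
    exact congrFun (congrFun this j) i
  change _ = ∑ k, ∑ j, (B x * Ω k j * (B x)ᵀ) k j
  simp only [hfin, Matrix.mul_apply (N := (h x)⁻¹), scalarCurvature, hric, Finset.mul_sum]
  have hswap : ∀ f : Fin 3 → Fin 3 → Fin 3 → ℝ,
      ∑ i, ∑ j, ∑ k, f i j k = ∑ k, ∑ j, ∑ i, f i j k := by
    intro f; simp only [Fin.sum_univ_three]; ring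
  rw [hswap]
  exact Finset.sum_congr rfl fun k _ => Finset.sum_congr rfl fun j _ =>
    Finset.sum_congr rfl fun i _ => mul_comm _ _

/-! ### Cylindrical coordinates -/

/-- The cylindrical coordinates `(ρ, z)` of a point. -/
def cyl (x : E3) : ℝ × ℝ := (rho x, x 2)

lemma rho_sq (x : E3) : rho x ^ 2 = x 0 ^ 2 + x 1 ^ 2 := Real.sq_sqrt (by positivity)

lemma rho_nonneg (x : E3) : 0 ≤ rho x := Real.sqrt_nonneg _

lemma norm_sq_eq_coords (x : E3) : ‖x‖ ^ 2 = x 0 ^ 2 + x 1 ^ 2 + x 2 ^ 2 := by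
  rw [EuclideanSpace.norm_sq_eq]; simp [Fin.sum_univ_three]

lemma norm_sq_eq_rho (x : E3) : ‖x‖ ^ 2 = rho x ^ 2 + x 2 ^ 2 := by
  rw [norm_sq_eq_coords, rho_sq]

lemma continuous_rho : Continuous rho := by unfold rho; fun_prop

lemma continuous_cyl : Continuous cyl := continuous_rho.prodMk (by fun_prop)

lemma isOpen_rho_pos : IsOpen {x : E3 | 0 < rho x} := isOpen_lt continuous_const continuous_rho

lemma contDiffAt_coord (i : Fin 3) (x : E3) {n : WithTop ℕ∞} :
    ContDiffAt ℝ n (fun y : E3 => y i) x := by fun_prop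

lemma pd_coord (i j : Fin 3) (x : E3) :
    pd i (fun y => y j) x = (1 : Matrix (Fin 3) (Fin 3) ℝ) i j := by
  have : (fun y : E3 => y j) = ⇑(EuclideanSpace.proj j : E3 →L[ℝ] ℝ) := rfl
  rw [pd, this, ContinuousLinearMap.fderiv]
  simp [basisVec, Matrix.one_apply, eq_comm]

lemma contDiffAt_rho {x : E3} (hx : 0 < rho x) {n : WithTop ℕ∞} : ContDiffAt ℝ n rho x := by
  unfold rho
  refine ContDiffAt.sqrt (by fun_prop) ?_
  rw [← rho_sq x]
  positivity

lemma contDiffAt_cyl {x : E3} (hx : 0 < rho x) {n : WithTop ℕ∞} : ContDiffAt ℝ n cyl x :=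
  (contDiffAt_rho hx).prodMk (contDiffAt_coord 2 x)

lemma pd_sq {f : E3 → ℝ} {x : E3} (i : Fin 3) (hf : DifferentiableAt ℝ f x) :
    pd i (fun y => f y ^ 2) x = 2 * f x * pd i f x := by
  simp only [sq]; rw [pd_mul i hf hf]; ring

lemma pd_rho {x : E3} (hx : 0 < rho x) (i : Fin 3) : pd i rho x = dRho x i := by
  have hd : DifferentiableAt ℝ rho x := (contDiffAt_rho hx (n := 1)).differentiableAt (by simp)
  have hc : ∀ j, DifferentiableAt ℝ (fun y : E3 => y j) x := fun j =>
    (contDiffAt_coord j x (n := 1)).differentiableAt (by simp)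
  have h1 := pd_sq i hd
  have h2 : pd i (fun y => rho y ^ 2) x = 2 * x 0 * (1 : Matrix (Fin 3) (Fin 3) ℝ) i 0
      + 2 * x 1 * (1 : Matrix (Fin 3) (Fin 3) ℝ) i 1 := by
    simp only [rho_sq]
    rw [pd_add i ((hc 0).fun_pow 2) ((hc 1).fun_pow 2), pd_sq i (hc 0), pd_sq i (hc 1), pd_coord, pd_coord]
  rw [h2] at h1
  have hne := hx.ne'
  fin_cases i
  · simp [Matrix.one_apply, dRho] at h1 ⊢; field_simp; linarith
  · simp [Matrix.one_apply, dRho] at h1 ⊢; field_simp; linarith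
  · simp [dRho, hne] at h1 ⊢; exact h1

/-- The coframe `dρ, dz, dφ`. -/
def cylCoframe : Field3 := fun x => Matrix.of ![dRho x, dZ, dPhi x]

/-- The dual frame of `dρ, dz, dφ`. -/
def cylFrame : Field3 := fun x =>
  !![x 0 / rho x, 0, -(x 1); x 1 / rho x, 0, x 0; 0, 1, 0]

lemma cylCoframe_mul_cylFrame {x : E3} (hx : 0 < rho x) : cylCoframe x * cylFrame x = 1 := by
  have h2 := rho_sq x
  ext i j
  fin_cases i <;> fin_cases j <;>
    simp [cylCoframe, cylFrame, Matrix.mul_apply, Fin.sum_univ_three, dRho, dZ, dPhi] <;>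
    field_simp <;> linarith

lemma cylFrame_mul_cylCoframe {x : E3} (hx : 0 < rho x) : cylFrame x * cylCoframe x = 1 :=
  mul_eq_one_comm.mp (cylCoframe_mul_cylFrame hx)

lemma contDiffAt_cylCoframe {x : E3} (hx : 0 < rho x) {n : WithTop ℕ∞} (i j : Fin 3) :
    ContDiffAt ℝ n (fun y => cylCoframe y i j) x := by
  have hr := contDiffAt_rho hx (n := n)
  have hc := fun j => contDiffAt_coord j x (n := n)
  have hx2 : rho x ^ 2 ≠ 0 := by positivity
  fin_cases i <;> fin_cases j <;> simp [cylCoframe, dRho, dZ, dPhi]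
  · exact (hc 0).div hr hx.ne'
  · exact (hc 1).div hr hx.ne'
  · exact contDiffAt_const
  · exact contDiffAt_const
  · exact contDiffAt_const
  · exact contDiffAt_const
  · exact (hc 1).neg.div (hr.pow 2) hx2
  · exact (hc 0).div (hr.pow 2) hx2
  · exact contDiffAt_const

lemma contDiffAt_cylFrame {x : E3} (hx : 0 < rho x) {n : WithTop ℕ∞} (i j : Fin 3) :
    ContDiffAt ℝ n (fun y => cylFrame y i j) x := by
  have hr := contDiffAt_rho hx (n := n)
  have hc := fun j => contDiffAt_coord j x (n := n)
  fin_cases i <;> fin_cases j <;> simp [cylFrame]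
  · exact (hc 0).div hr hx.ne'
  · exact contDiffAt_const
  · exact (hc 1).neg
  · exact (hc 1).div hr hx.ne'
  · exact contDiffAt_const
  · exact hc 0
  · exact contDiffAt_const
  · exact contDiffAt_const
  · exact contDiffAt_const

lemma pd_div_rho_sq {x : E3} (hx : 0 < rho x) {f : E3 → ℝ} (hf : DifferentiableAt ℝ f x)
    (i : Fin 3) : pd i (fun y => f y / rho y ^ 2) x
      = pd i f x / rho x ^ 2 - 2 * f x * dRho x i / rho x ^ 3 := by
  have hd : DifferentiableAt ℝ rho x := (contDiffAt_rho hx (n := 1)).differentiableAt (by simp)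
  have hq : DifferentiableAt ℝ (fun y => f y / rho y ^ 2) x := by
    have h0 : DifferentiableAt ℝ (fun y => (rho y ^ 2)⁻¹) x :=
      (hd.fun_pow 2).fun_inv (pow_pos hx 2).ne'
    simpa only [div_eq_mul_inv] using hf.fun_mul h0
  have h1 : pd i (fun y => f y / rho y ^ 2 * rho y ^ 2) x = pd i f x := by
    refine pd_congr i ?_
    filter_upwards [isOpen_rho_pos.mem_nhds hx] with y hy
    have : rho y ≠ 0 := ne_of_gt hy
    field_simp
  rw [pd_mul i hq (hd.fun_pow 2), pd_sq i hd, pd_rho hx] at h1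
  field_simp at h1 ⊢
  linarith

/-- Closedness of the three forms `dρ`, `dz`, `dφ`. This makes derivatives of the coframe cancel in
torsion and curvature, so that both can be computed as if `(ρ, z, φ)` were the coordinates. -/
lemma cylCoframe_closed {x : E3} (hx : 0 < rho x) (m i j : Fin 3) :
    pd i (fun y => cylCoframe y m j) x = pd j (fun y => cylCoframe y m i) x := by
  have hc : ∀ j, DifferentiableAt ℝ (fun y : E3 => y j) x := fun j =>
    (contDiffAt_coord j x (n := 1)).differentiableAt (by simp)
  have h2 := rho_sq x
  fin_cases m
  · have e : ∀ j, (fun y => cylCoframe y 0 j) =ᶠ[𝓝 x] pd j rho := by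
      intro j
      filter_upwards [isOpen_rho_pos.mem_nhds hx] with y hy
      rw [pd_rho hy]; rfl
    change pd i (fun y => cylCoframe y 0 j) x = pd j (fun y => cylCoframe y 0 i) x
    rw [pd_congr i (e j), pd_congr j (e i)]
    exact pd_comm (contDiffAt_rho hx) i j
  · change pd i (fun _ => dZ j) x = pd j (fun _ => dZ i) x
    rw [pd_const, pd_const]
  · have d0 : ∀ i, pd i (fun y => cylCoframe y 2 0) x = -(1 : Matrix (Fin 3) (Fin 3) ℝ) i 1
        / rho x ^ 2 + 2 * x 1 * dRho x i / rho x ^ 3 := by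
      intro i
      have := pd_div_rho_sq hx (hc 1).neg i
      have e : pd i (-fun y : E3 => y 1) x = -pd i (fun y : E3 => y 1) x := by
        rw [pd, pd, fderiv_neg]; rfl
      rw [e, pd_coord] at this
      change pd i (fun y => -(y 1) / rho y ^ 2) x = _
      refine this.trans ?_
      simp only [Pi.neg_apply]; ring
    have d1 : ∀ i, pd i (fun y => cylCoframe y 2 1) x = (1 : Matrix (Fin 3) (Fin 3) ℝ) i 0
        / rho x ^ 2 - 2 * x 0 * dRho x i / rho x ^ 3 := by
      intro i
      have := pd_div_rho_sq hx (hc 0) i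
      rw [pd_coord] at this
      exact this
    have d2 : ∀ i, pd i (fun y => cylCoframe y 2 2) x = 0 := fun i => pd_const i 0 x
    fin_cases i <;> fin_cases j <;> simp [d0, d1, d2, dRho] <;> field_simp <;> linarith

/-- Derivative of a function of `(ρ, z)` in the directions `∂_ρ`, `∂_z`, `∂_φ`. -/
def dh (m : Fin 3) (f : ℝ × ℝ → ℝ) (p : ℝ × ℝ) : ℝ :=
  fderiv ℝ f p ((![(1, 0), (0, 1), (0, 0)] : Fin 3 → ℝ × ℝ) m)

lemma fderiv_eq_dh (f : ℝ × ℝ → ℝ) (p v : ℝ × ℝ) :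
    fderiv ℝ f p v = v.1 * dh 0 f p + v.2 * dh 1 f p := by
  have : v = v.1 • ((1 : ℝ), (0 : ℝ)) + v.2 • ((0 : ℝ), (1 : ℝ)) := by ext <;> simp
  conv_lhs => rw [this, map_add, map_smul, map_smul]
  rfl

lemma fderiv_cyl {x : E3} (hx : 0 < rho x) (v : E3) :
    fderiv ℝ cyl x v = (fderiv ℝ rho x v, v 2) := by
  have h1 : DifferentiableAt ℝ rho x := (contDiffAt_rho hx (n := 1)).differentiableAt (by simp)
  have h2 : HasFDerivAt (fun y : E3 => y 2) (EuclideanSpace.proj 2 : E3 →L[ℝ] ℝ) x :=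
    (EuclideanSpace.proj 2 : E3 →L[ℝ] ℝ).hasFDerivAt
  have := h1.hasFDerivAt.prodMk h2
  have e : fderiv ℝ cyl x = _ := this.fderiv
  rw [e]; rfl

lemma differentiableAt_comp_cyl {f : ℝ × ℝ → ℝ} {x : E3} (hx : 0 < rho x)
    (hf : DifferentiableAt ℝ f (cyl x)) : DifferentiableAt ℝ (fun y => f (cyl y)) x :=
  hf.comp x ((contDiffAt_cyl hx (n := 1)).differentiableAt (by simp))

lemma pd_comp_cyl {f : ℝ × ℝ → ℝ} {x : E3} (hx : 0 < rho x) (hf : DifferentiableAt ℝ f (cyl x))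
    (i : Fin 3) : pd i (fun y => f (cyl y)) x = ∑ m, dh m f (cyl x) * cylCoframe x m i := by
  have h1 : DifferentiableAt ℝ cyl x := (contDiffAt_cyl hx (n := 1)).differentiableAt (by simp)
  have h2 := fderiv_fun_comp x hf h1
  have h3 : pd i (fun y => f (cyl y)) x = fderiv ℝ f (cyl x) (fderiv ℝ cyl x (basisVec i)) := by
    rw [pd, h2]; rfl
  have h4 : fderiv ℝ rho x (basisVec i) = dRho x i := pd_rho hx i
  have h5 : (basisVec i) 2 = dZ i := by fin_cases i <;> simp [basisVec, dZ]
  have h6 : dh 2 f (cyl x) = 0 := by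
    have : ((![(1, 0), (0, 1), (0, 0)] : Fin 3 → ℝ × ℝ) 2) = 0 := rfl
    rw [dh, this, map_zero]
  rw [h3, fderiv_cyl hx, fderiv_eq_dh, Fin.sum_univ_three, h6, h4, h5]
  change _ = dh 0 f (cyl x) * dRho x i + dh 1 f (cyl x) * dZ i + _
  ring

/-- Entrywise derivative of a matrix-valued function of `(ρ, z)`. -/
def dhM (m : Fin 3) (M : ℝ × ℝ → Matrix (Fin 3) (Fin 3) ℝ) (p : ℝ × ℝ) :
    Matrix (Fin 3) (Fin 3) ℝ := Matrix.of fun k l => dh m (fun q => M q k l) p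

/-- For dual bases `C` and `D`, this turns a contraction over Cartesian indices into one over the
indices of the cylindrical coframe. -/
lemma sum_mul_smul_apply {C D : Matrix (Fin 3) (Fin 3) ℝ} (h : C * D = 1)
    (Y : Fin 3 → Matrix (Fin 3) (Fin 3) ℝ) (b : Fin 3) :
    ∑ k, (D * ∑ m, C m k • Y m) k b = ∑ m, Y m m b := by
  have h' : ∀ m a, ∑ k, C m k * D k a = (1 : Matrix (Fin 3) (Fin 3) ℝ) m a := fun m a => by
    rw [← h, Matrix.mul_apply]
  calc ∑ k, (D * ∑ m, C m k • Y m) k b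
      = ∑ m, ∑ a, (∑ k, C m k * D k a) * Y m a b := by
        simp only [Matrix.mul_apply, Matrix.sum_apply, Matrix.smul_apply, smul_eq_mul]
        simp only [Fin.sum_univ_three]
        ring
    _ = ∑ m, Y m m b := by
        simp only [h', Matrix.one_apply, ite_mul, one_mul, zero_mul, Finset.sum_ite_eq,
          Finset.mem_univ, if_true]

/-- The scalar curvature of an axisymmetric metric, from a coframe `N (dρ, dz, dφ)` and its
connection forms `W_0 dρ + W_1 dz + W_2 dφ`. -/
theorem scalarCurvature_eq_of_cylCoframe {h : Field3} {x : E3} (hx : 0 < rho x)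
    {N Ni : ℝ × ℝ → Matrix (Fin 3) (Fin 3) ℝ} {W : Fin 3 → ℝ × ℝ → Matrix (Fin 3) (Fin 3) ℝ}
    (hh : ∀ᶠ y in 𝓝 x, h y = (N (cyl y) * cylCoframe y)ᵀ * (N (cyl y) * cylCoframe y))
    (hNi : ∀ᶠ p in 𝓝 (cyl x), Ni p * N p = 1)
    (hN : ∀ k l, ContDiffAt ℝ 2 (fun p => N p k l) (cyl x))
    (hNid : ∀ k l, DifferentiableAt ℝ (fun p => Ni p k l) (cyl x))
    (hW : ∀ m k l, DifferentiableAt ℝ (fun p => W m p k l) (cyl x))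
    (hskew : ∀ᶠ p in 𝓝 (cyl x), ∀ m, (W m p)ᵀ = -W m p)
    (htor : ∀ᶠ p in 𝓝 (cyl x), ∀ m n k,
      (W m p * N p + dhM m N p) k n = (W n p * N p + dhM n N p) k m) :
    scalarCurvature h x = ∑ m, ∑ n, (Ni (cyl x) * (dhM m (W n) (cyl x) - dhM n (W m) (cyl x)
      + W m (cyl x) * W n (cyl x) - W n (cyl x) * W m (cyl x)) * (Ni (cyl x))ᵀ) m n := by
  have hpos : ∀ᶠ y in 𝓝 x, 0 < rho y := isOpen_rho_pos.mem_nhds hx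
  have hcyl : Tendsto cyl (𝓝 x) (𝓝 (cyl x)) := continuous_cyl.continuousAt
  have hCd : ∀ {y}, 0 < rho y → DiffM cylCoframe y := fun hy k l =>
    (contDiffAt_cylCoframe hy (n := 1) k l).differentiableAt (by simp)
  have hNd : ∀ᶠ p in 𝓝 (cyl x), ∀ k l, DifferentiableAt ℝ (fun p => N p k l) p := by
    have : ∀ k l, ∀ᶠ p in 𝓝 (cyl x), DifferentiableAt ℝ (fun p => N p k l) p := fun k l =>
      ((hN k l).eventually (by simp)).mono fun y hy => hy.differentiableAt (by simp)
    simpa [eventually_all] using this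
  have hcomp : ∀ {y} {M : ℝ × ℝ → Matrix (Fin 3) (Fin 3) ℝ}, 0 < rho y →
      (∀ k l, DifferentiableAt ℝ (fun p => M p k l) (cyl y)) → ∀ i,
      pdM i (fun z => M (cyl z)) y = ∑ m, cylCoframe y m i • dhM m M (cyl y) := by
    intro y M hy hM i
    ext k l
    simp only [pdM, Matrix.of_apply, Matrix.sum_apply, Matrix.smul_apply, dhM, smul_eq_mul]
    rw [pd_comp_cyl hy (hM k l)]
    exact Finset.sum_congr rfl fun m _ => mul_comm _ _
  have hE := scalarCurvature_eq_of_coframe (h := h) (x := x)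
    (E := fun y => N (cyl y) * cylCoframe y) (B := fun y => cylFrame y * Ni (cyl y))
    (η := fun i y => ∑ m, cylCoframe y m i • W m (cyl y)) hh ?_ ?_ ?_ ?_ ?_ ?_
  · rw [hE]
    have hpd : ∀ k j, pdM k (fun y => ∑ m, cylCoframe y m j • W m (cyl y)) x
        = ∑ n, (pd k (fun y => cylCoframe y n j) x • W n (cyl x)
          + cylCoframe x n j • ∑ m, cylCoframe x m k • dhM m (W n) (cyl x)) := by
      intro k j
      ext a b
      have e1 : ∀ m, DifferentiableAt ℝ (fun y => cylCoframe y m j) x := fun m => hCd hx m j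
      have e2 : ∀ m, DifferentiableAt ℝ (fun y => W m (cyl y) a b) x := fun m =>
        differentiableAt_comp_cyl hx (hW m a b)
      simp only [pdM, Matrix.of_apply, Matrix.sum_apply, Matrix.smul_apply, smul_eq_mul,
        Matrix.add_apply]
      rw [pd_sum (f := fun m y => cylCoframe y m j * W m (cyl y) a b) _ _
        fun m _ => (e1 m).mul (e2 m)]
      refine Finset.sum_congr rfl fun n _ => ?_
      rw [pd_mul k (e1 n) (e2 n), pd_comp_cyl hx (hW n a b)]
      congr 2
      exact Finset.sum_congr rfl fun m _ => mul_comm _ _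
    set X : Fin 3 → Fin 3 → Matrix (Fin 3) (Fin 3) ℝ := fun m n =>
      dhM m (W n) (cyl x) - dhM n (W m) (cyl x)
      + W m (cyl x) * W n (cyl x) - W n (cyl x) * W m (cyl x) with hX
    have hΩ : ∀ k j, pdM k (fun y => ∑ m, cylCoframe y m j • W m (cyl y)) x
        - pdM j (fun y => ∑ m, cylCoframe y m k • W m (cyl y)) x
        + (∑ m, cylCoframe x m k • W m (cyl x)) * (∑ m, cylCoframe x m j • W m (cyl x))
        - (∑ m, cylCoframe x m j • W m (cyl x)) * (∑ m, cylCoframe x m k • W m (cyl x))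
        = ∑ m, cylCoframe x m k • ∑ n, cylCoframe x n j • X m n := by
      intro k j
      rw [hpd, hpd]
      simp only [fun n => cylCoframe_closed hx n j k, hX]
      simp only [Fin.sum_univ_three, smul_sub, smul_add, Matrix.add_mul, Matrix.mul_add,
        Matrix.smul_mul, Matrix.mul_smul, smul_smul,
        fun m n => mul_comm (cylCoframe x m j) (cylCoframe x n k)]
      abel
    simp only [hΩ]
    have hA : ∀ k j, cylFrame x * Ni (cyl x) * (∑ m, cylCoframe x m k • ∑ n, cylCoframe x n j •
        X m n) * (cylFrame x * Ni (cyl x))ᵀ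
        = cylFrame x * ∑ m, cylCoframe x m k •
          ((∑ n, cylCoframe x n j • (Ni (cyl x) * X m n * (Ni (cyl x))ᵀ)) * (cylFrame x)ᵀ) := by
      intro k j
      rw [Matrix.transpose_mul]
      simp only [Matrix.mul_sum, Matrix.sum_mul, Matrix.mul_smul, Matrix.smul_mul,
        Matrix.mul_assoc, Finset.smul_sum]
    -- The two Cartesian indices are converted to cylindrical ones separately, the second after a
    -- transposition.
    have hCF := cylCoframe_mul_cylFrame hx
    simp only [hA]
    rw [Finset.sum_comm]
    simp only [sum_mul_smul_apply hCF]
    rw [Finset.sum_comm]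
    refine Finset.sum_congr rfl fun m _ => ?_
    have := sum_mul_smul_apply hCF (fun n => (Ni (cyl x) * X m n * (Ni (cyl x))ᵀ)ᵀ) m
    simp only [Matrix.transpose_apply] at this
    rw [← this]
    refine Finset.sum_congr rfl fun j _ => ?_
    have e : cylFrame x * ∑ n, cylCoframe x n j • (Ni (cyl x) * X m n * (Ni (cyl x))ᵀ)ᵀ
        = ((∑ n, cylCoframe x n j • (Ni (cyl x) * X m n * (Ni (cyl x))ᵀ)) * (cylFrame x)ᵀ)ᵀ := by
      rw [Matrix.transpose_mul, Matrix.transpose_transpose, Matrix.transpose_sum]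
      simp only [Matrix.transpose_smul]
    rw [e, Matrix.transpose_apply]
  · filter_upwards [hcyl.eventually hNi, hpos] with y hy hy0
    rw [Matrix.mul_assoc, ← Matrix.mul_assoc (Ni _), hy, Matrix.one_mul, cylFrame_mul_cylCoframe hy0]
  · intro k l
    simp only [Matrix.mul_apply]
    exact ContDiffAt.sum fun j _ => ((hN k j).comp x (contDiffAt_cyl hx)).mul
      (contDiffAt_cylCoframe hx j l)
  · exact DiffM.mul (fun k l => (contDiffAt_cylFrame hx (n := 1) k l).differentiableAt (by simp))
      (fun k l => differentiableAt_comp_cyl hx (hNid k l))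
  · intro i k l
    simp only [Matrix.sum_apply, Matrix.smul_apply, smul_eq_mul]
    exact DifferentiableAt.fun_sum fun m _ => (hCd hx m i).mul
      (differentiableAt_comp_cyl hx (hW m k l))
  · filter_upwards [hcyl.eventually hskew] with y hy i
    rw [Matrix.transpose_sum, ← Finset.sum_neg_distrib]
    refine Finset.sum_congr rfl fun m _ => ?_
    rw [Matrix.transpose_smul, hy m, smul_neg]
  · filter_upwards [hcyl.eventually htor, hcyl.eventually hNd, hpos] with y hy hNy hy0 i j k
    -- The torsion splits into the part given in cylindrical indices and a part with derivatives of
    -- the coframe; the latter is symmetric in `i` and `j` by closedness.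
    have key : ∀ i j, ((∑ m, cylCoframe y m i • W m (cyl y)) * (N (cyl y) * cylCoframe y)
        + pdM i (fun y => N (cyl y) * cylCoframe y) y) k j
        = (∑ m, ∑ n, cylCoframe y m i * cylCoframe y n j *
          (W m (cyl y) * N (cyl y) + dhM m N (cyl y)) k n)
          + ∑ n, N (cyl y) k n * pd i (fun z => cylCoframe z n j) y := by
      intro i j
      rw [pdM_mul i (fun k l => differentiableAt_comp_cyl hy0 (hNy k l)) (hCd hy0),
        hcomp hy0 hNy]
      simp only [Matrix.add_apply, Matrix.mul_apply (N := cylCoframe y),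
        Matrix.mul_apply (M := N (cyl y)) (N := pdM i cylCoframe y), ← Matrix.mul_assoc,
        Matrix.sum_mul, Matrix.smul_mul, Matrix.sum_apply, Matrix.smul_apply, smul_eq_mul]
      rw [← add_assoc]
      congr 1
      simp only [Fin.sum_univ_three]
      ring
    rw [key, key]
    congr 1
    · rw [Finset.sum_comm]
      refine Finset.sum_congr rfl fun n _ => Finset.sum_congr rfl fun m _ => ?_
      rw [hy m n k]; ring
    · exact Finset.sum_congr rfl fun n _ => by rw [cylCoframe_closed hy0]

/-! ### Calculus in the half-plane -/

lemma dh_congr {f g : ℝ × ℝ → ℝ} {p : ℝ × ℝ} (m : Fin 3) (h : f =ᶠ[𝓝 p] g) :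
    dh m f p = dh m g p := by rw [dh, dh, h.fderiv_eq]

lemma dh_add {f g : ℝ × ℝ → ℝ} {p : ℝ × ℝ} (m : Fin 3) (hf : DifferentiableAt ℝ f p)
    (hg : DifferentiableAt ℝ g p) : dh m (fun q => f q + g q) p = dh m f p + dh m g p := by
  simp [dh, fderiv_fun_add hf hg]

lemma dh_sub {f g : ℝ × ℝ → ℝ} {p : ℝ × ℝ} (m : Fin 3) (hf : DifferentiableAt ℝ f p)
    (hg : DifferentiableAt ℝ g p) : dh m (fun q => f q - g q) p = dh m f p - dh m g p := by
  simp [dh, fderiv_fun_sub hf hg]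

lemma dh_mul {f g : ℝ × ℝ → ℝ} {p : ℝ × ℝ} (m : Fin 3) (hf : DifferentiableAt ℝ f p)
    (hg : DifferentiableAt ℝ g p) :
    dh m (fun q => f q * g q) p = dh m f p * g p + f p * dh m g p := by
  simp [dh, fderiv_fun_mul hf hg]; ring

lemma dh_neg (f : ℝ × ℝ → ℝ) (p : ℝ × ℝ) (m : Fin 3) :
    dh m (fun q => -f q) p = -dh m f p := by simp [dh, fderiv_fun_neg]

lemma dh_const (m : Fin 3) (a : ℝ) (p : ℝ × ℝ) : dh m (fun _ => a) p = 0 := by simp [dh]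

lemma dh_two (f : ℝ × ℝ → ℝ) (p : ℝ × ℝ) : dh 2 f p = 0 := by
  have : ((![(1, 0), (0, 1), (0, 0)] : Fin 3 → ℝ × ℝ) 2) = 0 := rfl
  rw [dh, this, map_zero]

lemma dh_exp {f : ℝ × ℝ → ℝ} {p : ℝ × ℝ} (m : Fin 3) (hf : DifferentiableAt ℝ f p) :
    dh m (fun q => Real.exp (f q)) p = Real.exp (f p) * dh m f p := by
  simp [dh, fderiv_exp hf]

lemma contDiffAt_dh {f : ℝ × ℝ → ℝ} {p : ℝ × ℝ} {n k : ℕ∞} (m : Fin 3) (hf : ContDiffAt ℝ k f p)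
    (hnk : n + 1 ≤ k) : ContDiffAt ℝ n (dh m f) p := by
  have := hf.fderiv_right (m := (n : WithTop ℕ∞)) (by exact_mod_cast hnk)
  exact this.clm_apply contDiffAt_const

lemma dh_fst (p : ℝ × ℝ) : dh 0 Prod.fst p = 1 := by simp [dh, fderiv_fst]

lemma dh_one_fst (p : ℝ × ℝ) : dh 1 Prod.fst p = 0 := by simp [dh, fderiv_fst]

/-- The skew-symmetric matrix with upper entries `p, q, r`. -/
def skew3 (p q r : ℝ) : Matrix (Fin 3) (Fin 3) ℝ := !![0, p, q; -p, 0, r; -q, -r, 0]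

lemma skew3_transpose (p q r : ℝ) : (skew3 p q r)ᵀ = -skew3 p q r := by
  ext i j; fin_cases i <;> fin_cases j <;> simp [skew3]

set_option maxHeartbeats 1600000 in
/-- The scalar curvature of `e^{2κ}(dρ² + dz²) + τ²(dφ + b dρ + c dz)²`. -/
theorem scalarCurvature_circle_bundle {h : Field3} {x : E3} (hx : 0 < rho x)
    {κ τ b c : ℝ × ℝ → ℝ} (hκ : ContDiffAt ℝ 2 κ (cyl x)) (hτ : ContDiffAt ℝ 2 τ (cyl x))
    (hb : ContDiffAt ℝ 2 b (cyl x)) (hc : ContDiffAt ℝ 2 c (cyl x)) (hτ0 : 0 < τ (cyl x))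
    (hh : ∀ᶠ y in 𝓝 x, h y = Real.exp (2 * κ (cyl y)) •
      (Matrix.vecMulVec (dRho y) (dRho y) + Matrix.vecMulVec dZ dZ)
      + (τ (cyl y) ^ 2) • Matrix.vecMulVec (dPhi y + b (cyl y) • dRho y + c (cyl y) • dZ)
        (dPhi y + b (cyl y) • dRho y + c (cyl y) • dZ)) :
    scalarCurvature h x = -2 * Real.exp (-2 * κ (cyl x)) *
        (dh 0 (dh 0 κ) (cyl x) + dh 1 (dh 1 κ) (cyl x))
      - 2 * Real.exp (-2 * κ (cyl x)) *
        (dh 0 (dh 0 τ) (cyl x) + dh 1 (dh 1 τ) (cyl x)) / τ (cyl x)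
      - 1 / 2 * τ (cyl x) ^ 2 * Real.exp (-4 * κ (cyl x)) *
        (dh 0 c (cyl x) - dh 1 b (cyl x)) ^ 2 := by
  set P := cyl x with hP
  -- The orthonormal coframe is `e^κ dρ`, `e^κ dz`, `τ(dφ + A)` with `A = b dρ + c dz` and `dA = F
  -- dρ ∧ dz`. The first structure equation is solved by `ω₁₂ = κ_z dρ - κ_ρ dz + λ(dφ + A)`, `ω₁₃ =
  -- μ(dφ + A) - ξ dz`, `ω₂₃ = ν(dφ + A) + ξ dρ`; the matrices `W m` collect the coefficients of
  -- `dρ`, `dz`, `dφ`.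
  let F : ℝ × ℝ → ℝ := fun p => dh 0 c p - dh 1 b p
  let e : ℝ × ℝ → ℝ := fun p => Real.exp (-κ p)
  let lam : ℝ × ℝ → ℝ := fun p => -(1 / 2) * τ p ^ 2 * e p ^ 2 * F p
  let mu : ℝ × ℝ → ℝ := fun p => -(e p * dh 0 τ p)
  let nu : ℝ × ℝ → ℝ := fun p => -(e p * dh 1 τ p)
  let xi : ℝ × ℝ → ℝ := fun p => 1 / 2 * τ p * e p * F p
  let N : ℝ × ℝ → Matrix (Fin 3) (Fin 3) ℝ := fun p =>
    !![Real.exp (κ p), 0, 0; 0, Real.exp (κ p), 0; τ p * b p, τ p * c p, τ p]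
  let Ni : ℝ × ℝ → Matrix (Fin 3) (Fin 3) ℝ := fun p =>
    !![e p, 0, 0; 0, e p, 0; -(b p * e p), -(c p * e p), (τ p)⁻¹]
  let W : Fin 3 → ℝ × ℝ → Matrix (Fin 3) (Fin 3) ℝ := fun m p =>
    (![skew3 (dh 1 κ p + lam p * b p) (mu p * b p) (nu p * b p + xi p),
      skew3 (lam p * c p - dh 0 κ p) (mu p * c p - xi p) (nu p * c p),
      skew3 (lam p) (mu p) (nu p)] : Fin 3 → Matrix (Fin 3) (Fin 3) ℝ) m
  have dd : ∀ {f : ℝ × ℝ → ℝ} (m : Fin 3), ContDiffAt ℝ 2 f P → ContDiffAt ℝ 1 (dh m f) P :=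
    fun m hf => contDiffAt_dh (n := 1) (k := 2) m hf (by norm_num)
  have d1 : ∀ {f : ℝ × ℝ → ℝ}, ContDiffAt ℝ 2 f P → ContDiffAt ℝ 1 f P :=
    fun hf => hf.of_le (by norm_num)
  have hF : ContDiffAt ℝ 1 F P := (dd 0 hc).sub (dd 1 hb)
  have he : ContDiffAt ℝ 2 e P := hκ.neg.exp
  have hlam : ContDiffAt ℝ 1 lam P :=
    ((contDiffAt_const.mul ((d1 hτ).pow 2)).mul ((d1 he).pow 2)).mul hF
  have hmu : ContDiffAt ℝ 1 mu P := ((d1 he).mul (dd 0 hτ)).neg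
  have hnu : ContDiffAt ℝ 1 nu P := ((d1 he).mul (dd 1 hτ)).neg
  have hxi : ContDiffAt ℝ 1 xi P := ((contDiffAt_const.mul (d1 hτ)).mul (d1 he)).mul hF
  have td : ∀ {f : ℝ × ℝ → ℝ}, ContDiffAt ℝ 1 f P → DifferentiableAt ℝ f P :=
    fun hf => hf.differentiableAt (by simp)
  have hexp : ∀ p, Real.exp (κ p) * e p = 1 := fun p => by
    simp only [e]; rw [← Real.exp_add]; simp
  have hev : ∀ {f : ℝ × ℝ → ℝ}, ContDiffAt ℝ 2 f P → ∀ᶠ p in 𝓝 P, DifferentiableAt ℝ f p :=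
    fun hf => (hf.eventually (by simp)).mono fun y hy => hy.differentiableAt (by simp)
  have hτev : ∀ᶠ p in 𝓝 P, 0 < τ p := hτ.continuousAt.eventually (lt_mem_nhds hτ0)
  rw [scalarCurvature_eq_of_cylCoframe (N := N) (Ni := Ni) (W := W) hx ?_ ?_ ?_ ?_ ?_ ?_ ?_]
  · have h_dmu : dh 0 mu P = e P * dh 0 κ P * dh 0 τ P - e P * dh 0 (dh 0 τ) P := by
      simp only [mu]
      rw [dh_neg, dh_mul 0 (td (d1 he)) (td (dd 0 hτ))]
      simp only [e]
      rw [dh_exp (f := fun q => -κ q) 0 (td (d1 hκ)).neg, dh_neg]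
      ring
    have h_dnu : dh 1 nu P = e P * dh 1 κ P * dh 1 τ P - e P * dh 1 (dh 1 τ) P := by
      simp only [nu]
      rw [dh_neg, dh_mul 1 (td (d1 he)) (td (dd 1 hτ))]
      simp only [e]
      rw [dh_exp (f := fun q => -κ q) 1 (td (d1 hκ)).neg, dh_neg]
      ring
    have hbd := td (d1 hb)
    have hcd := td (d1 hc)
    have a1 : ∀ m, dh m (fun p => dh 1 κ p + lam p * b p) P
        = dh m (dh 1 κ) P + (dh m lam P * b P + lam P * dh m b P) := fun m => by
      rw [dh_add m (td (dd 1 hκ)) ((td hlam).fun_mul hbd), dh_mul m (td hlam) hbd]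
    have a2 : ∀ m, dh m (fun p => mu p * b p) P = dh m mu P * b P + mu P * dh m b P := fun m =>
      dh_mul m (td hmu) hbd
    have a3 : ∀ m, dh m (fun p => nu p * b p + xi p) P
        = dh m nu P * b P + nu P * dh m b P + dh m xi P := fun m => by
      rw [dh_add m ((td hnu).fun_mul hbd) (td hxi), dh_mul m (td hnu) hbd]
    have a4 : ∀ m, dh m (fun p => lam p * c p - dh 0 κ p) P
        = dh m lam P * c P + lam P * dh m c P - dh m (dh 0 κ) P := fun m => by
      rw [dh_sub m ((td hlam).fun_mul hcd) (td (dd 0 hκ)), dh_mul m (td hlam) hcd]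
    have a5 : ∀ m, dh m (fun p => mu p * c p - xi p) P
        = dh m mu P * c P + mu P * dh m c P - dh m xi P := fun m => by
      rw [dh_sub m ((td hmu).fun_mul hcd) (td hxi), dh_mul m (td hmu) hcd]
    have a6 : ∀ m, dh m (fun p => nu p * c p) P = dh m nu P * c P + nu P * dh m c P := fun m =>
      dh_mul m (td hnu) hcd
    have h_skew : ∀ (m : Fin 3) (f g k : ℝ × ℝ → ℝ), dhM m (fun p => skew3 (f p) (g p) (k p)) P
        = skew3 (dh m f P) (dh m g P) (dh m k P) := by
      intro m f g k
      ext i j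
      fin_cases i <;> fin_cases j <;> simp [dhM, skew3, dh_const, dh_neg]
    have hW0 : ∀ m, dhM m (W 0) P = skew3 (dh m (dh 1 κ) P + (dh m lam P * b P + lam P * dh m b P))
        (dh m mu P * b P + mu P * dh m b P) (dh m nu P * b P + nu P * dh m b P + dh m xi P) :=
      fun m => by rw [← a1, ← a2, ← a3]; exact h_skew m _ _ _
    have hW1 : ∀ m, dhM m (W 1) P = skew3 (dh m lam P * c P + lam P * dh m c P - dh m (dh 0 κ) P)
        (dh m mu P * c P + mu P * dh m c P - dh m xi P) (dh m nu P * c P + nu P * dh m c P) :=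
      fun m => by rw [← a4, ← a5, ← a6]; exact h_skew m _ _ _
    have hW2 : ∀ m, dhM m (W 2) P = skew3 (dh m lam P) (dh m mu P) (dh m nu P) :=
      fun m => h_skew m _ _ _
    have b0 : W 0 P = skew3 (dh 1 κ P + lam P * b P) (mu P * b P) (nu P * b P + xi P) := rfl
    have b1 : W 1 P = skew3 (lam P * c P - dh 0 κ P) (mu P * c P - xi P) (nu P * c P) := rfl
    have b2 : W 2 P = skew3 (lam P) (mu P) (nu P) := rfl
    have s1 : ∀ p q r p' q' r', skew3 p q r - skew3 p' q' r' = skew3 (p - p') (q - q') (r - r') := by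
      intro p q r p' q' r'
      ext i j; fin_cases i <;> fin_cases j <;> simp [skew3] <;> ring
    have s1' : ∀ p q r p' q' r', skew3 p q r + skew3 p' q' r' = skew3 (p + p') (q + q') (r + r') := by
      intro p q r p' q' r'
      ext i j; fin_cases i <;> fin_cases j <;> simp [skew3] <;> ring
    -- The bracket of `so(3)`, written in the three upper entries.
    have s2 : ∀ p q r p' q' r', skew3 p q r * skew3 p' q' r' - skew3 p' q' r' * skew3 p q r
        = skew3 (q' * r - q * r') (p * r' - p' * r) (p' * q - p * q') := by
      intro p q r p' q' r'
      ext i j; fin_cases i <;> fin_cases j <;>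
        simp [skew3] <;> ring
    have s4 : ∀ p q r, Ni P * skew3 p q r * (Ni P)ᵀ
        = skew3 (e P ^ 2 * p) (-(e P ^ 2 * p * c P) + e P * q * (τ P)⁻¹)
          (e P ^ 2 * p * b P + e P * r * (τ P)⁻¹ ) := by
      intro p q r
      ext i j; fin_cases i <;> fin_cases j <;>
        simp [skew3, Ni, Matrix.mul_apply, Fin.sum_univ_three] <;> ring
    simp only [← hP, add_sub_assoc, Fin.sum_univ_three, hW0, hW1, hW2, b0, b1, b2, s1, s1', s2, s4,
      dh_two]
    simp only [skew3, Matrix.of_apply, Matrix.cons_val', Matrix.cons_val_zero, Matrix.cons_val_one,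
      Matrix.cons_val]
    have h_e2 : Real.exp (-2 * κ P) = e P ^ 2 := by
      simp only [e]; rw [← Real.exp_nat_mul]; congr 1; push_cast; ring
    have h_e4 : Real.exp (-4 * κ P) = e P ^ 4 := by
      simp only [e]; rw [← Real.exp_nat_mul]; congr 1; push_cast; ring
    rw [h_e2, h_e4, h_dmu, h_dnu]
    simp only [lam, mu, nu, xi, F]
    have hτne := hτ0.ne'
    field_simp
    ring
  · filter_upwards [hh] with y hy
    rw [hy]
    have h2 : Real.exp (2 * κ (cyl y)) = Real.exp (κ (cyl y)) ^ 2 := by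
      rw [← Real.exp_nat_mul]; congr 1
    rw [h2]
    ext i j
    simp only [N, cylCoframe, Matrix.mul_apply, Matrix.transpose_apply, Fin.sum_univ_three,
      Matrix.add_apply, Matrix.smul_apply, Matrix.vecMulVec_apply, Matrix.of_apply,
      Matrix.cons_val', Matrix.cons_val_zero, Matrix.cons_val_one, Matrix.cons_val,
      Pi.add_apply, Pi.smul_apply, smul_eq_mul]
    ring
  · filter_upwards [hτev] with p hp
    have h1 := hexp p
    have h2 : e p * Real.exp (κ p) = 1 := by rw [mul_comm]; exact h1
    have h3 : (τ p)⁻¹ * τ p = 1 := inv_mul_cancel₀ hp.ne'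
    ext i j
    fin_cases i <;> fin_cases j <;>
      simp [N, Ni, Matrix.mul_apply, Fin.sum_univ_three, h2, h3]
    · linear_combination (-b p) * h2 + b p * h3
    · linear_combination (-c p) * h2 + c p * h3
  · intro k l
    fin_cases k <;> fin_cases l <;> simp [N]
    · exact hκ.exp
    · exact contDiffAt_const
    · exact contDiffAt_const
    · exact contDiffAt_const
    · exact hκ.exp
    · exact contDiffAt_const
    · exact hτ.mul hb
    · exact hτ.mul hc
    · exact hτ
  · intro k l
    have hed := td (d1 he)
    fin_cases k <;> fin_cases l <;> simp [Ni]
    · exact hed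
    · exact hed
    · exact (td (d1 hb)).fun_mul hed
    · exact (td (d1 hc)).fun_mul hed
    · exact (td (d1 hτ)).fun_inv hτ0.ne'
  · intro m k l
    have hsk : ∀ {f g k' : ℝ × ℝ → ℝ}, DifferentiableAt ℝ f P → DifferentiableAt ℝ g P →
        DifferentiableAt ℝ k' P →
        DifferentiableAt ℝ (fun p => skew3 (f p) (g p) (k' p) k l) P := by
      intro f g k' hf hg hk
      fin_cases k <;> fin_cases l <;> simp [skew3] <;> assumption
    have hbd := td (d1 hb)
    have hcd := td (d1 hc)
    fin_cases m
    · exact hsk ((td (dd 1 hκ)).fun_add ((td hlam).fun_mul hbd)) ((td hmu).fun_mul hbd)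
        (((td hnu).fun_mul hbd).fun_add (td hxi))
    · exact hsk (((td hlam).fun_mul hcd).fun_sub (td (dd 0 hκ)))
        (((td hmu).fun_mul hcd).fun_sub (td hxi)) ((td hnu).fun_mul hcd)
    · exact hsk (td hlam) (td hmu) (td hnu)
  · refine Eventually.of_forall fun p m => ?_
    fin_cases m <;> exact skew3_transpose _ _ _
  · filter_upwards [hev hκ, hev hτ, hev hb, hev hc] with p hκp hτp hbp hcp m n k
    have h1 := hexp p
    have n0 : ∀ m, dhM m N p = !![Real.exp (κ p) * dh m κ p, 0, 0; 0, Real.exp (κ p) * dh m κ p, 0;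
        dh m τ p * b p + τ p * dh m b p, dh m τ p * c p + τ p * dh m c p, dh m τ p] := by
      intro m
      ext i j
      fin_cases i <;> fin_cases j <;> simp [dhM, N, dh_const, dh_exp m hκp, dh_mul m hτp hbp,
        dh_mul m hτp hcp]
    have c0 : W 0 p = skew3 (dh 1 κ p + lam p * b p) (mu p * b p) (nu p * b p + xi p) := rfl
    have c1 : W 1 p = skew3 (lam p * c p - dh 0 κ p) (mu p * c p - xi p) (nu p * c p) := rfl
    have c2 : W 2 p = skew3 (lam p) (mu p) (nu p) := rfl
    -- Multiplied by `e^κ`, the definitions of `λ, μ, ν, ξ` lose the factor `e^{-κ}`; in this form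
    -- they are all that the components of the torsion equation need.
    have k1 : Real.exp (κ p) * lam p = -(τ p * xi p) := by
      simp only [lam, xi]; linear_combination (-(1 / 2) * τ p ^ 2 * e p * F p) * h1
    have k2 : Real.exp (κ p) * mu p = -dh 0 τ p := by
      simp only [mu]; linear_combination (-dh 0 τ p) * h1
    have k3 : Real.exp (κ p) * nu p = -dh 1 τ p := by
      simp only [nu]; linear_combination (-dh 1 τ p) * h1
    have k4 : Real.exp (κ p) * xi p = 1 / 2 * τ p * (dh 0 c p - dh 1 b p) := by
      simp only [xi, F]; linear_combination (1 / 2 * τ p * (dh 0 c p - dh 1 b p)) * h1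
    fin_cases m <;> fin_cases n <;> fin_cases k <;>
      simp [n0, c0, c1, c2, N, skew3, dh_two] <;>
      first
        | ring1
        | linear_combination k1
        | linear_combination -k1
        | linear_combination k2
        | linear_combination -k2
        | linear_combination k3
        | linear_combination -k3
        | linear_combination b p * k1
        | linear_combination -b p * k1
        | linear_combination c p * k1
        | linear_combination -c p * k1
        | linear_combination -2 * k4 - b p * k3 + c p * k2
        | linear_combination 2 * k4 + b p * k3 - c p * k2

/-- The function `ρe^{-u}` is the length of the Killing field, so its Laplacian enters the circle
bundle formula. The term `-2u_ρ` completes the two-dimensional Laplacians of `u`, one from here and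
one from `κ = α - u`, to the Laplacian of `ℝ³`; `|∇u|²` also arises here. -/
lemma dh_log_mul_exp_laplacian {u : ℝ × ℝ → ℝ} {p : ℝ × ℝ} (hu : ContDiffAt ℝ 2 u p) :
    dh 0 (dh 0 fun q => q.1 * Real.exp (-u q)) p + dh 1 (dh 1 fun q => q.1 * Real.exp (-u q)) p
      = Real.exp (-u p) * (p.1 * (dh 0 u p ^ 2 + dh 1 u p ^ 2
        - (dh 0 (dh 0 u) p + dh 1 (dh 1 u) p)) - 2 * dh 0 u p) := by
  have hev : ∀ᶠ q in 𝓝 p, DifferentiableAt ℝ u q :=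
    (hu.eventually (by simp)).mono fun y hy => hy.differentiableAt (by simp)
  have h1 : ∀ m, DifferentiableAt ℝ (dh m u) p := fun m =>
    (contDiffAt_dh (n := 1) (k := 2) m hu (by norm_num)).differentiableAt (by simp)
  have hud := hev.self_of_nhds
  have hfst : ∀ q : ℝ × ℝ, DifferentiableAt ℝ (Prod.fst : ℝ × ℝ → ℝ) q := fun q =>
    differentiableAt_fst
  have hexp : ∀ m q, DifferentiableAt ℝ u q →
      dh m (fun q => Real.exp (-u q)) q = -(Real.exp (-u q) * dh m u q) := fun m q hq => by
    rw [dh_exp (f := fun q => -u q) m hq.fun_neg, dh_neg]; ring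
  have e0 : dh 0 (fun q => q.1 * Real.exp (-u q)) =ᶠ[𝓝 p]
      fun q => Real.exp (-u q) * (1 - q.1 * dh 0 u q) := by
    filter_upwards [hev] with q hq
    rw [dh_mul (f := Prod.fst) 0 (hfst q) hq.fun_neg.exp, hexp 0 q hq, dh_fst]; ring
  have e1 : dh 1 (fun q => q.1 * Real.exp (-u q)) =ᶠ[𝓝 p]
      fun q => Real.exp (-u q) * (0 - q.1 * dh 1 u q) := by
    filter_upwards [hev] with q hq
    rw [dh_mul (f := Prod.fst) 1 (hfst q) hq.fun_neg.exp, hexp 1 q hq, dh_one_fst]; ring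
  have hm : ∀ m, DifferentiableAt ℝ (fun q : ℝ × ℝ => q.1 * dh m u q) p := fun m =>
    (hfst p).fun_mul (h1 m)
  rw [dh_congr 0 e0, dh_congr 1 e1,
    dh_mul 0 hud.fun_neg.exp ((differentiableAt_const _).fun_sub (hm 0)),
    dh_mul 1 hud.fun_neg.exp ((differentiableAt_const _).fun_sub (hm 1)),
    dh_sub 0 (differentiableAt_const _) (hm 0), dh_sub 1 (differentiableAt_const _) (hm 1),
    dh_mul (f := Prod.fst) 0 (hfst p) (h1 0), dh_mul (f := Prod.fst) 1 (hfst p) (h1 1),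
    hexp 0 p hud, hexp 1 p hud, dh_fst, dh_one_fst, dh_const, dh_const]
  ring

/-- The scalar curvature of a Brill metric off the axis. -/
theorem scalarCurvature_brillForm {h : Field3} {x : E3} (hx : 0 < rho x)
    {u al b c : ℝ × ℝ → ℝ} (hu : ContDiffAt ℝ 2 u (cyl x)) (hal : ContDiffAt ℝ 2 al (cyl x))
    (hb : ContDiffAt ℝ 2 b (cyl x)) (hc : ContDiffAt ℝ 2 c (cyl x))
    (hh : ∀ᶠ y in 𝓝 x, h y = brillForm (fun y => u (cyl y)) (fun y => al (cyl y))
      (fun y => b (cyl y)) (fun y => c (cyl y)) y) :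
    2 * Real.exp (-2 * u (cyl x) + 2 * al (cyl x)) * scalarCurvature h x
      = 8 * (dh 0 (dh 0 u) (cyl x) + dh 1 (dh 1 u) (cyl x) + dh 0 u (cyl x) / rho x)
        - 4 * (dh 0 (dh 0 al) (cyl x) + dh 1 (dh 1 al) (cyl x))
        - 4 * (dh 0 u (cyl x) ^ 2 + dh 1 u (cyl x) ^ 2)
        - rho x ^ 2 * Real.exp (-2 * al (cyl x)) * (dh 1 b (cyl x) - dh 0 c (cyl x)) ^ 2 := by
  have hτ : ContDiffAt ℝ 2 (fun q : ℝ × ℝ => q.1 * Real.exp (-u q)) (cyl x) :=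
    contDiffAt_fst.mul hu.neg.exp
  have hfst : (cyl x).1 = rho x := rfl
  rw [scalarCurvature_circle_bundle hx (κ := fun q => al q - u q)
    (τ := fun q => q.1 * Real.exp (-u q)) (hal.sub hu) hτ hb hc (by rw [hfst]; positivity) ?_,
    dh_log_mul_exp_laplacian hu]
  · have hev : ∀ {f : ℝ × ℝ → ℝ}, ContDiffAt ℝ 2 f (cyl x) →
        ∀ᶠ q in 𝓝 (cyl x), DifferentiableAt ℝ f q := fun hf =>
      (hf.eventually (by simp)).mono fun y hy => hy.differentiableAt (by simp)
    have h1 : ∀ {f : ℝ × ℝ → ℝ} (m), ContDiffAt ℝ 2 f (cyl x) →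
        DifferentiableAt ℝ (dh m f) (cyl x) := fun m hf =>
      (contDiffAt_dh (n := 1) (k := 2) m hf (by norm_num)).differentiableAt (by simp)
    have hs : ∀ m, dh m (dh m fun q => al q - u q) (cyl x)
        = dh m (dh m al) (cyl x) - dh m (dh m u) (cyl x) := by
      intro m
      have : dh m (fun q => al q - u q) =ᶠ[𝓝 (cyl x)] fun q => dh m al q - dh m u q := by
        filter_upwards [hev hu, hev hal] with q h2 h3
        exact dh_sub m h3 h2
      rw [dh_congr m this, dh_sub m (h1 m hal) (h1 m hu)]
    rw [hs, hs, hfst]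
    set U := u (cyl x)
    set A := al (cyl x)
    have hne := hx.ne'
    have x1 : Real.exp (-2 * (A - U)) = Real.exp U ^ 2 * (Real.exp A ^ 2)⁻¹ := by
      rw [← Real.exp_nat_mul, ← Real.exp_nat_mul, ← Real.exp_neg, ← Real.exp_add]
      congr 1; push_cast; ring
    have x2 : Real.exp (-4 * (A - U)) = Real.exp U ^ 4 * (Real.exp A ^ 4)⁻¹ := by
      rw [← Real.exp_nat_mul, ← Real.exp_nat_mul, ← Real.exp_neg, ← Real.exp_add]
      congr 1; push_cast; ring
    have x3 : Real.exp (-2 * U + 2 * A) = (Real.exp U ^ 2)⁻¹ * Real.exp A ^ 2 := by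
      rw [← Real.exp_nat_mul, ← Real.exp_nat_mul, ← Real.exp_neg, ← Real.exp_add]
      congr 1; push_cast; ring
    have x4 : Real.exp (-2 * A) = (Real.exp A ^ 2)⁻¹ := by
      rw [← Real.exp_nat_mul, ← Real.exp_neg]
      congr 1; push_cast; ring
    rw [x1, x2, x3, x4, Real.exp_neg]
    have p1 := (Real.exp_pos U).ne'
    have p2 := (Real.exp_pos A).ne'
    field_simp
    ring
  · filter_upwards [hh] with y hy
    rw [hy, brillForm]
    have e1 : -2 * u (cyl y) + 2 * al (cyl y) = 2 * (al (cyl y) - u (cyl y)) := by ring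
    have e2 : rho y ^ 2 * Real.exp (-2 * u (cyl y))
        = ((cyl y).1 * Real.exp (-u (cyl y))) ^ 2 := by
      rw [mul_pow, ← Real.exp_nat_mul]
      congr 2; push_cast; ring
    rw [e1, e2]

/-! ### The inversion and the two ends -/

section Inversion

variable {m₁ : ℝ}

lemma norm_inv (x : E3) : ‖inv m₁ x‖ = (m₁ / 2) ^ 2 / ‖x‖ := by
  simpa [inv] using EuclideanGeometry.dist_inversion_center (0 : E3) x (m₁ / 2)

lemma inv_eq_smul (x : E3) : inv m₁ x = ((m₁ / 2) ^ 2 / ‖x‖ ^ 2) • x := by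
  simp [inv, EuclideanGeometry.inversion, div_pow]

lemma inv_inv (hm : 0 < m₁) (x : E3) : inv m₁ (inv m₁ x) = x :=
  EuclideanGeometry.inversion_inversion _ (by positivity) x

lemma inv_ne_zero (hm : 0 < m₁) {x : E3} (hx : x ≠ 0) : inv m₁ x ≠ 0 := fun h =>
  hx ((EuclideanGeometry.inversion_eq_center (by positivity)).mp h)

lemma contDiffAt_inv {x : E3} (hx : x ≠ 0) {n : ℕ∞} : ContDiffAt ℝ n (inv m₁) x :=
  ContDiffAt.inversion (n := n) contDiffAt_const contDiffAt_const contDiffAt_id hx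

lemma differentiableAt_inv {x : E3} (hx : x ≠ 0) : DifferentiableAt ℝ (inv m₁) x :=
  (contDiffAt_inv hx (n := 1)).differentiableAt (by simp)

lemma norm_inv_lt_iff (hm : 0 < m₁) {x : E3} (hx : x ≠ 0) :
    ‖inv m₁ x‖ < m₁ / 2 ↔ m₁ / 2 < ‖x‖ := by
  have : 0 < ‖x‖ := norm_pos_iff.mpr hx
  rw [norm_inv, div_lt_iff₀ this, sq]
  exact mul_lt_mul_iff_right₀ (by positivity)

lemma lt_norm_inv_iff (hm : 0 < m₁) {x : E3} (hx : x ≠ 0) :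
    m₁ / 2 < ‖inv m₁ x‖ ↔ ‖x‖ < m₁ / 2 := by
  rw [← norm_inv_lt_iff hm (inv_ne_zero hm hx), inv_inv hm]

end Inversion

/-! ### Jacobians, pullbacks and the transport of asymptotically flat charts. -/

lemma jacobian_mulVec (Ψ : E3 → E3) (y v : E3) (a : Fin 3) :
    (fderiv ℝ Ψ y v) a = ∑ i, jacobian Ψ y a i * v i := by
  have hv : v = ∑ i, v i • basisVec i := by
    ext j
    fin_cases j <;> simp [Fin.sum_univ_three, basisVec]
  conv_lhs => rw [hv, map_sum]
  simp only [map_smul, jacobian, Matrix.of_apply]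
  simp only [Fin.sum_univ_three, PiLp.add_apply, PiLp.smul_apply, smul_eq_mul]
  ring

lemma jacobian_comp {Φ Ψ : E3 → E3} {y : E3} (hΦ : DifferentiableAt ℝ Φ (Ψ y))
    (hΨ : DifferentiableAt ℝ Ψ y) :
    jacobian (Φ ∘ Ψ) y = jacobian Φ (Ψ y) * jacobian Ψ y := by
  ext a i
  have : jacobian (Φ ∘ Ψ) y a i = (fderiv ℝ Φ (Ψ y) (fderiv ℝ Ψ y (basisVec i))) a := by
    simp [jacobian, fderiv_comp y hΦ hΨ]
  rw [this, jacobian_mulVec, Matrix.mul_apply]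
  rfl

lemma jacobian_id (y : E3) : jacobian id y = 1 := by
  ext a i
  simp [jacobian, basisVec, Matrix.one_apply]

lemma pullback_comp {h : Field3} {Φ Ψ : E3 → E3} {y : E3} (hΦ : DifferentiableAt ℝ Φ (Ψ y))
    (hΨ : DifferentiableAt ℝ Ψ y) : pullback h (Φ ∘ Ψ) y = pullback (pullback h Φ) Ψ y := by
  simp only [pullback, jacobian_comp hΦ hΨ, Matrix.transpose_mul, Function.comp, Matrix.mul_assoc]

lemma pullback_id (h : Field3) : pullback h id = h := by
  funext y; simp [pullback, jacobian_id]

lemma pullback_apply_congr {h h' : Field3} {Ψ : E3 → E3} {y : E3} (H : h (Ψ y) = h' (Ψ y)) :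
    pullback h Ψ y = pullback h' Ψ y := by simp only [pullback, H]

lemma jacobian_inv_mul {m₁ : ℝ} (hm : 0 < m₁) {x : E3} (hx : x ≠ 0) :
    jacobian (inv m₁) (inv m₁ x) * jacobian (inv m₁) x = 1 := by
  rw [← jacobian_comp (differentiableAt_inv (inv_ne_zero hm hx)) (differentiableAt_inv hx),
    ← jacobian_id x]
  congr 1
  funext y
  exact inv_inv hm y

lemma isOpen_lt_norm (R : ℝ) : IsOpen {y : E3 | R < ‖y‖} :=
  isOpen_lt continuous_const continuous_norm

lemma eventually_lt_norm (R : ℝ) : ∀ᶠ y in cobounded E3, R < ‖y‖ :=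
  tendsto_norm_cobounded_atTop.eventually_gt_atTop R

/-- Asymptotic flatness of a chart only depends on the metric read in the chart. -/
lemma IsAFChart.congr {k : ℕ} {h h' : Field3} {R₀ : ℝ} {Ψ Ψ' : E3 → E3}
    (H : IsAFChart k h R₀ Ψ) (hs : ContDiffOn ℝ ∞ Ψ' {y | R₀ < ‖y‖})
    (hi : Set.InjOn Ψ' {y | R₀ < ‖y‖}) (hd : ∀ y, R₀ < ‖y‖ → (jacobian Ψ' y).det ≠ 0)
    (he : ∀ y, R₀ < ‖y‖ → pullback h' Ψ' y = pullback h Ψ y) : IsAFChart k h' R₀ Ψ' := by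
  have hloc : ∀ y, R₀ < ‖y‖ → pullback h' Ψ' =ᶠ[𝓝 y] pullback h Ψ := fun y hy =>
    (isOpen_lt_norm R₀).eventually_mem hy |>.mono fun z hz => he z hz
  have hloc' : ∀ i j y, R₀ < ‖y‖ →
      (fun y => pullback h' Ψ' y i j) =ᶠ[𝓝 y] fun y => pullback h Ψ y i j := fun i j y hy =>
    (hloc y hy).mono fun z hz => congrArg (fun A => A i j) hz
  refine ⟨H.radius_pos, hs, hi, hd, fun i j => ?_, fun y hy => ?_, fun i j a ha => ?_,
    fun i j => ?_, ?_⟩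
  · exact (H.metric_smooth i j).congr fun y hy => congrArg (fun A => A i j) (he y hy)
  · rw [he y hy]; exact H.metric_posDef y hy
  · refine (H.falloff i j a ha).congr' ?_ EventuallyEq.rfl
    filter_upwards [eventually_lt_norm R₀] with y hy
    have : (fun y => pullback h Ψ y i j - (1 : Matrix (Fin 3) (Fin 3) ℝ) i j) =ᶠ[𝓝 y]
        fun y => pullback h' Ψ' y i j - (1 : Matrix (Fin 3) (Fin 3) ℝ) i j :=
      (hloc' i j y hy).mono fun z hz => by
        simp only at hz ⊢
        rw [hz]
    exact (this.iteratedFDeriv ℝ a).self_of_nhds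
  · refine (memLp_congr_ae ?_).mp (H.deriv_L2 i j)
    filter_upwards [ae_restrict_mem (isOpen_lt_norm R₀).measurableSet] with y hy
    exact (hloc' i j y hy).symm.fderiv_eq
  · refine (integrableOn_congr_fun (fun y hy => ?_) (isOpen_lt_norm R₀).measurableSet).mp
      H.scalar_L1
    exact (scalarCurvature_congr (hloc y hy)).symm

namespace PseudosphericalData

variable {m₁ : ℝ} {ℓ : ℕ} (D : PseudosphericalData m₁ ℓ)

lemma gBar_of_le {x : E3} (hx : m₁ / 2 ≤ ‖x‖) : D.gBar x = D.g x := if_pos hx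

lemma gBar_of_lt {x : E3} (hx : ‖x‖ < m₁ / 2) : D.gBar x = pullback D.g (inv m₁) x :=
  if_neg (not_le.mpr hx)

/-- Inside the ball the doubled metric is `f^*g`, and `f ∘ f = id`; hence the inner metric read in
the chart `f` is the exterior metric. -/
lemma pullback_gBar_inv (hm : 0 < m₁) {x : E3} (hx : m₁ / 2 < ‖x‖) :
    pullback D.gBar (inv m₁) x = D.g x := by
  have hx0 : x ≠ 0 := norm_pos_iff.mp (by linarith)
  have h1 : pullback D.gBar (inv m₁) x = pullback (pullback D.g (inv m₁)) (inv m₁) x :=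
    pullback_apply_congr (D.gBar_of_lt ((norm_inv_lt_iff hm hx0).mpr hx))
  rw [h1, ← pullback_comp (differentiableAt_inv (inv_ne_zero hm hx0)) (differentiableAt_inv hx0)]
  have : inv m₁ ∘ inv m₁ = id := funext fun y => inv_inv hm y
  rw [this, pullback_id]

/-- An asymptotically flat end of the exterior gives two ends of the doubled manifold. -/
theorem hasTwoAFEnds (hm : 0 < m₁) {k : ℕ} {R₀ : ℝ} {Ψ : E3 → E3}
    (H : IsAFEndOfExterior k (m₁ / 2) D.g R₀ Ψ) :
    HasTwoAFEnds k D.gBar R₀ Ψ (inv m₁ ∘ Ψ) := by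
  have hc : 0 < m₁ / 2 := by positivity
  have hne : ∀ y, R₀ < ‖y‖ → Ψ y ≠ 0 := fun y hy => norm_pos_iff.mp (hc.trans (H.mapsTo hy))
  have hΨd : ∀ y, R₀ < ‖y‖ → DifferentiableAt ℝ Ψ y := fun y hy =>
    ((H.chart.smooth y hy).contDiffAt ((isOpen_lt_norm R₀).mem_nhds hy)).differentiableAt (by simp)
  have hinv : ∀ y, R₀ < ‖y‖ → ‖inv m₁ (Ψ y)‖ < m₁ / 2 := fun y hy =>
    (norm_inv_lt_iff hm (hne y hy)).mpr (H.mapsTo hy)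
  refine ⟨?_, ?_, fun y hy => hne y hy, fun y hy => inv_ne_zero hm (hne y hy), H.tendsto, ?_, ?_, ?_⟩
  · exact H.chart.congr H.chart.smooth H.chart.injOn H.chart.det_ne_zero fun y hy =>
      pullback_apply_congr (D.gBar_of_le (le_of_lt (H.mapsTo hy)))
  -- In the chart `f ∘ Ψ` the doubled metric is `Ψ^*(f^*ḡ) = Ψ^*g`, so every analytic condition is
  -- the one already known for `Ψ`.
  · refine H.chart.congr ?_ ?_ ?_ ?_
    · intro y hy
      exact (contDiffAt_inv (hne y hy) (n := ⊤)).comp_contDiffWithinAt y (H.chart.smooth y hy)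
    · intro y hy z hz h
      refine H.chart.injOn hy hz ?_
      rw [← inv_inv hm (Ψ y), ← inv_inv hm (Ψ z)]
      exact congrArg (inv m₁) h
    · intro y hy
      rw [jacobian_comp (differentiableAt_inv (hne y hy)) (hΨd y hy), Matrix.det_mul]
      refine mul_ne_zero (fun h0 => ?_) (H.chart.det_ne_zero y hy)
      have := congrArg Matrix.det (jacobian_inv_mul hm (hne y hy))
      rw [Matrix.det_mul, h0, mul_zero, Matrix.det_one] at this
      exact zero_ne_one this
    · intro y hy
      rw [pullback_comp (differentiableAt_inv (hne y hy)) (hΨd y hy)]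
      exact pullback_apply_congr (D.pullback_gBar_inv hm (H.mapsTo hy))
  · rw [tendsto_nhdsWithin_iff]
    constructor
    · rw [tendsto_zero_iff_norm_tendsto_zero]
      have h1 : Tendsto (fun y => ‖Ψ y‖) (cobounded E3) atTop :=
        tendsto_norm_cobounded_atTop.comp H.tendsto
      simpa only [Function.comp, norm_inv] using h1.const_div_atTop ((m₁ / 2) ^ 2)
    · filter_upwards [eventually_lt_norm R₀] with y hy
      exact inv_ne_zero hm (hne y hy)
  · rw [Set.disjoint_left]
    rintro _ ⟨y, hy, rfl⟩ ⟨z, hz, h⟩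
    have h1 := hinv z hz
    have h2 : m₁ / 2 < ‖Ψ y‖ := H.mapsTo hy
    rw [← h] at h2
    exact lt_asymm h1 h2
  -- What the two ends leave out is the compact set left out by `Ψ` in the exterior, together with
  -- its mirror image.
  · set K := {x : E3 | m₁ / 2 ≤ ‖x‖} \ Ψ '' {y | R₀ < ‖y‖} with hK
    have hKc : IsCompact (inv m₁ '' K) := by
      refine H.compact_compl.image_of_continuousOn fun x hx => ?_
      have : x ≠ 0 := norm_pos_iff.mp (hc.trans_le hx.1)
      exact (differentiableAt_inv this).continuousAt.continuousWithinAt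
    have : ({0}ᶜ : Set E3) \ (Ψ '' {y | R₀ < ‖y‖} ∪ (inv m₁ ∘ Ψ) '' {y | R₀ < ‖y‖})
        = K ∪ inv m₁ '' K := by
      ext x
      constructor
      · rintro ⟨hx0, hx⟩
        rw [Set.mem_union, not_or] at hx
        have hx0' : x ≠ 0 := hx0
        rcases le_or_gt (m₁ / 2) ‖x‖ with h | h
        · exact Or.inl ⟨h, hx.1⟩
        · refine Or.inr ⟨inv m₁ x, ⟨((lt_norm_inv_iff hm hx0').mpr h).le, ?_⟩, inv_inv hm x⟩
          rintro ⟨y, hy, hyx⟩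
          exact hx.2 ⟨y, hy, by simp [hyx, inv_inv hm]⟩
      · rintro (⟨h, hx⟩ | ⟨x, ⟨h, hx⟩, rfl⟩)
        · refine ⟨norm_pos_iff.mp (hc.trans_le h), ?_⟩
          rintro (h' | ⟨y, hy, rfl⟩)
          · exact hx h'
          · exact absurd (hinv y hy) (not_lt.mpr h)
        · have hx0 : x ≠ 0 := norm_pos_iff.mp (hc.trans_le h)
          refine ⟨inv_ne_zero hm hx0, ?_⟩
          rintro (⟨y, hy, hyx⟩ | ⟨y, hy, hyx⟩)
          · have h2 : m₁ / 2 < ‖Ψ y‖ := H.mapsTo hy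
            rw [hyx, lt_norm_inv_iff hm hx0] at h2
            exact absurd h2 (not_lt.mpr h)
          · refine hx ⟨y, hy, ?_⟩
            rw [← inv_inv hm x, ← hyx]
            exact (inv_inv hm _).symm
    rw [this]
    exact H.compact_compl.union hKc

end PseudosphericalData

/-! ### Reduction to the half-plane -/

/-- The point of the half-plane `{y = 0}` with cylindrical coordinates `(ρ, z)`. -/
def sec (p : ℝ × ℝ) : E3 := !₂[p.1, 0, p.2]

@[simp] lemma sec_zero (p : ℝ × ℝ) : sec p 0 = p.1 := rfl
@[simp] lemma sec_one (p : ℝ × ℝ) : sec p 1 = 0 := rfl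
@[simp] lemma sec_two (p : ℝ × ℝ) : sec p 2 = p.2 := rfl

lemma norm_sq_sec (p : ℝ × ℝ) : ‖sec p‖ ^ 2 = p.1 ^ 2 + p.2 ^ 2 := by
  rw [norm_sq_eq_coords]; simp

lemma contDiff_sec {n : WithTop ℕ∞} : ContDiff ℝ n sec := by
  rw [contDiff_euclidean]
  intro i
  fin_cases i
  · exact contDiff_fst
  · exact contDiff_const
  · exact contDiff_snd

lemma rho_sec {p : ℝ × ℝ} (hp : 0 ≤ p.1) : rho (sec p) = p.1 := by
  simp [rho, Real.sqrt_sq hp]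

lemma cyl_sec {p : ℝ × ℝ} (hp : 0 ≤ p.1) : cyl (sec p) = p := by
  rw [cyl, rho_sec hp, sec_two]

lemma norm_sec_cyl (x : E3) : ‖sec (cyl x)‖ = ‖x‖ := by
  have h : ‖sec (cyl x)‖ ^ 2 = ‖x‖ ^ 2 := by rw [norm_sq_sec, norm_sq_eq_rho]; rfl
  exact (pow_left_inj₀ (norm_nonneg _) (norm_nonneg _) two_ne_zero).mp h

/-- An axisymmetric function is determined by its restriction to the half-plane `y = 0`, which
allows all coefficients to be treated as functions of `(ρ, z)`. -/
lemma AxisymmetricOn.eq_sec_cyl {f : E3 → ℝ} {m₁ : ℝ} (hf : AxisymmetricOn f (exterior m₁)) {x : E3}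
    (hx : m₁ / 2 ≤ ‖x‖) : f x = f (sec (cyl x)) := by
  refine hf x hx _ ?_ (rho_sec (p := cyl x) (rho_nonneg x)).symm rfl
  simpa [exterior, norm_sec_cyl] using hx

lemma SmoothUpTo.contDiffAt {f : E3 → ℝ} {s : Set E3} (hf : SmoothUpTo f s) {x : E3} (hx : x ∈ s)
    {n : ℕ∞} : ContDiffAt ℝ n f x := by
  obtain ⟨V, hV, hs, hfV⟩ := hf
  exact ((hfV x (hs hx)).contDiffAt (hV.mem_nhds (hs hx))).of_le (by exact_mod_cast le_top)

/-- The section is linear on the whole plane, so no sign condition on `p.1` is needed. This gives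
smoothness in full neighbourhoods of axis points, which is used at `θ = 0` and `θ = π`. -/
lemma SmoothUpTo.contDiffAt_comp_sec {f : E3 → ℝ} {m₁ : ℝ} (hm : 0 < m₁)
    (hf : SmoothUpTo f (exterior m₁)) {p : ℝ × ℝ} (hp : (m₁ / 2) ^ 2 ≤ p.1 ^ 2 + p.2 ^ 2)
    {n : ℕ∞} : ContDiffAt ℝ n (fun q => f (sec q)) p := by
  have hx : sec p ∈ exterior m₁ := by
    rw [← norm_sq_sec] at hp
    exact (pow_le_pow_iff_left₀ (by positivity) (norm_nonneg _) two_ne_zero).mp hp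
  exact (hf.contDiffAt hx).comp p contDiff_sec.contDiffAt

/-- `2e^{-2u+2α}R + 4|∇u|² + …` for a Brill metric, expressed by `u` and `α` alone. -/
def brillDensity (u al : ℝ × ℝ → ℝ) (p : ℝ × ℝ) : ℝ :=
  8 * (dh 0 (dh 0 u) p + dh 1 (dh 1 u) p + dh 0 u p / p.1)
    - 4 * (dh 0 (dh 0 al) p + dh 1 (dh 1 al) p)

lemma dRho_sq_add {x : E3} (hx : 0 < rho x) : dRho x 0 ^ 2 + dRho x 1 ^ 2 = 1 := by
  have := rho_sq x
  simp [dRho]; field_simp; linarith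

lemma norm_gradient_sq (f : E3 → ℝ) (x : E3) : ‖gradient f x‖ ^ 2 = ∑ i, pd i f x ^ 2 := by
  rw [EuclideanSpace.norm_sq_eq]
  refine Finset.sum_congr rfl fun i _ => ?_
  have h1 : gradient f x i = inner ℝ (gradient f x) (basisVec i) := by
    rw [basisVec, EuclideanSpace.inner_single_right]; simp
  rw [h1, inner_gradient_left, Real.norm_eq_abs, sq_abs, pd]

lemma norm_gradient_comp_cyl_sq {f : ℝ × ℝ → ℝ} {x : E3} (hx : 0 < rho x)
    (hf : DifferentiableAt ℝ f (cyl x)) :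
    ‖gradient (fun y => f (cyl y)) x‖ ^ 2 = dh 0 f (cyl x) ^ 2 + dh 1 f (cyl x) ^ 2 := by
  rw [norm_gradient_sq]
  simp only [pd_comp_cyl hx hf, Fin.sum_univ_three, dh_two]
  have := dRho_sq_add hx
  have e0 : ∀ i, cylCoframe x 0 i = dRho x i := fun i => rfl
  have e1 : ∀ i, cylCoframe x 1 i = dZ i := fun i => rfl
  have e2 : dRho x 2 = 0 := rfl
  simp only [e0, e1, e2]
  simp [dZ]
  linear_combination (dh 0 f (cyl x)) ^ 2 * this

lemma fderiv_eq_sum_pd (f : E3 → ℝ) (x v : E3) : fderiv ℝ f x v = ∑ i, pd i f x * v i := by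
  have hv : v = ∑ i, v i • basisVec i := by
    ext j
    fin_cases j <;> simp [Fin.sum_univ_three, basisVec]
  conv_lhs => rw [hv, map_sum]
  simp only [map_smul, pd, smul_eq_mul, mul_comm]

lemma pdRho_comp_cyl {f : ℝ × ℝ → ℝ} {x : E3} (hx : 0 < rho x)
    (hf : DifferentiableAt ℝ f (cyl x)) : pdRho (fun y => f (cyl y)) x = dh 0 f (cyl x) := by
  have := dRho_sq_add hx
  rw [pdRho, fderiv_eq_sum_pd]
  simp only [pd_comp_cyl hx hf, Fin.sum_univ_three, dh_two]
  have e0 : ∀ i, cylCoframe x 0 i = dRho x i := fun i => rfl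
  have e1 : ∀ i, cylCoframe x 1 i = dZ i := fun i => rfl
  have e2 : dRho x 2 = 0 := rfl
  simp only [e0, e1, e2]
  simp [dZ]
  linear_combination (dh 0 f (cyl x)) * this

lemma pdZ_comp_cyl {f : ℝ × ℝ → ℝ} {x : E3} (hx : 0 < rho x)
    (hf : DifferentiableAt ℝ f (cyl x)) : pdZ (fun y => f (cyl y)) x = dh 1 f (cyl x) := by
  rw [pdZ, pd_comp_cyl hx hf, Fin.sum_univ_three, dh_two]
  have e0 : cylCoframe x 0 2 = 0 := rfl
  have e1 : cylCoframe x 1 2 = 1 := rfl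
  rw [e0, e1]; ring

/-- Off the axis, the mass density only involves the Laplacians of `u` and `α`. -/
lemma density_eq_brillDensity {h : Field3} {U α Aρ Az : E3 → ℝ} {x : E3} (hx : 0 < rho x)
    {u al b c : ℝ × ℝ → ℝ} (hu : ContDiffAt ℝ 2 u (cyl x)) (hal : ContDiffAt ℝ 2 al (cyl x))
    (hb : ContDiffAt ℝ 2 b (cyl x)) (hc : ContDiffAt ℝ 2 c (cyl x))
    (hU : U =ᶠ[𝓝 x] fun y => u (cyl y)) (hα : α =ᶠ[𝓝 x] fun y => al (cyl y))
    (hAρ : Aρ =ᶠ[𝓝 x] fun y => b (cyl y)) (hAz : Az =ᶠ[𝓝 x] fun y => c (cyl y))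
    (hh : ∀ᶠ y in 𝓝 x, h y = brillForm (fun y => u (cyl y)) (fun y => al (cyl y))
      (fun y => b (cyl y)) (fun y => c (cyl y)) y) :
    2 * Real.exp (-2 * U x + 2 * α x) * scalarCurvature h x + 4 * ‖gradient U x‖ ^ 2
      + rho x ^ 2 * Real.exp (-2 * α x) * (pdZ Aρ x - pdRho Az x) ^ 2
      = brillDensity u al (cyl x) := by
  have d : ∀ {f : ℝ × ℝ → ℝ}, ContDiffAt ℝ 2 f (cyl x) → DifferentiableAt ℝ f (cyl x) :=
    fun hf => hf.differentiableAt (by simp)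
  have g1 : gradient U x = gradient (fun y => u (cyl y)) x := by
    simp only [gradient, hU.fderiv_eq]
  have g2 : pdZ Aρ x = pdZ (fun y => b (cyl y)) x := pd_congr 2 hAρ
  have g3 : pdRho Az x = pdRho (fun y => c (cyl y)) x := by rw [pdRho, pdRho, hAz.fderiv_eq]
  rw [g1, g2, g3, norm_gradient_comp_cyl_sq hx (d hu), pdRho_comp_cyl hx (d hc),
    pdZ_comp_cyl hx (d hb), hU.self_of_nhds, hα.self_of_nhds,
    scalarCurvature_brillForm hx hu hal hb hc hh, brillDensity]
  have : (cyl x).1 = rho x := rfl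
  rw [this]; ring

/-! ### The inversion in the half-plane -/

/-- The inversion in the half-plane of cylindrical coordinates. -/
def hinv (m₁ : ℝ) (p : ℝ × ℝ) : ℝ × ℝ :=
  ((m₁ / 2) ^ 2 / (p.1 ^ 2 + p.2 ^ 2) * p.1, (m₁ / 2) ^ 2 / (p.1 ^ 2 + p.2 ^ 2) * p.2)

lemma contDiffAt_hinv {m₁ : ℝ} {p : ℝ × ℝ} (hp : p.1 ^ 2 + p.2 ^ 2 ≠ 0) {n : WithTop ℕ∞} :
    ContDiffAt ℝ n (hinv m₁) p := by
  have h : ContDiffAt ℝ n (fun q : ℝ × ℝ => q.1 ^ 2 + q.2 ^ 2) p := by fun_prop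
  have h2 : ContDiffAt ℝ n (fun q : ℝ × ℝ => (m₁ / 2) ^ 2 / (q.1 ^ 2 + q.2 ^ 2)) p :=
    contDiffAt_const.div h hp
  exact (h2.mul contDiffAt_fst).prodMk (h2.mul contDiffAt_snd)

lemma inv_apply {m₁ : ℝ} (x : E3) (i : Fin 3) :
    inv m₁ x i = (m₁ / 2) ^ 2 / ‖x‖ ^ 2 * x i := by rw [inv_eq_smul]; simp

lemma rho_inv {m₁ : ℝ} (x : E3) : rho (inv m₁ x) = (m₁ / 2) ^ 2 / ‖x‖ ^ 2 * rho x := by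
  have h : 0 ≤ (m₁ / 2) ^ 2 / ‖x‖ ^ 2 := by positivity
  rw [rho, inv_apply, inv_apply, mul_pow, mul_pow, ← mul_add, ← rho_sq, ← mul_pow,
    Real.sqrt_sq (mul_nonneg h (rho_nonneg x))]

lemma cyl_inv {m₁ : ℝ} (x : E3) : cyl (inv m₁ x) = hinv m₁ (cyl x) := by
  simp only [cyl, hinv, rho_inv, inv_apply, norm_sq_eq_rho]

/-- The derivative of the inversion is the dilation by `(m₁/2)²/|x|²` composed with the reflection
in the plane orthogonal to `x`. -/
lemma jacobian_inv {m₁ : ℝ} {x : E3} (hx : x ≠ 0) (a i : Fin 3) :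
    jacobian (inv m₁) x a i = (m₁ / 2) ^ 2 / ‖x‖ ^ 2 *
      ((1 : Matrix (Fin 3) (Fin 3) ℝ) a i - 2 * x a * x i / ‖x‖ ^ 2) := by
  have h := (EuclideanGeometry.hasFDerivAt_inversion (c := (0 : E3)) (R := m₁ / 2) hx).fderiv
  have h' : fderiv ℝ (inv m₁) x = _ := h
  have h2 : jacobian (inv m₁) x a i = (fderiv ℝ (inv m₁) x (basisVec i)) a := rfl
  rw [h2, h']
  have h3 : (ℝ ∙ (x - 0))ᗮ.reflection (basisVec i)
      = basisVec i - (2 * x i / ‖x‖ ^ 2) • x := by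
    rw [Submodule.reflection_orthogonal_apply, Submodule.reflection_singleton_apply]
    simp only [sub_zero, basisVec, EuclideanSpace.inner_single_right]
    simp [two_smul, ← add_smul]
    ring_nf
  have h4 : ∀ v : E3, ((((m₁ / 2) / dist x 0) ^ 2 • ((ℝ ∙ (x - 0))ᗮ.reflection : E3 →L[ℝ] E3)) v)
      = ((m₁ / 2) / dist x 0) ^ 2 • (ℝ ∙ (x - 0))ᗮ.reflection v := fun v => rfl
  rw [h4, h3]
  simp [basisVec, Matrix.one_apply, div_pow]
  left; ring

lemma ne_zero_of_rho_pos {x : E3} (hx : 0 < rho x) : x ≠ 0 := by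
  rintro rfl
  simp [rho] at hx

/-! ### The doubled metric inside the ball is again a Brill metric. -/

namespace PseudosphericalData

variable {m₁ : ℝ} {ℓ : ℕ} (D : PseudosphericalData m₁ ℓ)

/-- `U` as a function of `(ρ, z)`. -/
def u (p : ℝ × ℝ) : ℝ := D.U (sec p)

/-- `α` as a function of `(ρ, z)`. -/
def al (p : ℝ × ℝ) : ℝ := D.α (sec p)

/-- `A_ρ` as a function of `(ρ, z)`. -/
def ar (p : ℝ × ℝ) : ℝ := p.1 * D.a (sec p)

/-- `A_z` as a function of `(ρ, z)`. -/
def az (p : ℝ × ℝ) : ℝ := D.Az (sec p)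

/-- The doubled `U` inside the ball, as a function of `(ρ, z)`. -/
def uIn (p : ℝ × ℝ) : ℝ :=
  Real.log (p.1 ^ 2 + p.2 ^ 2) + 2 * Real.log (2 / m₁) + D.u (hinv m₁ p)

/-- The doubled `α` inside the ball, as a function of `(ρ, z)`. -/
def alIn (p : ℝ × ℝ) : ℝ := D.al (hinv m₁ p)

/-- The doubled `A_ρ` inside the ball, as a function of `(ρ, z)`. -/
def arIn (p : ℝ × ℝ) : ℝ := (m₁ / 2) ^ 2 / (p.1 ^ 2 + p.2 ^ 2) ^ 2 *
  ((p.2 ^ 2 - p.1 ^ 2) * D.ar (hinv m₁ p) - 2 * p.1 * p.2 * D.az (hinv m₁ p))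

/-- The doubled `A_z` inside the ball, as a function of `(ρ, z)`. -/
def azIn (p : ℝ × ℝ) : ℝ := (m₁ / 2) ^ 2 / (p.1 ^ 2 + p.2 ^ 2) ^ 2 *
  ((p.1 ^ 2 - p.2 ^ 2) * D.az (hinv m₁ p) - 2 * p.1 * p.2 * D.ar (hinv m₁ p))

section Smooth

variable {p : ℝ × ℝ} {n : ℕ∞}

lemma contDiffAt_u (hm : 0 < m₁) (hp : (m₁ / 2) ^ 2 ≤ p.1 ^ 2 + p.2 ^ 2) : ContDiffAt ℝ n D.u p :=
  D.U_smooth.contDiffAt_comp_sec hm hp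

lemma contDiffAt_al (hm : 0 < m₁) (hp : (m₁ / 2) ^ 2 ≤ p.1 ^ 2 + p.2 ^ 2) : ContDiffAt ℝ n D.al p :=
  D.α_smooth.contDiffAt_comp_sec hm hp

lemma contDiffAt_ar (hm : 0 < m₁) (hp : (m₁ / 2) ^ 2 ≤ p.1 ^ 2 + p.2 ^ 2) : ContDiffAt ℝ n D.ar p :=
  contDiffAt_fst.mul (D.a_smooth.contDiffAt_comp_sec hm hp)

lemma contDiffAt_az (hm : 0 < m₁) (hp : (m₁ / 2) ^ 2 ≤ p.1 ^ 2 + p.2 ^ 2) : ContDiffAt ℝ n D.az p :=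
  D.Az_smooth.contDiffAt_comp_sec hm hp

lemma hinv_norm_sq (h0 : 0 < p.1 ^ 2 + p.2 ^ 2) : (hinv m₁ p).1 ^ 2 + (hinv m₁ p).2 ^ 2
    = (m₁ / 2) ^ 4 / (p.1 ^ 2 + p.2 ^ 2) := by
  simp only [hinv]; field_simp

lemma le_hinv_norm_sq (h0 : 0 < p.1 ^ 2 + p.2 ^ 2) (hp : p.1 ^ 2 + p.2 ^ 2 ≤ (m₁ / 2) ^ 2) :
    (m₁ / 2) ^ 2 ≤ (hinv m₁ p).1 ^ 2 + (hinv m₁ p).2 ^ 2 := by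
  rw [hinv_norm_sq h0, le_div_iff₀ h0]
  nlinarith [sq_nonneg (m₁ / 2)]

lemma contDiffAt_alIn (hm : 0 < m₁) (h0 : 0 < p.1 ^ 2 + p.2 ^ 2) (hp : p.1 ^ 2 + p.2 ^ 2 ≤ (m₁ / 2) ^ 2) :
    ContDiffAt ℝ n D.alIn p :=
  (D.contDiffAt_al hm (le_hinv_norm_sq h0 hp)).comp p (contDiffAt_hinv h0.ne')

lemma contDiffAt_uIn (hm : 0 < m₁) (h0 : 0 < p.1 ^ 2 + p.2 ^ 2) (hp : p.1 ^ 2 + p.2 ^ 2 ≤ (m₁ / 2) ^ 2) :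
    ContDiffAt ℝ n D.uIn p := by
  have h1 : ContDiffAt ℝ n (fun q : ℝ × ℝ => q.1 ^ 2 + q.2 ^ 2) p := by fun_prop
  exact ((h1.log h0.ne').add contDiffAt_const).add
    ((D.contDiffAt_u hm (le_hinv_norm_sq h0 hp)).comp p (contDiffAt_hinv h0.ne'))

lemma contDiffAt_arIn (hm : 0 < m₁) (h0 : 0 < p.1 ^ 2 + p.2 ^ 2) (hp : p.1 ^ 2 + p.2 ^ 2 ≤ (m₁ / 2) ^ 2) :
    ContDiffAt ℝ n D.arIn p := by
  have h1 : ContDiffAt ℝ n (fun q : ℝ × ℝ => (m₁ / 2) ^ 2 / (q.1 ^ 2 + q.2 ^ 2) ^ 2) p :=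
    contDiffAt_const.div (by fun_prop) (by positivity)
  have h2 : ContDiffAt ℝ n (fun q => D.ar (hinv m₁ q)) p :=
    (D.contDiffAt_ar hm (le_hinv_norm_sq h0 hp)).comp p (contDiffAt_hinv h0.ne')
  have h3 : ContDiffAt ℝ n (fun q => D.az (hinv m₁ q)) p :=
    (D.contDiffAt_az hm (le_hinv_norm_sq h0 hp)).comp p (contDiffAt_hinv h0.ne')
  have h4 : ContDiffAt ℝ n (fun q : ℝ × ℝ => q.2 ^ 2 - q.1 ^ 2) p := by fun_prop
  have h5 : ContDiffAt ℝ n (fun q : ℝ × ℝ => 2 * q.1 * q.2) p := by fun_prop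
  exact h1.mul ((h4.mul h2).sub (h5.mul h3))

lemma contDiffAt_azIn (hm : 0 < m₁) (h0 : 0 < p.1 ^ 2 + p.2 ^ 2) (hp : p.1 ^ 2 + p.2 ^ 2 ≤ (m₁ / 2) ^ 2) :
    ContDiffAt ℝ n D.azIn p := by
  have h1 : ContDiffAt ℝ n (fun q : ℝ × ℝ => (m₁ / 2) ^ 2 / (q.1 ^ 2 + q.2 ^ 2) ^ 2) p :=
    contDiffAt_const.div (by fun_prop) (by positivity)
  have h2 : ContDiffAt ℝ n (fun q => D.ar (hinv m₁ q)) p :=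
    (D.contDiffAt_ar hm (le_hinv_norm_sq h0 hp)).comp p (contDiffAt_hinv h0.ne')
  have h3 : ContDiffAt ℝ n (fun q => D.az (hinv m₁ q)) p :=
    (D.contDiffAt_az hm (le_hinv_norm_sq h0 hp)).comp p (contDiffAt_hinv h0.ne')
  have h4 : ContDiffAt ℝ n (fun q : ℝ × ℝ => q.1 ^ 2 - q.2 ^ 2) p := by fun_prop
  have h5 : ContDiffAt ℝ n (fun q : ℝ × ℝ => 2 * q.1 * q.2) p := by fun_prop
  exact h1.mul ((h4.mul h3).sub (h5.mul h2))

end Smooth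

lemma U_eq {x : E3} (hx : m₁ / 2 ≤ ‖x‖) : D.U x = D.u (cyl x) := D.U_axisymmetric.eq_sec_cyl hx

lemma α_eq {x : E3} (hx : m₁ / 2 ≤ ‖x‖) : D.α x = D.al (cyl x) := D.α_axisymmetric.eq_sec_cyl hx

lemma Aρ_eq {x : E3} (hx : m₁ / 2 ≤ ‖x‖) : D.Aρ x = D.ar (cyl x) := by
  rw [Aρ, ar, D.a_axisymmetric.eq_sec_cyl hx]; rfl

lemma Az_eq {x : E3} (hx : m₁ / 2 ≤ ‖x‖) : D.Az x = D.az (cyl x) :=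
  D.Az_axisymmetric.eq_sec_cyl hx

lemma g_eq_brillForm {x : E3} (hx : m₁ / 2 ≤ ‖x‖) (hρ : 0 < rho x) :
    D.g x = brillForm (fun y => D.u (cyl y)) (fun y => D.al (cyl y)) (fun y => D.ar (cyl y))
      (fun y => D.az (cyl y)) x := by
  have h := D.Aρ_eq hx
  rw [Aρ] at h
  rw [D.g_eq x hx hρ]
  simp only [brillForm, D.U_eq hx, D.α_eq hx, D.Az_eq hx, h]

/-- With `k = (m₁/2)²`, the inversion multiplies both `dρ² + dz²` and `ρ²` by `k²/r⁴` and fixes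
`dφ`. Since the two parts of a Brill metric acquire the same factor, it can be absorbed into
`e^{-2U}`, which is the origin of the logarithms in the doubled `U`; the form `A_ρ dρ + A_z dz` is
simply pulled back. -/
lemma gBar_eq_brillForm (hm : 0 < m₁) {x : E3} (hx : ‖x‖ < m₁ / 2) (hρ : 0 < rho x) :
    D.gBar x = brillForm (fun y => D.uIn (cyl y)) (fun y => D.alIn (cyl y))
      (fun y => D.arIn (cyl y)) (fun y => D.azIn (cyl y)) x := by
  have hr2 := norm_sq_eq_rho x
  have hx0 : x ≠ 0 := ne_zero_of_rho_pos hρ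
  have hr : 0 < ‖x‖ := norm_pos_iff.mpr hx0
  have hρ2 := rho_sq x
  have hc : 0 < m₁ / 2 := by positivity
  have hρ' : 0 < rho (inv m₁ x) := by rw [rho_inv]; positivity
  rw [D.gBar_of_lt hx, pullback, D.g_eq_brillForm ((lt_norm_inv_iff hm hx0).mpr hx).le hρ']
  simp only [brillForm, cyl_inv]
  set X := D.u (hinv m₁ (cyl x)) with hX
  set A := D.al (hinv m₁ (cyl x)) with hA
  set B := D.ar (hinv m₁ (cyl x)) with hB
  set C := D.az (hinv m₁ (cyl x)) with hC
  have hfst : (cyl x).1 = rho x := rfl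
  have hsnd : (cyl x).2 = x 2 := rfl
  have eu : D.uIn (cyl x) = Real.log (‖x‖ ^ 2) + 2 * Real.log (2 / m₁) + X := by
    rw [uIn, hfst, hsnd, ← hr2]
  have ea : D.alIn (cyl x) = A := rfl
  have er : D.arIn (cyl x) = (m₁ / 2) ^ 2 / ‖x‖ ^ 4 *
      ((x 2 ^ 2 - rho x ^ 2) * B - 2 * rho x * x 2 * C) := by
    rw [arIn, hfst, hsnd, ← hr2, ← pow_mul]
  have ez : D.azIn (cyl x) = (m₁ / 2) ^ 2 / ‖x‖ ^ 4 *
      ((rho x ^ 2 - x 2 ^ 2) * C - 2 * rho x * x 2 * B) := by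
    rw [azIn, hfst, hsnd, ← hr2, ← pow_mul]
  have hlog : ∀ s : ℝ, Real.exp (-2 * (Real.log (‖x‖ ^ 2) + 2 * Real.log (2 / m₁) + X) + s)
      = (m₁ / 2) ^ 4 / ‖x‖ ^ 4 * Real.exp (-2 * X + s) := by
    intro s
    have e1 : -2 * (Real.log (‖x‖ ^ 2) + 2 * Real.log (2 / m₁) + X) + s
        = 4 * Real.log (m₁ / 2 / ‖x‖) + (-2 * X + s) := by
      rw [Real.log_pow, Real.log_div hc.ne' hr.ne', Real.log_div two_ne_zero hm.ne',
        Real.log_div hm.ne' two_ne_zero]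
      push_cast; ring
    have e2 : Real.exp (4 * Real.log (m₁ / 2 / ‖x‖)) = (m₁ / 2 / ‖x‖) ^ 4 := by
      have h4 : (4 : ℝ) * Real.log (m₁ / 2 / ‖x‖) = ((4 : ℕ) : ℝ) * Real.log (m₁ / 2 / ‖x‖) := by
        norm_num
      rw [h4, Real.exp_nat_mul, Real.exp_log (by positivity)]
    rw [e1, Real.exp_add, e2, div_pow]
  have hlog0 := hlog 0
  simp only [add_zero] at hlog0
  rw [eu, ea, er, ez, hlog, hlog0]
  set k := (m₁ / 2) ^ 2 with hk
  have hk4 : (m₁ / 2) ^ 4 = k ^ 2 := by rw [hk]; ring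
  have hkpos : 0 < k := by positivity
  set r := ‖x‖ with hrdef
  set ρ := rho x with hρdef
  have hxi : ∀ i, x i = ρ * dRho x i + x 2 * dZ i := by
    intro i; fin_cases i <;> simp [dRho, dZ, ← hρdef] <;> field_simp
  have hrp : rho (inv m₁ x) = k / r ^ 2 * ρ := rho_inv x
  have hdR : dRho (inv m₁ x) = dRho x := by
    funext i; fin_cases i <;> simp [dRho, hrp, inv_apply, ← hρdef, ← hrdef, ← hk] <;> field_simp
  have hJ : ∀ a i, jacobian (inv m₁) x a i = k / r ^ 2 *
      ((1 : Matrix (Fin 3) (Fin 3) ℝ) a i - 2 * x a * x i / r ^ 2) := fun a i => jacobian_inv hx0 a i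
  -- The Jacobian is a multiple of a symmetric reflection, so pulling back a covector only requires
  -- its pairing with `x`.
  have hJv : ∀ (v : Fin 3 → ℝ) i, ∑ a, jacobian (inv m₁) x a i * v a
      = k / r ^ 2 * (v i - 2 * (∑ a, x a * v a) * x i / r ^ 2) := by
    intro v i
    have h1 : ∑ a, (1 : Matrix (Fin 3) (Fin 3) ℝ) a i * v a = v i := by simp [Matrix.one_apply]
    rw [← h1]
    simp only [hJ, Fin.sum_univ_three]
    ring
  have t1 : ∀ i, ∑ a, jacobian (inv m₁) x a i * dRho x a
      = k / r ^ 4 * ((x 2 ^ 2 - ρ ^ 2) * dRho x i - 2 * ρ * x 2 * dZ i) := by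
    intro i
    have h1 : ∑ a, x a * dRho x a = ρ := by
      simp [Fin.sum_univ_three, dRho, ← hρdef]; field_simp; linarith
    rw [hJv, h1, hxi i]
    field_simp
    rw [hr2]; ring
  have t2 : ∀ i, ∑ a, jacobian (inv m₁) x a i * dZ a
      = k / r ^ 4 * ((ρ ^ 2 - x 2 ^ 2) * dZ i - 2 * ρ * x 2 * dRho x i) := by
    intro i
    have h1 : ∑ a, x a * dZ a = x 2 := by simp [Fin.sum_univ_three, dZ]
    rw [hJv, h1, hxi i]
    field_simp
    rw [hr2]; ring
  have hdP : ∀ a, dPhi (inv m₁ x) a = r ^ 2 / k * dPhi x a := by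
    intro a
    fin_cases a
    · simp [dPhi, hrp, inv_apply, ← hρdef, ← hrdef, ← hk]; field_simp
    · simp [dPhi, hrp, inv_apply, ← hρdef, ← hrdef, ← hk]; field_simp
    · simp [dPhi]
  -- The covector `dφ` annihilates `x`, so the reflection fixes it, and its scaling under the
  -- inversion cancels the dilation factor.
  have t3 : ∀ i, ∑ a, jacobian (inv m₁) x a i * dPhi (inv m₁ x) a = dPhi x i := by
    intro i
    have h1 : ∑ a, x a * dPhi x a = 0 := by
      simp [Fin.sum_univ_three, dPhi, ← hρdef]; field_simp; ring
    have h2 : ∑ a, x a * dPhi (inv m₁ x) a = r ^ 2 / k * ∑ a, x a * dPhi x a := by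
      simp only [hdP, Fin.sum_univ_three]; ring
    rw [hJv, h2, h1, hdP]
    field_simp
    ring
  have hpull : ∀ (J : Matrix (Fin 3) (Fin 3) ℝ) (s t : ℝ) (v w y : Fin 3 → ℝ) (i j : Fin 3),
      (Jᵀ * (s • (Matrix.vecMulVec v v + Matrix.vecMulVec w w) + t • Matrix.vecMulVec y y) * J) i j
      = s * ((∑ a, J a i * v a) * (∑ a, J a j * v a) + (∑ a, J a i * w a) * (∑ a, J a j * w a))
        + t * ((∑ a, J a i * y a) * (∑ a, J a j * y a)) := by
    intro J s t v w y i j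
    simp only [Matrix.mul_apply, Matrix.transpose_apply, Matrix.add_apply, Matrix.smul_apply,
      Matrix.vecMulVec_apply, smul_eq_mul, Fin.sum_univ_three]
    ring
  have t4 : ∀ i, ∑ a, jacobian (inv m₁) x a i * (dPhi (inv m₁ x) + B • dRho (inv m₁ x) + C • dZ) a
      = dPhi x i + k / r ^ 4 * ((x 2 ^ 2 - ρ ^ 2) * B - 2 * ρ * x 2 * C) * dRho x i
        + k / r ^ 4 * ((ρ ^ 2 - x 2 ^ 2) * C - 2 * ρ * x 2 * B) * dZ i := by
    intro i
    have : ∑ a, jacobian (inv m₁) x a i * (dPhi (inv m₁ x) + B • dRho (inv m₁ x) + C • dZ) a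
        = ∑ a, jacobian (inv m₁) x a i * dPhi (inv m₁ x) a
          + B * (∑ a, jacobian (inv m₁) x a i * dRho x a)
          + C * ∑ a, jacobian (inv m₁) x a i * dZ a := by
      rw [hdR]
      simp only [Pi.add_apply, Pi.smul_apply, smul_eq_mul, Fin.sum_univ_three]
      ring
    rw [this, t1, t2, t3]; ring
  ext i j
  rw [hpull, hdR]
  have t4' := t4
  rw [hdR] at t4'
  rw [t1, t1, t2, t2, t4', t4', hrp, hk4]
  simp only [Matrix.add_apply, Matrix.smul_apply, Matrix.vecMulVec_apply, smul_eq_mul,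
    Pi.add_apply, Pi.smul_apply]
  have hr4 : r ^ 4 = (ρ ^ 2 + x 2 ^ 2) ^ 2 := by rw [← hr2]; ring
  -- The pullback acts on `(dρ, dz)` by a multiple of an orthogonal matrix, because `(z² - ρ²)² +
  -- (2ρz)² = r⁴`.
  have hfact : k / r ^ 4 * ((x 2 ^ 2 - ρ ^ 2) * dRho x i - 2 * ρ * x 2 * dZ i) *
        (k / r ^ 4 * ((x 2 ^ 2 - ρ ^ 2) * dRho x j - 2 * ρ * x 2 * dZ j)) +
      k / r ^ 4 * ((ρ ^ 2 - x 2 ^ 2) * dZ i - 2 * ρ * x 2 * dRho x i) *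
        (k / r ^ 4 * ((ρ ^ 2 - x 2 ^ 2) * dZ j - 2 * ρ * x 2 * dRho x j))
      = k ^ 2 / r ^ 4 * (dRho x i * dRho x j + dZ i * dZ j) := by
    field_simp
    rw [hr4]; ring
  rw [hfact]
  ring

/-- All ingredients of the density are local, so away from the sphere the doubled coefficients may
be replaced near `x` by the smooth functions of `(ρ, z)` that represent them on that side. -/
lemma massDensity_of_lt (hm : 0 < m₁) {x : E3} (hx : m₁ / 2 < ‖x‖) (hρ : 0 < rho x) :
    D.massDensity x = brillDensity D.u D.al (cyl x) := by
  have hp : (m₁ / 2) ^ 2 ≤ (cyl x).1 ^ 2 + (cyl x).2 ^ 2 := by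
    have h := norm_sq_eq_rho x
    change _ ≤ rho x ^ 2 + x 2 ^ 2
    rw [← h]; gcongr
  have hev : ∀ᶠ y in 𝓝 x, m₁ / 2 ≤ ‖y‖ ∧ 0 < rho y := by
    filter_upwards [(isOpen_lt_norm _).mem_nhds hx, isOpen_rho_pos.mem_nhds hρ] with y h1 h2
    exact ⟨le_of_lt h1, h2⟩
  refine density_eq_brillDensity hρ (D.contDiffAt_u hm hp) (D.contDiffAt_al hm hp)
    (D.contDiffAt_ar hm hp) (D.contDiffAt_az hm hp) ?_ ?_ ?_ ?_ ?_
  · filter_upwards [hev] with y hy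
    rw [UBar, if_pos hy.1, D.U_eq hy.1]
  · filter_upwards [hev] with y hy
    rw [αBar, if_pos hy.1, D.α_eq hy.1]
  · filter_upwards [hev] with y hy
    rw [AρBar, if_pos hy.1, D.Aρ_eq hy.1]
  · filter_upwards [hev] with y hy
    rw [AzBar, if_pos hy.1, D.Az_eq hy.1]
  · filter_upwards [hev] with y hy
    rw [D.gBar_of_le hy.1, D.g_eq_brillForm hy.1 hy.2]

lemma massDensity_of_gt (hm : 0 < m₁) {x : E3} (hx : ‖x‖ < m₁ / 2) (hρ : 0 < rho x) :
    D.massDensity x = brillDensity D.uIn D.alIn (cyl x) := by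
  have hp0 : 0 < (cyl x).1 ^ 2 + (cyl x).2 ^ 2 := by
    change 0 < rho x ^ 2 + x 2 ^ 2
    positivity
  have hp : (cyl x).1 ^ 2 + (cyl x).2 ^ 2 ≤ (m₁ / 2) ^ 2 := by
    have h := norm_sq_eq_rho x
    change rho x ^ 2 + x 2 ^ 2 ≤ _
    rw [← h]; gcongr
  have hev : ∀ᶠ y in 𝓝 x, ‖y‖ < m₁ / 2 ∧ 0 < rho y := by
    filter_upwards [(isOpen_lt continuous_norm continuous_const).mem_nhds hx,
      isOpen_rho_pos.mem_nhds hρ] with y h1 h2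
    exact ⟨h1, h2⟩
  have hinv' : ∀ y : E3, ‖y‖ < m₁ / 2 → 0 < rho y → m₁ / 2 ≤ ‖inv m₁ y‖ := by
    intro y hy hρy
    exact ((lt_norm_inv_iff hm (ne_zero_of_rho_pos hρy)).mpr hy).le
  have n4 : ∀ y : E3, ‖y‖ ^ 4 = (rho y ^ 2 + y 2 ^ 2) ^ 2 := fun y => by
    rw [← norm_sq_eq_rho]; ring
  refine density_eq_brillDensity hρ (D.contDiffAt_uIn hm hp0 hp) (D.contDiffAt_alIn hm hp0 hp)
    (D.contDiffAt_arIn hm hp0 hp) (D.contDiffAt_azIn hm hp0 hp) ?_ ?_ ?_ ?_ ?_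
  · filter_upwards [hev] with y hy
    rw [UBar, if_neg (not_le.mpr hy.1), D.U_eq (hinv' y hy.1 hy.2), cyl_inv, uIn]
    have : Real.log ((cyl y).1 ^ 2 + (cyl y).2 ^ 2) = 2 * Real.log ‖y‖ := by
      change Real.log (rho y ^ 2 + y 2 ^ 2) = _
      rw [← norm_sq_eq_rho, Real.log_pow]; norm_num
    rw [this]
  · filter_upwards [hev] with y hy
    rw [αBar, if_neg (not_le.mpr hy.1), D.α_eq (hinv' y hy.1 hy.2), cyl_inv, alIn]
  · filter_upwards [hev] with y hy
    rw [AρBar, if_neg (not_le.mpr hy.1), D.Aρ_eq (hinv' y hy.1 hy.2),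
      D.Az_eq (hinv' y hy.1 hy.2), cyl_inv, n4]
    rfl
  · filter_upwards [hev] with y hy
    rw [AzBar, if_neg (not_le.mpr hy.1), D.Aρ_eq (hinv' y hy.1 hy.2),
      D.Az_eq (hinv' y hy.1 hy.2), cyl_inv, n4]
    rfl
  · filter_upwards [hev] with y hy
    rw [D.gBar_eq_brillForm hm hy.1 hy.2]

end PseudosphericalData

/-! ### Integration in logarithmic polar coordinates -/

/-- Logarithmic polar coordinates `(t, θ) ↦ (e^t sin θ, e^t cos θ)` in the half-plane. -/
def logPolar (q : ℝ × ℝ) : ℝ × ℝ := (Real.exp q.1 * Real.sin q.2, Real.exp q.1 * Real.cos q.2)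

/-- The strip `ℝ × (0, π)`. -/
def strip : Set (ℝ × ℝ) := Set.univ ×ˢ Set.Ioo 0 Real.pi

lemma measurableSet_strip : MeasurableSet strip := MeasurableSet.univ.prod measurableSet_Ioo

lemma continuous_logPolar : Continuous logPolar := by unfold logPolar; fun_prop

lemma logPolar_norm_sq (q : ℝ × ℝ) :
    (logPolar q).1 ^ 2 + (logPolar q).2 ^ 2 = Real.exp q.1 ^ 2 := by
  simp only [logPolar, mul_pow, ← mul_add, Real.sin_sq_add_cos_sq, mul_one]

lemma logPolar_fst_pos {q : ℝ × ℝ} (hq : q ∈ strip) : 0 < (logPolar q).1 :=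
  mul_pos (Real.exp_pos _) (Real.sin_pos_of_mem_Ioo hq.2)

lemma logPolar_injOn : Set.InjOn logPolar strip := by
  intro q hq q' hq' h
  have h1 : Real.exp q.1 ^ 2 = Real.exp q'.1 ^ 2 := by
    rw [← logPolar_norm_sq, ← logPolar_norm_sq, h]
  have h2 : Real.exp q.1 = Real.exp q'.1 :=
    (pow_left_inj₀ (Real.exp_pos _).le (Real.exp_pos _).le two_ne_zero).mp h1
  have h3 : Real.exp q.1 * Real.cos q.2 = Real.exp q'.1 * Real.cos q'.2 := congrArg Prod.snd h
  rw [h2] at h3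
  have h4 := mul_left_cancel₀ (Real.exp_pos _).ne' h3
  exact Prod.ext (Real.exp_injective h2)
    (Real.injOn_cos (Set.Ioo_subset_Icc_self hq.2) (Set.Ioo_subset_Icc_self hq'.2) h4)

lemma logPolar_image_strip : logPolar '' strip = Set.Ioi 0 ×ˢ Set.univ := by
  ext p
  constructor
  · rintro ⟨q, hq, rfl⟩
    exact ⟨logPolar_fst_pos hq, trivial⟩
  · rintro ⟨hp, -⟩
    have hp' : 0 < p.1 := hp
    have hr2 : 0 < p.1 ^ 2 + p.2 ^ 2 := by positivity
    set r := Real.sqrt (p.1 ^ 2 + p.2 ^ 2) with hr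
    have hr0 : 0 < r := Real.sqrt_pos.mpr hr2
    have hrsq : r ^ 2 = p.1 ^ 2 + p.2 ^ 2 := Real.sq_sqrt hr2.le
    have hlt : |p.2 / r| < 1 := by
      rw [abs_div, abs_of_pos hr0, div_lt_one hr0, ← sq_lt_sq₀ (abs_nonneg _) hr0.le, sq_abs, hrsq]
      nlinarith
    rw [abs_lt] at hlt
    refine ⟨(Real.log r, Real.arccos (p.2 / r)), ⟨trivial, Real.arccos_pos.mpr hlt.2, ?_⟩, ?_⟩
    · refine lt_of_le_of_ne (Real.arccos_le_pi _) fun h => ?_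
      have := Real.arccos_eq_pi.mp h
      linarith
    · refine Prod.ext ?_ ?_
      · simp only [logPolar, Real.exp_log hr0, Real.sin_arccos]
        have hnn : 0 ≤ 1 - (p.2 / r) ^ 2 := by
          rw [div_pow, hrsq, sub_nonneg, div_le_one hr2]; nlinarith
        rw [← sq_eq_sq₀ (by positivity) hp'.le, mul_pow, Real.sq_sqrt hnn, div_pow]
        field_simp
        linarith
      · simp only [logPolar, Real.exp_log hr0, Real.cos_arccos hlt.1.le hlt.2.le]
        field_simp

/-- The derivative of `logPolar`. -/
def logPolarDeriv (q : ℝ × ℝ) : ℝ × ℝ →L[ℝ] ℝ × ℝ :=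
  (Matrix.toLin (.finTwoProd ℝ) (.finTwoProd ℝ)
    !![Real.exp q.1 * Real.sin q.2, Real.exp q.1 * Real.cos q.2;
      Real.exp q.1 * Real.cos q.2, -(Real.exp q.1 * Real.sin q.2)]).toContinuousLinearMap

lemma hasFDerivAt_logPolar (q : ℝ × ℝ) : HasFDerivAt logPolar (logPolarDeriv q) q := by
  have h1 := (ContinuousLinearMap.fst ℝ ℝ ℝ).hasFDerivAt (x := q)
  have h2 := (ContinuousLinearMap.snd ℝ ℝ ℝ).hasFDerivAt (x := q)
  have he := (Real.hasDerivAt_exp q.1).comp_hasFDerivAt q h1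
  have hs := (Real.hasDerivAt_sin q.2).comp_hasFDerivAt q h2
  have hc := (Real.hasDerivAt_cos q.2).comp_hasFDerivAt q h2
  have h := (he.mul hs).prodMk (he.mul hc)
  refine h.congr_fderiv ?_
  unfold logPolarDeriv
  rw [Matrix.toLin_finTwoProd_toContinuousLinearMap]
  ext <;> simp <;> ring

lemma det_logPolarDeriv (q : ℝ × ℝ) : |(logPolarDeriv q).det| = Real.exp (2 * q.1) := by
  have : (logPolarDeriv q).det = -Real.exp (2 * q.1) := by
    unfold logPolarDeriv
    simp only [LinearMap.det_toContinuousLinearMap, LinearMap.det_toLin, Matrix.det_fin_two_of]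
    have e : Real.exp (2 * q.1) = Real.exp q.1 ^ 2 := by rw [← Real.exp_nat_mul]; norm_num
    have := Real.sin_sq_add_cos_sq q.2
    rw [e]
    linear_combination (-(Real.exp q.1) ^ 2) * this
  rw [this, abs_neg, abs_of_pos (Real.exp_pos _)]

open scoped ENNReal Pointwise

lemma lintegral_coords {F : ℝ → ℝ → ℝ → ℝ≥0∞}
    (hF : Measurable fun q : ℝ × ℝ × ℝ => F q.2.1 q.2.2 q.1) :
    ∫⁻ x : E3, F (x 0) (x 1) (x 2) = ∫⁻ z : ℝ, ∫⁻ q : ℝ × ℝ, F q.1 q.2 z := by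
  have h1 : MeasurePreserving (@WithLp.ofLp 2 (Fin 3 → ℝ)) := PiLp.volume_preserving_ofLp (Fin 3)
  have h2 := volume_preserving_piFinSuccAbove (fun _ : Fin 3 => ℝ) 2
  have h3 : MeasurePreserving (Prod.map id (MeasurableEquiv.finTwoArrow (α := ℝ)))
      ((volume : Measure ℝ).prod (volume : Measure (Fin 2 → ℝ)))
      ((volume : Measure ℝ).prod (volume : Measure (ℝ × ℝ))) :=
    (MeasurePreserving.id _).prod (volume_preserving_finTwoArrow ℝ)
  have h4 := h3.comp (h2.comp h1)
  have h5 := h4.lintegral_comp hF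
  rw [lintegral_prod _ hF.aemeasurable] at h5
  rw [← h5]
  rfl

lemma lintegral_radial {F : ℝ → ℝ≥0∞} (hF : Measurable F) :
    ∫⁻ q : ℝ × ℝ, F (Real.sqrt (q.1 ^ 2 + q.2 ^ 2))
      = ∫⁻ r in Set.Ioi (0 : ℝ), ENNReal.ofReal (2 * Real.pi * r) * F r := by
  rw [← lintegral_comp_polarCoord_symm]
  have h1 : ∀ p ∈ polarCoord.target, ENNReal.ofReal p.1 • F (Real.sqrt ((polarCoord.symm p).1 ^ 2
      + (polarCoord.symm p).2 ^ 2)) = ENNReal.ofReal p.1 * F p.1 := by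
    intro p hp
    have hp1 : 0 < p.1 := hp.1
    have : (polarCoord.symm p).1 ^ 2 + (polarCoord.symm p).2 ^ 2 = p.1 ^ 2 := by
      simp only [polarCoord_symm_apply, mul_pow, ← mul_add, Real.cos_sq_add_sin_sq, mul_one]
    rw [this, Real.sqrt_sq hp1.le, smul_eq_mul]
  rw [setLIntegral_congr_fun polarCoord.open_target.measurableSet h1]
  have hmeas : Measurable fun p : ℝ × ℝ => ENNReal.ofReal p.1 * F p.1 := by fun_prop
  have h2 : polarCoord.target = Set.Ioi (0 : ℝ) ×ˢ Set.Ioo (-Real.pi) Real.pi := rfl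
  rw [h2, Measure.volume_eq_prod, ← Measure.prod_restrict, lintegral_prod _ hmeas.aemeasurable]
  refine lintegral_congr fun r => ?_
  simp only [lintegral_const, Measure.restrict_apply_univ, Real.volume_Ioo]
  rw [mul_comm, ← mul_assoc, ← ENNReal.ofReal_mul (by linarith [Real.pi_pos])]
  congr 2; ring

lemma measurable_cyl : Measurable cyl := continuous_cyl.measurable

/-- Integration of axisymmetric functions on `ℝ³` in logarithmic polar coordinates. -/
theorem lintegral_comp_cyl {f : ℝ × ℝ → ℝ≥0∞} (hf : Measurable f) :
    ∫⁻ x : E3, f (cyl x) = ∫⁻ q in strip,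
      ENNReal.ofReal (2 * Real.pi * Real.exp (3 * q.1) * Real.sin q.2) * f (logPolar q) := by
  have h1 : ∫⁻ x : E3, f (cyl x)
      = ∫⁻ z : ℝ, ∫⁻ q : ℝ × ℝ, f (Real.sqrt (q.1 ^ 2 + q.2 ^ 2), z) := by
    refine lintegral_coords (F := fun a b z => f (Real.sqrt (a ^ 2 + b ^ 2), z)) ?_
    exact hf.comp (by fun_prop)
  have h2 : ∀ z : ℝ, ∫⁻ q : ℝ × ℝ, f (Real.sqrt (q.1 ^ 2 + q.2 ^ 2), z)
      = ∫⁻ r in Set.Ioi (0 : ℝ), ENNReal.ofReal (2 * Real.pi * r) * f (r, z) := fun z =>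
    lintegral_radial (F := fun r => f (r, z)) (hf.comp (by fun_prop))
  have hm : Measurable fun p : ℝ × ℝ => ENNReal.ofReal (2 * Real.pi * p.1) * f p := by fun_prop
  have h3 : ∫⁻ z : ℝ, ∫⁻ r in Set.Ioi (0 : ℝ), ENNReal.ofReal (2 * Real.pi * r) * f (r, z)
      = ∫⁻ p in Set.Ioi (0 : ℝ) ×ˢ Set.univ, ENNReal.ofReal (2 * Real.pi * p.1) * f p := by
    rw [Measure.volume_eq_prod, ← Measure.prod_restrict, Measure.restrict_univ,
      lintegral_prod_symm _ hm.aemeasurable]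
  rw [h1]
  simp only [h2]
  -- The weight `2πρ` with `ρ = e^t sin θ`, times the Jacobian `e^{2t}` of the logarithmic polar
  -- coordinates, gives `2πe^{3t} sin θ`.
  rw [h3, ← logPolar_image_strip, lintegral_image_eq_lintegral_abs_det_fderiv_mul volume
    measurableSet_strip (fun q _ => (hasFDerivAt_logPolar q).hasFDerivWithinAt) logPolar_injOn]
  refine lintegral_congr fun q => ?_
  rw [det_logPolarDeriv, ← mul_assoc, ← ENNReal.ofReal_mul (Real.exp_pos _).le]
  congr 2
  have : Real.exp (3 * q.1) = Real.exp (2 * q.1) * Real.exp q.1 := by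
    rw [← Real.exp_add]; congr 1; ring
  simp only [logPolar]
  rw [this]; ring

/-- The volume of `ℝ³` in the coordinates `(ρ, z)`. -/
theorem map_cyl_volume : Measure.map cyl (volume : Measure E3) = Measure.map logPolar
    ((volume.restrict strip).withDensity
      fun q => ENNReal.ofReal (2 * Real.pi * Real.exp (3 * q.1) * Real.sin q.2)) := by
  have hw : Measurable fun q : ℝ × ℝ =>
      ENNReal.ofReal (2 * Real.pi * Real.exp (3 * q.1) * Real.sin q.2) := by fun_prop
  have hl := continuous_logPolar.measurable
  ext B hB
  have hf : Measurable (B.indicator (1 : ℝ × ℝ → ℝ≥0∞)) := measurable_one.indicator hB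
  rw [← lintegral_indicator_one hB, ← lintegral_indicator_one hB, lintegral_map hf measurable_cyl,
    lintegral_map hf hl, lintegral_comp_cyl hf]
  exact (lintegral_withDensity_eq_lintegral_mul _ hw (hf.comp hl)).symm

/-- The surface measure of the unit sphere in the coordinates `(ρ, z)`. -/
theorem map_cyl_toSphere :
    Measure.map (fun n : Metric.sphere (0 : E3) 1 => cyl n) (volume : Measure E3).toSphere
      = Measure.map (fun θ : ℝ => (Real.sin θ, Real.cos θ))
        ((volume.restrict (Set.Ioo 0 Real.pi)).withDensity
          fun θ => ENNReal.ofReal (2 * Real.pi * Real.sin θ)) := by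
  have hcm : Measurable fun n : Metric.sphere (0 : E3) 1 => cyl n :=
    measurable_cyl.comp measurable_subtype_coe
  have hsc : Measurable fun θ : ℝ => (Real.sin θ, Real.cos θ) := by fun_prop
  have hw : Measurable fun θ : ℝ => ENNReal.ofReal (2 * Real.pi * Real.sin θ) := by fun_prop
  ext B hB
  rw [Measure.map_apply hcm hB, Measure.map_apply hsc hB, withDensity_apply _ (hsc hB),
    Measure.toSphere_apply' _ (hcm hB)]
  let r : ℝ × ℝ → ℝ := fun p => Real.sqrt (p.1 ^ 2 + p.2 ^ 2)
  -- The measure `toSphere` of a set is three times the volume of the open cone over it with the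
  -- origin removed; `T` is the image of this cone in the half-plane, where it is a product in `(t,
  -- θ)`.
  let T : Set (ℝ × ℝ) := {p | r p < 1} ∩ ({p | 0 < r p} ∩ (fun p => (p.1 / r p, p.2 / r p)) ⁻¹' B)
  have hrm : Measurable r := by simp only [r]; fun_prop
  have hT : MeasurableSet T := by
    refine (measurableSet_lt hrm measurable_const).inter
      ((measurableSet_lt measurable_const hrm).inter ?_)
    exact ((measurable_fst.div hrm).prodMk (measurable_snd.div hrm)) hB
  have hr : ∀ x : E3, r (cyl x) = ‖x‖ := by
    intro x
    change Real.sqrt (rho x ^ 2 + x 2 ^ 2) = _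
    rw [← norm_sq_eq_rho, Real.sqrt_sq (norm_nonneg _)]
  have hcyl : ∀ (s : ℝ) (x : E3), 0 ≤ s → cyl (s • x) = (s * rho x, s * x 2) := by
    intro s x hs
    have : rho (s • x) = s * rho x := by
      rw [rho, PiLp.smul_apply, PiLp.smul_apply, smul_eq_mul, smul_eq_mul, mul_pow, mul_pow,
        ← mul_add, ← rho_sq, ← mul_pow, Real.sqrt_sq (mul_nonneg hs (rho_nonneg x))]
    rw [cyl, this]; rfl
  have hset : (Set.Ioo (0 : ℝ) 1 • ((fun n : Metric.sphere (0 : E3) 1 => (n : E3)) ''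
      ((fun n : Metric.sphere (0 : E3) 1 => cyl n) ⁻¹' B))) = cyl ⁻¹' T := by
    ext x
    constructor
    · rintro ⟨s, hs, _, ⟨n, hn, rfl⟩, rfl⟩
      have hn1 : ‖(n : E3)‖ = 1 := by simp
      have hnorm : r (cyl (s • (n : E3))) = s := by
        rw [hr, norm_smul, hn1, mul_one, Real.norm_of_nonneg hs.1.le]
      refine ⟨?_, ?_, ?_⟩
      · change r (cyl (s • (n : E3))) < 1; rw [hnorm]; exact hs.2
      · change 0 < r (cyl (s • (n : E3))); rw [hnorm]; exact hs.1
      · change ((cyl (s • (n : E3))).1 / r (cyl (s • (n : E3))),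
          (cyl (s • (n : E3))).2 / r (cyl (s • (n : E3)))) ∈ B
        rw [hnorm, hcyl s n hs.1.le]
        have hs0 := hs.1.ne'
        simp only [mul_div_cancel_left₀ _ hs0]
        exact hn
    · rintro ⟨h1, h2, h3⟩
      have h1' : ‖x‖ < 1 := by rw [← hr]; exact h1
      have h2' : 0 < ‖x‖ := by rw [← hr]; exact h2
      refine ⟨‖x‖, ⟨h2', h1'⟩, ‖x‖⁻¹ • x, ⟨⟨‖x‖⁻¹ • x, ?_⟩, ?_, rfl⟩, ?_⟩
      · simp [norm_smul, inv_mul_cancel₀ h2'.ne']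
      · change cyl (‖x‖⁻¹ • x) ∈ B
        rw [hcyl _ _ (inv_nonneg.mpr h2'.le)]
        have h3' : (rho x / r (cyl x), x 2 / r (cyl x)) ∈ B := h3
        rw [hr, div_eq_inv_mul, div_eq_inv_mul] at h3'
        exact h3'
      · simp [smul_smul, mul_inv_cancel₀ h2'.ne']
  have hvol : (volume : Measure E3) (cyl ⁻¹' T) = ∫⁻ x : E3, T.indicator 1 (cyl x) := by
    rw [← lintegral_indicator_one (measurable_cyl hT)]
    rfl
  rw [hset, hvol, lintegral_comp_cyl (measurable_one.indicator hT)]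
  have hrQ : ∀ q, r (logPolar q) = Real.exp q.1 := by
    intro q
    simp only [r]
    rw [logPolar_norm_sq, Real.sqrt_sq (Real.exp_pos _).le]
  have hind : ∀ q : ℝ × ℝ, T.indicator (1 : ℝ × ℝ → ℝ≥0∞) (logPolar q)
      = (Set.Iio (0 : ℝ)).indicator 1 q.1
        * ((fun θ : ℝ => (Real.sin θ, Real.cos θ)) ⁻¹' B).indicator 1 q.2 := by
    intro q
    have hq : logPolar q ∈ T ↔ q.1 < 0 ∧ (Real.sin q.2, Real.cos q.2) ∈ B := by
      have e : ((logPolar q).1 / r (logPolar q), (logPolar q).2 / r (logPolar q))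
          = (Real.sin q.2, Real.cos q.2) := by
        rw [hrQ]; simp [logPolar]
      rw [hrQ] at e
      simp only [T, Set.mem_inter_iff, Set.mem_ofPred_eq, Set.mem_preimage, hrQ, e,
        Real.exp_pos, true_and, Real.exp_lt_one_iff]
    by_cases h1 : q.1 < 0 <;> by_cases h2 : (Real.sin q.2, Real.cos q.2) ∈ B <;>
      simp [Set.indicator, hq, h1, h2]
  have hsplit : ∀ q : ℝ × ℝ, ENNReal.ofReal (2 * Real.pi * Real.exp (3 * q.1) * Real.sin q.2)
        * T.indicator 1 (logPolar q)
      = ((Set.Iio (0 : ℝ)).indicator (fun t => ENNReal.ofReal (Real.exp (3 * t))) q.1)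
        * (((fun θ : ℝ => (Real.sin θ, Real.cos θ)) ⁻¹' B).indicator
          (fun θ => ENNReal.ofReal (2 * Real.pi * Real.sin θ)) q.2) := by
    intro q
    rw [hind]
    have e : ENNReal.ofReal (2 * Real.pi * Real.exp (3 * q.1) * Real.sin q.2)
        = ENNReal.ofReal (Real.exp (3 * q.1)) * ENNReal.ofReal (2 * Real.pi * Real.sin q.2) := by
      rw [← ENNReal.ofReal_mul (Real.exp_pos _).le]; congr 1; ring
    rw [e]
    by_cases h1 : q.1 ∈ Set.Iio (0 : ℝ) <;>
      by_cases h2 : q.2 ∈ (fun θ : ℝ => (Real.sin θ, Real.cos θ)) ⁻¹' B <;>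
      simp only [Set.indicator_of_mem, Set.indicator_of_notMem, h1, h2, Pi.one_apply,
        mul_one, mul_zero, zero_mul, not_false_eq_true]
  simp only [hsplit]
  have hexp : ∫⁻ t, (Set.Iio (0 : ℝ)).indicator (fun t => ENNReal.ofReal (Real.exp (3 * t))) t
      = ENNReal.ofReal (1 / 3) := by
    rw [lintegral_indicator measurableSet_Iio, setLIntegral_congr Iio_ae_eq_Iic,
      ← ofReal_integral_eq_lintegral_ofReal (integrableOn_exp_mul_Iic (by norm_num) 0)
        (Eventually.of_forall fun t => (Real.exp_pos _).le),
      integral_exp_mul_Iic (by norm_num) 0]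
    simp
  rw [strip, Measure.volume_eq_prod, ← Measure.prod_restrict, Measure.restrict_univ,
    lintegral_prod_mul, hexp, lintegral_indicator (hsc hB)]
  -- The dimension factor `3` cancels the radial integral `∫ e^{3t} dt = 1/3` over `t < 0`.
  · have hd : (Module.finrank ℝ E3 : ℝ≥0∞) = ENNReal.ofReal 3 := by simp
    rw [hd, ← mul_assoc, ← ENNReal.ofReal_mul (by norm_num)]
    norm_num
  · exact ((by fun_prop : Measurable fun t : ℝ => ENNReal.ofReal (Real.exp (3 * t))).indicator
      measurableSet_Iio).aemeasurable
  · exact (hw.indicator (hsc hB)).aemeasurable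

/-! ### Null sets and integrals of axisymmetric functions. -/

lemma measurable_logPolar_weight : Measurable fun q : ℝ × ℝ =>
    ENNReal.ofReal (2 * Real.pi * Real.exp (3 * q.1) * Real.sin q.2) := by fun_prop

/-- The pushed-forward volume is carried by the image of the open strip, which misses the axis. -/
lemma ae_rho_pos : ∀ᵐ x : E3, 0 < rho x := by
  have hS : MeasurableSet {p : ℝ × ℝ | 0 < p.1} := measurableSet_lt measurable_const measurable_fst
  have h : ∀ᵐ p ∂(Measure.map cyl (volume : Measure E3)), 0 < p.1 := by
    rw [map_cyl_volume, ae_map_iff continuous_logPolar.measurable.aemeasurable hS]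
    refine (withDensity_absolutelyContinuous _ _).ae_le ?_
    filter_upwards [ae_restrict_mem measurableSet_strip] with q hq using logPolar_fst_pos hq
  exact (ae_map_iff measurable_cyl.aemeasurable hS).mp h

lemma ae_sphere_rho_pos :
    ∀ᵐ n : Metric.sphere (0 : E3) 1 ∂((volume : Measure E3).toSphere), 0 < rho n := by
  have hcm : Measurable fun n : Metric.sphere (0 : E3) 1 => cyl n :=
    measurable_cyl.comp measurable_subtype_coe
  have hsc : Measurable fun θ : ℝ => (Real.sin θ, Real.cos θ) := by fun_prop
  have hS : MeasurableSet {p : ℝ × ℝ | 0 < p.1} := measurableSet_lt measurable_const measurable_fst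
  have h : ∀ᵐ p ∂(Measure.map (fun n : Metric.sphere (0 : E3) 1 => cyl n)
      (volume : Measure E3).toSphere), 0 < p.1 := by
    rw [map_cyl_toSphere, ae_map_iff hsc.aemeasurable hS]
    refine (withDensity_absolutelyContinuous _ _).ae_le ?_
    filter_upwards [ae_restrict_mem measurableSet_Ioo] with q hq using Real.sin_pos_of_mem_Ioo hq
  exact (ae_map_iff hcm.aemeasurable hS).mp h

lemma weight_toReal {q : ℝ × ℝ} (hq : q ∈ strip) :
    (ENNReal.ofReal (2 * Real.pi * Real.exp (3 * q.1) * Real.sin q.2)).toReal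
      = 2 * Real.pi * Real.exp (3 * q.1) * Real.sin q.2 := by
  have := Real.sin_pos_of_mem_Ioo hq.2
  exact ENNReal.toReal_ofReal (by positivity)

theorem integrable_comp_cyl_iff {f : ℝ × ℝ → ℝ} (hf : Measurable f) :
    Integrable (fun x : E3 => f (cyl x)) ↔ IntegrableOn
      (fun q => 2 * Real.pi * Real.exp (3 * q.1) * Real.sin q.2 * f (logPolar q)) strip := by
  have h1 := integrable_map_measure (μ := (volume : Measure E3)) (f := cyl) (g := f)
    hf.aestronglyMeasurable measurable_cyl.aemeasurable
  have h2 := integrable_map_measure (f := logPolar) (g := f) (μ := (volume.restrict strip).withDensity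
      fun q => ENNReal.ofReal (2 * Real.pi * Real.exp (3 * q.1) * Real.sin q.2))
    hf.aestronglyMeasurable continuous_logPolar.measurable.aemeasurable
  have h3 : Integrable (fun x : E3 => f (cyl x)) ↔ Integrable (f ∘ cyl) := Iff.rfl
  rw [h3, ← h1, map_cyl_volume, h2, integrable_withDensity_iff_integrable_smul'
    measurable_logPolar_weight (Eventually.of_forall fun _ => ENNReal.ofReal_lt_top), IntegrableOn]
  refine integrable_congr ?_
  filter_upwards [ae_restrict_mem measurableSet_strip] with q hq
  rw [weight_toReal hq]; rfl

theorem integral_comp_cyl {f : ℝ × ℝ → ℝ} (hf : Measurable f) :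
    ∫ x : E3, f (cyl x) = ∫ q in strip,
      2 * Real.pi * Real.exp (3 * q.1) * Real.sin q.2 * f (logPolar q) := by
  rw [← integral_map measurable_cyl.aemeasurable hf.aestronglyMeasurable, map_cyl_volume,
    integral_map continuous_logPolar.measurable.aemeasurable hf.aestronglyMeasurable,
    integral_withDensity_eq_integral_toReal_smul measurable_logPolar_weight
      (Eventually.of_forall fun _ => ENNReal.ofReal_lt_top)]
  refine integral_congr_ae ?_
  filter_upwards [ae_restrict_mem measurableSet_strip] with q hq
  rw [weight_toReal hq]; rfl

theorem integral_sphere_comp_cyl {f : ℝ × ℝ → ℝ} (hf : Measurable f) :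
    ∫ n : Metric.sphere (0 : E3) 1, f (cyl n) ∂((volume : Measure E3).toSphere)
      = ∫ θ in Set.Ioo 0 Real.pi, 2 * Real.pi * Real.sin θ * f (Real.sin θ, Real.cos θ) := by
  have hcm : Measurable fun n : Metric.sphere (0 : E3) 1 => cyl n :=
    measurable_cyl.comp measurable_subtype_coe
  have hsc : Measurable fun θ : ℝ => (Real.sin θ, Real.cos θ) := by fun_prop
  have hw : Measurable fun θ : ℝ => ENNReal.ofReal (2 * Real.pi * Real.sin θ) := by fun_prop
  rw [← integral_map hcm.aemeasurable hf.aestronglyMeasurable, map_cyl_toSphere,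
    integral_map hsc.aemeasurable hf.aestronglyMeasurable,
    integral_withDensity_eq_integral_toReal_smul hw
      (Eventually.of_forall fun _ => ENNReal.ofReal_lt_top)]
  refine integral_congr_ae ?_
  filter_upwards [ae_restrict_mem measurableSet_Ioo] with θ hθ
  have := Real.sin_pos_of_mem_Ioo hθ
  rw [ENNReal.toReal_ofReal (by positivity)]; rfl

lemma measurable_dh (m : Fin 3) (f : ℝ × ℝ → ℝ) : Measurable (dh m f) :=
  measurable_fderiv_apply_const ℝ f _

lemma measurable_brillDensity (u al : ℝ × ℝ → ℝ) : Measurable (brillDensity u al) := by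
  have h := fun m f => measurable_dh m f
  unfold brillDensity
  exact ((((h 0 _).add (h 1 _)).add ((h 0 _).div measurable_fst)).const_mul 8).sub
    (((h 0 _).add (h 1 _)).const_mul 4)

/-! ### Differentiation under the integral sign -/

lemma isOpen_contDiffAt (F : ℝ × ℝ → ℝ) (n : ℕ) : IsOpen {q | ContDiffAt ℝ n F q} := by
  rw [isOpen_iff_mem_nhds]
  intro q hq
  exact (show ContDiffAt ℝ n F q from hq).eventually (by simp)

lemma hasDerivAt_slice {F : ℝ × ℝ → ℝ} {s θ : ℝ} (h : DifferentiableAt ℝ F (s, θ)) :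
    HasDerivAt (fun s => F (s, θ)) (dh 0 F (s, θ)) s := by
  have h1 : HasDerivAt (fun s : ℝ => (s, θ)) ((1 : ℝ), (0 : ℝ)) s :=
    (hasDerivAt_id s).prodMk (hasDerivAt_const s θ)
  exact h.hasFDerivAt.comp_hasDerivAt s h1

lemma hasDerivAt_slice' {F : ℝ × ℝ → ℝ} {s θ : ℝ} (h : DifferentiableAt ℝ F (s, θ)) :
    HasDerivAt (fun θ => F (s, θ)) (dh 1 F (s, θ)) θ := by
  have h1 : HasDerivAt (fun θ : ℝ => (s, θ)) ((0 : ℝ), (1 : ℝ)) θ :=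
    (hasDerivAt_const θ s).prodMk (hasDerivAt_id θ)
  exact h.hasFDerivAt.comp_hasDerivAt θ h1

lemma aestronglyMeasurable_of_continuousOn_uIcc {f : ℝ → ℝ} {a b : ℝ}
    (hf : ContinuousOn f (Set.uIcc a b)) :
    AEStronglyMeasurable f (volume.restrict (Set.uIoc a b)) :=
  (hf.mono Set.uIoc_subset_uIcc).aestronglyMeasurable measurableSet_uIoc

/-- Differentiability at the points of a single compact slice spreads to a compact rectangle around
it by the tube lemma, and there the derivative has a constant bound. Information on one slice
therefore suffices, which matters at the boundary value `t₀`. -/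
lemma hasDerivAt_integral_slice {F : ℝ × ℝ → ℝ} {t a b : ℝ} (hab : a ≤ b)
    (hF : ∀ θ ∈ Set.Icc a b, ContDiffAt ℝ 1 F (t, θ)) :
    HasDerivAt (fun s => ∫ θ in a..b, F (s, θ)) (∫ θ in a..b, dh 0 F (t, θ)) t := by
  set O := {q | ContDiffAt ℝ ((1 : ℕ) : WithTop ℕ∞) F q} with hO
  have hOo : IsOpen O := isOpen_contDiffAt F 1
  have hsub : ({t} : Set ℝ) ×ˢ Set.Icc a b ⊆ O := by
    rintro ⟨s, θ⟩ ⟨hs, hθ⟩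
    obtain rfl : s = t := hs
    exact hF θ hθ
  obtain ⟨V, W, hV, -, htV, hW, hVW⟩ :=
    generalized_tube_lemma isCompact_singleton (isCompact_Icc (a := a) (b := b)) hOo hsub
  obtain ⟨ε, hε, hball⟩ := Metric.nhds_basis_closedBall.mem_iff.mp
    (hV.mem_nhds (htV (Set.mem_singleton t)))
  set K := Metric.closedBall t ε ×ˢ Set.Icc a b with hK
  have hKO : K ⊆ O := (Set.prod_mono hball hW).trans hVW
  have hKc : IsCompact K := (isCompact_closedBall t ε).prod isCompact_Icc
  have hcd : ContinuousOn (dh 0 F) K := fun q hq =>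
    ((contDiffAt_dh (n := 0) (k := 1) 0 (hKO hq) (by norm_num)).continuousAt).continuousWithinAt
  have hcF : ContinuousOn F K := fun q hq =>
    (show ContDiffAt ℝ ((1 : ℕ) : WithTop ℕ∞) F q from hKO hq).continuousAt.continuousWithinAt
  obtain ⟨C, hC⟩ := hKc.exists_bound_of_continuousOn hcd
  have hslice : ∀ s ∈ Metric.closedBall t ε, ContinuousOn (fun θ => F (s, θ)) (Set.uIcc a b) := by
    intro s hs
    rw [Set.uIcc_of_le hab]
    exact hcF.comp (by fun_prop) fun θ hθ => ⟨hs, hθ⟩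
  have ht : t ∈ Metric.closedBall t ε := Metric.mem_closedBall_self hε.le
  have hmem : ∀ {θ}, θ ∈ Set.uIoc a b → θ ∈ Set.Icc a b := fun {θ} hθ => by
    rw [Set.uIoc_of_le hab] at hθ; exact Set.Ioc_subset_Icc_self hθ
  refine (intervalIntegral.hasDerivAt_integral_of_dominated_loc_of_deriv_le
    (F := fun s θ => F (s, θ)) (F' := fun s θ => dh 0 F (s, θ)) (bound := fun _ => C)
    (Metric.closedBall_mem_nhds t hε) ?_ ?_ ?_ ?_ ?_ ?_).2
  · filter_upwards [Metric.closedBall_mem_nhds t hε] with s hs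
    exact aestronglyMeasurable_of_continuousOn_uIcc (hslice s hs)
  · exact (hslice t ht).intervalIntegrable
  · have : ContinuousOn (fun θ => dh 0 F (t, θ)) (Set.uIcc a b) := by
      rw [Set.uIcc_of_le hab]
      exact hcd.comp (by fun_prop) fun θ hθ => ⟨ht, hθ⟩
    exact aestronglyMeasurable_of_continuousOn_uIcc this
  · exact Eventually.of_forall fun θ hθ s hs => hC (s, θ) ⟨hs, hmem hθ⟩
  · exact intervalIntegrable_const
  · exact Eventually.of_forall fun θ hθ s hs =>
      hasDerivAt_slice ((show ContDiffAt ℝ ((1 : ℕ) : WithTop ℕ∞) F (s, θ) from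
        hKO ⟨hs, hmem hθ⟩).differentiableAt (by simp))

/-! ### The flux through coordinate spheres -/

/-- `sin θ` times the density `r² (8Δu - 4(α_ρρ + α_zz))` in logarithmic polar coordinates. -/
def polarDensity (v a : ℝ × ℝ → ℝ) (q : ℝ × ℝ) : ℝ :=
  8 * (Real.sin q.2 * (dh 0 (dh 0 v) q + dh 1 (dh 1 v) q + dh 0 v q) + Real.cos q.2 * dh 1 v q)
    - 4 * (Real.sin q.2 * (dh 0 (dh 0 a) q + dh 1 (dh 1 a) q))

/-- The integrand of the flux of `8∇u - 4∇α + 4(α/ρ)∂_ρ` through a coordinate sphere. -/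
def fluxIntegrand (v a : ℝ × ℝ → ℝ) (q : ℝ × ℝ) : ℝ :=
  Real.sin q.2 * (8 * dh 0 v q - 4 * dh 0 a q + 4 * a q)

/-- The flux, divided by `2π r`. -/
def polarFlux (v a : ℝ × ℝ → ℝ) (t : ℝ) : ℝ := ∫ θ in (0 : ℝ)..Real.pi, fluxIntegrand v a (t, θ)

lemma contDiffAt_fluxIntegrand {v a : ℝ × ℝ → ℝ} {q : ℝ × ℝ} (hv : ContDiffAt ℝ 2 v q)
    (ha : ContDiffAt ℝ 2 a q) : ContDiffAt ℝ 1 (fluxIntegrand v a) q := by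
  have d : ∀ {f : ℝ × ℝ → ℝ}, ContDiffAt ℝ 2 f q → ContDiffAt ℝ 1 (dh 0 f) q :=
    fun hf => contDiffAt_dh (n := 1) (k := 2) 0 hf (by norm_num)
  have hs : ContDiffAt ℝ 1 (fun q : ℝ × ℝ => Real.sin q.2) q := by fun_prop
  exact hs.mul (((contDiffAt_const.mul (d hv)).sub (contDiffAt_const.mul (d ha))).add
    (contDiffAt_const.mul (ha.of_le (by norm_num))))

lemma dh_fluxIntegrand {v a : ℝ × ℝ → ℝ} {q : ℝ × ℝ} (hv : ContDiffAt ℝ 2 v q)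
    (ha : ContDiffAt ℝ 2 a q) : dh 0 (fluxIntegrand v a) q
      = Real.sin q.2 * (8 * dh 0 (dh 0 v) q - 4 * dh 0 (dh 0 a) q + 4 * dh 0 a q) := by
  have d : ∀ {f : ℝ × ℝ → ℝ}, ContDiffAt ℝ 2 f q → DifferentiableAt ℝ (dh 0 f) q := fun hf =>
    (contDiffAt_dh (n := 1) (k := 2) 0 hf (by norm_num)).differentiableAt (by simp)
  have hd := ha.differentiableAt (by simp)
  have hsd : DifferentiableAt ℝ (fun q : ℝ × ℝ => Real.sin q.2) q := by fun_prop
  have hs0 : dh 0 (fun q : ℝ × ℝ => Real.sin q.2) q = 0 := by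
    have h := (Real.hasDerivAt_sin q.2).comp_hasFDerivAt q
      ((ContinuousLinearMap.snd ℝ ℝ ℝ).hasFDerivAt (x := q))
    have h' : fderiv ℝ (fun q : ℝ × ℝ => Real.sin q.2) q = _ := h.fderiv
    rw [dh, h']; simp
  have c : ∀ k : ℝ, DifferentiableAt ℝ (fun _ : ℝ × ℝ => k) q := fun k => differentiableAt_const k
  unfold fluxIntegrand
  rw [dh_mul 0 hsd ((((c 8).fun_mul (d hv)).fun_sub ((c 4).fun_mul (d ha))).fun_add
      ((c 4).fun_mul hd)), hs0,
    dh_add 0 (((c 8).fun_mul (d hv)).fun_sub ((c 4).fun_mul (d ha))) ((c 4).fun_mul hd),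
    dh_sub 0 ((c 8).fun_mul (d hv)) ((c 4).fun_mul (d ha)), dh_mul 0 (c 8) (d hv),
    dh_mul 0 (c 4) (d ha), dh_mul 0 (c 4) hd]
  simp only [dh_const]
  ring

lemma contDiffAt_two_dh {f : ℝ × ℝ → ℝ} {q : ℝ × ℝ} (m k : Fin 3) (hf : ContDiffAt ℝ 2 f q) :
    ContinuousAt (dh m (dh k f)) q :=
  (contDiffAt_dh (n := 0) (k := 1) m (contDiffAt_dh (n := 1) (k := 2) k hf (by norm_num))
    (by norm_num)).continuousAt

lemma contDiffAt_one_dh {f : ℝ × ℝ → ℝ} {q : ℝ × ℝ} (m : Fin 3) (hf : ContDiffAt ℝ 2 f q) :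
    ContinuousAt (dh m f) q :=
  (contDiffAt_dh (n := 1) (k := 2) m hf (by norm_num)).continuousAt

lemma continuousAt_polarDensity {v a : ℝ × ℝ → ℝ} {q : ℝ × ℝ} (hv : ContDiffAt ℝ 2 v q)
    (ha : ContDiffAt ℝ 2 a q) : ContinuousAt (polarDensity v a) q := by
  have hs : ContinuousAt (fun q : ℝ × ℝ => Real.sin q.2) q := by fun_prop
  have hc : ContinuousAt (fun q : ℝ × ℝ => Real.cos q.2) q := by fun_prop
  exact (continuousAt_const.mul ((hs.mul (((contDiffAt_two_dh 0 0 hv).add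
    (contDiffAt_two_dh 1 1 hv)).add (contDiffAt_one_dh 0 hv))).add
    (hc.mul (contDiffAt_one_dh 1 hv)))).sub (continuousAt_const.mul
    (hs.mul ((contDiffAt_two_dh 0 0 ha).add (contDiffAt_two_dh 1 1 ha))))

/-- The divergence theorem on coordinate spheres. -/
theorem hasDerivAt_exp_mul_polarFlux {v a : ℝ × ℝ → ℝ} {t : ℝ}
    (hv : ∀ θ, ContDiffAt ℝ 2 v (t, θ)) (ha : ∀ θ, ContDiffAt ℝ 2 a (t, θ))
    (ha0 : a (t, 0) = 0) (haπ : a (t, Real.pi) = 0) :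
    HasDerivAt (fun s => Real.exp s * polarFlux v a s)
      (∫ θ in (0 : ℝ)..Real.pi, Real.exp t * polarDensity v a (t, θ)) t := by
  have h1 : HasDerivAt (polarFlux v a) (∫ θ in (0 : ℝ)..Real.pi, dh 0 (fluxIntegrand v a) (t, θ)) t :=
    hasDerivAt_integral_slice Real.pi_pos.le fun θ _ => contDiffAt_fluxIntegrand (hv θ) (ha θ)
  refine ((Real.hasDerivAt_exp t).mul h1).congr_deriv ?_
  have hslice : ∀ {f : ℝ × ℝ → ℝ}, (∀ θ, ContinuousAt f (t, θ)) → Continuous fun θ => f (t, θ) :=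
    fun hf => continuous_iff_continuousAt.mpr fun θ =>
      (hf θ).comp (f := fun θ : ℝ => (t, θ)) (by fun_prop)
  have cF : Continuous fun θ => fluxIntegrand v a (t, θ) := hslice fun θ =>
    (contDiffAt_fluxIntegrand (hv θ) (ha θ)).continuousAt
  have cD : Continuous fun θ => polarDensity v a (t, θ) := hslice fun θ =>
    continuousAt_polarDensity (hv θ) (ha θ)
  have cF' : Continuous fun θ => dh 0 (fluxIntegrand v a) (t, θ) := hslice fun θ =>
    (contDiffAt_dh (n := 0) (k := 1) 0 (contDiffAt_fluxIntegrand (hv θ) (ha θ))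
      (by norm_num)).continuousAt
  have cS : Continuous fun θ => fluxIntegrand v a (t, θ) + dh 0 (fluxIntegrand v a) (t, θ) :=
    cF.add cF'
  have hd : ∀ {f : ℝ × ℝ → ℝ} (m : Fin 3) (θ : ℝ), ContDiffAt ℝ 2 f (t, θ) →
      DifferentiableAt ℝ (dh m f) (t, θ) := fun m θ hf =>
    (contDiffAt_dh (n := 1) (k := 2) m hf (by norm_num)).differentiableAt (by simp)
  -- A primitive in `θ` of the difference between the density and the radial derivative of the flux.
  -- Its `α`-part rests on `(sin θ a_θ - cos θ a)_θ = sin θ (a_θθ + a)`. The only terms surviving at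
  -- the poles contain `a` itself; this is where `α = 0` on the axis enters.
  let B : ℝ → ℝ := fun θ => 8 * (Real.sin θ * dh 1 v (t, θ))
    - 4 * (Real.sin θ * dh 1 a (t, θ) - Real.cos θ * a (t, θ))
  have hB : ∀ θ, HasDerivAt B (polarDensity v a (t, θ)
      - (fluxIntegrand v a (t, θ) + dh 0 (fluxIntegrand v a) (t, θ))) θ := by
    intro θ
    have e1 := hasDerivAt_slice' (hd 1 θ (hv θ))
    have e2 := hasDerivAt_slice' (hd 1 θ (ha θ))
    have e3 := hasDerivAt_slice' ((ha θ).differentiableAt (by simp))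
    have := (((Real.hasDerivAt_sin θ).mul e1).const_mul 8).sub
      ((((Real.hasDerivAt_sin θ).mul e2).sub ((Real.hasDerivAt_cos θ).mul e3)).const_mul 4)
    refine this.congr_deriv ?_
    rw [dh_fluxIntegrand (hv θ) (ha θ), polarDensity, fluxIntegrand]
    ring
  have hint := intervalIntegral.integral_eq_sub_of_hasDerivAt (fun θ _ => hB θ)
    ((cD.sub cS).intervalIntegrable 0 Real.pi)
  have hB0 : B Real.pi - B 0 = 0 := by simp [B, ha0, haπ]
  rw [hB0, intervalIntegral.integral_sub (cD.intervalIntegrable _ _)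
    (cS.intervalIntegrable _ _), intervalIntegral.integral_add (cF.intervalIntegrable _ _)
    (cF'.intervalIntegrable _ _)] at hint
  rw [intervalIntegral.integral_const_mul]
  unfold polarFlux
  linear_combination (-Real.exp t) * hint

/-! ### Logarithmic polar coordinates -/

lemma contDiff_logPolar {n : WithTop ℕ∞} : ContDiff ℝ n logPolar := by
  unfold logPolar; fun_prop

lemma dh_logPolar_fst (m : Fin 3) (q : ℝ × ℝ) : dh m (fun q => (logPolar q).1) q
    = (![(logPolar q).1, (logPolar q).2, 0] : Fin 3 → ℝ) m := by
  have h : fderiv ℝ (fun q => (logPolar q).1) q = _ := (hasFDerivAt_logPolar q).fst.fderiv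
  rw [dh, h]
  fin_cases m <;>
    simp [logPolarDeriv, Matrix.toLin_finTwoProd_toContinuousLinearMap, logPolar]

lemma dh_logPolar_snd (m : Fin 3) (q : ℝ × ℝ) : dh m (fun q => (logPolar q).2) q
    = (![(logPolar q).2, -(logPolar q).1, 0] : Fin 3 → ℝ) m := by
  have h : fderiv ℝ (fun q => (logPolar q).2) q = _ := (hasFDerivAt_logPolar q).snd.fderiv
  rw [dh, h]
  fin_cases m <;>
    simp [logPolarDeriv, Matrix.toLin_finTwoProd_toContinuousLinearMap, logPolar]

lemma dh_comp_logPolar {f : ℝ × ℝ → ℝ} {q : ℝ × ℝ} (hf : DifferentiableAt ℝ f (logPolar q))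
    (m : Fin 3) : dh m (fun q => f (logPolar q)) q
      = dh m (fun q => (logPolar q).1) q * dh 0 f (logPolar q)
        + dh m (fun q => (logPolar q).2) q * dh 1 f (logPolar q) := by
  have hl := (hasFDerivAt_logPolar q)
  have h := fderiv_fun_comp q hf hl.differentiableAt
  rw [dh, h, ContinuousLinearMap.comp_apply, fderiv_eq_dh]
  have e1 : fderiv ℝ (fun q => (logPolar q).1) q = _ := hl.fst.fderiv
  have e2 : fderiv ℝ (fun q => (logPolar q).2) q = _ := hl.snd.fderiv
  simp only [dh]
  rw [e1, e2, hl.fderiv]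
  rfl

/-- Logarithmic polar coordinates are a complex exponential up to an isometry of the plane, hence
conformal with factor `e^{2t}`, and the planar Laplacian is conformally covariant. -/
lemma laplacian_comp_logPolar {f : ℝ × ℝ → ℝ} {q : ℝ × ℝ} (hf : ContDiffAt ℝ 2 f (logPolar q)) :
    dh 0 (dh 0 fun q => f (logPolar q)) q + dh 1 (dh 1 fun q => f (logPolar q)) q
      = Real.exp (2 * q.1) * (dh 0 (dh 0 f) (logPolar q) + dh 1 (dh 1 f) (logPolar q)) := by
  have hev : ∀ᶠ p in 𝓝 q, DifferentiableAt ℝ f (logPolar p) :=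
    (continuous_logPolar.tendsto q).eventually ((hf.eventually (by simp)).mono fun y hy =>
      hy.differentiableAt (by simp))
  have e0 : dh 0 (fun q => f (logPolar q)) =ᶠ[𝓝 q] fun q =>
      (logPolar q).1 * dh 0 f (logPolar q) + (logPolar q).2 * dh 1 f (logPolar q) := by
    filter_upwards [hev] with p hp
    rw [dh_comp_logPolar hp, dh_logPolar_fst, dh_logPolar_snd]; rfl
  have e1 : dh 1 (fun q => f (logPolar q)) =ᶠ[𝓝 q] fun q =>
      (logPolar q).2 * dh 0 f (logPolar q) - (logPolar q).1 * dh 1 f (logPolar q) := by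
    filter_upwards [hev] with p hp
    rw [dh_comp_logPolar hp, dh_logPolar_fst, dh_logPolar_snd]
    simp only [Matrix.cons_val_one, Matrix.cons_val_zero]; ring
  have hd : ∀ m, DifferentiableAt ℝ (dh m f) (logPolar q) := fun m =>
    (contDiffAt_dh (n := 1) (k := 2) m hf (by norm_num)).differentiableAt (by simp)
  have hlp := (contDiff_logPolar (n := 1)).contDiffAt (x := q) |>.differentiableAt (by simp)
  have hdc : ∀ m, DifferentiableAt ℝ (fun q => dh m f (logPolar q)) q := fun m =>
    (hd m).comp q hlp
  have h1 : DifferentiableAt ℝ (fun q => (logPolar q).1) q := hlp.fst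
  have h2 : DifferentiableAt ℝ (fun q => (logPolar q).2) q := hlp.snd
  have hsymm : dh 0 (dh 1 f) (logPolar q) = dh 1 (dh 0 f) (logPolar q) := by
    have hs : IsSymmSndFDerivAt ℝ f (logPolar q) := hf.isSymmSndFDerivAt (by simp)
    have hdd : DifferentiableAt ℝ (fderiv ℝ f) (logPolar q) :=
      (hf.fderiv_right (m := 1) (by norm_num)).differentiableAt (by norm_num)
    have key : ∀ m k, dh m (dh k f) (logPolar q) = fderiv ℝ (fderiv ℝ f) (logPolar q)
        ((![(1, 0), (0, 1), (0, 0)] : Fin 3 → ℝ × ℝ) m)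
        ((![(1, 0), (0, 1), (0, 0)] : Fin 3 → ℝ × ℝ) k) := by
      intro m k
      have : dh k f = fun p => fderiv ℝ f p ((![(1, 0), (0, 1), (0, 0)] : Fin 3 → ℝ × ℝ) k) := rfl
      rw [this, dh, fderiv_clm_apply hdd (differentiableAt_const _)]
      simp
    rw [key, key]
    exact hs _ _
  have hn := logPolar_norm_sq q
  have hexp : Real.exp (2 * q.1) = Real.exp q.1 ^ 2 := by rw [← Real.exp_nat_mul]; norm_num
  rw [dh_congr 0 e0, dh_congr 1 e1, dh_add 0 (h1.fun_mul (hdc 0)) (h2.fun_mul (hdc 1)),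
    dh_sub 1 (h2.fun_mul (hdc 0)) (h1.fun_mul (hdc 1)), dh_mul 0 h1 (hdc 0), dh_mul 0 h2 (hdc 1),
    dh_mul 1 h2 (hdc 0), dh_mul 1 h1 (hdc 1), dh_comp_logPolar (hd 0), dh_comp_logPolar (hd 1),
    dh_comp_logPolar (hd 0), dh_comp_logPolar (hd 1), hsymm, hexp, ← hn]
  simp only [dh_logPolar_fst, dh_logPolar_snd, Matrix.cons_val_zero, Matrix.cons_val_one]
  ring

/-- The Brill density in logarithmic polar coordinates. -/
lemma brillDensity_logPolar {u al : ℝ × ℝ → ℝ} {q : ℝ × ℝ} (hq : q ∈ strip)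
    (hu : ContDiffAt ℝ 2 u (logPolar q)) (hal : ContDiffAt ℝ 2 al (logPolar q)) :
    Real.exp (2 * q.1) * Real.sin q.2 * brillDensity u al (logPolar q)
      = polarDensity (fun q => u (logPolar q)) (fun q => al (logPolar q)) q := by
  have hs : 0 < Real.sin q.2 := Real.sin_pos_of_mem_Ioo hq.2
  have he := Real.exp_pos q.1
  have hexp : Real.exp (2 * q.1) = Real.exp q.1 ^ 2 := by rw [← Real.exp_nat_mul]; norm_num
  have hud := hu.differentiableAt (by simp)
  rw [polarDensity, laplacian_comp_logPolar hu, laplacian_comp_logPolar hal,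
    dh_comp_logPolar hud, dh_comp_logPolar hud, brillDensity]
  simp only [dh_logPolar_fst, dh_logPolar_snd, Matrix.cons_val_zero, Matrix.cons_val_one]
  rw [hexp]
  -- The term `u_ρ/ρ` becomes the first-order part of the polar density through `e^t u_ρ = sin θ v_t
  -- + cos θ v_θ`.
  have hsc := Real.sin_sq_add_cos_sq q.2
  simp only [logPolar] at *
  field_simp
  linear_combination (-8 * dh 0 u (Real.exp q.1 * Real.sin q.2, Real.exp q.1 * Real.cos q.2)) * hsc

/-! ### Reflection in a coordinate sphere -/

/-- The reflection `t ↦ 2t₀ - t` of the logarithmic radius. -/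
def reflect (t₀ : ℝ) (q : ℝ × ℝ) : ℝ × ℝ := (2 * t₀ - q.1, q.2)

lemma contDiff_reflect (t₀ : ℝ) {n : WithTop ℕ∞} : ContDiff ℝ n (reflect t₀) := by
  unfold reflect; fun_prop

lemma dh_comp_reflect {f : ℝ × ℝ → ℝ} {t₀ : ℝ} {q : ℝ × ℝ}
    (hf : DifferentiableAt ℝ f (reflect t₀ q)) (m : Fin 3) :
    dh m (fun q => f (reflect t₀ q)) q = (![-1, 1, 0] : Fin 3 → ℝ) m * dh m f (reflect t₀ q) := by
  have hr : HasFDerivAt (reflect t₀)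
      ((-(ContinuousLinearMap.fst ℝ ℝ ℝ)).prod (ContinuousLinearMap.snd ℝ ℝ ℝ)) q :=
    ((ContinuousLinearMap.fst ℝ ℝ ℝ).hasFDerivAt.const_sub (2 * t₀)).prodMk
      (ContinuousLinearMap.snd ℝ ℝ ℝ).hasFDerivAt
  have h := fderiv_fun_comp q hf hr.differentiableAt
  rw [dh, h, ContinuousLinearMap.comp_apply, fderiv_eq_dh, hr.fderiv]
  fin_cases m <;> simp [dh]

lemma measurePreserving_reflect (t₀ : ℝ) : MeasurePreserving (reflect t₀) := by
  have h1 : MeasurePreserving (fun t : ℝ => 2 * t₀ - t) := Measure.measurePreserving_sub_left volume _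
  exact h1.prod (MeasurePreserving.id volume)

lemma reflect_reflect (t₀ : ℝ) (q : ℝ × ℝ) : reflect t₀ (reflect t₀ q) = q := by
  simp [reflect]

lemma measurableEmbedding_reflect (t₀ : ℝ) : MeasurableEmbedding (reflect t₀) := by
  have hm : Measurable (reflect t₀) := (measurePreserving_reflect t₀).measurable
  exact (MeasurableEquiv.mk ⟨reflect t₀, reflect t₀, reflect_reflect t₀, reflect_reflect t₀⟩
    hm hm).measurableEmbedding

/-- `U` after the reflection, in logarithmic polar coordinates. -/
def reflectU (t₀ k : ℝ) (v : ℝ × ℝ → ℝ) (q : ℝ × ℝ) : ℝ := 2 * q.1 + k + v (reflect t₀ q)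

section Reflected

variable {v a : ℝ × ℝ → ℝ} {t₀ k : ℝ} {q : ℝ × ℝ}

lemma contDiffAt_reflectU (hv : ContDiffAt ℝ 2 v (reflect t₀ q)) :
    ContDiffAt ℝ 2 (reflectU t₀ k v) q := by
  have h : ContDiffAt ℝ 2 (fun q => v (reflect t₀ q)) q :=
    hv.comp q (contDiff_reflect t₀).contDiffAt
  have h0 : ContDiffAt ℝ 2 (fun q : ℝ × ℝ => 2 * q.1 + k) q := by fun_prop
  exact h0.add h

lemma dh_reflectU (hv : DifferentiableAt ℝ v (reflect t₀ q)) (m : Fin 3) :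
    dh m (reflectU t₀ k v) q = (![2, 0, 0] : Fin 3 → ℝ) m
      + (![-1, 1, 0] : Fin 3 → ℝ) m * dh m v (reflect t₀ q) := by
  have h : DifferentiableAt ℝ (fun q => v (reflect t₀ q)) q :=
    hv.comp q ((contDiff_reflect t₀ (n := 1)).contDiffAt.differentiableAt (by simp))
  have h0 : HasFDerivAt (fun q : ℝ × ℝ => 2 * q.1 + k) ((2 : ℝ) • ContinuousLinearMap.fst ℝ ℝ ℝ) q :=
    ((ContinuousLinearMap.fst ℝ ℝ ℝ).hasFDerivAt.const_mul 2).add_const k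
  unfold reflectU
  rw [dh_add m h0.differentiableAt h, dh_comp_reflect hv]
  congr 1
  rw [dh, h0.fderiv]
  fin_cases m <;> simp

lemma dh_dh_reflectU (hv : ContDiffAt ℝ 2 v (reflect t₀ q)) (m : Fin 3) (hm : m ≠ 2) :
    dh m (dh m (reflectU t₀ k v)) q = dh m (dh m v) (reflect t₀ q) := by
  have hc := (contDiff_reflect t₀ (n := 1)).continuous.tendsto q
  have hev : dh m (reflectU t₀ k v) =ᶠ[𝓝 q] fun q => (![2, 0, 0] : Fin 3 → ℝ) m
      + (![-1, 1, 0] : Fin 3 → ℝ) m * dh m v (reflect t₀ q) := by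
    filter_upwards [hc.eventually (hv.eventually (by simp))] with p hp
    exact dh_reflectU (hp.differentiableAt (by simp)) m
  have hd : DifferentiableAt ℝ (dh m v) (reflect t₀ q) :=
    (contDiffAt_dh (n := 1) (k := 2) m hv (by norm_num)).differentiableAt (by simp)
  have h : DifferentiableAt ℝ (fun q => dh m v (reflect t₀ q)) q :=
    hd.comp q ((contDiff_reflect t₀ (n := 1)).contDiffAt.differentiableAt (by simp))
  rw [dh_congr m hev, dh_add m (differentiableAt_const _) ((differentiableAt_const _).fun_mul h),
    dh_mul m (differentiableAt_const _) h, dh_comp_reflect hd, dh_const, dh_const]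
  fin_cases m <;> simp at hm ⊢

lemma dh_dh_comp_reflect (ha : ContDiffAt ℝ 2 a (reflect t₀ q)) (m : Fin 3) (hm : m ≠ 2) :
    dh m (dh m fun q => a (reflect t₀ q)) q = dh m (dh m a) (reflect t₀ q) := by
  have hc := (contDiff_reflect t₀ (n := 1)).continuous.tendsto q
  have hev : dh m (fun q => a (reflect t₀ q)) =ᶠ[𝓝 q] fun q =>
      (![-1, 1, 0] : Fin 3 → ℝ) m * dh m a (reflect t₀ q) := by
    filter_upwards [hc.eventually (ha.eventually (by simp))] with p hp
    exact dh_comp_reflect (hp.differentiableAt (by simp)) m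
  have hd : DifferentiableAt ℝ (dh m a) (reflect t₀ q) :=
    (contDiffAt_dh (n := 1) (k := 2) m ha (by norm_num)).differentiableAt (by simp)
  have h : DifferentiableAt ℝ (fun q => dh m a (reflect t₀ q)) q :=
    hd.comp q ((contDiff_reflect t₀ (n := 1)).contDiffAt.differentiableAt (by simp))
  rw [dh_congr m hev, dh_mul m (differentiableAt_const _) h, dh_comp_reflect hd, dh_const]
  fin_cases m <;> simp at hm ⊢

/-- Second derivatives and `θ`-derivatives are even under the reflection, and `α` enters only
through second derivatives. The whole discrepancy comes from the term `8 sin θ v_t`, which changes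
sign and receives the derivative of `2t`. -/
lemma polarDensity_reflect (hv : ContDiffAt ℝ 2 v (reflect t₀ q))
    (ha : ContDiffAt ℝ 2 a (reflect t₀ q)) :
    polarDensity (reflectU t₀ k v) (fun q => a (reflect t₀ q)) q
      = polarDensity v a (reflect t₀ q)
        + (16 * Real.sin q.2 - 16 * Real.sin q.2 * dh 0 v (reflect t₀ q)) := by
  have hd := hv.differentiableAt (by simp)
  have e : (reflect t₀ q).2 = q.2 := rfl
  simp only [polarDensity, dh_dh_reflectU hv 0 (by decide), dh_dh_reflectU hv 1 (by decide),
    dh_dh_comp_reflect ha 0 (by decide), dh_dh_comp_reflect ha 1 (by decide), dh_reflectU hd,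
    Matrix.cons_val_zero, Matrix.cons_val_one, e]
  ring

lemma fluxIntegrand_reflect (hv : DifferentiableAt ℝ v (reflect t₀ q))
    (ha : DifferentiableAt ℝ a (reflect t₀ q)) :
    fluxIntegrand (reflectU t₀ k v) (fun q => a (reflect t₀ q)) q
      = Real.sin q.2 * (16 - 8 * dh 0 v (reflect t₀ q) + 4 * dh 0 a (reflect t₀ q)
        + 4 * a (reflect t₀ q)) := by
  simp only [fluxIntegrand, dh_reflectU hv, dh_comp_reflect ha, Matrix.cons_val_zero]
  ring

end Reflected

/-! ### The flux identities on the two halves -/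

lemma measurable_polarDensity (v a : ℝ × ℝ → ℝ) : Measurable (polarDensity v a) := by
  have h := fun m f => measurable_dh m f
  have hs : Measurable fun q : ℝ × ℝ => Real.sin q.2 := by fun_prop
  have hc : Measurable fun q : ℝ × ℝ => Real.cos q.2 := by fun_prop
  unfold polarDensity
  exact (((hs.mul (((h 0 _).add (h 1 _)).add (h 0 _))).add (hc.mul (h 1 _))).const_mul 8).sub
    ((hs.mul ((h 0 _).add (h 1 _))).const_mul 4)

lemma integral_Ioo_eq_interval (f : ℝ → ℝ) :
    ∫ θ in Set.Ioo 0 Real.pi, f θ = ∫ θ in (0 : ℝ)..Real.pi, f θ := by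
  rw [intervalIntegral.integral_of_le Real.pi_pos.le, integral_Ioc_eq_integral_Ioo]

section ReflectedFlux

variable {v a : ℝ × ℝ → ℝ} {t₀ k : ℝ}

/-- The limit of the flux at infinity. -/
theorem tendsto_exp_mul_polarFlux (hv : ∀ t θ, t₀ ≤ t → ContDiffAt ℝ 2 v (t, θ))
    (ha : ∀ t θ, t₀ ≤ t → ContDiffAt ℝ 2 a (t, θ))
    (ha0 : ∀ t, t₀ ≤ t → a (t, 0) = 0) (haπ : ∀ t, t₀ ≤ t → a (t, Real.pi) = 0)
    (hI : IntegrableOn (fun q : ℝ × ℝ => Real.exp q.1 * polarDensity v a q)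
      (Set.Ioi t₀ ×ˢ Set.Ioo 0 Real.pi)) :
    Tendsto (fun t => Real.exp t * polarFlux v a t) atTop
      (𝓝 (Real.exp t₀ * polarFlux v a t₀ + ∫ q in Set.Ioi t₀ ×ˢ Set.Ioo 0 Real.pi,
        Real.exp q.1 * polarDensity v a q)) := by
  have hI' := hI
  rw [IntegrableOn, Measure.volume_eq_prod, ← Measure.prod_restrict] at hI'
  have hI1 : IntegrableOn (fun t => ∫ θ in (0 : ℝ)..Real.pi, Real.exp t * polarDensity v a (t, θ))
      (Set.Ioi t₀) := by
    have := hI'.integral_prod_left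
    simp only [integral_Ioo_eq_interval] at this
    exact this
  have hval : ∫ q in Set.Ioi t₀ ×ˢ Set.Ioo 0 Real.pi, Real.exp q.1 * polarDensity v a q
      = ∫ t in Set.Ioi t₀, ∫ θ in (0 : ℝ)..Real.pi, Real.exp t * polarDensity v a (t, θ) := by
    rw [Measure.volume_eq_prod, setIntegral_prod _ hI]
    simp only [integral_Ioo_eq_interval]
  have hder := fun t (ht : t₀ ≤ t) =>
    hasDerivAt_exp_mul_polarFlux (fun θ => hv t θ ht) (fun θ => ha t θ ht) (ha0 t ht) (haπ t ht)
  have hlim := (intervalIntegral_tendsto_integral_Ioi t₀ hI1 tendsto_id).const_add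
    (Real.exp t₀ * polarFlux v a t₀)
  rw [hval]
  refine hlim.congr' ?_
  filter_upwards [eventually_ge_atTop t₀] with t ht
  have := intervalIntegral.integral_eq_sub_of_hasDerivAt (a := t₀) (b := t)
    (fun x hx => hder x (by rw [Set.uIcc_of_le ht] at hx; exact hx.1))
    ((intervalIntegrable_iff_integrableOn_Ioc_of_le ht).mpr
      (hI1.mono_set Set.Ioc_subset_Ioi_self))
  rw [id, this]
  ring

lemma integrableOn_exp_Iio_prod (t₀ : ℝ) :
    IntegrableOn (fun q : ℝ × ℝ => Real.exp q.1) (Set.Iio t₀ ×ˢ Set.Ioo 0 Real.pi) := by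
  have h1 : Integrable Real.exp (volume.restrict (Set.Iio t₀)) :=
    (integrableOn_exp_Iic t₀).mono_set Set.Iio_subset_Iic_self
  have h2 : Integrable (fun _ : ℝ => (1 : ℝ)) (volume.restrict (Set.Ioo 0 Real.pi)) :=
    integrable_const _
  have := h1.mul_prod h2
  rw [Measure.prod_restrict, ← Measure.volume_eq_prod] at this
  simpa [IntegrableOn] using this

lemma reflect_preimage (t₀ : ℝ) : reflect t₀ ⁻¹' (Set.Ioi t₀ ×ˢ Set.Ioo 0 Real.pi)
    = Set.Iio t₀ ×ˢ Set.Ioo 0 Real.pi := by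
  ext q
  simp only [reflect, Set.mem_preimage, Set.mem_prod, Set.mem_Ioi, Set.mem_Iio]
  constructor <;> rintro ⟨h, h'⟩ <;> exact ⟨by linarith, h'⟩

/-- For `t < t₀` one has `e^t ≤ e^{2t₀ - t}`, so the even part is dominated by the reflection of the
integrable exterior density; the remaining term is bounded, and `e^t` is integrable at `-∞`. -/
lemma integrableOn_polarDensity_reflect {C : ℝ} (hv : ∀ t θ, t₀ ≤ t → ContDiffAt ℝ 2 v (t, θ))
    (ha : ∀ t θ, t₀ ≤ t → ContDiffAt ℝ 2 a (t, θ))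
    (hC : ∀ t, t₀ ≤ t → ∀ θ ∈ Set.Ioo 0 Real.pi, |dh 0 v (t, θ)| ≤ C)
    (hI : IntegrableOn (fun q : ℝ × ℝ => Real.exp q.1 * polarDensity v a q)
      (Set.Ioi t₀ ×ˢ Set.Ioo 0 Real.pi)) :
    IntegrableOn (fun q : ℝ × ℝ => Real.exp q.1 *
      polarDensity (reflectU t₀ k v) (fun q => a (reflect t₀ q)) q)
      (Set.Iio t₀ ×ˢ Set.Ioo 0 Real.pi) := by
  have h1 := ((measurePreserving_reflect t₀).integrableOn_comp_preimage
    (measurableEmbedding_reflect t₀)).mpr hI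
  rw [reflect_preimage] at h1
  have h2 := h1.norm.add ((integrableOn_exp_Iio_prod t₀).mul_const (16 + 16 * C))
  have hme : Measurable fun q : ℝ × ℝ => Real.exp q.1 := by fun_prop
  refine h2.mono' (hme.mul (measurable_polarDensity _ _)).aestronglyMeasurable ?_
  filter_upwards [ae_restrict_mem (measurableSet_Iio.prod measurableSet_Ioo)] with q hq
  have hq1 : q.1 < t₀ := hq.1
  have hr : t₀ ≤ 2 * t₀ - q.1 := by linarith
  have hCq := hC _ hr _ hq.2
  rw [polarDensity_reflect (hv _ _ hr) (ha _ _ hr)]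
  have hs0 := Real.sin_nonneg_of_mem_Icc (Set.Ioo_subset_Icc_self hq.2)
  have hs1 := Real.sin_le_one q.2
  have hee : Real.exp q.1 ≤ Real.exp (2 * t₀ - q.1) := Real.exp_le_exp.mpr (by linarith)
  have hb : |16 * Real.sin q.2 - 16 * Real.sin q.2 * dh 0 v (reflect t₀ q)| ≤ 16 + 16 * C := by
    have hab : |dh 0 v (reflect t₀ q)| ≤ C := hCq
    have : |Real.sin q.2 * dh 0 v (reflect t₀ q)| ≤ C := by
      rw [abs_mul, abs_of_nonneg hs0]
      nlinarith [abs_nonneg (dh 0 v (reflect t₀ q))]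
    rw [abs_le] at this ⊢
    constructor <;> nlinarith
  change ‖_‖ ≤ ‖Real.exp (2 * t₀ - q.1) * polarDensity v a (reflect t₀ q)‖
    + Real.exp q.1 * (16 + 16 * C)
  simp only [Real.norm_eq_abs, abs_mul, Real.abs_exp]
  calc Real.exp q.1 * |polarDensity v a (reflect t₀ q)
        + (16 * Real.sin q.2 - 16 * Real.sin q.2 * dh 0 v (reflect t₀ q))|
      ≤ Real.exp q.1 * (|polarDensity v a (reflect t₀ q)| + (16 + 16 * C)) := by
        gcongr
        exact (abs_add_le _ _).trans (by gcongr)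
    _ ≤ _ := by
        rw [mul_add]
        gcongr

/-- The integral over the reflected half is a flux through the sphere of reflection. -/
theorem integral_polarDensity_reflect {C : ℝ} (hv : ∀ t θ, t₀ ≤ t → ContDiffAt ℝ 2 v (t, θ))
    (ha : ∀ t θ, t₀ ≤ t → ContDiffAt ℝ 2 a (t, θ))
    (ha0 : ∀ t, t₀ ≤ t → a (t, 0) = 0) (haπ : ∀ t, t₀ ≤ t → a (t, Real.pi) = 0)
    (hC : ∀ t, t₀ ≤ t → ∀ θ ∈ Set.Ioo 0 Real.pi,
      |dh 0 v (t, θ)| ≤ C ∧ |dh 0 a (t, θ)| ≤ C ∧ |a (t, θ)| ≤ C)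
    (hI : IntegrableOn (fun q : ℝ × ℝ => Real.exp q.1 * polarDensity v a q)
      (Set.Ioi t₀ ×ˢ Set.Ioo 0 Real.pi)) :
    ∫ q in Set.Iio t₀ ×ˢ Set.Ioo 0 Real.pi, Real.exp q.1 *
      polarDensity (reflectU t₀ k v) (fun q => a (reflect t₀ q)) q
      = Real.exp t₀ * polarFlux (reflectU t₀ k v) (fun q => a (reflect t₀ q)) t₀ := by
  set v' := reflectU t₀ k v with hv'
  set a' := fun q => a (reflect t₀ q) with ha'
  have hJ := integrableOn_polarDensity_reflect (k := k) hv ha (fun t ht θ hθ => (hC t ht θ hθ).1) hI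
  have hI' := hJ
  rw [IntegrableOn, Measure.volume_eq_prod, ← Measure.prod_restrict] at hI'
  have hI1 : IntegrableOn (fun t => ∫ θ in (0 : ℝ)..Real.pi, Real.exp t * polarDensity v' a' (t, θ))
      (Set.Iic t₀) := by
    have := hI'.integral_prod_left
    simp only [integral_Ioo_eq_interval] at this
    exact (integrableOn_congr_set_ae Iio_ae_eq_Iic).mp this
  rw [Measure.volume_eq_prod, setIntegral_prod _ hJ, ← integral_Iic_eq_integral_Iio]
  simp only [integral_Ioo_eq_interval]
  have hle : ∀ {t}, t ≤ t₀ → t₀ ≤ 2 * t₀ - t := fun h => by linarith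
  have hder : ∀ t ∈ Set.Iic t₀, HasDerivAt (fun s => Real.exp s * polarFlux v' a' s)
      (∫ θ in (0 : ℝ)..Real.pi, Real.exp t * polarDensity v' a' (t, θ)) t := fun t ht =>
    hasDerivAt_exp_mul_polarFlux (fun θ => contDiffAt_reflectU (hv _ _ (hle ht)))
      (fun θ => ContDiffAt.comp (g := a) (t, θ) (ha _ _ (hle ht)) (contDiff_reflect t₀).contDiffAt)
      (ha0 _ (hle ht)) (haπ _ (hle ht))
  -- The origin contributes nothing: inside the ball the flux without its factor `e^s` stays
  -- bounded, by the bounds on the exterior data.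
  have hlim : Tendsto (fun s => Real.exp s * polarFlux v' a' s) atBot (𝓝 0) := by
    have hb : ∀ᶠ s in atBot, ‖polarFlux v' a' s‖ ≤ (16 + 16 * C) * |Real.pi - 0| := by
      filter_upwards [eventually_le_atBot t₀] with s hs
      have hR := hle hs
      have hpf : polarFlux v' a' s = ∫ θ in (0 : ℝ)..Real.pi, Real.sin θ *
          (16 - 8 * dh 0 v (reflect t₀ (s, θ)) + 4 * dh 0 a (reflect t₀ (s, θ))
            + 4 * a (reflect t₀ (s, θ))) :=
        intervalIntegral.integral_congr fun θ _ =>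
          fluxIntegrand_reflect ((hv _ _ hR).differentiableAt (by simp))
            ((ha _ _ hR).differentiableAt (by simp))
      have hC0 : 0 ≤ C := (abs_nonneg _).trans (hC t₀ le_rfl (Real.pi / 2)
        ⟨by positivity, by linarith [Real.pi_pos]⟩).1
      rw [hpf, intervalIntegral.integral_of_le Real.pi_pos.le, integral_Ioc_eq_integral_Ioo]
      have := norm_setIntegral_le_of_norm_le_const (μ := volume) (s := Set.Ioo 0 Real.pi)
        (C := 16 + 16 * C) (f := fun θ => Real.sin θ *
          (16 - 8 * dh 0 v (reflect t₀ (s, θ)) + 4 * dh 0 a (reflect t₀ (s, θ))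
            + 4 * a (reflect t₀ (s, θ)))) (by simp) (by
          intro θ hθ
          obtain ⟨h1, h2, h3⟩ := hC _ hR θ hθ
          have hs0 := Real.sin_nonneg_of_mem_Icc (Set.Ioo_subset_Icc_self hθ)
          have hs1 := Real.sin_le_one θ
          have h1' : |dh 0 v (reflect t₀ (s, θ))| ≤ C := h1
          have h2' : |dh 0 a (reflect t₀ (s, θ))| ≤ C := h2
          have h3' : |a (reflect t₀ (s, θ))| ≤ C := h3
          rw [Real.norm_eq_abs, abs_mul, abs_of_nonneg hs0]
          have hX : |16 - 8 * dh 0 v (reflect t₀ (s, θ)) + 4 * dh 0 a (reflect t₀ (s, θ))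
              + 4 * a (reflect t₀ (s, θ))| ≤ 16 + 16 * C := by
            rw [abs_le] at *
            constructor <;> linarith
          calc _ ≤ 1 * (16 + 16 * C) := by gcongr
            _ = _ := one_mul _)
      simpa [abs_of_pos Real.pi_pos, max_eq_left Real.pi_pos.le] using this
    have := Real.tendsto_exp_atBot.zero_mul_isBoundedUnder_le
      (isBoundedUnder_of_eventually_le hb)
    exact this
  rw [integral_Iic_of_hasDerivAt_of_tendsto' hder hI1 hlim, sub_zero]

/-- The flux is continuous across a minimal sphere. -/
lemma polarFlux_reflect (hv : ∀ θ, DifferentiableAt ℝ v (t₀, θ))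
    (ha : ∀ θ, DifferentiableAt ℝ a (t₀, θ))
    (hmin : ∀ θ ∈ Set.Ioo 0 Real.pi, 2 - 2 * dh 0 v (t₀, θ) + dh 0 a (t₀, θ) = 0) :
    polarFlux (reflectU t₀ k v) (fun q => a (reflect t₀ q)) t₀ = polarFlux v a t₀ := by
  refine intervalIntegral.integral_congr_uIoo fun θ hθ => ?_
  rw [Set.uIoo_of_le Real.pi_pos.le] at hθ
  have hr : reflect t₀ (t₀, θ) = (t₀, θ) := by simp [reflect]; ring
  have e := fluxIntegrand_reflect (k := k) (q := (t₀, θ)) (by rw [hr]; exact hv θ)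
    (by rw [hr]; exact ha θ)
  rw [hr] at e
  have hm := hmin θ hθ
  simp only [fluxIntegrand] at e ⊢
  rw [e]
  -- The integrands from the two sides differ by `8 sin θ (2 - 2v_t + a_t)`.
  linear_combination (8 * Real.sin θ) * hm

end ReflectedFlux

lemma hinv_logPolar {m₁ : ℝ} (hm : 0 < m₁) (q : ℝ × ℝ) :
    hinv m₁ (logPolar q) = logPolar (reflect (Real.log (m₁ / 2)) q) := by
  have hc : 0 < m₁ / 2 := by positivity
  have e : Real.exp (2 * Real.log (m₁ / 2) - q.1) * Real.exp q.1 ^ 2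
      = (m₁ / 2) ^ 2 * Real.exp q.1 := by
    have h2 : Real.exp (2 * Real.log (m₁ / 2)) = (m₁ / 2) ^ 2 := by
      rw [mul_comm, Real.exp_mul, Real.exp_log hc]; norm_num
    rw [Real.exp_sub, h2]
    field_simp
  have e0 := (Real.exp_pos q.1).ne'
  have e' : (m₁ / 2) ^ 2 / Real.exp q.1 ^ 2 * Real.exp q.1
      = Real.exp (2 * Real.log (m₁ / 2) - q.1) := by
    rw [div_mul_eq_mul_div, ← e]; field_simp
  simp only [hinv, logPolar_norm_sq]
  simp only [logPolar, reflect]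
  rw [← e']
  ext <;> simp <;> ring

/-! ### The integral of the mass density as the limit of the exterior flux. -/

namespace PseudosphericalData

variable {m₁ : ℝ} {ℓ : ℕ} (D : PseudosphericalData m₁ ℓ)

/-- `U` in logarithmic polar coordinates. -/
def v (q : ℝ × ℝ) : ℝ := D.u (logPolar q)

/-- `α` in logarithmic polar coordinates. -/
def va (q : ℝ × ℝ) : ℝ := D.al (logPolar q)

lemma sq_le_logPolar (hm : 0 < m₁) {q : ℝ × ℝ} :
    (m₁ / 2) ^ 2 ≤ (logPolar q).1 ^ 2 + (logPolar q).2 ^ 2 ↔ Real.log (m₁ / 2) ≤ q.1 := by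
  rw [logPolar_norm_sq, sq_le_sq₀ (by positivity) (Real.exp_pos _).le,
    Real.log_le_iff_le_exp (by positivity)]

lemma sq_lt_logPolar (hm : 0 < m₁) {q : ℝ × ℝ} :
    (m₁ / 2) ^ 2 < (logPolar q).1 ^ 2 + (logPolar q).2 ^ 2 ↔ Real.log (m₁ / 2) < q.1 := by
  rw [logPolar_norm_sq, sq_lt_sq₀ (by positivity) (Real.exp_pos _).le,
    Real.log_lt_iff_lt_exp (by positivity)]

lemma contDiffAt_v (hm : 0 < m₁) {q : ℝ × ℝ} (hq : Real.log (m₁ / 2) ≤ q.1) {n : ℕ∞} :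
    ContDiffAt ℝ n D.v q :=
  (D.contDiffAt_u hm ((sq_le_logPolar hm).mpr hq)).comp q contDiff_logPolar.contDiffAt

lemma contDiffAt_va (hm : 0 < m₁) {q : ℝ × ℝ} (hq : Real.log (m₁ / 2) ≤ q.1) {n : ℕ∞} :
    ContDiffAt ℝ n D.va q :=
  (D.contDiffAt_al hm ((sq_le_logPolar hm).mpr hq)).comp q contDiff_logPolar.contDiffAt

lemma va_axis (hm : 0 < m₁) {t θ : ℝ} (ht : Real.log (m₁ / 2) ≤ t) (hθ : Real.sin θ = 0) :
    D.va (t, θ) = 0 := by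
  have h := (sq_le_logPolar hm (q := (t, θ))).mpr ht
  refine D.α_axis _ ?_ ?_
  · have hn := norm_sq_sec (logPolar (t, θ))
    rw [← hn] at h
    exact (sq_le_sq₀ (by positivity) (norm_nonneg _)).mp h
  · rw [rho_sec (by simp [logPolar, hθ])]
    simp [logPolar, hθ]

lemma uIn_logPolar (hm : 0 < m₁) : (fun q => D.uIn (logPolar q))
    = reflectU (Real.log (m₁ / 2)) (2 * Real.log (2 / m₁)) D.v := by
  funext q
  rw [uIn, logPolar_norm_sq, hinv_logPolar hm, Real.log_pow, Real.log_exp]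
  simp [reflectU, v]

lemma alIn_logPolar (hm : 0 < m₁) : (fun q => D.alIn (logPolar q))
    = fun q => D.va (reflect (Real.log (m₁ / 2)) q) := by
  funext q
  rw [alIn, hinv_logPolar hm, va]

open Classical in
/-- The mass density as a function of `(ρ, z)`. -/
def meridianDensity (p : ℝ × ℝ) : ℝ :=
  if (m₁ / 2) ^ 2 < p.1 ^ 2 + p.2 ^ 2 then brillDensity D.u D.al p else brillDensity D.uIn D.alIn p

lemma measurableSet_meridian (c : ℝ) : MeasurableSet {p : ℝ × ℝ | c < p.1 ^ 2 + p.2 ^ 2} :=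
  measurableSet_lt measurable_const (by fun_prop)

lemma measurable_meridianDensity : Measurable D.meridianDensity :=
  Measurable.ite (measurableSet_meridian _) (measurable_brillDensity _ _)
    (measurable_brillDensity _ _)

/-- The sphere, where the doubled data need not be differentiable, and the axis are null sets. The
replacement is a measurable function of `(ρ, z)`, as the change of coordinates requires. -/
lemma massDensity_ae_eq (hm : 0 < m₁) : D.massDensity =ᵐ[volume] fun x => D.meridianDensity (cyl x) := by
  have hsph : ∀ᵐ x : E3, ‖x‖ ≠ m₁ / 2 := by
    have h := Measure.addHaar_sphere (volume : Measure E3) 0 (m₁ / 2)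
    refine measure_mono_null (fun x hx => ?_) h
    simpa using hx
  filter_upwards [ae_rho_pos, hsph] with x hρ hx
  have hn : ‖x‖ ^ 2 = (cyl x).1 ^ 2 + (cyl x).2 ^ 2 := norm_sq_eq_rho x
  rcases lt_or_gt_of_ne hx with h | h
  · rw [D.massDensity_of_gt hm h hρ, meridianDensity, if_neg]
    rw [← hn, not_lt, sq_le_sq₀ (norm_nonneg _) (by positivity)]
    exact h.le
  · rw [D.massDensity_of_lt hm h hρ, meridianDensity, if_pos]
    rw [← hn, sq_lt_sq₀ (by positivity) (norm_nonneg _)]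
    exact h

lemma weighted_meridianDensity_out (hm : 0 < m₁) {q : ℝ × ℝ} (hq : Real.log (m₁ / 2) < q.1)
    (hs : q ∈ strip) : 2 * Real.pi * Real.exp (3 * q.1) * Real.sin q.2
      * D.meridianDensity (logPolar q)
      = 2 * Real.pi * (Real.exp q.1 * polarDensity D.v D.va q) := by
  have h1 := (sq_lt_logPolar hm).mpr hq
  have e3 : Real.exp (3 * q.1) = Real.exp q.1 * Real.exp (2 * q.1) := by
    rw [← Real.exp_add]; congr 1; ring
  rw [meridianDensity, if_pos h1]
  have h := brillDensity_logPolar hs (D.contDiffAt_u (n := 2) hm h1.le) (D.contDiffAt_al hm h1.le)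
  change _ = polarDensity D.v D.va q at h
  rw [← h, e3]
  ring

lemma weighted_meridianDensity_in (hm : 0 < m₁) {q : ℝ × ℝ} (hq : q.1 < Real.log (m₁ / 2))
    (hs : q ∈ strip) : 2 * Real.pi * Real.exp (3 * q.1) * Real.sin q.2
      * D.meridianDensity (logPolar q)
      = 2 * Real.pi * (Real.exp q.1 * polarDensity
        (reflectU (Real.log (m₁ / 2)) (2 * Real.log (2 / m₁)) D.v)
        (fun q => D.va (reflect (Real.log (m₁ / 2)) q)) q) := by
  have h1 : ¬ (m₁ / 2) ^ 2 < (logPolar q).1 ^ 2 + (logPolar q).2 ^ 2 := fun h =>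
    absurd ((sq_lt_logPolar hm).mp h) (not_lt.mpr hq.le)
  have h0 : 0 < (logPolar q).1 ^ 2 + (logPolar q).2 ^ 2 := by
    rw [logPolar_norm_sq]; positivity
  have e3 : Real.exp (3 * q.1) = Real.exp q.1 * Real.exp (2 * q.1) := by
    rw [← Real.exp_add]; congr 1; ring
  rw [meridianDensity, if_neg h1]
  have h := brillDensity_logPolar hs (D.contDiffAt_uIn (n := 2) hm h0 (not_lt.mp h1))
    (D.contDiffAt_alIn hm h0 (not_lt.mp h1))
  rw [D.uIn_logPolar hm, D.alIn_logPolar hm] at h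
  rw [← h, e3]
  ring

/-- Integrability of the mass density, and its integral as the limit of a flux. -/
theorem integrable_massDensity_and_tendsto (hm : 0 < m₁) {C : ℝ}
    (hC : ∀ t, Real.log (m₁ / 2) ≤ t → ∀ θ ∈ Set.Ioo 0 Real.pi,
      |dh 0 D.v (t, θ)| ≤ C ∧ |dh 0 D.va (t, θ)| ≤ C ∧ |D.va (t, θ)| ≤ C)
    (hext : IntegrableOn D.massDensity {x | m₁ / 2 < ‖x‖})
    (hmin : ∀ θ ∈ Set.Ioo 0 Real.pi,
      2 - 2 * dh 0 D.v (Real.log (m₁ / 2), θ) + dh 0 D.va (Real.log (m₁ / 2), θ) = 0) :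
    Integrable D.massDensity ∧ Tendsto (fun t => Real.exp t * polarFlux D.v D.va t) atTop
      (𝓝 ((1 / (2 * Real.pi)) * ∫ x, D.massDensity x)) := by
  set t₀ := Real.log (m₁ / 2) with ht₀
  have hv : ∀ t θ, t₀ ≤ t → ContDiffAt ℝ 2 D.v (t, θ) := fun t θ ht => D.contDiffAt_v (n := 2) hm ht
  have ha : ∀ t θ, t₀ ≤ t → ContDiffAt ℝ 2 D.va (t, θ) := fun t θ ht =>
    D.contDiffAt_va (n := 2) hm ht
  have ha0 : ∀ t, t₀ ≤ t → D.va (t, 0) = 0 := fun t ht => D.va_axis hm ht Real.sin_zero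
  have haπ : ∀ t, t₀ ≤ t → D.va (t, Real.pi) = 0 := fun t ht => D.va_axis hm ht Real.sin_pi
  have hπ : (2 * Real.pi) ≠ 0 := by positivity
  set G := fun q : ℝ × ℝ => 2 * Real.pi * Real.exp (3 * q.1) * Real.sin q.2
      * D.meridianDensity (logPolar q) with hG
  have hout : ∀ {q : ℝ × ℝ}, q ∈ Set.Ioi t₀ ×ˢ Set.Ioo 0 Real.pi → q ∈ strip := fun hq =>
    ⟨Set.mem_univ _, hq.2⟩
  have hin : ∀ {q : ℝ × ℝ}, q ∈ Set.Iio t₀ ×ˢ Set.Ioo 0 Real.pi → q ∈ strip := fun hq =>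
    ⟨Set.mem_univ _, hq.2⟩
  have mO : MeasurableSet (Set.Ioi t₀ ×ˢ Set.Ioo 0 Real.pi) := measurableSet_Ioi.prod measurableSet_Ioo
  have mI : MeasurableSet (Set.Iio t₀ ×ˢ Set.Ioo 0 Real.pi) := measurableSet_Iio.prod measurableSet_Ioo
  have GO : Set.EqOn G (fun q => 2 * Real.pi * (Real.exp q.1 * polarDensity D.v D.va q))
      (Set.Ioi t₀ ×ˢ Set.Ioo 0 Real.pi) := fun q hq =>
    D.weighted_meridianDensity_out hm hq.1 (hout hq)
  have GI : Set.EqOn G (fun q => 2 * Real.pi * (Real.exp q.1 * polarDensity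
        (reflectU t₀ (2 * Real.log (2 / m₁)) D.v) (fun q => D.va (reflect t₀ q)) q))
      (Set.Iio t₀ ×ˢ Set.Ioo 0 Real.pi) := fun q hq =>
    D.weighted_meridianDensity_in hm hq.1 (hin hq)
  -- The change of coordinates is available on all of `ℝ³`, so the exterior is cut out by the
  -- indicator of an axisymmetric set.
  have hGO : IntegrableOn G (Set.Ioi t₀ ×ˢ Set.Ioo 0 Real.pi) := by
    set S := {p : ℝ × ℝ | (m₁ / 2) ^ 2 < p.1 ^ 2 + p.2 ^ 2} with hS
    have hpre : cyl ⁻¹' S = {x | m₁ / 2 < ‖x‖} := by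
      ext x
      have hn : ‖x‖ ^ 2 = (cyl x).1 ^ 2 + (cyl x).2 ^ 2 := norm_sq_eq_rho x
      change (m₁ / 2) ^ 2 < (cyl x).1 ^ 2 + (cyl x).2 ^ 2 ↔ m₁ / 2 < ‖x‖
      rw [← hn, sq_lt_sq₀ (by positivity) (norm_nonneg _)]
    have h1 : Integrable (fun x => S.indicator D.meridianDensity (cyl x)) := by
      have h2 : IntegrableOn (fun x => D.meridianDensity (cyl x)) {x | m₁ / 2 < ‖x‖} :=
        hext.congr_fun_ae (ae_restrict_of_ae (D.massDensity_ae_eq hm))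
      rw [← hpre] at h2
      exact (integrable_indicator_iff (measurable_cyl (measurableSet_meridian _))).mpr h2
    have h3 := ((integrable_comp_cyl_iff
      (D.measurable_meridianDensity.indicator (measurableSet_meridian _))).mp h1).mono_set
      (fun q hq => hout hq)
    refine h3.congr_fun (fun q hq => ?_) mO
    have hqS : logPolar q ∈ S := (sq_lt_logPolar hm).mpr hq.1
    change _ * S.indicator D.meridianDensity (logPolar q) = _
    rw [Set.indicator_of_mem hqS]
  have hI : IntegrableOn (fun q : ℝ × ℝ => Real.exp q.1 * polarDensity D.v D.va q)
      (Set.Ioi t₀ ×ˢ Set.Ioo 0 Real.pi) := by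
    refine ((hGO.congr_fun GO mO).const_mul (2 * Real.pi)⁻¹).congr (Eventually.of_forall fun q => ?_)
    exact inv_mul_cancel_left₀ hπ _
  have hGI : IntegrableOn G (Set.Iio t₀ ×ˢ Set.Ioo 0 Real.pi) :=
    IntegrableOn.congr_fun ((integrableOn_polarDensity_reflect (k := 2 * Real.log (2 / m₁)) hv ha
      (fun t ht θ hθ => (hC t ht θ hθ).1) hI).const_mul (2 * Real.pi)) (fun q hq => (GI hq).symm) mI
  have hae : (strip : Set (ℝ × ℝ)) =ᵐ[volume]
      (Set.Iio t₀ ×ˢ Set.Ioo 0 Real.pi ∪ Set.Ioi t₀ ×ˢ Set.Ioo 0 Real.pi : Set (ℝ × ℝ)) := by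
    rw [← Set.union_prod, Set.Iio_union_Ioi, strip]
    refine Measure.set_prod_ae_eq (μ := volume) (ν := volume) ?_ (ae_eq_refl _)
    exact (ae_eq_univ.mpr (by simp)).symm
  have hdisj : Disjoint (Set.Iio t₀ ×ˢ Set.Ioo 0 Real.pi) (Set.Ioi t₀ ×ˢ Set.Ioo 0 Real.pi) :=
    Set.disjoint_prod.mpr (Or.inl (Set.disjoint_left.mpr fun x h h' =>
      lt_asymm (Set.mem_Iio.mp h) (Set.mem_Ioi.mp h')))
  have hGs : IntegrableOn G strip := (integrableOn_congr_set_ae hae).mpr (hGI.union hGO)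
  have hint := (integrable_comp_cyl_iff D.measurable_meridianDensity).mpr hGs
  refine ⟨hint.congr (D.massDensity_ae_eq hm).symm, ?_⟩
  -- The inner half contributes the flux through the sphere from inside, which by minimality is the
  -- starting value of the outer flux; adding the outer integral gives the limit at infinity.
  rw [integral_congr_ae (D.massDensity_ae_eq hm), integral_comp_cyl D.measurable_meridianDensity,
    setIntegral_congr_set hae, setIntegral_union hdisj mO hGI hGO, setIntegral_congr_fun mO GO,
    setIntegral_congr_fun mI GI, integral_const_mul, integral_const_mul,
    integral_polarDensity_reflect hv ha ha0 haπ hC hI, ← mul_add, one_div,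
    inv_mul_cancel_left₀ hπ, polarFlux_reflect
      (fun θ => (hv t₀ θ le_rfl).differentiableAt (by simp))
      (fun θ => (ha t₀ θ le_rfl).differentiableAt (by simp)) hmin]
  exact tendsto_exp_mul_polarFlux hv ha ha0 haπ hI

end PseudosphericalData

/-! ### Radial derivatives and bounds on the exterior -/

/-- In logarithmic polar coordinates `∂_t` is the Euler field `r∂_r`, whose value at a point is its
position vector. -/
lemma dh_zero_comp_sec_logPolar {F : E3 → ℝ} {q : ℝ × ℝ}
    (hF : DifferentiableAt ℝ F (sec (logPolar q))) :
    dh 0 (fun q => F (sec (logPolar q))) q = fderiv ℝ F (sec (logPolar q)) (sec (logPolar q)) := by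
  obtain ⟨t, θ⟩ := q
  have hs : ∀ s, sec (logPolar (s, θ)) = Real.exp s • sec (Real.sin θ, Real.cos θ) := by
    intro s
    ext i
    fin_cases i <;> simp [sec, logPolar]
  have hd : DifferentiableAt ℝ (fun q => F (sec (logPolar q))) (t, θ) := by
    have h1 : DifferentiableAt ℝ (fun q => sec (logPolar q)) (t, θ) :=
      ((contDiff_sec (n := 1)).comp contDiff_logPolar).contDiffAt.differentiableAt (by simp)
    exact hF.comp (t, θ) h1
  have h2 : HasDerivAt (fun s => sec (logPolar (s, θ))) (sec (logPolar (t, θ))) t := by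
    simp only [hs]
    exact (Real.hasDerivAt_exp t).smul_const _
  exact (hasDerivAt_slice hd).unique (hF.hasFDerivAt.comp_hasDerivAt t h2)

lemma norm_sec_logPolar (q : ℝ × ℝ) : ‖sec (logPolar q)‖ = Real.exp q.1 := by
  have h : ‖sec (logPolar q)‖ ^ 2 = Real.exp q.1 ^ 2 := by rw [norm_sq_sec, logPolar_norm_sq]
  exact (pow_left_inj₀ (norm_nonneg _) (Real.exp_pos _).le two_ne_zero).mp h

/-- The decay gives the bound near infinity; on the remaining bounded part of the exterior, which is
compact, the continuous quotient by `‖x‖ ^ q` is bounded. -/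
lemma exists_bound_exterior {G : Type*} [NormedAddCommGroup G] {m₁ : ℝ} (hm : 0 < m₁) {F : E3 → G}
    {q : ℝ} (hF : ContinuousOn F (exterior m₁)) (ho : F =o[cobounded E3] fun x => ‖x‖ ^ q) :
    ∃ C, 0 ≤ C ∧ ∀ x ∈ exterior m₁, ‖F x‖ ≤ C * ‖x‖ ^ q := by
  have h1 := ho.bound one_pos
  rw [← comap_norm_atTop, eventually_comap] at h1
  obtain ⟨R, hR⟩ := eventually_atTop.mp h1
  have hpos : ∀ x ∈ exterior m₁, 0 < ‖x‖ := fun x hx => lt_of_lt_of_le (by positivity) hx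
  have hcl : IsClosed (exterior m₁) := isClosed_le continuous_const continuous_norm
  have hK : IsCompact (Metric.closedBall (0 : E3) R ∩ exterior m₁) :=
    (isCompact_closedBall 0 R).inter_right hcl
  have hc : ContinuousOn (fun x : E3 => ‖F x‖ / ‖x‖ ^ q) (Metric.closedBall (0 : E3) R ∩ exterior m₁) := by
    refine ContinuousOn.div (hF.norm.mono Set.inter_subset_right) ?_ ?_
    · exact continuous_norm.continuousOn.rpow_const fun x hx => Or.inl (hpos x hx.2).ne'
    · exact fun x hx => (Real.rpow_pos_of_pos (hpos x hx.2) q).ne'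
  obtain ⟨C, hC⟩ := hK.exists_bound_of_continuousOn hc
  refine ⟨max 1 C, by positivity, fun x hx => ?_⟩
  have hp := Real.rpow_pos_of_pos (hpos x hx) q
  rcases le_total R ‖x‖ with h | h
  · have := hR ‖x‖ h x rfl
    rw [one_mul, Real.norm_of_nonneg hp.le] at this
    exact this.trans (le_mul_of_one_le_left hp.le (le_max_left _ _))
  · have := hC x ⟨by simpa using h, hx⟩
    rw [Real.norm_of_nonneg (by positivity), div_le_iff₀ hp] at this
    exact this.trans (by gcongr; exact le_max_right _ _)

lemma IsLittleOk.isLittleO {f : E3 → ℝ} {k : ℕ} {p : ℝ} (h : IsLittleOk k f p) :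
    f =o[cobounded E3] fun x => ‖x‖ ^ p := by
  have := (h 0 (Nat.zero_le _)).norm_left
  simp only [norm_iteratedFDeriv_zero] at this
  simpa using this.of_norm_left

lemma IsLittleOk.isLittleO_fderiv {f : E3 → ℝ} {k : ℕ} {p : ℝ} (h : IsLittleOk k f p) (hk : 1 ≤ k) :
    fderiv ℝ f =o[cobounded E3] fun x => ‖x‖ ^ (p - 1) := by
  have := (h 1 hk).norm_left
  simp only [norm_iteratedFDeriv_one] at this
  simpa using this.of_norm_left

lemma isLittleOk_one {f : E3 → ℝ} {p : ℝ} (h0 : f =o[cobounded E3] fun x => ‖x‖ ^ p)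
    (h1 : fderiv ℝ f =o[cobounded E3] fun x => ‖x‖ ^ (p - 1)) : IsLittleOk 1 f p := by
  intro j hj
  interval_cases j
  · refine IsLittleO.of_norm_left ?_
    simpa using h0.norm_left
  · refine IsLittleO.of_norm_left ?_
    simp only [norm_iteratedFDeriv_one]
    simpa using h1.norm_left

lemma SmoothUpTo.differentiableAt {f : E3 → ℝ} {s : Set E3} (hf : SmoothUpTo f s) {x : E3}
    (hx : x ∈ s) : DifferentiableAt ℝ f x := (hf.contDiffAt hx (n := 1)).differentiableAt (by simp)

lemma SmoothUpTo.continuousAt {f : E3 → ℝ} {s : Set E3} (hf : SmoothUpTo f s) {x : E3}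
    (hx : x ∈ s) : ContinuousAt f x := (hf.differentiableAt hx).continuousAt

lemma SmoothUpTo.continuousAt_fderiv {f : E3 → ℝ} {s : Set E3} (hf : SmoothUpTo f s) {x : E3}
    (hx : x ∈ s) : ContinuousAt (fderiv ℝ f) x :=
  ((hf.contDiffAt hx (n := 1)).fderiv_right (m := 0) (by norm_num)).continuousAt

lemma SmoothUpTo.exists_bound {f : E3 → ℝ} {m₁ : ℝ} (hm : 0 < m₁) {k : ℕ} {p : ℝ}
    (hf : SmoothUpTo f (exterior m₁)) (hk : 1 ≤ k) (ho : IsLittleOk k f p) :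
    ∃ C, 0 ≤ C ∧ ∀ x ∈ exterior m₁, |f x| ≤ C * ‖x‖ ^ p ∧ ‖fderiv ℝ f x‖ ≤ C * ‖x‖ ^ (p - 1) := by
  obtain ⟨C, hC0, hC⟩ := exists_bound_exterior hm
    (fun x hx => (hf.continuousAt hx).continuousWithinAt) ho.isLittleO
  obtain ⟨C', hC0', hC'⟩ := exists_bound_exterior hm
    (fun x hx => (hf.continuousAt_fderiv hx).continuousWithinAt) (ho.isLittleO_fderiv hk)
  refine ⟨max C C', by positivity, fun x hx => ⟨(hC x hx).trans ?_, (hC' x hx).trans ?_⟩⟩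
  · gcongr; exact le_max_left _ _
  · gcongr; exact le_max_right _ _

lemma rpow_le_of_nonpos {c r p : ℝ} (hc : 0 < c) (hr : c ≤ r) (hp : p ≤ 0) : r ^ p ≤ c ^ p :=
  Real.rpow_le_rpow_of_nonpos hc hr hp

namespace PseudosphericalData

variable {m₁ : ℝ} {ℓ : ℕ} (D : PseudosphericalData m₁ ℓ)

lemma mem_exterior_sec_logPolar (hm : 0 < m₁) {q : ℝ × ℝ} (hq : Real.log (m₁ / 2) ≤ q.1) :
    sec (logPolar q) ∈ exterior m₁ := by
  change m₁ / 2 ≤ _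
  rw [norm_sec_logPolar]
  exact (Real.log_le_iff_le_exp (by positivity)).mp hq

lemma dh_zero_v (hm : 0 < m₁) {q : ℝ × ℝ} (hq : Real.log (m₁ / 2) ≤ q.1) :
    dh 0 D.v q = fderiv ℝ D.U (sec (logPolar q)) (sec (logPolar q)) :=
  dh_zero_comp_sec_logPolar (D.U_smooth.differentiableAt (mem_exterior_sec_logPolar hm hq))

lemma dh_zero_va (hm : 0 < m₁) {q : ℝ × ℝ} (hq : Real.log (m₁ / 2) ≤ q.1) :
    dh 0 D.va q = fderiv ℝ D.α (sec (logPolar q)) (sec (logPolar q)) :=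
  dh_zero_comp_sec_logPolar (D.α_smooth.differentiableAt (mem_exterior_sec_logPolar hm hq))

/-- Since `∂_t = r∂_r`, a gradient bounded by `C r^{-3/2}` gives `C r^{-1/2}`, which is bounded for
`r ≥ m₁/2`. The condition `5 ≤ ℓ` ensures that the decay of `α` includes its first derivative. -/
lemma exists_polar_bound (hm : 0 < m₁) (hℓ : 5 ≤ ℓ) : ∃ C, ∀ t, Real.log (m₁ / 2) ≤ t → ∀ θ : ℝ,
    |dh 0 D.v (t, θ)| ≤ C ∧ |dh 0 D.va (t, θ)| ≤ C ∧ |D.va (t, θ)| ≤ C := by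
  obtain ⟨C, hC0, hC⟩ := D.U_smooth.exists_bound hm (by omega) D.U_falloff
  obtain ⟨C', hC0', hC'⟩ := D.α_smooth.exists_bound hm (by omega) D.α_falloff
  have hc : 0 < m₁ / 2 := by positivity
  refine ⟨max C C' * (m₁ / 2) ^ (-1 / 2 : ℝ), fun t ht θ => ?_⟩
  have hx := mem_exterior_sec_logPolar hm (q := (t, θ)) ht
  rw [D.dh_zero_v hm ht, D.dh_zero_va hm ht]
  have hxp : 0 < ‖sec (logPolar (t, θ))‖ := lt_of_lt_of_le hc hx
  have hmono := rpow_le_of_nonpos hc (show m₁ / 2 ≤ ‖sec (logPolar (t, θ))‖ from hx)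
    (show (-1 / 2 : ℝ) ≤ 0 by norm_num)
  have hsplit : ‖sec (logPolar (t, θ))‖ ^ (-1 / 2 - 1 : ℝ) * ‖sec (logPolar (t, θ))‖
      = ‖sec (logPolar (t, θ))‖ ^ (-1 / 2 : ℝ) := by
    rw [Real.rpow_sub_one hxp.ne']; field_simp
  have key : ∀ {f : E3 → ℝ} {K : ℝ}, ‖fderiv ℝ f (sec (logPolar (t, θ)))‖
      ≤ K * ‖sec (logPolar (t, θ))‖ ^ (-1 / 2 - 1 : ℝ) → K ≤ max C C' →
      |fderiv ℝ f (sec (logPolar (t, θ))) (sec (logPolar (t, θ)))|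
        ≤ max C C' * (m₁ / 2) ^ (-1 / 2 : ℝ) := by
    intro f K h hK
    refine ((fderiv ℝ f _).le_opNorm _).trans ((mul_le_mul_of_nonneg_right h hxp.le).trans ?_)
    rw [mul_assoc, hsplit]
    gcongr
  refine ⟨key (hC _ hx).2 (le_max_left _ _), key (hC' _ hx).2 (le_max_right _ _), ?_⟩
  refine (hC' _ hx).1.trans ?_
  gcongr
  exact le_max_right _ _

end PseudosphericalData

/-! ### The metric in Cartesian coordinates -/

/-- Components of the rotation field `∂_φ`. -/
def rotField (x : E3) : Fin 3 → ℝ := ![-x 1, x 0, 0]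

/-- Components of the 1-form `A_ρ dρ + A_z dz` with `A_ρ = ρ a`. -/
def meridianForm (a Az : E3 → ℝ) (x : E3) : Fin 3 → ℝ := ![a x * x 0, a x * x 1, Az x]

/-- From `δ = dρ² + dz² + ρ²dφ²`, with `ρ²dφ` the form dual to the rotation field and `A_ρ dρ = a(x
dx + y dy)`. In this form the only factor that is singular on the axis is the projection `dρ² +
dz²`, and it is multiplied by `e^{2α} - 1`, which vanishes there. -/
lemma brillForm_apply {U α a Az : E3 → ℝ} {x : E3} (hρ : 0 < rho x) (i j : Fin 3) :
    brillForm U α (fun y => rho y * a y) Az x i j = Real.exp (-2 * U x) *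
      ((1 : Matrix (Fin 3) (Fin 3) ℝ) i j
        + (Real.exp (2 * α x) - 1) * (dRho x i * dRho x j + dZ i * dZ j)
        + (rotField x i * meridianForm a Az x j + meridianForm a Az x i * rotField x j)
        + rho x ^ 2 * (meridianForm a Az x i * meridianForm a Az x j)) := by
  have h2 := rho_sq x
  have hne := hρ.ne'
  have hone : (1 : Matrix (Fin 3) (Fin 3) ℝ) i j
      = dRho x i * dRho x j + dZ i * dZ j + rho x ^ 2 * (dPhi x i * dPhi x j) := by
    fin_cases i <;> fin_cases j <;> simp [dRho, dZ, dPhi] <;> field_simp <;> linarith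
  have hw : ∀ i, rotField x i = rho x ^ 2 * dPhi x i := by
    intro i
    fin_cases i <;> simp [rotField, dPhi] <;> field_simp
  have hA : ∀ i, meridianForm a Az x i = rho x * a x * dRho x i + Az x * dZ i := by
    intro i
    fin_cases i <;> simp [meridianForm, dRho, dZ] <;> field_simp
  simp only [brillForm, Matrix.add_apply, Matrix.smul_apply, Matrix.vecMulVec_apply, smul_eq_mul,
    Pi.add_apply, Pi.smul_apply, hone, hw, hA, Real.exp_add]
  ring

namespace PseudosphericalData

variable {m₁ : ℝ} {ℓ : ℕ} (D : PseudosphericalData m₁ ℓ)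

lemma g_apply {x : E3} (hx : x ∈ exterior m₁) (hρ : 0 < rho x) (i j : Fin 3) :
    D.g x i j = Real.exp (-2 * D.U x) *
      ((1 : Matrix (Fin 3) (Fin 3) ℝ) i j
        + (Real.exp (2 * D.α x) - 1) * (dRho x i * dRho x j + dZ i * dZ j)
        + (rotField x i * meridianForm D.a D.Az x j + meridianForm D.a D.Az x i * rotField x j)
        + rho x ^ 2 * (meridianForm D.a D.Az x i * meridianForm D.a D.Az x j)) := by
  rw [D.g_eq x hx hρ, brillForm_apply hρ]

end PseudosphericalData

/-! ### Meridian half-planes -/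

/-- The parametrization of the meridian half-plane in the direction `(c, s)`. -/
def meridian (c s : ℝ) : ℝ × ℝ →L[ℝ] E3 :=
  (ContinuousLinearMap.fst ℝ ℝ ℝ).smulRight (!₂[c, s, 0] : E3)
    + (ContinuousLinearMap.snd ℝ ℝ ℝ).smulRight (basisVec 2)

section Meridian

variable {c s : ℝ}

lemma meridian_zero (p : ℝ × ℝ) : meridian c s p 0 = p.1 * c := by
  simp [meridian, basisVec]

lemma meridian_one (p : ℝ × ℝ) : meridian c s p 1 = p.1 * s := by
  simp [meridian, basisVec]

lemma meridian_two (p : ℝ × ℝ) : meridian c s p 2 = p.2 := by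
  simp [meridian, basisVec]

lemma rho_meridian (hcs : c ^ 2 + s ^ 2 = 1) {p : ℝ × ℝ} (hp : 0 ≤ p.1) :
    rho (meridian c s p) = p.1 := by
  have : (p.1 * c) ^ 2 + (p.1 * s) ^ 2 = p.1 ^ 2 := by
    linear_combination p.1 ^ 2 * hcs
  rw [rho, meridian_zero, meridian_one, this, Real.sqrt_sq hp]

lemma cyl_meridian (hcs : c ^ 2 + s ^ 2 = 1) {p : ℝ × ℝ} (hp : 0 ≤ p.1) :
    cyl (meridian c s p) = p := by
  rw [cyl, rho_meridian hcs hp, meridian_two]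

lemma meridian_cyl {x : E3} (hx : 0 < rho x) :
    meridian (x 0 / rho x) (x 1 / rho x) (cyl x) = x := by
  have hne := hx.ne'
  have h1 : (cyl x).1 = rho x := rfl
  have h2 : (cyl x).2 = x 2 := rfl
  ext i
  fin_cases i
  · change meridian _ _ _ 0 = x 0
    rw [meridian_zero, h1]; field_simp
  · change meridian _ _ _ 1 = x 1
    rw [meridian_one, h1]; field_simp
  · change meridian _ _ _ 2 = x 2
    rw [meridian_two, h2]

lemma norm_meridian_le (hcs : c ^ 2 + s ^ 2 = 1) (p : ℝ × ℝ) :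
    ‖meridian c s p‖ ^ 2 = p.1 ^ 2 + p.2 ^ 2 := by
  rw [norm_sq_eq_coords, meridian_zero, meridian_one, meridian_two]
  linear_combination p.1 ^ 2 * hcs

lemma abs_dh_comp_meridian_le (hcs : c ^ 2 + s ^ 2 = 1) {f : E3 → ℝ} {p : ℝ × ℝ}
    (hf : DifferentiableAt ℝ f (meridian c s p)) (m : Fin 3) :
    |dh m (fun q => f (meridian c s q)) p| ≤ ‖fderiv ℝ f (meridian c s p)‖ := by
  have h := fderiv_fun_comp p hf (meridian c s).differentiableAt
  rw [dh, h, ContinuousLinearMap.comp_apply, (meridian c s).fderiv]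
  refine ((fderiv ℝ f _).le_opNorm _).trans ?_
  refine mul_le_of_le_one_right (norm_nonneg _) ?_
  have := norm_meridian_le hcs ((![(1, 0), (0, 1), (0, 0)] : Fin 3 → ℝ × ℝ) m)
  have h1 : ‖meridian c s ((![(1, 0), (0, 1), (0, 0)] : Fin 3 → ℝ × ℝ) m)‖ ^ 2 ≤ 1 ^ 2 := by
    rw [this]; fin_cases m <;> simp
  exact (sq_le_sq₀ (norm_nonneg _) zero_le_one).mp h1

end Meridian

lemma fderiv_comp_cyl_rotField {f : ℝ × ℝ → ℝ} {x : E3} (hx : 0 < rho x)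
    (hf : DifferentiableAt ℝ f (cyl x)) :
    fderiv ℝ (fun y => f (cyl y)) x (WithLp.toLp 2 (rotField x)) = 0 := by
  rw [fderiv_eq_sum_pd]
  simp only [pd_comp_cyl hx hf, Fin.sum_univ_three, dh_two]
  simp [cylCoframe, rotField, dRho, dZ]
  ring

lemma norm_rotField (x : E3) : ‖(WithLp.toLp 2 (rotField x) : E3)‖ = rho x := by
  have h : ‖(WithLp.toLp 2 (rotField x) : E3)‖ ^ 2 = rho x ^ 2 := by
    rw [norm_sq_eq_coords, rho_sq]; simp [rotField]; ring
  exact (pow_left_inj₀ (norm_nonneg _) (rho_nonneg _) two_ne_zero).mp h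

/-! ### Pointwise control by `∂g`, and integrability of the mass density outside the sphere. -/

namespace PseudosphericalData

variable {m₁ : ℝ} {ℓ : ℕ} (D : PseudosphericalData m₁ ℓ)

section Meridian

variable {c s : ℝ} {p : ℝ × ℝ}

lemma mem_exterior_meridian (hm : 0 < m₁) (hcs : c ^ 2 + s ^ 2 = 1)
    (hp : (m₁ / 2) ^ 2 ≤ p.1 ^ 2 + p.2 ^ 2) : meridian c s p ∈ exterior m₁ := by
  rw [← norm_meridian_le hcs] at hp
  exact (sq_le_sq₀ (by positivity) (norm_nonneg _)).mp hp

/-- The metric components along a meridian half-plane. -/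
lemma g_meridian (hm : 0 < m₁) (hcs : c ^ 2 + s ^ 2 = 1) (hp0 : 0 < p.1)
    (hp : (m₁ / 2) ^ 2 ≤ p.1 ^ 2 + p.2 ^ 2) (i j : Fin 3) :
    D.g (meridian c s p) i j = Real.exp (-2 * D.u p) *
      ((1 : Matrix (Fin 3) (Fin 3) ℝ) i j
        + (Real.exp (2 * D.al p) - 1)
          * ((![c, s, 0] : Fin 3 → ℝ) i * (![c, s, 0] : Fin 3 → ℝ) j + dZ i * dZ j)
        + p.1 * ((![-s, c, 0] : Fin 3 → ℝ) i * (![c * D.ar p, s * D.ar p, D.az p] : Fin 3 → ℝ) j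
          + (![c * D.ar p, s * D.ar p, D.az p] : Fin 3 → ℝ) i * (![-s, c, 0] : Fin 3 → ℝ) j)
        + p.1 ^ 2 * ((![c * D.ar p, s * D.ar p, D.az p] : Fin 3 → ℝ) i
          * (![c * D.ar p, s * D.ar p, D.az p] : Fin 3 → ℝ) j)) := by
  have hx := mem_exterior_meridian hm hcs hp
  have hρ := rho_meridian hcs hp0.le
  have hcyl := cyl_meridian hcs hp0.le
  have hne := hp0.ne'
  have hU := D.U_eq hx
  have hα := D.α_eq hx
  have hA := D.Aρ_eq hx
  have hz := D.Az_eq hx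
  rw [Aρ, hρ] at hA
  rw [hcyl] at hU hα hA hz
  have e1 : ∀ i, dRho (meridian c s p) i = (![c, s, 0] : Fin 3 → ℝ) i := by
    intro i
    fin_cases i <;> simp [dRho, hρ, meridian_zero, meridian_one] <;> field_simp
  have e2 : ∀ i, rotField (meridian c s p) i = p.1 * (![-s, c, 0] : Fin 3 → ℝ) i := by
    intro i
    fin_cases i <;> simp [rotField, meridian_zero, meridian_one]
  have e3 : ∀ i, meridianForm D.a D.Az (meridian c s p) i
      = (![c * D.ar p, s * D.ar p, D.az p] : Fin 3 → ℝ) i := by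
    intro i
    rw [← hA, ← hz]
    fin_cases i <;> simp [meridianForm, meridian_zero, meridian_one] <;> ring
  rw [D.g_apply hx (by rw [hρ]; exact hp0), hU, hα, hρ]
  simp only [e1, e2, e3]
  ring

end Meridian

set_option maxHeartbeats 400000 in
/-- The derivatives of the metric components control `∇U` and `A_{ρ,z} - A_{z,ρ}`. -/
lemma deriv_bounds (hm : 0 < m₁) {x : E3} (hx : m₁ / 2 < ‖x‖) (hρ : 0 < rho x) {K : ℝ}
    (hK : ∀ i j, ‖fderiv ℝ (fun y => D.g y i j) x‖ ≤ K) :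
    |dh 0 D.u (cyl x)| ≤ 2 * Real.exp (2 * D.u (cyl x)) * K ∧
    |dh 1 D.u (cyl x)| ≤ 2 * Real.exp (2 * D.u (cyl x)) * K ∧
    rho x * |dh 1 D.ar (cyl x) - dh 0 D.az (cyl x)| ≤ Real.exp (2 * D.u (cyl x)) * K *
      (8 + 4 * (rho x * |D.ar (cyl x)| + rho x * |D.az (cyl x)|)) := by
  set c := x 0 / rho x with hc
  set s := x 1 / rho x with hs
  have hne := hρ.ne'
  have hcs : c ^ 2 + s ^ 2 = 1 := by
    have := rho_sq x
    rw [hc, hs]; field_simp; linarith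
  set p := cyl x with hp
  have hTp : meridian c s p = x := meridian_cyl hρ
  have hp1 : p.1 = rho x := rfl
  have hpn : (m₁ / 2) ^ 2 < p.1 ^ 2 + p.2 ^ 2 := by
    have h := norm_sq_eq_rho x
    change _ < rho x ^ 2 + x 2 ^ 2
    rw [← h]; gcongr
  have hev : ∀ᶠ q : ℝ × ℝ in 𝓝 p, 0 < q.1 ∧ (m₁ / 2) ^ 2 < q.1 ^ 2 + q.2 ^ 2 := by
    have o1 : IsOpen {q : ℝ × ℝ | 0 < q.1} := isOpen_lt continuous_const continuous_fst
    have o2 : IsOpen {q : ℝ × ℝ | (m₁ / 2) ^ 2 < q.1 ^ 2 + q.2 ^ 2} :=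
      isOpen_lt continuous_const (by fun_prop)
    filter_upwards [o1.mem_nhds (show 0 < p.1 from hρ), o2.mem_nhds hpn] with q h1 h2 using ⟨h1, h2⟩
  have hgd : ∀ i j, DifferentiableAt ℝ (fun y => D.g y i j) x := fun i j =>
    (D.g_smooth i j).differentiableAt (le_of_lt hx)
  have hgm : ∀ i j, DifferentiableAt ℝ (fun q => D.g (meridian c s q) i j) p := fun i j =>
    DifferentiableAt.comp (g := fun y => D.g y i j) p (by rw [hTp]; exact hgd i j)
      (meridian c s).differentiableAt
  have hbd : ∀ i j m, |dh m (fun q => D.g (meridian c s q) i j) p| ≤ K := fun i j m => by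
    have := abs_dh_comp_meridian_le hcs (f := fun y => D.g y i j) (p := p)
      (by rw [hTp]; exact hgd i j) m
    rw [hTp] at this
    exact this.trans (hK i j)
  have hK0 : 0 ≤ K := (norm_nonneg _).trans (hK 0 0)
  have du : DifferentiableAt ℝ D.u p := (D.contDiffAt_u (n := 1) hm hpn.le).differentiableAt (by simp)
  have dar : DifferentiableAt ℝ D.ar p :=
    (D.contDiffAt_ar (n := 1) hm hpn.le).differentiableAt (by simp)
  have daz : DifferentiableAt ℝ D.az p :=
    (D.contDiffAt_az (n := 1) hm hpn.le).differentiableAt (by simp)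
  have dfst : DifferentiableAt ℝ (Prod.fst : ℝ × ℝ → ℝ) p := differentiableAt_fst
  have dk : ∀ k : ℝ, DifferentiableAt ℝ (fun _ : ℝ × ℝ => k) p := fun k => differentiableAt_const k
  have dE : DifferentiableAt ℝ (fun q => Real.exp (-2 * D.u q)) p := ((dk _).fun_mul du).exp
  have hE : ∀ m, dh m (fun q => Real.exp (-2 * D.u q)) p
      = -2 * Real.exp (-2 * D.u p) * dh m D.u p := by
    intro m
    rw [dh_exp m ((dk (-2)).fun_mul du), dh_mul m (dk (-2)) du, dh_const]; ring
  set E := Real.exp (-2 * D.u p) with hEdef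
  have hEpos : 0 < E := Real.exp_pos _
  have hEinv : Real.exp (2 * D.u p) * E = 1 := by
    rw [hEdef, ← Real.exp_add]; simp
  have hEp := Real.exp_pos (2 * D.u p)
  -- a bound for quadratic expressions in `c, s`
  have hc1 : |c| ≤ 1 := abs_le_one_iff_mul_self_le_one.mpr (by nlinarith [sq_nonneg s])
  have hs1 : |s| ≤ 1 := abs_le_one_iff_mul_self_le_one.mpr (by nlinarith [sq_nonneg c])
  have lin : ∀ {k y : ℝ}, |k| ≤ 1 → |y| ≤ K → |k * y| ≤ K := by
    intro k y hk hy
    rw [abs_mul]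
    calc |k| * |y| ≤ 1 * K := by gcongr
      _ = K := one_mul K
  have cc : |c * c| ≤ 1 := by rw [abs_mul]; exact mul_le_one₀ hc1 (abs_nonneg _) hc1
  have ss : |s * s| ≤ 1 := by rw [abs_mul]; exact mul_le_one₀ hs1 (abs_nonneg _) hs1
  have cs : |c * s| ≤ 1 := by rw [abs_mul]; exact mul_le_one₀ hc1 (abs_nonneg _) hs1
  -- the component along `∂_φ, ∂_φ`
  have J1 : (fun q => Real.exp (-2 * D.u q)) =ᶠ[𝓝 p] fun q =>
      (s * s) * D.g (meridian c s q) 0 0 - 2 * (c * s) * D.g (meridian c s q) 0 1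
        + (c * c) * D.g (meridian c s q) 1 1 := by
    filter_upwards [hev] with q hq
    simp only [D.g_meridian hm hcs hq.1 hq.2.le]
    simp [dZ, -neg_mul]
    linear_combination (-Real.exp (-2 * D.u q)) * hcs
  -- On a meridian half-plane the Euclidean orthonormal frame `e_ρ = (c, s, 0)`, `e_φ = (-s, c, 0)`,
  -- `e_z` is constant. The functions `ρe^{-2u}A_ρ = g(e_ρ, e_φ)` and `ρe^{-2u}A_z = g(e_φ, e_z)`
  -- are thus combinations of the `g_ij` with constant coefficients.
  have J4 : (fun q => q.1 * (Real.exp (-2 * D.u q) * D.ar q)) =ᶠ[𝓝 p] fun q =>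
      (c * s) * (D.g (meridian c s q) 1 1 - D.g (meridian c s q) 0 0)
        + (c * c - s * s) * D.g (meridian c s q) 0 1 := by
    filter_upwards [hev] with q hq
    simp only [D.g_meridian hm hcs hq.1 hq.2.le]
    simp [dZ, -neg_mul]
    linear_combination (-(c ^ 2 + s ^ 2 + 1) * q.1 * Real.exp (-2 * D.u q) * D.ar q) * hcs
  have J2 : (fun q => q.1 * (Real.exp (-2 * D.u q) * D.az q)) =ᶠ[𝓝 p] fun q =>
      c * D.g (meridian c s q) 1 2 - s * D.g (meridian c s q) 0 2 := by
    filter_upwards [hev] with q hq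
    simp only [D.g_meridian hm hcs hq.1 hq.2.le]
    simp [dZ, -neg_mul]
    linear_combination (-q.1 * Real.exp (-2 * D.u q) * D.az q) * hcs
  have R1 : ∀ m, |2 * E * dh m D.u p| ≤ 4 * K := by
    intro m
    have h := dh_congr m J1
    rw [hE, dh_add m (((dk _).fun_mul (hgm 0 0)).fun_sub ((dk _).fun_mul (hgm 0 1)))
      ((dk _).fun_mul (hgm 1 1)), dh_sub m ((dk _).fun_mul (hgm 0 0)) ((dk _).fun_mul (hgm 0 1)),
      dh_mul m (dk _) (hgm 0 0), dh_mul m (dk _) (hgm 0 1), dh_mul m (dk _) (hgm 1 1),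
      dh_const, dh_const, dh_const] at h
    have b1 := abs_le.mp (lin ss (hbd 0 0 m))
    have b2 := abs_le.mp (lin cs (hbd 0 1 m))
    have b3 := abs_le.mp (lin cc (hbd 1 1 m))
    rw [abs_le]
    constructor <;> linarith
  have hU : ∀ m, |dh m D.u p| ≤ 2 * Real.exp (2 * D.u p) * K := by
    intro m
    have h := R1 m
    have e : dh m D.u p = Real.exp (2 * D.u p) / 2 * (2 * E * dh m D.u p) := by
      linear_combination (-dh m D.u p) * hEinv
    rw [e, abs_mul, abs_of_pos (by positivity)]
    calc _ ≤ Real.exp (2 * D.u p) / 2 * (4 * K) := by gcongr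
      _ = _ := by ring
  have X4 : |rho x * E * (dh 1 D.ar p - 2 * dh 1 D.u p * D.ar p)| ≤ 4 * K := by
    have h := dh_congr 1 J4
    rw [dh_mul (f := Prod.fst) 1 dfst (dE.fun_mul dar), dh_mul 1 dE dar, hE, dh_one_fst,
      dh_add 1 ((dk _).fun_mul ((hgm 1 1).fun_sub (hgm 0 0))) ((dk _).fun_mul (hgm 0 1)),
      dh_mul 1 (dk _) ((hgm 1 1).fun_sub (hgm 0 0)), dh_mul 1 (dk _) (hgm 0 1),
      dh_sub 1 (hgm 1 1) (hgm 0 0), dh_const, dh_const, hp1] at h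
    have b1 := abs_le.mp (lin cs (hbd 0 0 1))
    have b2 := abs_le.mp (lin cs (hbd 1 1 1))
    have b3 := abs_le.mp (lin cc (hbd 0 1 1))
    have b4 := abs_le.mp (lin ss (hbd 0 1 1))
    rw [abs_le]
    constructor <;> linarith
  -- Differentiating the factor `ρ` leaves the term `e^{-2u}A_z` without a derivative; it needs a
  -- separate bound by `K`.
  have X2 : |E * D.az p + rho x * E * (dh 0 D.az p - 2 * dh 0 D.u p * D.az p)| ≤ 2 * K := by
    have h := dh_congr 0 J2
    rw [dh_mul (f := Prod.fst) 0 dfst (dE.fun_mul daz), dh_mul 0 dE daz, hE, dh_fst,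
      dh_sub 0 ((dk _).fun_mul (hgm 1 2)) ((dk _).fun_mul (hgm 0 2)),
      dh_mul 0 (dk _) (hgm 1 2), dh_mul 0 (dk _) (hgm 0 2), dh_const, dh_const, hp1] at h
    have b1 := abs_le.mp (lin hc1 (hbd 1 2 0))
    have b2 := abs_le.mp (lin hs1 (hbd 0 2 0))
    rw [abs_le]
    constructor <;> linarith
  -- rotation
  have X3 : |E * D.az p| ≤ 2 * K := by
    -- The function `ρ g(e_ρ, e_z)` is axisymmetric, so its derivative along `∂_φ` vanishes. The
    -- product rule then expresses `ρ g(e_φ, e_z) = ρ²e^{-2u}A_z` through derivatives of the `g_ij`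
    -- along a field of length `ρ`, which gives the bound on `e^{-2u}A_z`.
    have hQ : (fun y : E3 => y 0 * D.g y 0 2 + y 1 * D.g y 1 2) =ᶠ[𝓝 x]
        fun y => (fun q : ℝ × ℝ => q.1 ^ 3 * (Real.exp (-2 * D.u q) * (D.ar q * D.az q))) (cyl y) := by
      filter_upwards [(isOpen_lt_norm _).mem_nhds hx, isOpen_rho_pos.mem_nhds hρ] with y h1 h2
      have h1' : m₁ / 2 < ‖y‖ := h1
      have h2' : 0 < rho y := h2
      have hU := D.U_eq h1'.le
      have hA := D.Aρ_eq h1'.le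
      have hz := D.Az_eq h1'.le
      have hr := rho_sq y
      rw [Aρ] at hA
      have e1 : (cyl y).1 = rho y := rfl
      simp only [D.g_apply (le_of_lt h1) h2', e1]
      rw [← hU, ← hA, ← hz]
      simp [dRho, dZ, rotField, meridianForm, -neg_mul]
      linear_combination (-Real.exp (-2 * D.U y) * rho y ^ 2 * D.a y * D.Az y) * hr
    have dc : ∀ i, DifferentiableAt ℝ (fun y : E3 => y i) x := fun i =>
      (contDiffAt_coord i x (n := 1)).differentiableAt (by simp)
    have h0 := fderiv_comp_cyl_rotField (f := fun q : ℝ × ℝ =>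
      q.1 ^ 3 * (Real.exp (-2 * D.u q) * (D.ar q * D.az q))) hρ
      ((dfst.fun_pow 3).fun_mul (dE.fun_mul (dar.fun_mul daz)))
    rw [← hQ.fderiv_eq, fderiv_fun_add ((dc 0).fun_mul (hgd 0 2)) ((dc 1).fun_mul (hgd 1 2)),
      fderiv_fun_mul (dc 0) (hgd 0 2), fderiv_fun_mul (dc 1) (hgd 1 2)] at h0
    have hco : ∀ i (v : E3), fderiv ℝ (fun y : E3 => y i) x v = v i := fun i v => by
      have : (fun y : E3 => y i) = ⇑(EuclideanSpace.proj i : E3 →L[ℝ] ℝ) := rfl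
      rw [this, ContinuousLinearMap.fderiv]; rfl
    simp only [add_apply, smul_apply, smul_eq_mul, hco] at h0
    have hw : ∀ i j, |fderiv ℝ (fun y => D.g y i j) x (WithLp.toLp 2 (rotField x))| ≤ K * rho x := by
      intro i j
      refine ((fderiv ℝ (fun y => D.g y i j) x).le_opNorm _).trans ?_
      rw [norm_rotField]
      gcongr
      exact hK i j
    have hJ := J2.self_of_nhds
    simp only [hTp, hp1] at hJ
    have e0 : x 0 = rho x * c := by rw [hc]; field_simp
    have e1 : x 1 = rho x * s := by rw [hs]; field_simp
    have r0 : rotField x 0 = -x 1 := rfl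
    have r1 : rotField x 1 = x 0 := rfl
    rw [r0, r1, e0, e1] at h0
    set d0 := fderiv ℝ (fun y => D.g y 0 2) x (WithLp.toLp 2 (rotField x)) with hd0
    set d1 := fderiv ℝ (fun y => D.g y 1 2) x (WithLp.toLp 2 (rotField x)) with hd1
    have hkey : rho x * (E * D.az p) = -(c * d0 + s * d1) := by
      have : rho x * (rho x * (E * D.az p) + (c * d0 + s * d1)) = 0 := by
        rw [hJ]; linear_combination h0
      have := (mul_eq_zero.mp this).resolve_left hne
      linarith
    have : rho x * |E * D.az p| ≤ rho x * (2 * K) := by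
      rw [← abs_of_pos hρ, ← abs_mul, hkey, abs_neg, abs_of_pos hρ]
      refine (abs_add_le _ _).trans ?_
      rw [abs_mul, abs_mul]
      have t1 : |c| * |d0| ≤ 1 * (K * rho x) := by gcongr; exact hw 0 2
      have t2 : |s| * |d1| ≤ 1 * (K * rho x) := by gcongr; exact hw 1 2
      linarith
    exact le_of_mul_le_mul_left this hρ
  refine ⟨hU 0, hU 1, ?_⟩
  -- The curl of `A` is assembled from the three bounded quantities; the products of `A` with `∇u`
  -- that are left over use the bound on `∇u`.
  have e : rho x * E * (dh 1 D.ar p - dh 0 D.az p)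
      = rho x * E * (dh 1 D.ar p - 2 * dh 1 D.u p * D.ar p)
        - (E * D.az p + rho x * E * (dh 0 D.az p - 2 * dh 0 D.u p * D.az p)) + E * D.az p
        + rho x * ((2 * E * dh 1 D.u p) * D.ar p - (2 * E * dh 0 D.u p) * D.az p) := by ring
  have hfin : |rho x * E * (dh 1 D.ar p - dh 0 D.az p)|
      ≤ K * (8 + 4 * (rho x * |D.ar p| + rho x * |D.az p|)) := by
    rw [e]
    have t1 : |rho x * ((2 * E * dh 1 D.u p) * D.ar p - (2 * E * dh 0 D.u p) * D.az p)|
        ≤ rho x * (4 * K * |D.ar p| + 4 * K * |D.az p|) := by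
      rw [abs_mul, abs_of_pos hρ]
      gcongr
      refine (abs_sub _ _).trans ?_
      rw [abs_mul, abs_mul (2 * E * dh 0 D.u p)]
      gcongr
      · exact R1 1
      · exact R1 0
    have b1 := abs_le.mp X4
    have b2 := abs_le.mp X2
    have b3 := abs_le.mp X3
    have b4 := abs_le.mp t1
    have e3 : K * (8 + 4 * (rho x * |D.ar p| + rho x * |D.az p|))
        = 8 * K + rho x * (4 * K * |D.ar p| + 4 * K * |D.az p|) := by ring
    rw [abs_le, e3]
    constructor <;> linarith
  have e2 : rho x * |dh 1 D.ar p - dh 0 D.az p|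
      = Real.exp (2 * D.u p) * |rho x * E * (dh 1 D.ar p - dh 0 D.az p)| := by
    rw [abs_mul, abs_of_pos (by positivity : 0 < rho x * E)]
    linear_combination (-rho x * |dh 1 D.ar p - dh 0 D.az p|) * hEinv
  rw [e2, mul_assoc (Real.exp (2 * D.u p)) K]
  gcongr

/-- For integrability the divergence form is undone: the scalar curvature is in `L¹`, and the other
two terms are squares of quantities controlled by `∂g ∈ L²`. -/
lemma massDensity_exterior (hm : 0 < m₁) {x : E3} (hx : m₁ / 2 < ‖x‖) (hρ : 0 < rho x) :
    D.massDensity x = 2 * Real.exp (-2 * D.u (cyl x) + 2 * D.al (cyl x)) * scalarCurvature D.g x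
      + 4 * (dh 0 D.u (cyl x) ^ 2 + dh 1 D.u (cyl x) ^ 2)
      + Real.exp (-2 * D.al (cyl x))
        * (rho x * |dh 1 D.ar (cyl x) - dh 0 D.az (cyl x)|) ^ 2 := by
  have hp : (m₁ / 2) ^ 2 ≤ (cyl x).1 ^ 2 + (cyl x).2 ^ 2 := by
    have h := norm_sq_eq_rho x
    change _ ≤ rho x ^ 2 + x 2 ^ 2
    rw [← h]; gcongr
  have hev : ∀ᶠ y in 𝓝 x, D.g y = brillForm (fun y => D.u (cyl y)) (fun y => D.al (cyl y))
      (fun y => D.ar (cyl y)) (fun y => D.az (cyl y)) y := by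
    filter_upwards [(isOpen_lt_norm _).mem_nhds hx, isOpen_rho_pos.mem_nhds hρ] with y h1 h2
    exact D.g_eq_brillForm (le_of_lt h1) h2
  rw [D.massDensity_of_lt hm hx hρ, scalarCurvature_brillForm hρ (D.contDiffAt_u hm hp)
    (D.contDiffAt_al hm hp) (D.contDiffAt_ar hm hp) (D.contDiffAt_az hm hp) hev, brillDensity,
    mul_pow, sq_abs]
  have : (cyl x).1 = rho x := rfl
  rw [this]; ring

lemma rho_le_norm (x : E3) : rho x ≤ ‖x‖ := by
  refine (sq_le_sq₀ (rho_nonneg x) (norm_nonneg x)).mp ?_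
  rw [norm_sq_eq_rho]; nlinarith [sq_nonneg (x 2)]

/-- All four quantities are `O(r^{-1/2})`: from `ρ ≤ r` one has `ρA_ρ = ρ²a = O(r² r^{-5/2})` and
`ρA_z = O(r r^{-3/2})`. -/
lemma exists_coefficient_bound (hm : 0 < m₁) (hℓ : 5 ≤ ℓ) : ∃ C, 0 ≤ C ∧ ∀ x ∈ exterior m₁,
    |D.U x| ≤ C ∧ |D.α x| ≤ C ∧ rho x * |D.Aρ x| ≤ C ∧ rho x * |D.Az x| ≤ C := by
  obtain ⟨C₁, h₁, hU⟩ := D.U_smooth.exists_bound hm (by omega) D.U_falloff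
  obtain ⟨C₂, h₂, hα⟩ := D.α_smooth.exists_bound hm (by omega) D.α_falloff
  obtain ⟨C₃, h₃, ha⟩ := D.a_smooth.exists_bound hm (by omega) D.a_falloff
  obtain ⟨C₄, h₄, hz⟩ := D.Az_smooth.exists_bound hm (by omega) D.Az_falloff
  have hc : 0 < m₁ / 2 := by positivity
  set M := (m₁ / 2) ^ (-1 / 2 : ℝ) with hM
  have hM0 : 0 ≤ M := by positivity
  refine ⟨(C₁ + C₂ + C₃ + C₄) * M, by positivity, fun x hx => ?_⟩
  have hxp : 0 < ‖x‖ := lt_of_lt_of_le hc hx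
  have hmono : ‖x‖ ^ (-1 / 2 : ℝ) ≤ M := rpow_le_of_nonpos hc hx (by norm_num)
  have e1 : ‖x‖ * ‖x‖ ^ (-3 / 2 : ℝ) = ‖x‖ ^ (-1 / 2 : ℝ) := by
    rw [← Real.rpow_one_add' hxp.le (by norm_num)]; norm_num
  have e2 : ‖x‖ * (‖x‖ * ‖x‖ ^ (-5 / 2 : ℝ)) = ‖x‖ ^ (-1 / 2 : ℝ) := by
    rw [← Real.rpow_one_add' hxp.le (by norm_num), ← Real.rpow_one_add' hxp.le (by norm_num)]
    norm_num
  have hr := rho_le_norm x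
  have hr0 := rho_nonneg x
  have w : ∀ {K : ℝ}, K ≤ C₁ + C₂ + C₃ + C₄ → K * ‖x‖ ^ (-1 / 2 : ℝ) ≤ (C₁ + C₂ + C₃ + C₄) * M :=
    fun hK => mul_le_mul hK hmono (by positivity) (by positivity)
  refine ⟨(hU x hx).1.trans (w (by linarith)), (hα x hx).1.trans (w (by linarith)), ?_, ?_⟩
  · rw [Aρ, abs_mul, abs_of_nonneg hr0]
    refine le_trans ?_ (w (K := C₃) (by linarith))
    calc rho x * (rho x * |D.a x|) ≤ ‖x‖ * (‖x‖ * (C₃ * ‖x‖ ^ (-5 / 2 : ℝ))) := by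
          gcongr; exact (ha x hx).1
      _ = C₃ * (‖x‖ * (‖x‖ * ‖x‖ ^ (-5 / 2 : ℝ))) := by ring
      _ = _ := by rw [e2]
  · refine le_trans ?_ (w (K := C₄) (by linarith))
    calc rho x * |D.Az x| ≤ ‖x‖ * (C₄ * ‖x‖ ^ (-3 / 2 : ℝ)) := by
          gcongr; exact (hz x hx).1
      _ = C₄ * (‖x‖ * ‖x‖ ^ (-3 / 2 : ℝ)) := by ring
      _ = _ := by rw [e1]

/-- The mass density is integrable outside the minimal sphere. -/
theorem integrableOn_massDensity (hm : 0 < m₁) (hℓ : 5 ≤ ℓ) :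
    IntegrableOn D.massDensity {x | m₁ / 2 < ‖x‖} := by
  obtain ⟨C, hC0, hC⟩ := D.exists_coefficient_bound hm hℓ
  set K : E3 → ℝ := fun x => ∑ i, ∑ j, ‖fderiv ℝ (fun y => D.g y i j) x‖ with hK
  have hKL : MemLp K 2 (volume.restrict {x | m₁ / 2 < ‖x‖}) :=
    memLp_finsetSum _ fun i _ => memLp_finsetSum _ fun j _ => (D.deriv_L2 i j).norm
  have hK2 : IntegrableOn (fun x => K x ^ 2) {x | m₁ / 2 < ‖x‖} := hKL.integrable_sq
  -- The factor `e^{4C}` bounds `e^{-2u+2α}`. The coefficient of `K²` collects the squared bounds of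
  -- `deriv_bounds`: two derivatives of `u`, then the curl term with its weight `e^{-2α} ≤ e^{2C}`.
  have hdom := (D.scalar_L1.norm.const_mul (2 * Real.exp (4 * C))).add
    (hK2.const_mul (4 * (2 * (2 * Real.exp (2 * C)) ^ 2)
      + Real.exp (2 * C) * (Real.exp (2 * C) * (8 + 4 * (C + C))) ^ 2))
  have hmeas : AEStronglyMeasurable D.massDensity (volume.restrict {x | m₁ / 2 < ‖x‖}) :=
    AEStronglyMeasurable.restrict ((D.measurable_meridianDensity.comp
      measurable_cyl).aestronglyMeasurable.congr (D.massDensity_ae_eq hm).symm)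
  refine hdom.mono' hmeas ?_
  filter_upwards [ae_restrict_mem (isOpen_lt_norm (m₁ / 2)).measurableSet,
    ae_restrict_of_ae ae_rho_pos] with x hx hρ
  have hx' : m₁ / 2 < ‖x‖ := hx
  obtain ⟨b1, b2, b3, b4⟩ := hC x hx'.le
  rw [D.U_eq hx'.le] at b1
  rw [D.α_eq hx'.le] at b2
  rw [D.Aρ_eq hx'.le] at b3
  rw [D.Az_eq hx'.le] at b4
  have hKx : ∀ i j, ‖fderiv ℝ (fun y => D.g y i j) x‖ ≤ K x := fun i j =>
    (Finset.single_le_sum (f := fun j => ‖fderiv ℝ (fun y => D.g y i j) x‖)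
      (fun _ _ => norm_nonneg _) (Finset.mem_univ j)).trans
      (Finset.single_le_sum (f := fun i => ∑ j, ‖fderiv ℝ (fun y => D.g y i j) x‖)
        (fun _ _ => Finset.sum_nonneg fun _ _ => norm_nonneg _) (Finset.mem_univ i))
  have hK0 : 0 ≤ K x := (norm_nonneg _).trans (hKx 0 0)
  obtain ⟨d0, d1, d2⟩ := D.deriv_bounds hm hx' hρ hKx
  have a1 := abs_le.mp b1
  have a2 := abs_le.mp b2
  have E1 : Real.exp (2 * D.u (cyl x)) ≤ Real.exp (2 * C) := Real.exp_le_exp.mpr (by linarith)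
  have E2 : Real.exp (-2 * D.al (cyl x)) ≤ Real.exp (2 * C) := Real.exp_le_exp.mpr (by linarith)
  have E3 : Real.exp (-2 * D.u (cyl x) + 2 * D.al (cyl x)) ≤ Real.exp (4 * C) :=
    Real.exp_le_exp.mpr (by linarith)
  have s0 : dh 0 D.u (cyl x) ^ 2 ≤ (2 * Real.exp (2 * C)) ^ 2 * K x ^ 2 := by
    rw [← sq_abs, ← mul_pow]
    gcongr
    exact d0.trans (by gcongr)
  have s1 : dh 1 D.u (cyl x) ^ 2 ≤ (2 * Real.exp (2 * C)) ^ 2 * K x ^ 2 := by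
    rw [← sq_abs, ← mul_pow]
    gcongr
    exact d1.trans (by gcongr)
  have s2 : (rho x * |dh 1 D.ar (cyl x) - dh 0 D.az (cyl x)|) ^ 2
      ≤ (Real.exp (2 * C) * (8 + 4 * (C + C))) ^ 2 * K x ^ 2 := by
    rw [← mul_pow]
    refine pow_le_pow_left₀ (by positivity) (d2.trans ?_) 2
    calc _ ≤ Real.exp (2 * C) * K x * (8 + 4 * (C + C)) := by gcongr
      _ = _ := by ring
  rw [D.massDensity_exterior hm hx' hρ, Real.norm_eq_abs]
  refine (abs_add_le _ _).trans ((add_le_add_left (abs_add_le _ _) _).trans ?_)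
  rw [abs_mul, abs_of_pos (by positivity : 0 < 2 * Real.exp (-2 * D.u (cyl x) + 2 * D.al (cyl x))),
    abs_of_nonneg (by positivity : 0 ≤ 4 * (dh 0 D.u (cyl x) ^ 2 + dh 1 D.u (cyl x) ^ 2)),
    abs_of_nonneg (by positivity : 0 ≤ Real.exp (-2 * D.al (cyl x))
        * (rho x * |dh 1 D.ar (cyl x) - dh 0 D.az (cyl x)|) ^ 2)]
  have t1 : 2 * Real.exp (-2 * D.u (cyl x) + 2 * D.al (cyl x)) * |scalarCurvature D.g x|
      ≤ 2 * Real.exp (4 * C) * |scalarCurvature D.g x| := by gcongr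
  have t2 : Real.exp (-2 * D.al (cyl x))
        * (rho x * |dh 1 D.ar (cyl x) - dh 0 D.az (cyl x)|) ^ 2
      ≤ Real.exp (2 * C) * ((Real.exp (2 * C) * (8 + 4 * (C + C))) ^ 2 * K x ^ 2) := by gcongr
  change _ ≤ 2 * Real.exp (4 * C) * |scalarCurvature D.g x| + (4 * (2 * (2 * Real.exp (2 * C)) ^ 2)
      + Real.exp (2 * C) * (Real.exp (2 * C) * (8 + 4 * (C + C))) ^ 2) * K x ^ 2
  linarith

end PseudosphericalData

/-! ### Minimality of the boundary sphere -/

lemma differentiableAt_norm_E3 {x : E3} (hx : x ≠ 0) : DifferentiableAt ℝ (fun y : E3 => ‖y‖) x :=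
  (contDiffAt_norm ℝ hx (n := 1)).differentiableAt (by simp)

lemma pd_norm {x : E3} (hx : x ≠ 0) (i : Fin 3) : pd i (fun y : E3 => ‖y‖) x = x i / ‖x‖ := by
  have hn : ‖x‖ ≠ 0 := norm_ne_zero_iff.mpr hx
  have h1 := pd_sq i (differentiableAt_norm_E3 hx)
  have hc : ∀ j, DifferentiableAt ℝ (fun y : E3 => y j) x := fun j =>
    (contDiffAt_coord j x (n := 1)).differentiableAt (by simp)
  have h2 : pd i (fun y : E3 => ‖y‖ ^ 2) x = 2 * x i := by
    simp only [norm_sq_eq_coords]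
    rw [pd_add i (((hc 0).fun_pow 2).fun_add ((hc 1).fun_pow 2)) ((hc 2).fun_pow 2),
      pd_add i ((hc 0).fun_pow 2) ((hc 1).fun_pow 2), pd_sq i (hc 0), pd_sq i (hc 1),
      pd_sq i (hc 2), pd_coord, pd_coord, pd_coord]
    simp only [Matrix.one_apply]
    fin_cases i <;> simp
  rw [h2] at h1
  field_simp
  linarith

lemma DiffM.det {M : Field3} {x : E3} (hM : DiffM M x) : DifferentiableAt ℝ (fun y => (M y).det) x := by
  simp only [Matrix.det_fin_three]
  have m3 : ∀ a b c d e f : Fin 3, DifferentiableAt ℝ (fun y => M y a b * M y c d * M y e f) x :=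
    fun a b c d e f => ((hM a b).fun_mul (hM c d)).fun_mul (hM e f)
  exact ((((((m3 _ _ _ _ _ _).fun_sub (m3 _ _ _ _ _ _)).fun_sub (m3 _ _ _ _ _ _)).fun_add
    (m3 _ _ _ _ _ _)).fun_add (m3 _ _ _ _ _ _)).fun_sub (m3 _ _ _ _ _ _))

lemma DiffM.inv {M : Field3} {x : E3} (hM : DiffM M x) (hdet : (M x).det ≠ 0) :
    DiffM (fun y => (M y)⁻¹) x := by
  intro i j
  have hadj : DifferentiableAt ℝ (fun y => (M y).adjugate i j) x := by
    simp only [Matrix.adjugate_apply]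
    refine DiffM.det (M := fun y => (M y).updateRow j (Pi.single i 1)) fun k l => ?_
    by_cases hk : k = j
    · subst hk
      simp only [Matrix.updateRow_self]
      exact differentiableAt_const _
    · simp only [Matrix.updateRow_ne hk]
      exact hM k l
  have e : (fun y => (M y)⁻¹ i j) = fun y => ((M y).det)⁻¹ * (M y).adjugate i j := by
    funext y
    rw [Matrix.inv_def, Matrix.smul_apply, Ring.inverse_eq_inv', smul_eq_mul]
  rw [e]
  exact (hM.det.fun_inv hdet).fun_mul hadj

/-- The exterior contains the half-space beyond the tangent plane at `x`, which is convex with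
nonempty interior. This lets an identity known only on the closed exterior determine full
derivatives at the boundary. -/
lemma uniqueDiffWithinAt_exterior {m₁ : ℝ} (hm : 0 < m₁) {x : E3} (hx : ‖x‖ = m₁ / 2) :
    UniqueDiffWithinAt ℝ (exterior m₁) x := by
  set H : Set E3 := {y | ‖x‖ ^ 2 ≤ inner ℝ x y} with hH
  have hx0 : 0 < ‖x‖ := by rw [hx]; positivity
  have hsub : H ⊆ exterior m₁ := by
    intro y hy
    have h1 : ‖x‖ ^ 2 ≤ inner ℝ x y := hy
    have h2 := h1.trans (real_inner_le_norm x y)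
    change m₁ / 2 ≤ ‖y‖
    rw [← hx]
    nlinarith
  refine UniqueDiffWithinAt.mono (uniqueDiffWithinAt_convex (s := H) ?_ ?_ ?_) hsub
  · exact convex_halfSpace_ge (innerₛₗ ℝ x).isLinear _
  · refine ⟨(2 : ℝ) • x, ?_⟩
    refine mem_interior.mpr ⟨{y | ‖x‖ ^ 2 < inner ℝ x y}, fun y hy => ?_,
      isOpen_lt continuous_const (by fun_prop), ?_⟩
    · exact le_of_lt (show ‖x‖ ^ 2 < inner ℝ x y from hy)
    · change ‖x‖ ^ 2 < inner ℝ x ((2 : ℝ) • x)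
      rw [inner_smul_right, real_inner_self_eq_norm_sq]
      nlinarith
  · refine subset_closure ?_
    change ‖x‖ ^ 2 ≤ inner ℝ x x
    rw [real_inner_self_eq_norm_sq]

/-- In the coframe `dρ, dz, dφ` the form `A` enters by a unipotent change of basis, so it does not
affect the determinant; the factor `ρ²` is cancelled by the determinant `-1/ρ` of the coframe. -/
lemma det_brillForm {U α Aρ Az : E3 → ℝ} {x : E3} (hρ : 0 < rho x) :
    (brillForm U α Aρ Az x).det = Real.exp (-3 * U x + 2 * α x) ^ 2 := by
  set E₁ := Real.exp (-2 * U x + 2 * α x) with hE₁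
  set F := rho x ^ 2 * Real.exp (-2 * U x) with hF
  have e : brillForm U α Aρ Az x = (cylCoframe x)ᵀ *
      !![E₁ + F * Aρ x ^ 2, F * (Aρ x * Az x), F * Aρ x;
        F * (Aρ x * Az x), E₁ + F * Az x ^ 2, F * Az x; F * Aρ x, F * Az x, F] * cylCoframe x := by
    ext i j
    simp only [brillForm, ← hE₁, ← hF, Matrix.add_apply, Matrix.smul_apply, Matrix.vecMulVec_apply,
      smul_eq_mul, Pi.add_apply, Pi.smul_apply, Matrix.mul_apply, Fin.sum_univ_three,
      Matrix.transpose_apply, cylCoframe, Matrix.of_apply, Matrix.cons_val_zero,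
      Matrix.cons_val_one, Matrix.cons_val]
    ring
  have hC : (cylCoframe x).det = -(rho x)⁻¹ := by
    have := rho_sq x
    simp [Matrix.det_fin_three, cylCoframe, dRho, dZ, dPhi]
    field_simp
    linarith
  have hexp : E₁ ^ 2 * Real.exp (-2 * U x) = Real.exp (-3 * U x + 2 * α x) ^ 2 := by
    rw [hE₁, ← Real.exp_nat_mul, ← Real.exp_nat_mul, ← Real.exp_add]
    congr 1; push_cast; ring
  rw [e, Matrix.det_mul, Matrix.det_mul, Matrix.det_transpose, hC, ← hexp, Matrix.det_fin_three]
  simp only [Matrix.of_apply, Matrix.cons_val', Matrix.cons_val_zero, Matrix.cons_val_one,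
    Matrix.cons_val, Matrix.cons_val_fin_one, hF]
  field_simp
  ring

/-- The gradient direction of `|y|` for a Brill metric. -/
lemma brillForm_mulVec {U α Aρ Az : E3 → ℝ} {x : E3} (hρ : 0 < rho x) :
    brillForm U α Aρ Az x *ᵥ (fun i => x i / ‖x‖
        - (rho x * Aρ x + x 2 * Az x) / ‖x‖ * rotField x i)
      = Real.exp (-2 * U x + 2 * α x) • fun i => x i / ‖x‖ := by
  have h2 := rho_sq x
  have hn : ‖x‖ ≠ 0 := norm_ne_zero_iff.mpr (ne_zero_of_rho_pos hρ)
  have hne := hρ.ne'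
  set X : Fin 3 → ℝ := fun i => x i / ‖x‖
        - (rho x * Aρ x + x 2 * Az x) / ‖x‖ * rotField x i with hX
  have d0 : dRho x ⬝ᵥ X = rho x / ‖x‖ := by
    simp [dotProduct, Fin.sum_univ_three, dRho, hX, rotField]
    field_simp
    linear_combination -h2
  have d1 : dZ ⬝ᵥ X = x 2 / ‖x‖ := by
    simp [dotProduct, Fin.sum_univ_three, dZ, hX, rotField]
  have d2 : dPhi x ⬝ᵥ X = -((rho x * Aρ x + x 2 * Az x) / ‖x‖) := by
    simp [dotProduct, Fin.sum_univ_three, dPhi, hX, rotField]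
    field_simp
    linear_combination (rho x * Aρ x + x 2 * Az x) * h2
  rw [brillForm, Matrix.add_mulVec, Matrix.smul_mulVec, Matrix.smul_mulVec, Matrix.add_mulVec,
    Matrix.vecMulVec_mulVec, Matrix.vecMulVec_mulVec, Matrix.vecMulVec_mulVec, add_dotProduct,
    add_dotProduct, smul_dotProduct, smul_dotProduct, d0, d1, d2]
  ext i
  have hz : -((rho x * Aρ x + x 2 * Az x) / ‖x‖) + Aρ x • (rho x / ‖x‖) + Az x • (x 2 / ‖x‖) = 0 := by
    simp only [smul_eq_mul]; field_simp; ring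
  rw [hz]
  fin_cases i <;> simp [dRho, dZ] <;> field_simp

lemma fderiv_comp_cyl_radial {f : ℝ × ℝ → ℝ} {x : E3} (hx : 0 < rho x)
    (hf : DifferentiableAt ℝ f (cyl x)) :
    fderiv ℝ (fun y => f (cyl y)) x x = rho x * dh 0 f (cyl x) + x 2 * dh 1 f (cyl x) := by
  have h2 := rho_sq x
  rw [fderiv_eq_sum_pd]
  simp only [pd_comp_cyl hx hf, Fin.sum_univ_three, dh_two]
  simp [cylCoframe, dRho, dZ]
  field_simp
  linear_combination (-dh 0 f (cyl x)) * h2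

lemma dh_zero_comp_logPolar {f : ℝ × ℝ → ℝ} {q : ℝ × ℝ} (hf : DifferentiableAt ℝ f (logPolar q)) :
    dh 0 (fun q => f (logPolar q)) q
      = (logPolar q).1 * dh 0 f (logPolar q) + (logPolar q).2 * dh 1 f (logPolar q) := by
  rw [dh_comp_logPolar hf, dh_logPolar_fst, dh_logPolar_snd]; rfl

/-! ### Minimality of the boundary as an equation for `U` and `α`. -/

namespace PseudosphericalData

variable {m₁ : ℝ} {ℓ : ℕ} (D : PseudosphericalData m₁ ℓ)

/-- The function `e^{-2u+α}`. -/
def areaWeight (p : ℝ × ℝ) : ℝ := Real.exp (-2 * D.u p + D.al p)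

/-- The rotational component of the normal field. -/
def normalShift (p : ℝ × ℝ) : ℝ :=
  D.areaWeight p * ((p.1 * D.ar p + p.2 * D.az p) * (Real.sqrt (p.1 ^ 2 + p.2 ^ 2))⁻¹)

/-- `(det g)^{1/2}` times the unit normal of the coordinate spheres, and its non-vanishing
denominator. -/
lemma normal_density {x : E3} (hx : x ∈ exterior m₁) (hρ : 0 < rho x) (i : Fin 3) :
    gradLength D.g (fun y => ‖y‖) x ≠ 0 ∧
    Real.sqrt (D.g x).det * (∑ j, (D.g x)⁻¹ i j * pd j (fun y => ‖y‖) x)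
        / gradLength D.g (fun y => ‖y‖) x
      = D.areaWeight (cyl x) * ‖x‖⁻¹ * x i - D.normalShift (cyl x) * rotField x i := by
  have hx0 := ne_zero_of_rho_pos hρ
  have hn : ‖x‖ ≠ 0 := norm_ne_zero_iff.mpr hx0
  have hg := D.g_eq_brillForm hx hρ
  set u := D.u (cyl x) with hu
  set al := D.al (cyl x) with hal
  -- The radial vector, corrected by a multiple of `∂_φ` so that `dφ + A` annihilates it; lowering
  -- its index with `g` then gives a multiple of `dr`, so it has the direction of the normal.
  set X : Fin 3 → ℝ := fun i => x i / ‖x‖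
        - (rho x * D.ar (cyl x) + x 2 * D.az (cyl x)) / ‖x‖ * rotField x i with hX
  have hmv : D.g x *ᵥ X = Real.exp (-2 * u + 2 * al) • fun i => x i / ‖x‖ := by
    rw [hg]; exact brillForm_mulVec hρ
  have hdet : (D.g x).det = Real.exp (-3 * u + 2 * al) ^ 2 := by
    rw [hg]; exact det_brillForm hρ
  have hunit : IsUnit (D.g x).det := by
    rw [hdet]; exact (pow_pos (Real.exp_pos _) 2).ne'.isUnit
  have hinv : (D.g x)⁻¹ *ᵥ (fun i => x i / ‖x‖) = Real.exp (2 * u - 2 * al) • X := by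
    have h1 : (D.g x)⁻¹ *ᵥ (D.g x *ᵥ X) = X := by
      rw [Matrix.mulVec_mulVec, Matrix.nonsing_inv_mul _ hunit, Matrix.one_mulVec]
    rw [hmv, Matrix.mulVec_smul] at h1
    conv_rhs => rw [← h1]
    rw [smul_smul, ← Real.exp_add]
    have : 2 * u - 2 * al + (-2 * u + 2 * al) = 0 := by ring
    rw [this, Real.exp_zero, one_smul]
  have hsum : ∀ i, ∑ j, (D.g x)⁻¹ i j * pd j (fun y => ‖y‖) x = Real.exp (2 * u - 2 * al) * X i := by
    intro i
    have := congrFun hinv i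
    simp only [Matrix.mulVec, dotProduct, Pi.smul_apply, smul_eq_mul] at this
    rw [← this]
    exact Finset.sum_congr rfl fun j _ => by rw [pd_norm hx0]
  have hgl : gradLength D.g (fun y => ‖y‖) x = Real.exp (u - al) := by
    have hsq : ∑ i, ∑ j, (D.g x)⁻¹ i j * pd i (fun y => ‖y‖) x * pd j (fun y => ‖y‖) x
        = Real.exp (u - al) ^ 2 := by
      have h1 : ∀ i, ∑ j, (D.g x)⁻¹ i j * pd i (fun y => ‖y‖) x * pd j (fun y => ‖y‖) x
          = (x i / ‖x‖) * (Real.exp (2 * u - 2 * al) * X i) := by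
        intro i
        rw [← hsum i, Finset.mul_sum]
        exact Finset.sum_congr rfl fun j _ => by rw [pd_norm hx0 i]; ring
      have hXs : ∑ i, x i / ‖x‖ * X i = 1 := by
        have hns := norm_sq_eq_coords x
        simp [Fin.sum_univ_three, hX, rotField]
        field_simp
        linear_combination -hns
      have h2 : Real.exp (2 * u - 2 * al) = Real.exp (u - al) ^ 2 := by
        rw [← Real.exp_nat_mul]; congr 1; push_cast; ring
      simp only [h1, h2]
      calc _ = Real.exp (u - al) ^ 2 * ∑ i, x i / ‖x‖ * X i := by
            rw [Finset.mul_sum]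
            exact Finset.sum_congr rfl fun i _ => by ring
        _ = _ := by rw [hXs, mul_one]
    rw [gradLength, hsq, Real.sqrt_sq (Real.exp_pos _).le]
  have hns : Real.sqrt ((cyl x).1 ^ 2 + (cyl x).2 ^ 2) = ‖x‖ := by
    change Real.sqrt (rho x ^ 2 + x 2 ^ 2) = _
    rw [← norm_sq_eq_rho, Real.sqrt_sq (norm_nonneg _)]
  refine ⟨by rw [hgl]; exact (Real.exp_pos _).ne', ?_⟩
  rw [hsum, hgl, hdet, Real.sqrt_sq (Real.exp_pos _).le, normalShift, areaWeight, hns]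
  have he : Real.exp (-3 * u + 2 * al) * Real.exp (2 * u - 2 * al)
      = Real.exp (-2 * u + al) * Real.exp (u - al) := by
    rw [← Real.exp_add, ← Real.exp_add]; congr 1; ring
  have e1 : (cyl x).1 = rho x := rfl
  have e2 : (cyl x).2 = x 2 := rfl
  rw [e1, e2, div_eq_iff (Real.exp_pos _).ne', ← mul_assoc, he, hX]
  ring

/-- Minimality of the boundary in terms of the coefficients. -/
theorem minimal_radial (hm : 0 < m₁) (hmin : HasMinimalBoundary m₁ D.g) {x : E3}
    (hx : ‖x‖ = m₁ / 2) (hρ : 0 < rho x) :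
    2 - 2 * (rho x * dh 0 D.u (cyl x) + x 2 * dh 1 D.u (cyl x))
      + (rho x * dh 0 D.al (cyl x) + x 2 * dh 1 D.al (cyl x)) = 0 := by
  have hxe : x ∈ exterior m₁ := hx.ge
  have hx0 := ne_zero_of_rho_pos hρ
  have hn : ‖x‖ ≠ 0 := norm_ne_zero_iff.mpr hx0
  have hp : (m₁ / 2) ^ 2 ≤ (cyl x).1 ^ 2 + (cyl x).2 ^ 2 := by
    have h := norm_sq_eq_rho x
    change _ ≤ rho x ^ 2 + x 2 ^ 2
    rw [← h, hx]
  have du : DifferentiableAt ℝ D.u (cyl x) :=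
    (D.contDiffAt_u (n := 1) hm hp).differentiableAt (by simp)
  have dal : DifferentiableAt ℝ D.al (cyl x) :=
    (D.contDiffAt_al (n := 1) hm hp).differentiableAt (by simp)
  have dar : DifferentiableAt ℝ D.ar (cyl x) :=
    (D.contDiffAt_ar (n := 1) hm hp).differentiableAt (by simp)
  have daz : DifferentiableAt ℝ D.az (cyl x) :=
    (D.contDiffAt_az (n := 1) hm hp).differentiableAt (by simp)
  have dexpo : DifferentiableAt ℝ (fun p => -2 * D.u p + D.al p) (cyl x) :=
    ((differentiableAt_const _).fun_mul du).fun_add dal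
  have dW : DifferentiableAt ℝ D.areaWeight (cyl x) := dexpo.exp
  have dS : DifferentiableAt ℝ D.normalShift (cyl x) := by
    have hpos : (cyl x).1 ^ 2 + (cyl x).2 ^ 2 ≠ 0 := by
      have : 0 < (m₁ / 2) ^ 2 := by positivity
      exact (this.trans_le hp).ne'
    have d1 : DifferentiableAt ℝ (fun p : ℝ × ℝ => Real.sqrt (p.1 ^ 2 + p.2 ^ 2)) (cyl x) :=
      DifferentiableAt.sqrt (by fun_prop) hpos
    have d2 : Real.sqrt ((cyl x).1 ^ 2 + (cyl x).2 ^ 2) ≠ 0 :=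
      (Real.sqrt_pos.mpr (lt_of_le_of_ne (by positivity) hpos.symm)).ne'
    exact dW.fun_mul (((differentiableAt_fst.fun_mul dar).fun_add
      (differentiableAt_snd.fun_mul daz)).fun_mul (d1.fun_inv d2))
  set P : Fin 3 → E3 → ℝ := fun i y =>
    D.areaWeight (cyl y) * ‖y‖⁻¹ * y i - D.normalShift (cyl y) * rotField y i with hPdef
  have dc : ∀ i, DifferentiableAt ℝ (fun y : E3 => y i) x := fun i =>
    (contDiffAt_coord i x (n := 1)).differentiableAt (by simp)
  have dWc := differentiableAt_comp_cyl hρ dW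
  have dSc := differentiableAt_comp_cyl hρ dS
  have dni : DifferentiableAt ℝ (fun y : E3 => ‖y‖⁻¹) x := (differentiableAt_norm_E3 hx0).fun_inv hn
  have dψ : DifferentiableAt ℝ (fun y : E3 => D.areaWeight (cyl y) * ‖y‖⁻¹) x := dWc.fun_mul dni
  have drot : ∀ i, DifferentiableAt ℝ (fun y => rotField y i) x := by
    intro i
    fin_cases i
    · exact (dc 1).fun_neg
    · exact dc 0
    · exact differentiableAt_const _
  have dP : ∀ i, DifferentiableAt ℝ (P i) x := fun i =>
    (dψ.fun_mul (dc i)).fun_sub (dSc.fun_mul (drot i))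
  set W : Fin 3 → E3 → ℝ := fun i y => Real.sqrt (D.g y).det
    * (∑ j, (D.g y)⁻¹ i j * pd j (fun y => ‖y‖) y) / gradLength D.g (fun y => ‖y‖) y with hWdef
  have hM : DiffM D.g x := fun i j => (D.g_smooth i j).differentiableAt hxe
  have hdet : (D.g x).det ≠ 0 := (D.g_posDef x hxe).det_pos.ne'
  have hMi := hM.inv hdet
  have dpd : ∀ j, DifferentiableAt ℝ (fun y => pd j (fun y : E3 => ‖y‖) y) x := by
    intro j
    have : (fun y => pd j (fun y : E3 => ‖y‖) y) =ᶠ[𝓝 x] fun y => y j * ‖y‖⁻¹ := by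
      filter_upwards [isOpen_ne.mem_nhds hx0] with y hy
      rw [pd_norm hy, div_eq_mul_inv]
    exact this.differentiableAt_iff.mpr ((dc j).fun_mul dni)
  have dW' : ∀ i, DifferentiableAt ℝ (W i) x := by
    intro i
    have h1 : DifferentiableAt ℝ (fun y => Real.sqrt (D.g y).det) x := hM.det.sqrt hdet
    have h2 : DifferentiableAt ℝ (fun y => ∑ j, (D.g y)⁻¹ i j * pd j (fun y => ‖y‖) y) x :=
      DifferentiableAt.fun_sum fun j _ => (hMi i j).fun_mul (dpd j)
    have hne := (D.normal_density hxe hρ i).1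
    have h3 : DifferentiableAt ℝ (fun y => gradLength D.g (fun y => ‖y‖) y) x := by
      unfold gradLength
      refine DifferentiableAt.sqrt (DifferentiableAt.fun_sum fun i _ => DifferentiableAt.fun_sum
        fun j _ => ((hMi i j).fun_mul (dpd i)).fun_mul (dpd j)) ?_
      intro h0
      exact hne (by rw [gradLength, h0, Real.sqrt_zero])
    have := (h1.fun_mul h2).fun_mul (h3.fun_inv hne)
    simpa only [hWdef, div_eq_mul_inv] using this
  -- The normal density and its explicit form agree only on the closed exterior, while the mean
  -- curvature uses full derivatives at a boundary point. Both functions are differentiable there,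
  -- and unique differentiability identifies their derivatives.
  have hfd : ∀ i, fderiv ℝ (W i) x = fderiv ℝ (P i) x := by
    intro i
    have hev : W i =ᶠ[𝓝[exterior m₁] x] P i := by
      filter_upwards [self_mem_nhdsWithin,
        mem_nhdsWithin_of_mem_nhds (isOpen_rho_pos.mem_nhds hρ)] with y hy hy'
      exact (D.normal_density hy hy' i).2
    refine (uniqueDiffWithinAt_exterior hm hx).eq
      (dW' i).hasFDerivAt.hasFDerivWithinAt ?_
    exact (dP i).hasFDerivAt.hasFDerivWithinAt.congr_of_eventuallyEq hev (hev.self_of_nhdsWithin hxe)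
  have hmc := hmin x hx
  have hsd : (Real.sqrt (D.g x).det)⁻¹ ≠ 0 :=
    _root_.inv_ne_zero (Real.sqrt_pos.mpr (D.g_posDef x hxe).det_pos).ne'
  have hdiv : ∑ i, pd i (P i) x = 0 := by
    have h := (mul_eq_zero.mp hmc).resolve_left hsd
    rw [← h]
    exact Finset.sum_congr rfl fun i _ => by rw [pd, pd, ← hfd i]
  -- the divergence
  have hpdP : ∀ i, pd i (P i) x = pd i (fun y : E3 => D.areaWeight (cyl y) * ‖y‖⁻¹) x * x i
      + D.areaWeight (cyl x) * ‖x‖⁻¹ - pd i (fun y => D.normalShift (cyl y)) x * rotField x i := by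
    intro i
    have hr : pd i (fun y => rotField y i) x = 0 := by
      fin_cases i
      · have : (fun y : E3 => rotField y 0) = fun y => (0 : ℝ) - y 1 := by
          funext y; simp [rotField]
        change pd 0 (fun y : E3 => rotField y 0) x = 0
        rw [this, pd_sub 0 (differentiableAt_const _) (dc 1), pd_const, pd_coord]; simp
      · change pd 1 (fun y : E3 => y 0) x = 0
        rw [pd_coord]; simp
      · exact pd_const _ _ _
    rw [hPdef, pd_sub i (dψ.fun_mul (dc i)) (dSc.fun_mul (drot i)), pd_mul i dψ (dc i),
      pd_mul i dSc (drot i), pd_coord, hr]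
    simp
  have hrad : fderiv ℝ (fun y : E3 => D.areaWeight (cyl y) * ‖y‖⁻¹) x x
      = ‖x‖⁻¹ * D.areaWeight (cyl x) * (-2 * (rho x * dh 0 D.u (cyl x) + x 2 * dh 1 D.u (cyl x))
      + (rho x * dh 0 D.al (cyl x) + x 2 * dh 1 D.al (cyl x)) - 1) := by
    have h1 : fderiv ℝ (fun y : E3 => ‖y‖⁻¹) x x = -‖x‖⁻¹ := by
      have h2 := (hasDerivAt_inv hn).comp_hasFDerivAt x (differentiableAt_norm_E3 hx0).hasFDerivAt
      have h3 : fderiv ℝ (fun y : E3 => ‖y‖⁻¹) x = _ := h2.fderiv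
      have h4 : fderiv ℝ (fun y : E3 => ‖y‖) x x = ‖x‖ := by
        have hns := norm_sq_eq_coords x
        rw [fderiv_eq_sum_pd]
        simp only [pd_norm hx0, Fin.sum_univ_three]
        field_simp
        linarith
      rw [h3, smul_apply, h4, smul_eq_mul]
      field_simp
    have hw : ∀ m, dh m D.areaWeight (cyl x)
        = D.areaWeight (cyl x) * (-2 * dh m D.u (cyl x) + dh m D.al (cyl x)) := by
      intro m
      have := dh_exp m dexpo
      rw [dh_add m ((differentiableAt_const _).fun_mul du) dal,
        dh_mul m (differentiableAt_const _) du, dh_const] at this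
      refine this.trans ?_
      rw [areaWeight]; ring
    rw [fderiv_fun_mul dWc dni]
    simp only [add_apply, smul_apply, smul_eq_mul]
    rw [h1, fderiv_comp_cyl_radial hρ dW, hw, hw]
    ring
  -- The rotational part is divergence-free: the rotation field is, and its coefficient is
  -- axisymmetric. In the radial part the constant `2` arises as `3 - 1`, from the divergence of `x`
  -- and the radial derivative of `1/|x|`.
  have hrot := fderiv_comp_cyl_rotField hρ dS
  rw [fderiv_eq_sum_pd] at hrad hrot
  simp only [hpdP, Finset.sum_sub_distrib, Finset.sum_add_distrib] at hdiv
  rw [hrad, show ∑ i, pd i (fun y => D.normalShift (cyl y)) x * rotField x i = 0 from hrot] at hdiv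
  simp only [Finset.sum_const, Finset.card_univ, Fintype.card_fin, nsmul_eq_mul] at hdiv
  push_cast at hdiv
  have hpos : ‖x‖⁻¹ * D.areaWeight (cyl x) ≠ 0 :=
    mul_ne_zero (_root_.inv_ne_zero hn) (Real.exp_pos _).ne'
  refine (mul_eq_zero.mp (?_ : ‖x‖⁻¹ * D.areaWeight (cyl x) * _ = 0)).resolve_left hpos
  linear_combination hdiv

/-- Minimality in logarithmic polar coordinates. -/
lemma minimal_polar (hm : 0 < m₁) (hmin : HasMinimalBoundary m₁ D.g) :
    ∀ θ ∈ Set.Ioo 0 Real.pi,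
      2 - 2 * dh 0 D.v (Real.log (m₁ / 2), θ) + dh 0 D.va (Real.log (m₁ / 2), θ) = 0 := by
  intro θ hθ
  set q : ℝ × ℝ := (Real.log (m₁ / 2), θ) with hq
  have hq1 : 0 < (logPolar q).1 := logPolar_fst_pos ⟨Set.mem_univ _, hθ⟩
  have hx : ‖sec (logPolar q)‖ = m₁ / 2 := by
    rw [norm_sec_logPolar]; exact Real.exp_log (by positivity)
  have hr : rho (sec (logPolar q)) = (logPolar q).1 := rho_sec hq1.le
  have hc : cyl (sec (logPolar q)) = logPolar q := cyl_sec hq1.le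
  have h := D.minimal_radial hm hmin hx (by rw [hr]; exact hq1)
  rw [hc, hr, sec_two] at h
  have hp := (sq_le_logPolar hm (q := q)).mpr le_rfl
  have h1 := dh_zero_comp_logPolar (q := q)
    ((D.contDiffAt_u (n := 1) hm hp).differentiableAt (by simp))
  have h2 := dh_zero_comp_logPolar (q := q)
    ((D.contDiffAt_al (n := 1) hm hp).differentiableAt (by simp))
  rw [← h1, ← h2] at h
  exact h

end PseudosphericalData

/-! ### Orders of decay off the axis -/

/-- The filter of neighbourhoods of infinity, off the axis. -/
def offAxis : Filter E3 := cobounded E3 ⊓ 𝓟 {x | 0 < rho x}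

/-- `f = O(r^p)` and `∂f = O(r^{p-1})` off the axis. -/
structure HasOrder (p : ℝ) (f : E3 → ℝ) : Prop where
  diff : ∀ᶠ x in offAxis, DifferentiableAt ℝ f x
  val : f =O[offAxis] fun x => ‖x‖ ^ p
  der : fderiv ℝ f =O[offAxis] fun x => ‖x‖ ^ (p - 1)

/-- `f = o(r^p)` and `∂f = o(r^{p-1})` off the axis. -/
structure HasSmallOrder (p : ℝ) (f : E3 → ℝ) : Prop where
  diff : ∀ᶠ x in offAxis, DifferentiableAt ℝ f x
  val : f =o[offAxis] fun x => ‖x‖ ^ p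
  der : fderiv ℝ f =o[offAxis] fun x => ‖x‖ ^ (p - 1)

lemma eventually_offAxis_lt (c : ℝ) : ∀ᶠ x in offAxis, c < ‖x‖ :=
  (eventually_lt_norm c).filter_mono inf_le_left

lemma eventually_offAxis_rho : ∀ᶠ x in offAxis, 0 < rho x :=
  Filter.Eventually.filter_mono inf_le_right (eventually_principal.mpr fun _ h => h)

lemma rpow_mul_rpow_eventually (p q : ℝ) :
    (fun x : E3 => ‖x‖ ^ p * ‖x‖ ^ q) =ᶠ[offAxis] fun x => ‖x‖ ^ (p + q) := by
  filter_upwards [eventually_offAxis_lt 0] with x hx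
  rw [Real.rpow_add hx]

lemma rpow_isBigO {p q : ℝ} (h : p ≤ q) :
    (fun x : E3 => ‖x‖ ^ p) =O[offAxis] fun x => ‖x‖ ^ q := by
  refine IsBigO.of_bound 1 ?_
  filter_upwards [eventually_offAxis_lt 1] with x hx
  rw [one_mul, Real.norm_of_nonneg (by positivity), Real.norm_of_nonneg (by positivity)]
  exact Real.rpow_le_rpow_of_exponent_le hx.le h

section

variable {p q : ℝ} {f g : E3 → ℝ}

lemma HasSmallOrder.hasOrder (h : HasSmallOrder p f) : HasOrder p f := ⟨h.diff, h.val.isBigO, h.der.isBigO⟩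

lemma HasSmallOrder.mono (h : HasSmallOrder p f) (hpq : p ≤ q) : HasSmallOrder q f :=
  ⟨h.diff, h.val.trans_isBigO (rpow_isBigO hpq), h.der.trans_isBigO (rpow_isBigO (by linarith))⟩

lemma HasSmallOrder.congr (h : HasSmallOrder p f) (hfg : ∀ᶠ x in offAxis, f =ᶠ[𝓝 x] g) :
    HasSmallOrder p g := by
  refine ⟨?_, h.val.congr' ?_ EventuallyEq.rfl, h.der.congr' ?_ EventuallyEq.rfl⟩
  · filter_upwards [h.diff, hfg] with x h1 h2 using h2.differentiableAt_iff.mp h1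
  · filter_upwards [hfg] with x hx using hx.self_of_nhds
  · filter_upwards [hfg] with x hx using hx.fderiv_eq

lemma HasSmallOrder.add (hf : HasSmallOrder p f) (hg : HasSmallOrder p g) :
    HasSmallOrder p fun x => f x + g x := by
  refine ⟨?_, hf.val.add hg.val, (hf.der.add hg.der).congr' ?_ EventuallyEq.rfl⟩
  · filter_upwards [hf.diff, hg.diff] with x h1 h2 using h1.fun_add h2
  · filter_upwards [hf.diff, hg.diff] with x h1 h2 using (fderiv_fun_add h1 h2).symm

lemma HasOrder.add (hf : HasOrder p f) (hg : HasOrder p g) : HasOrder p fun x => f x + g x := by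
  refine ⟨?_, hf.val.add hg.val, (hf.der.add hg.der).congr' ?_ EventuallyEq.rfl⟩
  · filter_upwards [hf.diff, hg.diff] with x h1 h2 using h1.fun_add h2
  · filter_upwards [hf.diff, hg.diff] with x h1 h2 using (fderiv_fun_add h1 h2).symm

lemma HasOrder.mul (hf : HasOrder p f) (hg : HasOrder q g) :
    HasOrder (p + q) fun x => f x * g x := by
  refine ⟨?_, ?_, ?_⟩
  · filter_upwards [hf.diff, hg.diff] with x h1 h2 using h1.fun_mul h2
  · exact (hf.val.mul hg.val).congr' EventuallyEq.rfl (rpow_mul_rpow_eventually p q)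
  · have h1 : (fun x => f x • fderiv ℝ g x) =O[offAxis] fun x => ‖x‖ ^ (p + q - 1) := by
      refine (hf.val.smul hg.der).congr' EventuallyEq.rfl ?_
      refine (rpow_mul_rpow_eventually p (q - 1)).trans (Eventually.of_forall fun x => ?_)
      simp only []; congr 1; ring
    have h2 : (fun x => g x • fderiv ℝ f x) =O[offAxis] fun x => ‖x‖ ^ (p + q - 1) := by
      refine (hg.val.smul hf.der).congr' EventuallyEq.rfl ?_
      refine (rpow_mul_rpow_eventually q (p - 1)).trans (Eventually.of_forall fun x => ?_)
      simp only []; congr 1; ring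
    refine (h1.add h2).congr' ?_ EventuallyEq.rfl
    filter_upwards [hf.diff, hg.diff] with x h1 h2 using (fderiv_fun_mul h1 h2).symm

lemma HasSmallOrder.mul (hf : HasSmallOrder p f) (hg : HasOrder q g) :
    HasSmallOrder (p + q) fun x => f x * g x := by
  refine ⟨?_, ?_, ?_⟩
  · filter_upwards [hf.diff, hg.diff] with x h1 h2 using h1.fun_mul h2
  · exact (hf.val.mul_isBigO hg.val).congr' EventuallyEq.rfl (rpow_mul_rpow_eventually p q)
  · have h1 : (fun x => f x • fderiv ℝ g x) =o[offAxis] fun x => ‖x‖ ^ (p + q - 1) := by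
      refine (hf.val.smul_isBigO hg.der).congr' EventuallyEq.rfl ?_
      refine (rpow_mul_rpow_eventually p (q - 1)).trans (Eventually.of_forall fun x => ?_)
      simp only []; congr 1; ring
    have h2 : (fun x => g x • fderiv ℝ f x) =o[offAxis] fun x => ‖x‖ ^ (p + q - 1) := by
      refine (hg.val.smul_isLittleO hf.der).congr' EventuallyEq.rfl ?_
      refine (rpow_mul_rpow_eventually q (p - 1)).trans (Eventually.of_forall fun x => ?_)
      simp only []; congr 1; ring
    refine (h1.add h2).congr' ?_ EventuallyEq.rfl
    filter_upwards [hf.diff, hg.diff] with x h1 h2 using (fderiv_fun_mul h1 h2).symm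

lemma hasOrder_const (c : ℝ) : HasOrder 0 fun _ => c := by
  refine ⟨Eventually.of_forall fun x => differentiableAt_const c, ?_, ?_⟩
  · simp only [Real.rpow_zero]
    exact isBigO_const_const c one_ne_zero _
  · have : fderiv ℝ (fun _ : E3 => c) = fun _ => 0 := by funext x; simp
    rw [this]
    exact isBigO_zero _ _

lemma HasSmallOrder.const_mul (hf : HasSmallOrder p f) (c : ℝ) :
    HasSmallOrder p fun x => c * f x := by
  have := hf.mul (hasOrder_const c)
  simpa only [add_zero, mul_comm] using this

lemma hasOrder_coord (i : Fin 3) : HasOrder 1 fun x : E3 => x i := by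
  refine ⟨Eventually.of_forall fun x => (contDiffAt_coord i x (n := 1)).differentiableAt (by simp),
    IsBigO.of_bound 1 ?_, ?_⟩
  · refine Eventually.of_forall fun x => ?_
    rw [Real.rpow_one, one_mul, norm_norm]
    exact PiLp.norm_apply_le x i
  · have h : fderiv ℝ (fun y : E3 => y i) = fun _ => (EuclideanSpace.proj i : E3 →L[ℝ] ℝ) := by
      funext x
      exact (EuclideanSpace.proj i : E3 →L[ℝ] ℝ).fderiv
    rw [h]
    simp only [sub_self, Real.rpow_zero]
    exact isBigO_const_const _ one_ne_zero _

lemma IsLittleOk.hasSmallOrder {k : ℕ} {m₁ : ℝ} (hf : SmoothUpTo f (exterior m₁)) (hk : 1 ≤ k)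
    (h : IsLittleOk k f p) : HasSmallOrder p f := by
  refine ⟨?_, h.isLittleO.mono inf_le_left, (h.isLittleO_fderiv hk).mono inf_le_left⟩
  filter_upwards [eventually_offAxis_lt (m₁ / 2)] with x hx
  exact hf.differentiableAt (le_of_lt hx)

lemma tendsto_rpow_offAxis (hp : p < 0) : Tendsto (fun x : E3 => ‖x‖ ^ p) offAxis (𝓝 0) := by
  have h1 : Tendsto (fun x : E3 => ‖x‖) offAxis atTop :=
    tendsto_norm_cobounded_atTop.mono_left inf_le_left
  have h2 := (tendsto_rpow_neg_atTop (neg_pos.mpr hp)).comp h1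
  simp only [neg_neg] at h2
  exact h2

lemma HasSmallOrder.tendsto (h : HasSmallOrder p f) (hp : p < 0) : Tendsto f offAxis (𝓝 0) :=
  h.val.isBigO.trans_tendsto (tendsto_rpow_offAxis hp)

lemma exp_sub_one_isBigO : (fun s : ℝ => Real.exp s - 1) =O[𝓝 0] fun s => s := by
  have := (Real.hasDerivAt_exp 0).isBigO_sub
  simpa using this

lemma exp_sub_one_sub_id_isBigO : (fun s : ℝ => Real.exp s - 1 - s) =O[𝓝 0] fun s => s ^ 2 := by
  refine IsBigO.of_bound 1 ?_
  filter_upwards [Metric.ball_mem_nhds (0 : ℝ) one_pos] with s hs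
  have hs' : |s| ≤ 1 := by simpa using (Metric.mem_ball.mp hs).le
  rw [Real.norm_eq_abs, Real.norm_eq_abs, abs_of_nonneg (sq_nonneg s), one_mul]
  exact Real.abs_exp_sub_one_sub_id_le hs'

lemma HasSmallOrder.exp_sub_one (h : HasSmallOrder p f) (hp : p < 0) :
    HasSmallOrder p fun x => Real.exp (f x) - 1 := by
  have ht := h.tendsto hp
  refine ⟨?_, ?_, ?_⟩
  · filter_upwards [h.diff] with x hx using hx.exp.sub_const 1
  · exact (exp_sub_one_isBigO.comp_tendsto ht).trans_isLittleO h.val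
  · have h1 : (fun x => Real.exp (f x)) =O[offAxis] fun _ => (1 : ℝ) :=
      ((Real.continuous_exp.tendsto 0).comp ht).isBigO_one ℝ
    have h2 := h1.smul_isLittleO h.der
    simp only [one_smul] at h2
    refine h2.congr' ?_ EventuallyEq.rfl
    filter_upwards [h.diff] with x hx
    rw [fderiv_sub_const]
    exact (fderiv_exp hx).symm

/-- The derivative of the remainder is `(e^f - 1) df`, again a product of two small factors. -/
lemma HasSmallOrder.exp_sub_one_sub (h : HasSmallOrder p f) (hp : p < 0) :
    HasSmallOrder (p + p) fun x => Real.exp (f x) - 1 - f x := by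
  have ht := h.tendsto hp
  refine ⟨?_, ?_, ?_⟩
  · filter_upwards [h.diff] with x hx using (hx.exp.sub_const 1).fun_sub hx
  · refine (exp_sub_one_sub_id_isBigO.comp_tendsto ht).trans_isLittleO ?_
    have := h.val.mul h.val
    refine this.congr' (Eventually.of_forall fun x => ?_) (rpow_mul_rpow_eventually p p)
    simp [sq]
  · have h2 := (h.exp_sub_one hp).val.smul h.der
    refine h2.congr' ?_ ?_
    · filter_upwards [h.diff] with x hx
      rw [fderiv_fun_sub (hx.exp.sub_const 1) hx, fderiv_sub_const, fderiv_exp hx, sub_smul,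
        one_smul]
    · refine (rpow_mul_rpow_eventually p (p - 1)).trans (Eventually.of_forall fun x => ?_)
      simp only []; congr 1; ring

end

/-! ### Functions vanishing on the axis -/

/-- `f` is of order `o(r^p)`, and `f/ρ` is `o(r^{p-1})`. -/
structure VanishesOnAxis (p : ℝ) (f : E3 → ℝ) : Prop where
  order : HasSmallOrder p f
  div : (fun x => f x * (rho x)⁻¹) =o[offAxis] fun x => ‖x‖ ^ (p - 1)

/-- The Euclidean projection to the meridian plane. -/
def meridianProj (i j : Fin 3) (x : E3) : ℝ := dRho x i * dRho x j + dZ i * dZ j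

lemma norm_fderiv_le_sum (f : E3 → ℝ) (x : E3) : ‖fderiv ℝ f x‖ ≤ ∑ i, |pd i f x| := by
  refine ContinuousLinearMap.opNorm_le_bound _ (by positivity) fun v => ?_
  rw [fderiv_eq_sum_pd, Finset.sum_mul]
  refine (Finset.abs_sum_le_sum_abs _ _).trans (Finset.sum_le_sum fun i _ => ?_)
  rw [abs_mul]
  gcongr
  exact PiLp.norm_apply_le v i

lemma abs_dRho_le (x : E3) (i : Fin 3) : |dRho x i| ≤ 1 := by
  have h2 := rho_sq x
  have h0 := rho_nonneg x
  fin_cases i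
  · change |x 0 / rho x| ≤ 1
    rw [abs_div, abs_of_nonneg h0]
    exact div_le_one_of_le₀ (abs_le_of_sq_le_sq (by nlinarith [sq_nonneg (x 1)]) h0) h0
  · change |x 1 / rho x| ≤ 1
    rw [abs_div, abs_of_nonneg h0]
    exact div_le_one_of_le₀ (abs_le_of_sq_le_sq (by nlinarith [sq_nonneg (x 0)]) h0) h0
  · simp [dRho]

lemma differentiableAt_dRho {x : E3} (hx : 0 < rho x) (i : Fin 3) :
    DifferentiableAt ℝ (fun y => dRho y i) x :=
  (contDiffAt_cylCoframe hx (n := 1) 0 i).differentiableAt (by simp)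

/-- Follows by differentiating `ρ dρ = x dx + y dy` componentwise. The loss is `1/ρ` rather than
`1/r`, and this is what makes estimates near the axis delicate. -/
lemma norm_fderiv_dRho_le {x : E3} (hx : 0 < rho x) (i : Fin 3) :
    ‖fderiv ℝ (fun y => dRho y i) x‖ ≤ 6 * (rho x)⁻¹ := by
  have hne := hx.ne'
  have key : ∀ k, |pd k (fun y => dRho y i) x| ≤ 2 * (rho x)⁻¹ := by
    intro k
    have hd := (contDiffAt_rho hx (n := 1)).differentiableAt (by simp)
    have hi : DifferentiableAt ℝ (fun y => dRho y i) x := differentiableAt_dRho hx i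
    have hmul : (fun y => rho y * dRho y i) =ᶠ[𝓝 x]
        fun y => (![y 0, y 1, 0] : Fin 3 → ℝ) i := by
      filter_upwards [isOpen_rho_pos.mem_nhds hx] with y hy
      have hy' : rho y ≠ 0 := ne_of_gt hy
      fin_cases i <;> simp [dRho] <;> field_simp
    have h1 := pd_congr k hmul
    rw [pd_mul k hd hi, pd_rho hx] at h1
    have h2 : |pd k (fun y : E3 => (![y 0, y 1, 0] : Fin 3 → ℝ) i) x| ≤ 1 := by
      fin_cases i
      · change |pd k (fun y : E3 => y 0) x| ≤ 1
        rw [pd_coord, Matrix.one_apply]; split_ifs <;> simp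
      · change |pd k (fun y : E3 => y 1) x| ≤ 1
        rw [pd_coord, Matrix.one_apply]; split_ifs <;> simp
      · change |pd k (fun y : E3 => (0 : ℝ)) x| ≤ 1
        rw [pd_const]; simp
    have h3 : |dRho x k * dRho x i| ≤ 1 := by
      rw [abs_mul]
      exact mul_le_one₀ (abs_dRho_le x k) (abs_nonneg _) (abs_dRho_le x i)
    have h4 : rho x * pd k (fun y => dRho y i) x
        = pd k (fun y : E3 => (![y 0, y 1, 0] : Fin 3 → ℝ) i) x - dRho x k * dRho x i := by
      linarith
    have h5 : rho x * |pd k (fun y => dRho y i) x| ≤ 2 := by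
      have e : rho x * |pd k (fun y => dRho y i) x| = |rho x * pd k (fun y => dRho y i) x| := by
        rw [abs_mul, abs_of_pos hx]
      rw [e, h4]
      exact (abs_sub _ _).trans (by linarith)
    rw [← div_eq_mul_inv, le_div_iff₀ hx]
    linarith
  refine (norm_fderiv_le_sum _ _).trans ((Finset.sum_le_sum fun k _ => key k).trans ?_)
  simp only [Finset.sum_const, Finset.card_univ, Fintype.card_fin, nsmul_eq_mul]
  push_cast
  linarith

lemma differentiableAt_meridianProj {x : E3} (hx : 0 < rho x) (i j : Fin 3) :
    DifferentiableAt ℝ (meridianProj i j) x :=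
  ((differentiableAt_dRho hx i).fun_mul (differentiableAt_dRho hx j)).fun_add
    (differentiableAt_const _)

/-- The projection is bounded, but its derivative is of size `1/ρ`; the stronger control of `f/ρ`
compensates for it. -/
lemma VanishesOnAxis.mul_meridianProj {p : ℝ} {f : E3 → ℝ} (h : VanishesOnAxis p f) (i j : Fin 3) :
    HasSmallOrder p fun x => f x * meridianProj i j x := by
  have hb : meridianProj i j =O[offAxis] fun _ => (1 : ℝ) := by
    refine IsBigO.of_bound 2 (Eventually.of_forall fun x => ?_)
    have h1 : |dRho x i * dRho x j| ≤ 1 := by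
      rw [abs_mul]
      exact mul_le_one₀ (abs_dRho_le x i) (abs_nonneg _) (abs_dRho_le x j)
    have h2 : |dZ i * dZ j| ≤ 1 := by fin_cases i <;> fin_cases j <;> simp [dZ]
    rw [meridianProj, Real.norm_eq_abs]
    refine (abs_add_le _ _).trans ?_
    rw [norm_one]; linarith
  have hbd : fderiv ℝ (meridianProj i j) =O[offAxis] fun x => (rho x)⁻¹ := by
    refine IsBigO.of_bound 12 ?_
    filter_upwards [eventually_offAxis_rho] with x hx
    have e : fderiv ℝ (meridianProj i j) x = dRho x i • fderiv ℝ (fun y => dRho y j) x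
        + dRho x j • fderiv ℝ (fun y => dRho y i) x := by
      unfold meridianProj
      rw [fderiv_add_const]
      exact fderiv_fun_mul (differentiableAt_dRho hx i) (differentiableAt_dRho hx j)
    have a1 := norm_fderiv_dRho_le hx i
    have a2 := norm_fderiv_dRho_le hx j
    have a3 := abs_dRho_le x i
    have a4 := abs_dRho_le x j
    have hi : 0 < (rho x)⁻¹ := by positivity
    rw [e, Real.norm_of_nonneg hi.le]
    refine (norm_add_le _ _).trans ?_
    rw [norm_smul, norm_smul, Real.norm_eq_abs, Real.norm_eq_abs]
    have t1 : |dRho x i| * ‖fderiv ℝ (fun y => dRho y j) x‖ ≤ 1 * (6 * (rho x)⁻¹) := by gcongr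
    have t2 : |dRho x j| * ‖fderiv ℝ (fun y => dRho y i) x‖ ≤ 1 * (6 * (rho x)⁻¹) := by gcongr
    linarith
  refine ⟨?_, ?_, ?_⟩
  · filter_upwards [h.order.diff, eventually_offAxis_rho] with x h1 h2
    exact h1.fun_mul (differentiableAt_meridianProj h2 i j)
  · simpa using h.order.val.mul_isBigO hb
  · have h1 : (fun x => f x • fderiv ℝ (meridianProj i j) x) =o[offAxis]
        fun x => ‖x‖ ^ (p - 1) :=
      ((isBigO_refl f offAxis).smul hbd).trans_isLittleO h.div
    have h2 : (fun x => meridianProj i j x • fderiv ℝ f x) =o[offAxis]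
        fun x => ‖x‖ ^ (p - 1) := by
      simpa using hb.smul_isLittleO h.order.der
    refine (h1.add h2).congr' ?_ EventuallyEq.rfl
    filter_upwards [h.order.diff, eventually_offAxis_rho] with x h1 h2
    exact (fderiv_fun_mul h1 (differentiableAt_meridianProj h2 i j)).symm

lemma VanishesOnAxis.const_mul {p : ℝ} {f : E3 → ℝ} (h : VanishesOnAxis p f) (c : ℝ) :
    VanishesOnAxis p fun x => c * f x :=
  ⟨h.order.const_mul c, by simpa only [mul_assoc] using h.div.const_mul_left c⟩

lemma VanishesOnAxis.exp_sub_one {p : ℝ} {f : E3 → ℝ} (h : VanishesOnAxis p f) (hp : p < 0) :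
    VanishesOnAxis p fun x => Real.exp (f x) - 1 :=
  ⟨h.order.exp_sub_one hp, ((exp_sub_one_isBigO.comp_tendsto (h.order.tendsto hp)).mul
    (isBigO_refl (fun x => (rho x)⁻¹) offAxis)).trans_isLittleO h.div⟩

lemma VanishesOnAxis.exp_sub_one_sub {p : ℝ} {f : E3 → ℝ} (h : VanishesOnAxis p f) (hp : p < 0) :
    VanishesOnAxis (p + p) fun x => Real.exp (f x) - 1 - f x := by
  refine ⟨h.order.exp_sub_one_sub hp, ?_⟩
  refine ((exp_sub_one_sub_id_isBigO.comp_tendsto (h.order.tendsto hp)).mul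
    (isBigO_refl (fun x => (rho x)⁻¹) offAxis)).trans_isLittleO ?_
  refine (h.order.val.mul h.div).congr' (Eventually.of_forall fun x => ?_) ?_
  · simp only [Function.comp]; ring
  · refine (rpow_mul_rpow_eventually p (p - 1)).trans (Eventually.of_forall fun x => ?_)
    simp only []; congr 1; ring

lemma exists_radius {G : Type*} [NormedAddCommGroup G] {F : E3 → G} {q : ℝ}
    (h : F =o[cobounded E3] fun x => ‖x‖ ^ q) {ε : ℝ} (hε : 0 < ε) :
    ∃ R, 0 < R ∧ ∀ x : E3, R ≤ ‖x‖ → ‖F x‖ ≤ ε * ‖x‖ ^ q := by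
  have h1 := h.bound hε
  rw [← comap_norm_atTop, eventually_comap] at h1
  obtain ⟨R, hR⟩ := eventually_atTop.mp h1
  refine ⟨max R 1, by positivity, fun x hx => ?_⟩
  have := hR ‖x‖ ((le_max_left _ _).trans hx) x rfl
  rwa [Real.norm_of_nonneg (by positivity)] at this

/-- Where `ρ ≥ r/2`, dividing by `ρ` costs no more than dividing by `r`. Nearer the axis, the mean
value inequality along the horizontal segment from the axis bounds `|f|` by `ρ` times the gradient;
`p ≤ 1` makes `r^{p-1}` nonincreasing, so the gradient on the segment is controlled by its bound at
radius `r/2`. -/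
lemma vanishesOnAxis_of_axis {f : E3 → ℝ} {m₁ : ℝ} {k : ℕ} {p : ℝ} (hp : p ≤ 1)
    (hf : SmoothUpTo f (exterior m₁)) (hk : 1 ≤ k) (h : IsLittleOk k f p)
    (haxis : ∀ x ∈ exterior m₁, rho x = 0 → f x = 0) : VanishesOnAxis p f := by
  refine ⟨h.hasSmallOrder hf hk, ?_⟩
  refine IsLittleO.of_bound fun ε hε => ?_
  -- Large enough for both regimes: `2` from `r ≤ 2ρ`, and `2^{1-p}` from points of norm at least
  -- `r/2`.
  set B : ℝ := 2 + 2⁻¹ ^ (p - 1) with hB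
  have hB1 : (2 : ℝ)⁻¹ ^ (p - 1) ≤ B := by rw [hB]; linarith
  have hB2 : 2 ≤ B := by rw [hB]; linarith [Real.rpow_pos_of_pos (by norm_num : (0 : ℝ) < 2⁻¹) (p - 1)]
  have hB0 : 0 < B := by linarith
  obtain ⟨R₀, hR₀, h0⟩ := exists_radius h.isLittleO (ε := ε / B) (by positivity)
  obtain ⟨R₁, hR₁, h1⟩ := exists_radius (h.isLittleO_fderiv hk) (ε := ε / B) (by positivity)
  filter_upwards [eventually_offAxis_lt (2 * R₀), eventually_offAxis_lt (2 * R₁),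
    eventually_offAxis_lt (2 * |m₁ / 2|), eventually_offAxis_rho] with x x0 x1 x2 hρ
  have hxp : 0 < ‖x‖ := by linarith
  have hns := norm_sq_eq_rho x
  have hrp : 0 < ‖x‖ ^ (p - 1) := Real.rpow_pos_of_pos hxp _
  rw [Real.norm_eq_abs, abs_mul, abs_of_pos (inv_pos.mpr hρ), Real.norm_of_nonneg hrp.le,
    ← div_eq_mul_inv, div_le_iff₀ hρ]
  rcases le_total (‖x‖ / 2) (rho x) with hc | hc
  · have e : ‖x‖ ^ p = ‖x‖ ^ (p - 1) * ‖x‖ := by rw [Real.rpow_sub_one hxp.ne']; field_simp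
    calc |f x| ≤ ε / B * ‖x‖ ^ p := h0 x (by linarith)
      _ = ε / B * ‖x‖ ^ (p - 1) * ‖x‖ := by rw [e]; ring
      _ ≤ ε / B * ‖x‖ ^ (p - 1) * (B * rho x) := by
          gcongr
          nlinarith
      _ = ε * ‖x‖ ^ (p - 1) * rho x := by field_simp
  · set y : E3 := !₂[0, 0, x 2] with hy
    -- The height `z` is constant along the segment, and `z² = r² - ρ² ≥ 3r²/4` in this regime.
    have hseg : ∀ w ∈ segment ℝ y x, ‖x‖ / 2 ≤ ‖w‖ := by
      intro w hw
      rw [segment_eq_image'] at hw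
      obtain ⟨s, hs, rfl⟩ := hw
      change ‖x‖ / 2 ≤ ‖y + s • (x - y)‖
      have hz : (y + s • (x - y)) 2 = x 2 := by simp [hy]
      have hwn := norm_sq_eq_coords (y + s • (x - y))
      have h3 : (‖x‖ / 2) ^ 2 ≤ ‖y + s • (x - y)‖ ^ 2 := by
        rw [hwn, hz]
        have : rho x ^ 2 ≤ (‖x‖ / 2) ^ 2 := by gcongr
        nlinarith [sq_nonneg ((y + s • (x - y)) 0), sq_nonneg ((y + s • (x - y)) 1)]
      exact (sq_le_sq₀ (by positivity) (norm_nonneg _)).mp h3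
    have hext : ∀ w ∈ segment ℝ y x, w ∈ exterior m₁ := fun w hw => by
      have := hseg w hw
      change m₁ / 2 ≤ ‖w‖
      linarith [le_abs_self (m₁ / 2)]
    have hyx : ‖x - y‖ = rho x := by
      have : ‖x - y‖ ^ 2 = rho x ^ 2 := by
        rw [norm_sq_eq_coords, rho_sq]; simp [hy]
      exact (pow_left_inj₀ (norm_nonneg _) hρ.le two_ne_zero).mp this
    have hfy : f y = 0 := haxis y (hext y (left_mem_segment ℝ y x)) (by simp [rho, hy])
    have hmv := (convex_segment (𝕜 := ℝ) y x).norm_image_sub_le_of_norm_fderiv_le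
      (f := f) (C := ε / B * (2⁻¹ ^ (p - 1) * ‖x‖ ^ (p - 1)))
      (fun w hw => hf.differentiableAt (hext w hw)) (fun w hw => by
        have hw2 := hseg w hw
        refine (h1 w (by linarith)).trans ?_
        gcongr
        rw [← Real.mul_rpow (by norm_num) hxp.le]
        refine Real.rpow_le_rpow_of_nonpos (by positivity) ?_ (by linarith)
        linarith)
      (left_mem_segment ℝ y x) (right_mem_segment ℝ y x)
    rw [hfy, sub_zero, hyx] at hmv
    refine hmv.trans (mul_le_mul_of_nonneg_right ?_ hρ.le)
    calc ε / B * (2⁻¹ ^ (p - 1) * ‖x‖ ^ (p - 1)) ≤ ε / B * (B * ‖x‖ ^ (p - 1)) := by gcongr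
      _ = ε * ‖x‖ ^ (p - 1) := by field_simp

/-! ### Asymptotics of the metric -/

lemma hasOrder_rotField (i : Fin 3) : HasOrder 1 fun x => rotField x i := by
  fin_cases i
  · have := (hasOrder_coord 1).mul (hasOrder_const (-1))
    simp only [add_zero] at this
    refine (?_ : HasOrder 1 fun x : E3 => -x 1)
    simpa using this
  · exact hasOrder_coord 0
  · have h : HasOrder 1 fun _ : E3 => (0 : ℝ) := by
      have := (hasOrder_coord 0).mul (hasOrder_const 0)
      simpa using this
    exact h

lemma hasOrder_rho_sq : HasOrder 2 fun x => rho x ^ 2 := by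
  have h := fun i => (hasOrder_coord i).mul (hasOrder_coord i)
  have h2 := (h 0).add (h 1)
  have e : (1 : ℝ) + 1 = 2 := by norm_num
  rw [e] at h2
  have e2 : (fun x : E3 => rho x ^ 2) = fun x => x 0 * x 0 + x 1 * x 1 := by
    funext x; rw [rho_sq]; ring
  rw [e2]
  exact h2

lemma hasSmallOrder_meridianForm {a Az : E3 → ℝ} (ha : HasSmallOrder (-5 / 2) a)
    (hz : HasSmallOrder (-3 / 2) Az) (i : Fin 3) :
    HasSmallOrder (-3 / 2) fun x => meridianForm a Az x i := by
  have e : (-5 / 2 : ℝ) + 1 = -3 / 2 := by norm_num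
  fin_cases i
  · have := ha.mul (hasOrder_coord 0)
    rw [e] at this
    exact this
  · have := ha.mul (hasOrder_coord 1)
    rw [e] at this
    exact this
  · exact hz

/-- An estimate off the axis extends to the axis by continuity. -/
lemma isLittleO_of_offAxis {G : Type*} [NormedAddCommGroup G] {F : E3 → G} {c q : ℝ}
    (hF : ∀ x, c < ‖x‖ → ContinuousAt F x) (h : F =o[offAxis] fun x => ‖x‖ ^ q) :
    F =o[cobounded E3] fun x => ‖x‖ ^ q := by
  refine IsLittleO.of_bound fun ε hε => ?_
  have h1 := h.bound hε
  rw [offAxis, eventually_inf_principal, ← comap_norm_atTop, eventually_comap] at h1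
  obtain ⟨R, hR⟩ := eventually_atTop.mp h1
  have hS : {x : E3 | max R (max c 0) < ‖x‖} ∈ cobounded E3 := eventually_lt_norm _
  filter_upwards [hS] with x hx
  have hx' : max R (max c 0) < ‖x‖ := hx
  have hcx : c < ‖x‖ := lt_of_le_of_lt ((le_max_left _ _).trans (le_max_right _ _)) hx'
  have h0x : 0 < ‖x‖ := lt_of_le_of_lt ((le_max_right _ _).trans (le_max_right _ _)) hx'
  -- approximate `x` by points off the axis
  set y : ℝ → E3 := fun s => x + s • basisVec 0 with hy
  have hyc : Continuous y := by fun_prop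
  have hy0 : Tendsto y (𝓝[≠] 0) (𝓝 x) := by
    have : Tendsto y (𝓝 0) (𝓝 (y 0)) := hyc.tendsto 0
    simp only [hy, zero_smul, add_zero] at this
    exact this.mono_left nhdsWithin_le_nhds
  have hρ : ∀ᶠ s in 𝓝[≠] (0 : ℝ), 0 < rho (y s) := by
    have e : ∀ s, rho (y s) ^ 2 = (x 0 + s) ^ 2 + x 1 ^ 2 := by
      intro s; rw [rho_sq]; simp [hy, basisVec]
    have hne : ∀ᶠ s in 𝓝[≠] (0 : ℝ), x 0 + s ≠ 0 := by
      by_cases h0 : x 0 = 0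
      · filter_upwards [self_mem_nhdsWithin] with s hs
        rw [h0, zero_add]; exact hs
      · have hc : ContinuousAt (fun s : ℝ => x 0 + s) 0 := by fun_prop
        exact (hc.eventually_ne (by simpa using h0)).filter_mono nhdsWithin_le_nhds
    filter_upwards [hne] with s hs
    have h1 := e s
    have h2 : 0 < (x 0 + s) ^ 2 := by positivity
    refine lt_of_le_of_ne (rho_nonneg _) fun h3 => ?_
    rw [← h3] at h1
    nlinarith [sq_nonneg (x 1)]
  have hlim1 : Tendsto (fun s => ‖F (y s)‖) (𝓝[≠] 0) (𝓝 ‖F x‖) :=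
    ((hF x hcx).tendsto.comp hy0).norm
  have hlim2 : Tendsto (fun s => ε * ‖‖y s‖ ^ q‖) (𝓝[≠] 0) (𝓝 (ε * ‖‖x‖ ^ q‖)) := by
    refine Tendsto.const_mul ε (Tendsto.norm ?_)
    exact (hy0.norm).rpow_const (Or.inl h0x.ne')
  refine le_of_tendsto_of_tendsto hlim1 hlim2 ?_
  have hbig : ∀ᶠ s in 𝓝[≠] (0 : ℝ), R < ‖y s‖ :=
    hy0.norm.eventually (lt_mem_nhds (lt_of_le_of_lt (le_max_left _ _) hx'))
  filter_upwards [hρ, hbig] with s h2 h3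
  exact hR _ h3.le (y s) rfl h2

/-! ### Linear part and remainder of `g - δ`. -/

namespace PseudosphericalData

variable {m₁ : ℝ} {ℓ : ℕ} (D : PseudosphericalData m₁ ℓ)

/-- The linear part of the metric perturbation. -/
def linearPart (i j : Fin 3) (x : E3) : ℝ :=
  -2 * D.U x * (1 : Matrix (Fin 3) (Fin 3) ℝ) i j + 2 * D.α x * meridianProj i j x
    + (rotField x i * meridianForm D.a D.Az x j + meridianForm D.a D.Az x i * rotField x j)

lemma hasSmallOrder_cross (hℓ : 5 ≤ ℓ) (i j : Fin 3) : HasSmallOrder (-1 / 2) fun x =>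
    rotField x i * meridianForm D.a D.Az x j + meridianForm D.a D.Az x i * rotField x j := by
  have hA := hasSmallOrder_meridianForm (D.a_falloff.hasSmallOrder D.a_smooth (by omega))
    (D.Az_falloff.hasSmallOrder D.Az_smooth (by omega))
  have h := fun i j => (hA i).mul (hasOrder_rotField j)
  have e : (-3 / 2 : ℝ) + 1 = -1 / 2 := by norm_num
  simp only [e] at h
  have := (h j i).add (h i j)
  simpa only [mul_comm] using this

lemma hasSmallOrder_quadratic (hℓ : 5 ≤ ℓ) (i j : Fin 3) : HasSmallOrder (-1) fun x =>
    rho x ^ 2 * (meridianForm D.a D.Az x i * meridianForm D.a D.Az x j) := by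
  have hA := hasSmallOrder_meridianForm (D.a_falloff.hasSmallOrder D.a_smooth (by omega))
    (D.Az_falloff.hasSmallOrder D.Az_smooth (by omega))
  have h := ((hA i).mul (hA j).hasOrder).mul hasOrder_rho_sq
  have e : (-3 / 2 : ℝ) + (-3 / 2) + 2 = -1 := by norm_num
  rw [e] at h
  simpa only [mul_comm] using h

lemma vanishesOnAxis_α (hℓ : 5 ≤ ℓ) : VanishesOnAxis (-1 / 2) fun x => 2 * D.α x :=
  (vanishesOnAxis_of_axis (by norm_num) D.α_smooth (by omega) D.α_falloff D.α_axis).const_mul 2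

lemma hasSmallOrder_U (hℓ : 5 ≤ ℓ) : HasSmallOrder (-1 / 2) fun x => -2 * D.U x :=
  (D.U_falloff.hasSmallOrder D.U_smooth (by omega)).const_mul (-2)

lemma eventually_offAxis_nhds {P : E3 → Prop} (h : ∀ y, m₁ / 2 < ‖y‖ → 0 < rho y → P y) :
    ∀ᶠ x in offAxis, ∀ᶠ y in 𝓝 x, P y := by
  filter_upwards [eventually_offAxis_lt (m₁ / 2), eventually_offAxis_rho] with x hx hρ
  filter_upwards [(isOpen_lt_norm _).mem_nhds hx, isOpen_rho_pos.mem_nhds hρ] with y h1 h2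
  exact h y h1 h2

lemma hasSmallOrder_linearPart (hℓ : 5 ≤ ℓ) (i j : Fin 3) :
    HasSmallOrder (-1 / 2) (D.linearPart i j) := by
  have h1 := (D.hasSmallOrder_U hℓ).mul (hasOrder_const ((1 : Matrix (Fin 3) (Fin 3) ℝ) i j))
  rw [add_zero] at h1
  exact (h1.add ((D.vanishesOnAxis_α hℓ).mul_meridianProj i j)).add (D.hasSmallOrder_cross hℓ i j)

/-- The metric agrees with its linear part to second order. -/
theorem hasSmallOrder_remainder (hℓ : 5 ≤ ℓ) (i j : Fin 3) : HasSmallOrder (-1) fun x =>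
    D.g x i j - (1 : Matrix (Fin 3) (Fin 3) ℝ) i j - D.linearPart i j x := by
  have hneg : (-1 / 2 : ℝ) < 0 := by norm_num
  have e : (-1 / 2 : ℝ) + -1 / 2 = -1 := by norm_num
  have hU := D.hasSmallOrder_U hℓ
  have hα := D.vanishesOnAxis_α hℓ
  have hS := D.hasSmallOrder_cross hℓ i j
  have hT := D.hasSmallOrder_quadratic hℓ i j
  -- With `P` the meridian projection, `S` the cross term and `T` the term quadratic in `A`, the
  -- remainder is `(e^{-2U} - 1 + 2U)δ + (e^{2α} - 1 - 2α)P + T + (e^{-2U} - 1)((e^{2α} - 1)P + S +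
  -- T)`, and each summand is at least quadratic in the coefficients.
  have h1 := (hU.exp_sub_one_sub hneg).mul
    (hasOrder_const ((1 : Matrix (Fin 3) (Fin 3) ℝ) i j))
  have h2 := (hα.exp_sub_one_sub hneg).mul_meridianProj i j
  have h3 := ((hα.exp_sub_one hneg).mul_meridianProj i j).add (hS.add (hT.mono (by norm_num)))
  have h4 := (hU.exp_sub_one hneg).mul h3.hasOrder
  rw [add_zero, e] at h1
  rw [e] at h2 h4
  refine (((h1.add h2).add hT).add h4).congr (eventually_offAxis_nhds (m₁ := m₁) fun y hy hρ => ?_)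
  simp only [D.g_apply (le_of_lt hy) hρ, linearPart, meridianProj]
  ring

/-- The metric is asymptotically flat of order one. -/
theorem isLittleOk_g (hℓ : 5 ≤ ℓ) (i j : Fin 3) :
    IsLittleOk 1 (fun x => D.g x i j - (1 : Matrix (Fin 3) (Fin 3) ℝ) i j) (-1 / 2) := by
  have h := ((D.hasSmallOrder_remainder hℓ i j).mono (q := -1 / 2) (by norm_num)).add
    (D.hasSmallOrder_linearPart hℓ i j)
  simp only [sub_add_cancel] at h
  have e : fderiv ℝ (fun x => D.g x i j - (1 : Matrix (Fin 3) (Fin 3) ℝ) i j)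
      = fderiv ℝ fun x => D.g x i j := by
    funext x; rw [fderiv_sub_const]
  -- The estimates were obtained off the axis because of the projection `P`; the metric itself is
  -- smooth across the axis, so they extend by continuity.
  refine isLittleOk_one (isLittleO_of_offAxis (c := m₁ / 2) (fun x hx => ?_) h.val)
    (isLittleO_of_offAxis (c := m₁ / 2) (fun x hx => ?_) h.der)
  · exact ((D.g_smooth i j).continuousAt (le_of_lt hx)).sub continuousAt_const
  · rw [e]
    exact (D.g_smooth i j).continuousAt_fderiv (le_of_lt hx)

/-- The identity is an asymptotically flat chart of the exterior. -/
theorem isAFEndOfExterior_id (hm : 0 < m₁) (hℓ : 5 ≤ ℓ) :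
    IsAFEndOfExterior 1 (m₁ / 2) D.g (m₁ / 2) id := by
  have hp : pullback D.g id = D.g := pullback_id D.g
  refine ⟨⟨by positivity, contDiff_id.contDiffOn, Set.injOn_id _, fun y _ => ?_, fun i j => ?_,
    fun y hy => ?_, fun i j => ?_, fun i j => ?_, ?_⟩, fun x hx => hx, tendsto_id, ?_⟩
  · rw [jacobian_id, Matrix.det_one]; exact one_ne_zero
  · rw [hp]
    obtain ⟨V, hV, hs, hf⟩ := D.g_smooth i j
    exact hf.mono fun y hy => hs (show m₁ / 2 ≤ ‖y‖ from le_of_lt hy)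
  · rw [hp]; exact D.g_posDef y (le_of_lt hy)
  · rw [hp]; exact D.isLittleOk_g hℓ i j
  · rw [hp]; exact D.deriv_L2 i j
  · rw [hp]; exact D.scalar_L1
  · have : ({x : E3 | m₁ / 2 ≤ ‖x‖} \ id '' {y | m₁ / 2 < ‖y‖}) = Metric.sphere 0 (m₁ / 2) := by
      ext x
      simp only [Set.image_id, Set.mem_sdiff, mem_sphere_zero_iff_norm]
      change (m₁ / 2 ≤ ‖x‖ ∧ ¬ m₁ / 2 < ‖x‖) ↔ _
      constructor
      · rintro ⟨h1, h2⟩; linarith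
      · intro h; exact ⟨h.ge, h.not_gt⟩
    rw [this]
    exact isCompact_sphere 0 _

end PseudosphericalData

/-! ### The mass integrand -/

/-- `(h_{ij,i} - h_{ii,j}) ν^j`. -/
def admForm (h : Field3) (x ν : E3) : ℝ :=
  ∑ j, (∑ i, (pd i (fun y => h y i j) x - pd j (fun y => h y i i) x)) * ν j

lemma admForm_add {h k : Field3} {x : E3} (hh : DiffM h x) (hk : DiffM k x) (ν : E3) :
    admForm (fun y => h y + k y) x ν = admForm h x ν + admForm k x ν := by
  simp only [admForm, Matrix.add_apply, pd_add _ (hh _ _) (hk _ _), ← Finset.sum_add_distrib,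
    ← add_mul]
  refine Finset.sum_congr rfl fun j _ => ?_
  congr 1
  exact Finset.sum_congr rfl fun i _ => by ring

lemma abs_admForm_le {h : Field3} {x ν : E3} (hν : ‖ν‖ ≤ 1) {K : ℝ}
    (hK : ∀ i j, ‖fderiv ℝ (fun y => h y i j) x‖ ≤ K) : |admForm h x ν| ≤ 18 * K := by
  have hb : ∀ k i j, |pd k (fun y => h y i j) x| ≤ K := fun k i j => by
    refine ((fderiv ℝ (fun y => h y i j) x).le_opNorm _).trans ?_
    have : ‖basisVec k‖ = 1 := by simp [basisVec]
    rw [this, mul_one]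
    exact hK i j
  have hK0 : 0 ≤ K := (abs_nonneg _).trans (hb 0 0 0)
  have hνj : ∀ j, |ν j| ≤ 1 := fun j => (PiLp.norm_apply_le ν j).trans hν
  have h1 : ∀ j, |(∑ i, (pd i (fun y => h y i j) x - pd j (fun y => h y i i) x)) * ν j| ≤ 6 * K := by
    intro j
    rw [abs_mul]
    have h2 : |∑ i, (pd i (fun y => h y i j) x - pd j (fun y => h y i i) x)| ≤ 6 * K := by
      refine (Finset.abs_sum_le_sum_abs _ _).trans ((Finset.sum_le_sum fun i _ =>
        (abs_sub _ _).trans (add_le_add (hb i i j) (hb j i i))).trans ?_)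
      simp only [Finset.sum_const, Finset.card_univ, Fintype.card_fin, nsmul_eq_mul]
      push_cast; linarith
    calc _ ≤ 6 * K * 1 := by gcongr; exact hνj j
      _ = 6 * K := mul_one _
  refine (Finset.abs_sum_le_sum_abs _ _).trans ((Finset.sum_le_sum fun j _ => h1 j).trans ?_)
  simp only [Finset.sum_const, Finset.card_univ, Fintype.card_fin, nsmul_eq_mul]
  push_cast; linarith

lemma differentiableAt_coord (i : Fin 3) (x : E3) : DifferentiableAt ℝ (fun y : E3 => y i) x :=
  (contDiffAt_coord i x (n := 1)).differentiableAt (by simp)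

lemma fderiv_self_eq (f : E3 → ℝ) (x : E3) :
    fderiv ℝ f x x = pd 0 f x * x 0 + pd 1 f x * x 1 + pd 2 f x * x 2 := by
  rw [fderiv_eq_sum_pd, Fin.sum_univ_three]

/-- For `fδ` the divergence minus the gradient of the trace is `∇f - 3∇f = -2∇f`, here with `f =
-2U`. -/
lemma admForm_conformal {U : E3 → ℝ} {x : E3} (hU : DifferentiableAt ℝ U x) :
    admForm (fun y => Matrix.of fun i j => -2 * U y * (1 : Matrix (Fin 3) (Fin 3) ℝ) i j) x x
      = 4 * fderiv ℝ U x x := by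
  have h : ∀ k i j, pd k (fun y => -2 * U y * (1 : Matrix (Fin 3) (Fin 3) ℝ) i j) x
      = -2 * pd k U x * (1 : Matrix (Fin 3) (Fin 3) ℝ) i j := by
    intro k i j
    rw [pd_mul k ((differentiableAt_const _).fun_mul hU) (differentiableAt_const _),
      pd_mul k (differentiableAt_const _) hU, pd_const, pd_const]
    ring
  rw [fderiv_self_eq]
  simp only [admForm, Matrix.of_apply, h, Fin.sum_univ_three]
  simp
  ring

lemma pd_dRho {x : E3} (hx : 0 < rho x) (k i : Fin 3) : pd k (fun y => dRho y i) x
    = ((1 : Matrix (Fin 3) (Fin 3) ℝ) k i - dZ k * dZ i - dRho x k * dRho x i) * (rho x)⁻¹ := by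
  have hd := (contDiffAt_rho hx (n := 1)).differentiableAt (by simp)
  have hmul : (fun y => rho y * dRho y i) =ᶠ[𝓝 x] fun y => (![y 0, y 1, 0] : Fin 3 → ℝ) i := by
    filter_upwards [isOpen_rho_pos.mem_nhds hx] with y hy
    have hy' : rho y ≠ 0 := ne_of_gt hy
    fin_cases i <;> simp [dRho] <;> field_simp
  have h1 := pd_congr k hmul
  rw [pd_mul k hd (differentiableAt_dRho hx i), pd_rho hx] at h1
  have h2 : pd k (fun y : E3 => (![y 0, y 1, 0] : Fin 3 → ℝ) i) x
      = (1 : Matrix (Fin 3) (Fin 3) ℝ) k i - dZ k * dZ i := by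
    fin_cases i
    · change pd k (fun y : E3 => y 0) x = _
      rw [pd_coord]; simp [dZ]; rfl
    · change pd k (fun y : E3 => y 1) x = _
      rw [pd_coord]; simp [dZ]; rfl
    · change pd k (fun y : E3 => (0 : ℝ)) x = _
      rw [pd_const]; fin_cases k <;> simp [dZ]
  rw [h2] at h1
  rw [← div_eq_mul_inv, eq_div_iff hx.ne']
  linarith

lemma pd_meridianProj {x : E3} (hx : 0 < rho x) (k i j : Fin 3) : pd k (meridianProj i j) x
    = pd k (fun y => dRho y i) x * dRho x j + dRho x i * pd k (fun y => dRho y j) x := by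
  unfold meridianProj
  rw [pd_add k ((differentiableAt_dRho hx i).fun_mul (differentiableAt_dRho hx j))
    (differentiableAt_const _), pd_mul k (differentiableAt_dRho hx i) (differentiableAt_dRho hx j),
    pd_const, add_zero]

/-- The projection `P` has trace `2`, fixes `x` and has divergence `e_ρ/ρ`, so `fP` contributes
`x·∇f + f - 2x·∇f` with `f = 2α`. The undifferentiated `α` in the flux comes from the divergence of
`P`. -/
lemma admForm_meridianProj {α : E3 → ℝ} {x : E3} (hx : 0 < rho x) (hα : DifferentiableAt ℝ α x) :
    admForm (fun y => Matrix.of fun i j => 2 * α y * meridianProj i j y) x x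
      = -2 * fderiv ℝ α x x + 2 * α x := by
  have h : ∀ k i j, pd k (fun y => 2 * α y * meridianProj i j y) x
      = 2 * pd k α x * meridianProj i j x + 2 * α x * pd k (meridianProj i j) x := by
    intro k i j
    rw [pd_mul k ((differentiableAt_const _).fun_mul hα) (differentiableAt_meridianProj hx i j),
      pd_mul k (differentiableAt_const _) hα, pd_const]
    ring
  have hn := dRho_sq_add hx
  have hne := hx.ne'
  have x0 : x 0 = rho x * dRho x 0 := by simp [dRho]; field_simp
  have x1 : x 1 = rho x * dRho x 1 := by simp [dRho]; field_simp
  have d2 : dRho x 2 = 0 := rfl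
  have z0 : dZ 0 = 0 := rfl
  have z1 : dZ 1 = 0 := rfl
  have z2 : dZ 2 = 1 := rfl
  rw [fderiv_self_eq]
  simp only [admForm, Matrix.of_apply, h, Fin.sum_univ_three, pd_meridianProj hx, pd_dRho hx]
  simp only [meridianProj, d2, z0, z1, z2, x0, x1, Matrix.one_apply]
  simp
  generalize dRho x 0 = n at *
  generalize dRho x 1 = m at *
  have hm : m ^ 2 = 1 - n ^ 2 := by linarith
  field_simp
  ring_nf
  simp only [hm]
  ring

/-- The rotation field is orthogonal to `A`, so the trace vanishes. In the radial component of the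
divergence, orthogonality and the skew derivative of the rotation field leave only derivatives of
`a` and `A_z` along `∂_φ`. -/
lemma admForm_cross {a Az : E3 → ℝ} {x : E3} (ha : DifferentiableAt ℝ a x)
    (hz : DifferentiableAt ℝ Az x) (Ha : fderiv ℝ a x (WithLp.toLp 2 (rotField x)) = 0)
    (Hz : fderiv ℝ Az x (WithLp.toLp 2 (rotField x)) = 0) :
    admForm (fun y => Matrix.of fun i j =>
      rotField y i * meridianForm a Az y j + meridianForm a Az y i * rotField y j) x x = 0 := by
  have dc := fun i => differentiableAt_coord i x
  have dw : ∀ i, DifferentiableAt ℝ (fun y => rotField y i) x := by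
    intro i
    fin_cases i
    · exact (dc 1).fun_neg
    · exact dc 0
    · exact differentiableAt_const _
  have dA : ∀ i, DifferentiableAt ℝ (fun y => meridianForm a Az y i) x := by
    intro i
    fin_cases i
    · exact ha.fun_mul (dc 0)
    · exact ha.fun_mul (dc 1)
    · exact hz
  have pw : ∀ k i, pd k (fun y => rotField y i) x = (![-(1 : Matrix (Fin 3) (Fin 3) ℝ) k 1,
      (1 : Matrix (Fin 3) (Fin 3) ℝ) k 0, 0] : Fin 3 → ℝ) i := by
    intro k i
    fin_cases i
    · change pd k (fun y : E3 => -y 1) x = -(1 : Matrix (Fin 3) (Fin 3) ℝ) k 1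
      rw [← pd_coord, pd, pd, fderiv_fun_neg]; rfl
    · exact pd_coord k 0 x
    · exact pd_const k 0 x
  have pA : ∀ k i, pd k (fun y => meridianForm a Az y i) x
      = (![pd k a x * x 0 + a x * (1 : Matrix (Fin 3) (Fin 3) ℝ) k 0,
        pd k a x * x 1 + a x * (1 : Matrix (Fin 3) (Fin 3) ℝ) k 1, pd k Az x] : Fin 3 → ℝ) i := by
    intro k i
    fin_cases i
    · change pd k (fun y : E3 => a y * y 0) x = _
      rw [pd_mul k ha (dc 0), pd_coord]; rfl
    · change pd k (fun y : E3 => a y * y 1) x = _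
      rw [pd_mul k ha (dc 1), pd_coord]; rfl
    · rfl
  have h : ∀ k i j, pd k (fun y => rotField y i * meridianForm a Az y j
      + meridianForm a Az y i * rotField y j) x
      = pd k (fun y => rotField y i) x * meridianForm a Az x j
        + rotField x i * pd k (fun y => meridianForm a Az y j) x
        + (pd k (fun y => meridianForm a Az y i) x * rotField x j
        + meridianForm a Az x i * pd k (fun y => rotField y j) x) := by
    intro k i j
    rw [pd_add k ((dw i).fun_mul (dA j)) ((dA i).fun_mul (dw j)), pd_mul k (dw i) (dA j),
      pd_mul k (dA i) (dw j)]
  rw [fderiv_eq_sum_pd, Fin.sum_univ_three] at Ha Hz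
  simp only [admForm, Matrix.of_apply, h, Fin.sum_univ_three, pw, pA]
  simp [rotField, meridianForm] at Ha Hz ⊢
  linear_combination (x 0 ^ 2 + x 1 ^ 2) * Ha + x 2 * Hz

/-! ### The mass integrand of an axisymmetric metric to leading order. -/

namespace PseudosphericalData

variable {m₁ : ℝ} {ℓ : ℕ} (D : PseudosphericalData m₁ ℓ)

/-- `r` times the leading part of the mass integrand. -/
def radialFlux (x : E3) : ℝ := 4 * fderiv ℝ D.U x x - 2 * fderiv ℝ D.α x x + 2 * D.α x

lemma fderiv_rotField_eq_zero {f : E3 → ℝ} (hm : 0 < m₁) (hf : SmoothUpTo f (exterior m₁))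
    (hs : AxisymmetricOn f (exterior m₁)) {x : E3} (hx : m₁ / 2 < ‖x‖) (hρ : 0 < rho x) :
    fderiv ℝ f x (WithLp.toLp 2 (rotField x)) = 0 := by
  have hev : f =ᶠ[𝓝 x] fun y => (fun p => f (sec p)) (cyl y) := by
    filter_upwards [(isOpen_lt_norm _).mem_nhds hx] with y hy
    exact hs.eq_sec_cyl (le_of_lt hy)
  have hp : (m₁ / 2) ^ 2 ≤ (cyl x).1 ^ 2 + (cyl x).2 ^ 2 := by
    have h := norm_sq_eq_rho x
    change _ ≤ rho x ^ 2 + x 2 ^ 2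
    rw [← h]; gcongr
  rw [hev.fderiv_eq]
  exact fderiv_comp_cyl_rotField hρ
    ((hf.contDiffAt_comp_sec hm hp (n := 1)).differentiableAt (by simp))

lemma admForm_linearPart (hm : 0 < m₁) {x : E3} (hx : m₁ / 2 < ‖x‖) (hρ : 0 < rho x) :
    DiffM (fun y => Matrix.of fun i j => D.linearPart i j y) x ∧
    admForm (fun y => Matrix.of fun i j => D.linearPart i j y) x x = D.radialFlux x := by
  have hxe : x ∈ exterior m₁ := le_of_lt hx
  have dU := D.U_smooth.differentiableAt hxe
  have dα := D.α_smooth.differentiableAt hxe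
  have da := D.a_smooth.differentiableAt hxe
  have dz := D.Az_smooth.differentiableAt hxe
  have dc := fun i => differentiableAt_coord i x
  set h₁ : Field3 := fun y => Matrix.of fun i j =>
    -2 * D.U y * (1 : Matrix (Fin 3) (Fin 3) ℝ) i j with hh₁
  set h₂ : Field3 := fun y => Matrix.of fun i j => 2 * D.α y * meridianProj i j y with hh₂
  set h₃ : Field3 := fun y => Matrix.of fun i j => rotField y i * meridianForm D.a D.Az y j
    + meridianForm D.a D.Az y i * rotField y j with hh₃
  have e : (fun y => Matrix.of fun i j => D.linearPart i j y) = fun y => (h₁ y + h₂ y) + h₃ y := by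
    funext y
    ext i j
    rfl
  have d1 : DiffM h₁ x := fun i j =>
    ((differentiableAt_const _).fun_mul dU).fun_mul (differentiableAt_const _)
  have d2 : DiffM h₂ x := fun i j =>
    ((differentiableAt_const _).fun_mul dα).fun_mul (differentiableAt_meridianProj hρ i j)
  have dw : ∀ i, DifferentiableAt ℝ (fun y => rotField y i) x := by
    intro i
    fin_cases i
    · exact (dc 1).fun_neg
    · exact dc 0
    · exact differentiableAt_const _
  have dA : ∀ i, DifferentiableAt ℝ (fun y => meridianForm D.a D.Az y i) x := by
    intro i
    fin_cases i
    · exact da.fun_mul (dc 0)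
    · exact da.fun_mul (dc 1)
    · exact dz
  have d3 : DiffM h₃ x := fun i j => ((dw i).fun_mul (dA j)).fun_add ((dA i).fun_mul (dw j))
  rw [e]
  refine ⟨(d1.add d2).add d3, ?_⟩
  rw [admForm_add (d1.add d2) d3, admForm_add d1 d2, admForm_conformal dU,
    admForm_meridianProj hρ dα, admForm_cross da dz
      (fderiv_rotField_eq_zero hm D.a_smooth D.a_axisymmetric hx hρ)
      (fderiv_rotField_eq_zero hm D.Az_smooth D.Az_axisymmetric hx hρ), radialFlux]
  ring

/-- The mass integrand, to leading order. -/
theorem exists_radius_admForm (hm : 0 < m₁) (hℓ : 5 ≤ ℓ) {ε : ℝ} (hε : 0 < ε) :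
    ∃ R, ∀ r, R < r → ∀ n : E3, ‖n‖ = 1 → 0 < rho n →
      |r ^ 2 * admForm D.g (r • n) n - r * D.radialFlux (r • n)| ≤ ε := by
  have h : ∀ᶠ x in offAxis, ∀ i j, ‖fderiv ℝ (fun y => D.g y i j
      - (1 : Matrix (Fin 3) (Fin 3) ℝ) i j - D.linearPart i j y) x‖ ≤ ε / 18 * ‖x‖ ^ (-2 : ℝ) := by
    rw [eventually_all]
    intro i
    rw [eventually_all]
    intro j
    -- The divisor `18` is the constant of `abs_admForm_le`; the decay `r⁻²` is what the area factor
    -- `r²` consumes.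
    have h1 := (D.hasSmallOrder_remainder hℓ i j).der.bound (c := ε / 18) (by positivity)
    filter_upwards [h1] with x hx
    rw [Real.norm_of_nonneg (by positivity)] at hx
    have e : (-1 - 1 : ℝ) = -2 := by norm_num
    rwa [e] at hx
  rw [offAxis, eventually_inf_principal, ← comap_norm_atTop, eventually_comap] at h
  obtain ⟨R, hR⟩ := eventually_atTop.mp h
  refine ⟨max R (m₁ / 2), fun r hr n hn hρn => ?_⟩
  have hrR : R < r := lt_of_le_of_lt (le_max_left _ _) hr
  have hrm : m₁ / 2 < r := lt_of_le_of_lt (le_max_right _ _) hr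
  have hr0 : 0 < r := lt_trans (by positivity) hrm
  set x := r • n with hxdef
  have hxn : ‖x‖ = r := by rw [hxdef, norm_smul, hn, mul_one, Real.norm_of_nonneg hr0.le]
  have hρ : 0 < rho x := by
    have : rho x ^ 2 = r ^ 2 * rho n ^ 2 := by
      rw [rho_sq, rho_sq, hxdef]; simp; ring
    refine lt_of_le_of_ne (rho_nonneg x) fun h0 => ?_
    rw [← h0] at this
    have : 0 < r ^ 2 * rho n ^ 2 := by positivity
    linarith
  have hK := hR ‖x‖ (by rw [hxn]; exact hrR.le) x rfl hρ
  have hx : m₁ / 2 < ‖x‖ := by rw [hxn]; exact hrm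
  obtain ⟨dl, hl⟩ := D.admForm_linearPart hm hx hρ
  have dg : DiffM D.g x := fun i j => (D.g_smooth i j).differentiableAt (le_of_lt hx)
  set lin : Field3 := fun y => Matrix.of fun i j => D.linearPart i j y with hlin
  set rem : Field3 := fun y => Matrix.of fun i j => D.g y i j
      - (1 : Matrix (Fin 3) (Fin 3) ℝ) i j - D.linearPart i j y with hrem
  have drem : DiffM rem x := fun i j => ((dg i j).sub_const _).fun_sub (dl i j)
  have dsum : DiffM (fun y => rem y + lin y) x := drem.add dl
  have hgsum : admForm D.g x n = admForm (fun y => rem y + lin y) x n := by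
    have hpd : ∀ k i j, pd k (fun y => D.g y i j) x = pd k (fun y => (rem y + lin y) i j) x := by
      intro k i j
      have e : (fun y => (rem y + lin y) i j)
          = fun y => D.g y i j - (1 : Matrix (Fin 3) (Fin 3) ℝ) i j := by
        funext y
        simp [hrem, hlin]
      rw [e, pd_sub k (dg i j) (differentiableAt_const _), pd_const, sub_zero]
    simp only [admForm, hpd]
  -- The leading part was computed with `ν = x = r n` instead of the unit normal.
  have hscale : r * admForm lin x n = D.radialFlux x := by
    rw [← hl, admForm, admForm, Finset.mul_sum]
    refine Finset.sum_congr rfl fun j _ => ?_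
    have : x j = r * n j := by rw [hxdef]; simp
    rw [this]; ring
  have hbound := abs_admForm_le (h := rem) (x := x) (ν := n) hn.le
    (K := ε / 18 * ‖x‖ ^ (-2 : ℝ)) (fun i j => hK i j)
  have e1 : r ^ 2 * admForm D.g x n - r * D.radialFlux x = r ^ 2 * admForm rem x n := by
    rw [hgsum, admForm_add drem dl, ← hscale]; ring
  have e2 : ‖x‖ ^ (-2 : ℝ) = (r ^ 2)⁻¹ := by
    rw [hxn, Real.rpow_neg hr0.le]
    norm_num
  rw [e1, abs_mul, abs_of_nonneg (by positivity)]
  rw [e2] at hbound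
  calc r ^ 2 * |admForm rem x n| ≤ r ^ 2 * (18 * (ε / 18 * (r ^ 2)⁻¹)) := by gcongr
    _ = ε := by field_simp

end PseudosphericalData

/-! ### The mass -/

lemma admFlux_eq (h : Field3) (r : ℝ) : admFlux h r = (1 / (16 * Real.pi)) * (r ^ 2 *
    ∫ n : Metric.sphere (0 : E3) 1, admForm h (r • (n : E3)) n ∂((volume : Measure E3).toSphere)) :=
  rfl

lemma norm_smul_sphere {r : ℝ} (hr : 0 < r) (n : Metric.sphere (0 : E3) 1) :
    ‖r • (n : E3)‖ = r := by
  rw [norm_smul, norm_eq_of_mem_sphere, mul_one, Real.norm_of_nonneg hr.le]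

lemma admFlux_congr {h k : Field3} {c : ℝ} (hc : 0 < c) (hk : ∀ x, c < ‖x‖ → h x = k x) {r : ℝ}
    (hr : c < r) : admFlux h r = admFlux k r := by
  rw [admFlux_eq, admFlux_eq]
  congr 2
  refine integral_congr_ae (ae_of_all _ fun n => ?_)
  have hn : c < ‖r • (n : E3)‖ := by rwa [norm_smul_sphere (hc.trans hr)]
  have hev : ∀ i j, (fun y => h y i j) =ᶠ[𝓝 (r • (n : E3))] fun y => k y i j := fun i j => by
    filter_upwards [(isOpen_lt_norm _).mem_nhds hn] with y hy
    rw [hk y hy]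
  simp only [admForm, pd_congr _ (hev _ _)]

lemma HasADMMass.congr {h k : Field3} {m c : ℝ} (hc : 0 < c) (hk : ∀ x, c < ‖x‖ → h x = k x)
    (H : HasADMMass k m) : HasADMMass h m := by
  refine Tendsto.congr' ?_ H
  filter_upwards [eventually_gt_atTop c] with r hr
  exact (admFlux_congr hc hk hr).symm

lemma measurable_fderiv_self (f : E3 → ℝ) : Measurable fun x => fderiv ℝ f x x := by
  simp only [fderiv_self_eq, pd]
  have := fun i : Fin 3 => measurable_fderiv_apply_const ℝ f (basisVec i)
  fun_prop

/-- The radial derivative is `ρ∂_ρ + z∂_z` applied to a function of `(ρ, z)`, hence again such a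
function; this allows the sphere integral to be reduced to one over `θ`. -/
lemma SmoothUpTo.fderiv_self_eq_sec_cyl {f : E3 → ℝ} {m₁ : ℝ} (hm : 0 < m₁)
    (hf : SmoothUpTo f (exterior m₁)) (hs : AxisymmetricOn f (exterior m₁)) {x : E3}
    (hx : m₁ / 2 < ‖x‖) (hρ : 0 < rho x) :
    fderiv ℝ f x x = fderiv ℝ f (sec (cyl x)) (sec (cyl x)) := by
  have key : ∀ y : E3, m₁ / 2 < ‖y‖ → 0 < rho y → fderiv ℝ f y y
      = (cyl y).1 * dh 0 (fun p => f (sec p)) (cyl y)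
        + (cyl y).2 * dh 1 (fun p => f (sec p)) (cyl y) := by
    intro y hy hρy
    have hev : f =ᶠ[𝓝 y] fun z => (fun p => f (sec p)) (cyl z) := by
      filter_upwards [(isOpen_lt_norm _).mem_nhds hy] with z hz
      exact hs.eq_sec_cyl (le_of_lt hz)
    have hp : (m₁ / 2) ^ 2 ≤ (cyl y).1 ^ 2 + (cyl y).2 ^ 2 := by
      have h := norm_sq_eq_rho y
      change _ ≤ rho y ^ 2 + y 2 ^ 2
      rw [← h]; gcongr
    rw [hev.fderiv_eq]
    exact fderiv_comp_cyl_radial hρy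
      ((hf.contDiffAt_comp_sec hm hp (n := 1)).differentiableAt (by simp))
  have hrho : rho (sec (cyl x)) = rho x := by
    simp [rho, sec, cyl]
  have hcyl : cyl (sec (cyl x)) = cyl x := Prod.ext hrho rfl
  have hn : ‖sec (cyl x)‖ = ‖x‖ := by
    rw [← sq_eq_sq₀ (norm_nonneg _) (norm_nonneg _), norm_sq_eq_rho, norm_sq_eq_rho, hrho]
    rfl
  rw [key x hx hρ, key _ (by rwa [hn]) (by rwa [hrho]), hcyl]

lemma continuous_comp_sphere {f : E3 → ℝ} {r : ℝ} (hr : 0 < r)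
    (hf : ∀ x, ‖x‖ = r → ContinuousAt f x) :
    Continuous fun n : Metric.sphere (0 : E3) 1 => f (r • (n : E3)) := by
  rw [continuous_iff_continuousAt]
  intro n
  exact ContinuousAt.comp (f := fun n : Metric.sphere (0 : E3) 1 => r • (n : E3))
    (hf _ (norm_smul_sphere hr n)) (by fun_prop)

lemma integrable_sphere_of_continuous {f : Metric.sphere (0 : E3) 1 → ℝ} (hf : Continuous f) :
    Integrable f (volume : Measure E3).toSphere :=
  hf.integrable_of_hasCompactSupport (HasCompactSupport.of_compactSpace f)

/-! ### Comparison of the ADM flux with the flux of the divergence identity. -/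

namespace PseudosphericalData

variable {m₁ : ℝ} {ℓ : ℕ} (D : PseudosphericalData m₁ ℓ)

lemma continuousAt_radialFlux {x : E3} (hx : x ∈ exterior m₁) : ContinuousAt D.radialFlux x := by
  have h1 := D.U_smooth.continuousAt_fderiv hx
  have h2 := D.α_smooth.continuousAt_fderiv hx
  have h3 := D.α_smooth.continuousAt hx
  unfold radialFlux
  exact ((continuousAt_const.mul (h1.clm_apply continuousAt_id)).sub
    (continuousAt_const.mul (h2.clm_apply continuousAt_id))).add (continuousAt_const.mul h3)

lemma continuous_admForm_sphere (hm : 0 < m₁) {r : ℝ} (hr : m₁ / 2 < r) :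
    Continuous fun n : Metric.sphere (0 : E3) 1 => admForm D.g (r • (n : E3)) n := by
  have hr0 : 0 < r := lt_trans (by positivity) hr
  have h : ∀ k i j, Continuous fun n : Metric.sphere (0 : E3) 1 =>
      pd k (fun y => D.g y i j) (r • (n : E3)) := fun k i j =>
    continuous_comp_sphere hr0 fun x hx =>
      ((D.g_smooth i j).continuousAt_fderiv (show m₁ / 2 ≤ ‖x‖ by rw [hx]; exact hr.le)).clm_apply
        continuousAt_const
  unfold admForm
  refine continuous_finsetSum _ fun j _ => (continuous_finsetSum _ fun i _ =>
    (h i i j).sub (h j i i)).mul ?_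
  fun_prop

/-- The surface measure has density `2π sin θ`, and `fluxIntegrand` is `2 sin θ` times `radialFlux`;
the ratio of these constants is `π`. -/
lemma integral_radialFlux (hm : 0 < m₁) {r : ℝ} (hr : m₁ / 2 < r) :
    ∫ n : Metric.sphere (0 : E3) 1, D.radialFlux (r • (n : E3)) ∂((volume : Measure E3).toSphere)
      = Real.pi * polarFlux D.v D.va (Real.log r) := by
  have hr0 : 0 < r := lt_trans (by positivity) hr
  set s : Set E3 := {x | m₁ / 2 < ‖x‖} with hs
  have hms : MeasurableSet s := (isOpen_lt_norm _).measurableSet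
  -- The reduction to `θ` needs a globally measurable function. Derivatives are always measurable,
  -- whereas `α` is unrestricted inside the ball and is cut off there.
  set F : ℝ × ℝ → ℝ := fun p => (fun x => 4 * fderiv ℝ D.U x x - 2 * fderiv ℝ D.α x x
    + 2 * s.indicator D.α x) (r • sec p) with hF
  have hsec : Measurable sec := (contDiff_sec (n := 0)).continuous.measurable
  have hind : Measurable (s.indicator D.α) := by
    classical
    rw [← Set.piecewise_eq_indicator]
    exact ContinuousOn.measurable_piecewise (fun x hx =>
      (D.α_smooth.continuousAt (show m₁ / 2 ≤ ‖x‖ from le_of_lt hx)).continuousWithinAt) continuous_zero.continuousOn hms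
  have hFm : Measurable F := by
    refine Measurable.comp (g := fun x => 4 * fderiv ℝ D.U x x - 2 * fderiv ℝ D.α x x
      + 2 * s.indicator D.α x) ?_ (hsec.const_smul r)
    exact (((measurable_fderiv_self D.U).const_mul 4).sub
      ((measurable_fderiv_self D.α).const_mul 2)).add (hind.const_mul 2)
  have hFs : ∀ p, m₁ / 2 < ‖r • sec p‖ → F p = D.radialFlux (r • sec p) := by
    intro p hp
    have : s.indicator D.α (r • sec p) = D.α (r • sec p) := 
      Set.indicator_of_mem (show r • sec p ∈ s from hp) _
    simp only [hF, this, radialFlux]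
  have h1 : ∫ n : Metric.sphere (0 : E3) 1, D.radialFlux (r • (n : E3))
      ∂((volume : Measure E3).toSphere) = ∫ n : Metric.sphere (0 : E3) 1, F (cyl n)
      ∂((volume : Measure E3).toSphere) := by
    refine integral_congr_ae ?_
    filter_upwards [ae_sphere_rho_pos] with n hn
    have hrho : rho (r • (n : E3)) = r * rho (n : E3) := by
      rw [← sq_eq_sq₀ (rho_nonneg _) (mul_nonneg hr0.le (rho_nonneg _)), mul_pow, rho_sq, rho_sq]
      simp; ring
    have hsc : r • sec (cyl n) = sec (cyl (r • (n : E3))) := by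
      ext i
      fin_cases i <;> simp [sec, cyl, hrho]
    have hx : m₁ / 2 < ‖r • (n : E3)‖ := by rwa [norm_smul_sphere hr0]
    have hρ : 0 < rho (r • (n : E3)) := by rw [hrho]; positivity
    have hnorm : ‖sec (cyl (r • (n : E3)))‖ = ‖r • (n : E3)‖ := by
      rw [← sq_eq_sq₀ (norm_nonneg _) (norm_nonneg _), norm_sq_eq_rho, norm_sq_eq_rho]
      simp [rho, sec, cyl]
    rw [hFs _ (by rwa [hsc, hnorm]), hsc, radialFlux, radialFlux,
      D.U_smooth.fderiv_self_eq_sec_cyl hm D.U_axisymmetric hx hρ,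
      D.α_smooth.fderiv_self_eq_sec_cyl hm D.α_axisymmetric hx hρ,
      D.α_axisymmetric.eq_sec_cyl hx.le]
  rw [h1, integral_sphere_comp_cyl hFm, integral_Ioo_eq_interval, polarFlux,
    ← intervalIntegral.integral_const_mul]
  congr 1
  funext θ
  have hlog : r • sec (Real.sin θ, Real.cos θ) = sec (logPolar (Real.log r, θ)) := by
    ext i
    fin_cases i <;> simp [sec, logPolar, Real.exp_log hr0]
  have hle : Real.log (m₁ / 2) ≤ Real.log r := Real.log_le_log (by positivity) hr.le
  rw [hFs _ (by rw [hlog, norm_sec_logPolar]; simpa [Real.exp_log hr0] using hr), hlog, radialFlux,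
    ← D.dh_zero_v hm (q := (Real.log r, θ)) hle, ← D.dh_zero_va hm (q := (Real.log r, θ)) hle,
    fluxIntegrand]
  change _ = Real.pi * (Real.sin θ * (8 * dh 0 D.v (Real.log r, θ) - 4 * dh 0 D.va (Real.log r, θ)
    + 4 * D.α (sec (logPolar (Real.log r, θ)))))
  ring

/-- The error of the leading-order formula is uniform over the unit sphere minus its poles, a set of
full measure, and the sphere has finite area. -/
lemma tendsto_admFlux_sub (hm : 0 < m₁) (hℓ : 5 ≤ ℓ) :
    Tendsto (fun r => admFlux D.g r - 1 / 16 * (r * polarFlux D.v D.va (Real.log r))) atTop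
      (𝓝 0) := by
  set μ := (volume : Measure E3).toSphere with hμ
  set T : ℝ := μ.real Set.univ with hT
  have hT0 : 0 ≤ T := measureReal_nonneg
  rw [Metric.tendsto_atTop]
  intro ε hε
  obtain ⟨R, hR⟩ := D.exists_radius_admForm hm hℓ (ε := ε / (T + 1)) (by positivity)
  refine ⟨max R (m₁ / 2) + 1, fun r hr => ?_⟩
  have hrR : R < r := by linarith [le_max_left R (m₁ / 2)]
  have hrm : m₁ / 2 < r := by linarith [le_max_right R (m₁ / 2)]
  have hr0 : 0 < r := lt_trans (by positivity) hrm
  have i1 := integrable_sphere_of_continuous (D.continuous_admForm_sphere hm hrm)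
  have i2 := integrable_sphere_of_continuous (continuous_comp_sphere hr0 (f := D.radialFlux)
    fun x hx => D.continuousAt_radialFlux (show m₁ / 2 ≤ ‖x‖ by rw [hx]; exact hrm.le))
  have e : admFlux D.g r - 1 / 16 * (r * polarFlux D.v D.va (Real.log r))
      = 1 / (16 * Real.pi) * ∫ n : Metric.sphere (0 : E3) 1,
        (r ^ 2 * admForm D.g (r • (n : E3)) n - r * D.radialFlux (r • (n : E3))) ∂μ := by
    rw [integral_sub (i1.const_mul _) (i2.const_mul _), integral_const_mul, integral_const_mul,
      D.integral_radialFlux hm hrm, admFlux_eq]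
    field_simp
  have hb : ‖∫ n : Metric.sphere (0 : E3) 1,
      (r ^ 2 * admForm D.g (r • (n : E3)) n - r * D.radialFlux (r • (n : E3))) ∂μ‖
      ≤ ε / (T + 1) * T := by
    refine norm_integral_le_of_norm_le_const ?_
    filter_upwards [ae_sphere_rho_pos] with n hn
    exact hR r hrR n (norm_eq_of_mem_sphere n) hn
  have hb' : ε / (T + 1) * T < ε := by
    rw [div_mul_eq_mul_div, div_lt_iff₀ (by positivity)]
    nlinarith
  have hpi : 1 / (16 * Real.pi) ≤ 1 := by
    rw [div_le_one (by positivity)]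
    linarith [Real.pi_gt_three]
  rw [dist_zero_right, e, norm_mul, Real.norm_of_nonneg (by positivity)]
  calc _ ≤ 1 * (ε / (T + 1) * T) := by gcongr
    _ < ε := by rwa [one_mul]

/-- The exterior metric has the mass given by the mass density. -/
theorem integrable_massDensity_and_hasADMMass (hm : 0 < m₁) (hℓ : 5 ≤ ℓ)
    (hmin : HasMinimalBoundary m₁ D.g) : Integrable D.massDensity ∧
      HasADMMass D.g (1 / (32 * Real.pi) * ∫ x, D.massDensity x) := by
  obtain ⟨C, hC⟩ := D.exists_polar_bound hm hℓ
  obtain ⟨hint, hlim⟩ := D.integrable_massDensity_and_tendsto hm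
    (fun t ht θ _ => hC t ht θ) (D.integrableOn_massDensity hm hℓ) (D.minimal_polar hm hmin)
  refine ⟨hint, ?_⟩
  -- The constant of the mass formula is `1/16 · 1/(2π)`: the first factor compares the ADM flux
  -- with the polar flux, the second removes the integration over `φ`.
  have h1 := (hlim.comp Real.tendsto_log_atTop).const_mul (1 / 16)
  have h2 := (D.tendsto_admFlux_sub hm hℓ).add h1
  have e : 0 + 1 / 16 * (1 / (2 * Real.pi) * ∫ x, D.massDensity x)
      = 1 / (32 * Real.pi) * ∫ x, D.massDensity x := by
    field_simp; ring
  rw [e] at h2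
  refine Tendsto.congr' ?_ h2
  filter_upwards [eventually_gt_atTop 0] with r hr
  simp only [Function.comp_apply, Real.exp_log hr]
  ring

end PseudosphericalData

end Doubling

end

theorem lemma2p1 (m₁ : ℝ) (hm₁ : 0 < m₁) (ℓ : ℕ) (hℓ : 5 ≤ ℓ)
    (D : Doubling.PseudosphericalData m₁ ℓ) (hmin : Doubling.HasMinimalBoundary m₁ D.g) :
    Doubling.HasTwoAFEnds 1 D.gBar (m₁ / 2) id (Doubling.inv m₁) ∧
    (∀ (k : ℕ) (R₀ : ℝ) (Ψ : Doubling.E3 → Doubling.E3),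
      Doubling.IsAFEndOfExterior k (m₁ / 2) D.g R₀ Ψ →
        Doubling.HasTwoAFEnds k D.gBar R₀ Ψ (Doubling.inv m₁ ∘ Ψ)) ∧
    MeasureTheory.Integrable D.massDensity ∧
    Doubling.HasADMMass D.gBar (1 / (32 * Real.pi) * ∫ x, D.massDensity x) ∧
    Doubling.HasADMMass (Doubling.pullback D.gBar (Doubling.inv m₁))
      (1 / (32 * Real.pi) * ∫ x, D.massDensity x) := by
  obtain ⟨hint, hmass⟩ := D.integrable_massDensity_and_hasADMMass hm₁ hℓ hmin
  -- The first claim is the case `Ψ = id` of the second. For `|x| > m₁/2` both `ḡ` and its pullback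
  -- by the inversion coincide with `g`, so both ends inherit the mass of `g`.
  exact ⟨D.hasTwoAFEnds hm₁ (D.isAFEndOfExterior_id hm₁ hℓ), fun _ _ _ H => D.hasTwoAFEnds hm₁ H,
    hint, hmass.congr (half_pos hm₁) fun _ hx => D.gBar_of_le hx.le,
    hmass.congr (half_pos hm₁) fun _ hx => D.pullback_gBar_inv hm₁ hx⟩
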